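/- **Setting.** Let $\mathbb T^1=\mathbb R/2\pi\mathbb Z$. A closed contact manifold $(M_1,\xi_1)$ is a *prequantization* over a closed symplectic manifold $(W,\omega)$ if there are a principal $\mathbb T^1$-bundle $\pi_1:M_1\to W$ and a contact form $\alpha_1$ with $\ker\alpha_1=\xi_1$, $\pi_1^*\omega=d\alpha_1$, whose Reeb flow has all orbits periodic of minimal period $2\pi$ and induces the $\mathbb T^1$-action. For $k\ge 1$ let $\mathbb Z_k\subset\mathbb T^1$ act through $[j]\mapsto 2\pi j/k$, let $M_k=M_1/\mathbb Z_k$, let $\alpha_k$ be the unique 1-form on $M_k$ whose pull-back to $M_1$ is $\alpha_1$, and $\xi_k=\ker\alpha_k$. For a closed contact manifold $(M,\ker\alpha)$, $\widetilde{\mathrm{Cont}_0}(M,\ker\alpha)$ is the group of homotopy classes, relative to the end points, of contact isotopies $(\phi_t)_{t\in[0,1]}$ with $\phi_0=\mathrm{id}$. The contact product is $M\times M\times\mathbb R$ with the contact form $\beta=\mathrm{pr}_2^*\alpha-e^\theta\mathrm{pr}_1^*\alpha$, and $\Delta=\{(x,x,0)\}$ is its diagonal Legendrian. Legendrian isotopies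 starting at $\Delta$ are the families $(\phi_t(\Delta))$ with $(\phi_t)$ a compactly supported contact isotopy of the contact product, $\phi_0=\mathrm{id}$; such an isotopy is positive (non-negative) if $\beta(\frac{d}{dt}\phi_t(x))>0$ ($\ge0$) for all $t\in[0,1]$ and $x\in\Delta$. Non-negativity of a Legendrian isotopy starting at another Legendrian isotopic to $\Delta$ is defined in the same way. $(M,\ker\alpha)$ is *strongly orderable* if there is no positive loop of Legendrians based at $\Delta$ that is contractible (homotopic, relative to the end points, to the constant loop). For homotopy classes $\widetilde\Lambda_0,\widetilde\Lambda_1$ of Legendrian isotopies starting at $\Delta$ write $\widetilde\Lambda_0\preceq\widetilde\Lambda_1$ if they can be joined by a path that projects to a non-negative Legendrian isotopy. For $\widetilde\phi=[(\phi_t)]$ with $\phi_t^*\alpha=e^{g_t}\alpha$, let $\widetilde\Phi$ be the class of its graph $\Phi_t(x_1,x_2,\theta)=(x_1,\phi_t(x_2),\theta+g_t(x_2))$, and put $$C_+^{\alpha}(\widetilde\phi)=\inf\{T\in\mathbb R\mid \widetilde\Phi\cdot\Delta\preceq\widetilde{\phi_\beta^{T}}\cdot\Delta\},$$ where $\phi_\beta^t$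 is the Reeb flow of $\beta$ and $\widetilde{\phi_\beta^T}=[(\phi_\beta^{tT})_{t\in[0,1]}]$. For $T>0$ let $\lceil x\rceil_T=T\lceil x/T\rceil$. **Lemma.** Let $(M_1,\xi_1=\ker\alpha_1)$ be a closed prequantization over a closed symplectic manifold $(W,\omega)$, and suppose that it is strongly orderable. Then for every integer $k\ge 1$: 1. $(M_k,\xi_k)$ is strongly orderable (and $C_+^{\alpha_k}$ takes real values); 2. every $\widetilde\phi\in\widetilde{\mathrm{Cont}_0}(M_k,\xi_k)$ has a unique lift $\widetilde\psi\in\widetilde{\mathrm{Cont}_0}(M_1,\xi_1)$ (represented by the isotopy, starting at the identity, that lifts an isotopy representing $\widetilde\phi$), and $C_+^{\alpha_k}(\widetilde\phi)\ge C_+^{\alpha_1}(\widetilde\psi)$; 3. $\lceil C_+^{\alpha_k}(\widetilde\psi\,\widetilde\phi\,\widetilde\psi^{-1})\rceil_{2\pi/k}=\lceil C_+^{\alpha_k}(\widetilde\phi)\rceil_{2\pi/k}$ for all $\widetilde\phi,\widetilde\psi\in\widetilde{\mathrm{Cont}_0}(M_k,\xi_k)$. -/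

import Mathlib

open Set Function
open scoped Manifold ContDiff Topology

noncomputable section

namespace ContactGeometry

/-! ### Differential forms on manifolds -/

section Forms

variable {E : Type*} [NormedAddCommGroup E] [NormedSpace ℝ E]
  {H : Type*} [TopologicalSpace H] (I : ModelWithCorners ℝ E H)
  (M : Type*) [TopologicalSpace M] [ChartedSpace H M]

/-- A (not necessarily smooth) differential form of degree `n` on `M`. -/
abbrev DForm (n : ℕ) : Type _ := ∀ x : M, (TangentSpace I x) [⋀^Fin n]→L[ℝ] ℝ

end Forms

section Forms

variable {E : Type*} [NormedAddCommGroup E] [NormedSpace ℝ E]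
  {H : Type*} [TopologicalSpace H] {I : ModelWithCorners ℝ E H}
  {M : Type*} [TopologicalSpace M] [ChartedSpace H M]
  {E' : Type*} [NormedAddCommGroup E'] [NormedSpace ℝ E']
  {H' : Type*} [TopologicalSpace H'] {I' : ModelWithCorners ℝ E' H'}
  {N : Type*} [TopologicalSpace N] [ChartedSpace H' N]
  {E'' : Type*} [NormedAddCommGroup E''] [NormedSpace ℝ E'']
  {H'' : Type*} [TopologicalSpace H''] {I'' : ModelWithCorners ℝ E'' H''}
  {P : Type*} [TopologicalSpace P] [ChartedSpace H'' P]

/-- The pull-back `f^* σ` of a form along a (differentiable) map `f : M → N`. -/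
def DForm.pull {n : ℕ} (f : M → N) (σ : DForm I' N n) : DForm I M n :=
  fun x => (σ (f x)).compContinuousLinearMap (mfderiv I I' f x)

/-- The expression of a form in the preferred chart at `x`, as a form on the model space `E`. -/
def DForm.inChart {n : ℕ} (σ : DForm I M n) (x : M) : E → E [⋀^Fin n]→L[ℝ] ℝ :=
  fun y => (σ ((extChartAt I x).symm y)).compContinuousLinearMap
    (mfderiv 𝓘(ℝ, E) I (extChartAt I x).symm y)

/-- Smoothness of a form on a manifold without boundary: smoothness in all preferred charts. -/
def DForm.IsSmooth {n : ℕ} (σ : DForm I M n) : Prop :=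
  ∀ x : M, ContDiffOn ℝ ∞ (σ.inChart x) (extChartAt I x).target

/-- The exterior derivative of a form on a manifold without boundary, computed at each point `x` in
the preferred chart at `x`. With Mathlib's normalization, `dα(X, Y) = X α(Y) - Y α(X) - α([X, Y])`
for a 1-form `α`. -/
def DForm.d {n : ℕ} (σ : DForm I M n) : DForm I M (n + 1) :=
  fun x => (extDeriv (σ.inChart x) (extChartAt I x x)).compContinuousLinearMap
    (mfderiv I 𝓘(ℝ, E) (extChartAt I x) x)

theorem DForm.pull_comp {n : ℕ} {f : N → P} {g : M → N} (σ : DForm I'' P n)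
    (hf : MDifferentiable I' I'' f) (hg : MDifferentiable I I' g) :
    (DForm.pull (f ∘ g) σ : DForm I M n) = DForm.pull g (DForm.pull f σ : DForm I' N n) := by
  funext x
  ext v
  simp only [DForm.pull, ContinuousAlternatingMap.compContinuousLinearMap_apply]
  rw [mfderiv_comp x (hf (g x)) (hg x)]
  rfl

theorem DForm.pull_id {n : ℕ} (σ : DForm I M n) : (DForm.pull id σ : DForm I M n) = σ := by
  funext x
  ext v
  simp only [DForm.pull, ContinuousAlternatingMap.compContinuousLinearMap_apply, mfderiv_id]
  rfl

/-- A contact form on a manifold without boundary: a smooth, nowhere vanishing 1-form `α` such that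
`dα` is nondegenerate on the hyperplane field `ξ = ker α`. The contact manifold is `(M, ker α)`,
cooriented by `α`. -/
structure IsContactForm (α : DForm I M 1) : Prop where
  smooth : α.IsSmooth
  ne_zero : ∀ x, α x ≠ 0
  nondegenerate : ∀ (x : M) (u : TangentSpace I x), α x ![u] = 0 →
    (∀ v : TangentSpace I x, α x ![v] = 0 → α.d x ![u, v] = 0) → u = 0

/-- A symplectic form on a manifold without boundary. -/
structure IsSymplecticForm (σ : DForm I M 2) : Prop where
  smooth : σ.IsSmooth
  closed : ∀ x, σ.d x = 0
  nondegenerate : ∀ (x : M) (u : TangentSpace I x),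
    (∀ v : TangentSpace I x, σ x ![u, v] = 0) → u = 0

/-- The Reeb condition at a point: `α(R) = 1` and `dα(R, ·) = 0`. -/
def IsReebVector (α : DForm I M 1) {x : M} (R : TangentSpace I x) : Prop :=
  α x ![R] = 1 ∧ ∀ v : TangentSpace I x, α.d x ![R, v] = 0

/-- `F` is the (complete) Reeb flow of `α`: each `t ↦ F t x` is an integral curve, starting at `x`,
of the Reeb vector field of `α`. -/
def IsReebFlow (α : DForm I M 1) (F : ℝ → M → M) : Prop :=
  (∀ x, F 0 x = x) ∧
  ∀ (x : M) (t : ℝ), ∃ R : TangentSpace I (F t x), IsReebVector α R ∧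
    HasMFDerivAt 𝓘(ℝ, ℝ) I (fun s => F s x) t
      ((ContinuousLinearMap.id ℝ ℝ).smulRight R : ℝ →L[ℝ] TangentSpace I (F t x))

open Classical in
/-- The Reeb flow `φ_α^t` of a contact form whose Reeb vector field is complete. -/
def reebFlow (α : DForm I M 1) : ℝ → M → M :=
  if h : ∃ F, IsReebFlow α F then h.choose else fun _ x => x

end Forms

/-! ### Contact isotopies and the universal cover of the identity component -/

section Isotopies

variable {E : Type*} [NormedAddCommGroup E] [NormedSpace ℝ E]
  {H : Type*} [TopologicalSpace H] {I : ModelWithCorners ℝ E H}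
  {M : Type*} [TopologicalSpace M] [ChartedSpace H M]
  {A : Type*} [NormedAddCommGroup A] [NormedSpace ℝ A]

/-- A smooth family `(φ_a)_{a ∈ K}` of contactomorphisms of `(M, ker α)`: the map
`(a, x) ↦ φ_a(x)` is smooth on `K × M`, each `φ_a` is invertible (with inverses again depending
smoothly on `(a, x)`), and each `φ_a` preserves `ker α`. Values for `a ∉ K` are irrelevant. -/
structure IsContactFamily (α : DForm I M 1) (K : Set A) (φ : A → M → M) : Prop where
  smooth : ContMDiffOn (𝓘(ℝ, A).prod I) I ∞ (uncurry φ) (K ×ˢ univ)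
  exists_inv : ∃ ψ : A → M → M,
    ContMDiffOn (𝓘(ℝ, A).prod I) I ∞ (uncurry ψ) (K ×ˢ univ) ∧
    ∀ a ∈ K, LeftInverse (ψ a) (φ a) ∧ RightInverse (ψ a) (φ a)
  contact : ∀ a ∈ K, ∀ (x : M) (v : Fin 1 → TangentSpace I x),
    (DForm.pull (φ a) α : DForm I M 1) x v = 0 ↔ α x v = 0

/-- The family `(φ_a)_{a ∈ K}` is supported in a compact set. -/
def HasCompactSupp (K : Set A) (φ : A → M → M) : Prop :=
  ∃ C : Set M, IsCompact C ∧ ∀ a ∈ K, ∀ x ∉ C, φ a x = x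

/-- `α(d/dt φ_t(x))`, with one-sided derivatives at the end points of `[0,1]`. -/
def contactSpeed (α : DForm I M 1) (φ : ℝ → M → M) (t : ℝ) (x : M) : ℝ :=
  α (φ t x) ![mfderivWithin 𝓘(ℝ, ℝ) I (fun s => φ s x) (Icc 0 1) t (1 : ℝ)]

theorem contMDiff_slice {K : Set A} {φ : A → M → M}
    (h : ContMDiffOn (𝓘(ℝ, A).prod I) I ∞ (uncurry φ) (K ×ˢ univ)) {a : A} (ha : a ∈ K) :
    ContMDiff I I ∞ (φ a) := by
  have h1 : ContMDiffOn I (𝓘(ℝ, A).prod I) ∞ (fun x : M => (a, x)) univ :=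
    (contMDiff_const.prodMk contMDiff_id).contMDiffOn
  have := h.comp h1 (fun x _ => ⟨ha, mem_univ _⟩)
  exact contMDiffOn_univ.1 this

theorem contMDiffOn_fiberComp {K : Set A} {φ ψ : A → M → M}
    (hφ : ContMDiffOn (𝓘(ℝ, A).prod I) I ∞ (uncurry φ) (K ×ˢ univ))
    (hψ : ContMDiffOn (𝓘(ℝ, A).prod I) I ∞ (uncurry ψ) (K ×ˢ univ)) :
    ContMDiffOn (𝓘(ℝ, A).prod I) I ∞ (uncurry fun a => φ a ∘ ψ a) (K ×ˢ univ) := by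
  have h1 : ContMDiffOn (𝓘(ℝ, A).prod I) (𝓘(ℝ, A).prod I) ∞
      (fun p : A × M => (p.1, uncurry ψ p)) (K ×ˢ univ) :=
    contMDiff_fst.contMDiffOn.prodMk hψ
  exact hφ.comp h1 (fun p hp => ⟨hp.1, mem_univ _⟩)

theorem IsContactFamily.comp {α : DForm I M 1} {K : Set A} {φ ψ : A → M → M}
    (hφ : IsContactFamily α K φ) (hψ : IsContactFamily α K ψ) :
    IsContactFamily α K (fun a => φ a ∘ ψ a) := by
  obtain ⟨φ', hφ's, hφ'⟩ := hφ.exists_inv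
  obtain ⟨ψ', hψ's, hψ'⟩ := hψ.exists_inv
  refine ⟨contMDiffOn_fiberComp hφ.smooth hψ.smooth,
    ⟨fun a => ψ' a ∘ φ' a, contMDiffOn_fiberComp hψ's hφ's, fun a ha =>
      ⟨(hφ' a ha).1.comp (hψ' a ha).1, (hφ' a ha).2.comp (hψ' a ha).2⟩⟩, ?_⟩
  intro a ha x v
  have e := congrFun (DForm.pull_comp (I := I) (I' := I) α
    ((contMDiff_slice hφ.smooth ha).mdifferentiable (by simp))
    ((contMDiff_slice hψ.smooth ha).mdifferentiable (by simp))) x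
  rw [e, ← hψ.contact a ha x v]
  exact hφ.contact a ha (ψ a x) (fun i => mfderiv I I (ψ a) x (v i))

theorem IsContactFamily.inv {α : DForm I M 1} {K : Set A} {φ ψ : A → M → M}
    (hφ : IsContactFamily α K φ)
    (hs : ContMDiffOn (𝓘(ℝ, A).prod I) I ∞ (uncurry ψ) (K ×ˢ univ))
    (hψ : ∀ a ∈ K, LeftInverse (ψ a) (φ a) ∧ RightInverse (ψ a) (φ a)) :
    IsContactFamily α K ψ := by
  refine ⟨hs, ⟨φ, hφ.smooth, fun a ha => ⟨(hψ a ha).2, (hψ a ha).1⟩⟩, ?_⟩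
  intro a ha x v
  have e := congrFun (DForm.pull_comp (I := I) (I' := I) α
    ((contMDiff_slice hφ.smooth ha).mdifferentiable (by simp))
    ((contMDiff_slice hs ha).mdifferentiable (by simp))) x
  rw [(hψ a ha).2.comp_eq_id, DForm.pull_id] at e
  have h := hφ.contact a ha (ψ a x) (fun i => mfderiv I I (ψ a) x (v i))
  rw [e]
  exact h.symm

/-- A contact isotopy `(φ_t)_{t ∈ [0,1]}` of `(M, ker α)` starting at the identity. -/
structure ContactIsotopy (α : DForm I M 1) where
  toFun : ℝ → M → M
  isContactFamily : IsContactFamily α (Icc (0 : ℝ) 1) toFun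
  map_zero : toFun 0 = id

namespace ContactIsotopy

variable {α : DForm I M 1}

/-- Smooth homotopy, relative to the end points, of contact isotopies starting at the identity.
The first parameter is the homotopy parameter `s`, the second one is the time `t`. -/
def Homotopic (φ ψ : ContactIsotopy α) : Prop :=
  ∃ h : ℝ × ℝ → M → M, IsContactFamily α (Icc (0 : ℝ) 1 ×ˢ Icc (0 : ℝ) 1) h ∧
    (∀ s ∈ Icc (0 : ℝ) 1, h (s, 0) = id ∧ h (s, 1) = φ.toFun 1) ∧
    ∀ t ∈ Icc (0 : ℝ) 1, h (0, t) = φ.toFun t ∧ h (1, t) = ψ.toFun t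

/-- The product isotopy `(φ_t ∘ ψ_t)`. -/
def mul (φ ψ : ContactIsotopy α) : ContactIsotopy α where
  toFun t := φ.toFun t ∘ ψ.toFun t
  isContactFamily := φ.isContactFamily.comp ψ.isContactFamily
  map_zero := by rw [φ.map_zero, ψ.map_zero]; rfl

/-- The inverse isotopy `(φ_t⁻¹)`. -/
def inv (φ : ContactIsotopy α) : ContactIsotopy α where
  toFun := φ.isContactFamily.exists_inv.choose
  isContactFamily := φ.isContactFamily.inv φ.isContactFamily.exists_inv.choose_spec.1
    φ.isContactFamily.exists_inv.choose_spec.2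
  map_zero := by
    have h := (φ.isContactFamily.exists_inv.choose_spec.2 0 (by simp)).1
    have h0 := φ.map_zero
    funext x
    have := h x
    rw [h0] at this
    exact this

theorem inv_spec (φ : ContactIsotopy α) {t : ℝ} (ht : t ∈ Icc (0 : ℝ) 1) :
    LeftInverse (φ.inv.toFun t) (φ.toFun t) ∧ RightInverse (φ.inv.toFun t) (φ.toFun t) :=
  φ.isContactFamily.exists_inv.choose_spec.2 t ht

/-- The identity isotopy. -/
def one (α : DForm I M 1) : ContactIsotopy α where
  toFun _ := id
  isContactFamily :=
    ⟨contMDiff_snd.contMDiffOn, ⟨fun _ => id, contMDiff_snd.contMDiffOn, fun _ _ =>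
      ⟨fun _ => rfl, fun _ => rfl⟩⟩, fun _ _ x v => by rw [DForm.pull_id]⟩
  map_zero := rfl

theorem contMDiffOn_snd (φ : ContactIsotopy α) :
    ContMDiffOn (𝓘(ℝ, ℝ × ℝ).prod I) I ∞ (uncurry fun p : ℝ × ℝ => φ.toFun p.2)
      ((Icc (0 : ℝ) 1 ×ˢ Icc (0 : ℝ) 1) ×ˢ univ) := by
  have h1 : ContMDiff (𝓘(ℝ, ℝ × ℝ).prod I) (𝓘(ℝ, ℝ).prod I) ∞
      (fun q : (ℝ × ℝ) × M => (q.1.2, q.2)) :=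
    (contDiff_snd.contMDiff.comp contMDiff_fst).prodMk contMDiff_snd
  exact φ.isContactFamily.smooth.comp h1.contMDiffOn (fun q hq => ⟨hq.1.2, mem_univ _⟩)

theorem isContactFamily_snd (φ : ContactIsotopy α) :
    IsContactFamily α (Icc (0 : ℝ) 1 ×ˢ Icc (0 : ℝ) 1) (fun p => φ.toFun p.2) :=
  ⟨φ.contMDiffOn_snd, ⟨fun p => φ.inv.toFun p.2, φ.inv.contMDiffOn_snd, fun _ hp =>
    φ.inv_spec hp.2⟩, fun p hp => φ.isContactFamily.contact p.2 hp.2⟩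

theorem Homotopic.mul_left (χ : ContactIsotopy α) {φ ψ : ContactIsotopy α}
    (h : φ.Homotopic ψ) : (χ.mul φ).Homotopic (χ.mul ψ) := by
  obtain ⟨h, hc, h0, h1⟩ := h
  refine ⟨fun p => χ.toFun p.2 ∘ h p, χ.isContactFamily_snd.comp hc, fun s hs => ⟨?_, ?_⟩,
    fun t ht => ⟨?_, ?_⟩⟩
  · simp [(h0 s hs).1, χ.map_zero]
  · simp [(h0 s hs).2, mul]
  · simp [(h1 t ht).1, mul]
  · simp [(h1 t ht).2, mul]

theorem Homotopic.mul_right (χ : ContactIsotopy α) {φ ψ : ContactIsotopy α}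
    (h : φ.Homotopic ψ) : (φ.mul χ).Homotopic (ψ.mul χ) := by
  obtain ⟨h, hc, h0, h1⟩ := h
  refine ⟨fun p => h p ∘ χ.toFun p.2, hc.comp χ.isContactFamily_snd, fun s hs => ⟨?_, ?_⟩,
    fun t ht => ⟨?_, ?_⟩⟩
  · simp [(h0 s hs).1, χ.map_zero]
  · simp [(h0 s hs).2, mul]
  · simp [(h1 t ht).1, mul]
  · simp [(h1 t ht).2, mul]

theorem Homotopic.inv {φ ψ : ContactIsotopy α} (h : φ.Homotopic ψ) :
    φ.inv.Homotopic ψ.inv := by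
  obtain ⟨h, hc, h0, h1⟩ := h
  obtain ⟨k, hks, hk⟩ := hc.exists_inv
  have key : ∀ p ∈ Icc (0 : ℝ) 1 ×ˢ Icc (0 : ℝ) 1, ∀ (f g : M → M), h p = f →
      RightInverse g f → k p = g := by
    intro p hp f g hf hg
    funext x
    have := (hk p hp).1 (g x)
    rw [hf, hg x] at this
    exact this
  have z : (0 : ℝ) ∈ Icc (0 : ℝ) 1 := by simp
  have o : (1 : ℝ) ∈ Icc (0 : ℝ) 1 := by simp
  refine ⟨k, hc.inv hks hk, fun s hs => ⟨?_, ?_⟩, fun t ht => ⟨?_, ?_⟩⟩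
  · exact key _ ⟨hs, z⟩ _ _ (h0 s hs).1 (fun _ => rfl)
  · exact key _ ⟨hs, o⟩ _ _ (h0 s hs).2 (φ.inv_spec o).2
  · exact key _ ⟨z, ht⟩ _ _ (h1 t ht).1 (φ.inv_spec ht).2
  · exact key _ ⟨o, ht⟩ _ _ (h1 t ht).2 (ψ.inv_spec ht).2

end ContactIsotopy

/-- The universal cover of `Cont_0(M, ker α)` (`M` closed): contact isotopies starting at the
identity modulo homotopy relative to the end points. -/
def UCont (α : DForm I M 1) : Type _ := Quot (ContactIsotopy.Homotopic (α := α))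

namespace UCont

variable {α : DForm I M 1}

/-- The class of a contact isotopy. -/
def mk (φ : ContactIsotopy α) : UCont α := Quot.mk _ φ

instance : One (UCont α) := ⟨mk (ContactIsotopy.one α)⟩

instance : Mul (UCont α) :=
  ⟨Quot.map₂ ContactIsotopy.mul (fun χ _ _ h => h.mul_left χ) (fun _ _ χ h => h.mul_right χ)⟩

instance : Inv (UCont α) := ⟨Quot.map ContactIsotopy.inv (fun _ _ h => h.inv)⟩

end UCont

/-! ### Legendrian isotopies of a compact Legendrian `Λ`

Legendrian isotopies starting at `Λ` are encoded as families of subsets `P : ℝ → Set M`, of which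
only the `P t` with `t ∈ [0,1]` matter. -/

/-- The two paths `P`, `Q` in the Legendrian isotopy class of `Λ`, starting at `Λ`, are homotopic
relative to their end points: there is a smooth family `Λ_t^s = h_{s,t}(Λ)`, given by compactly
supported contactomorphisms, with `Λ_0^s = Λ`, `Λ_1^s = P 1`, `Λ_t^0 = P t` and `Λ_t^1 = Q t`. -/
def LegHomotopic (α : DForm I M 1) (Λ : Set M) (P Q : ℝ → Set M) : Prop :=
  ∃ h : ℝ × ℝ → M → M, IsContactFamily α (Icc (0 : ℝ) 1 ×ˢ Icc (0 : ℝ) 1) h ∧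
    HasCompactSupp (Icc (0 : ℝ) 1 ×ˢ Icc (0 : ℝ) 1) h ∧
    (∀ s ∈ Icc (0 : ℝ) 1, h (s, 0) = id ∧ h (s, 1) '' Λ = P 1) ∧
    ∀ t ∈ Icc (0 : ℝ) 1, h (0, t) '' Λ = P t ∧ h (1, t) '' Λ = Q t

/-- There is a positive contractible loop of Legendrians based at `Λ`. -/
def HasPositiveContractibleLoop (α : DForm I M 1) (Λ : Set M) : Prop :=
  ∃ φ : ContactIsotopy α, HasCompactSupp (Icc (0 : ℝ) 1) φ.toFun ∧
    (∀ t ∈ Icc (0 : ℝ) 1, ∀ x ∈ Λ, 0 < contactSpeed α φ.toFun t x) ∧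
    LegHomotopic α Λ (fun t => φ.toFun t '' Λ) (fun _ => Λ)

/-- The relation `[P] ≼ [Q]` on the universal cover of the Legendrian isotopy class of `Λ`: there is
a non-negative Legendrian isotopy `(ψ_t(P 1))` starting at `P 1` such that the path
`s ↦ [(ψ_{st})] · [P]` in the universal cover ends at `[Q]`. -/
def LegLE (α : DForm I M 1) (Λ : Set M) (P Q : ℝ → Set M) : Prop :=
  ∃ ψ : ContactIsotopy α, HasCompactSupp (Icc (0 : ℝ) 1) ψ.toFun ∧
    (∀ t ∈ Icc (0 : ℝ) 1, ∀ x ∈ P 1, 0 ≤ contactSpeed α ψ.toFun t x) ∧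
    LegHomotopic α Λ (fun t => ψ.toFun t '' P t) Q

/-- `ℓ_+^α([P], [Q]) = inf {T | [P] ≼ φ_α^T · [Q]}`, with values in `[-∞, +∞]`; here
`φ_α^T · [Q]` is represented by the path `t ↦ φ_α^{tT}(Q t)`. -/
def ellPlus (α : DForm I M 1) (Λ : Set M) (P Q : ℝ → Set M) : EReal :=
  sInf {c : EReal | ∃ T : ℝ, c = T ∧ LegLE α Λ P (fun t => reebFlow α (t * T) '' Q t)}

end Isotopies

/-! ### The contact product, graphs, and the order spectral selector -/

section ContactProduct

variable {E : Type*} [NormedAddCommGroup E] [NormedSpace ℝ E]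
  {H : Type*} [TopologicalSpace H] {I : ModelWithCorners ℝ E H}
  {M : Type*} [TopologicalSpace M] [ChartedSpace H M]

/-- The product contact form `β = pr₂^* α - e^θ pr₁^* α` on `M × M × ℝ`. -/
def productForm (α : DForm I M 1) : DForm (I.prod (I.prod 𝓘(ℝ, ℝ))) (M × M × ℝ) 1 :=
  fun p => DForm.pull (fun q : M × M × ℝ => q.2.1) α p -
    Real.exp p.2.2 • DForm.pull (fun q : M × M × ℝ => q.1) α p

variable (M) in
/-- The diagonal `Δ = {(x, x, 0)}`. -/
def diagonal : Set (M × M × ℝ) := range fun x : M => (x, x, (0 : ℝ))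

/-- `(M, ker α)` is strongly orderable: its contact product has no positive contractible loop of
Legendrians based at the diagonal. -/
def StronglyOrderable (α : DForm I M 1) : Prop :=
  ¬ HasPositiveContractibleLoop (productForm α) (diagonal M)

open Classical in
/-- The conformal factor `g_t` of a contact isotopy: `φ_t^* α = e^{g_t} α`. -/
def conformalFactor {α : DForm I M 1} (φ : ContactIsotopy α) (t : ℝ) (x : M) : ℝ :=
  if h : ∃ g : ℝ, DForm.pull (φ.toFun t) α x = Real.exp g • α x then h.choose else 0

/-- The graph `Φ_t(x₁, x₂, θ) = (x₁, φ_t(x₂), θ + g_t(x₂))` of a contact isotopy. -/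
def graphMap {α : DForm I M 1} (φ : ContactIsotopy α) (t : ℝ) : M × M × ℝ → M × M × ℝ :=
  fun p => (p.1, φ.toFun t p.2.1, p.2.2 + conformalFactor φ t p.2.1)

/-- `C_+^α(φ̃) = ℓ_+^β(Φ̃ · Δ, Δ)` where `Φ̃` is the graph of `φ̃`. The value of `ℓ_+^β` does not
depend on the isotopy representing `φ̃`; formally the infimum over all representatives is taken. -/
def CPlus {α : DForm I M 1} (φ : UCont α) : EReal :=
  ⨅ (f : ContactIsotopy α) (_ : UCont.mk f = φ),
    ellPlus (productForm α) (diagonal M) (fun t => graphMap f t '' diagonal M)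
      (fun _ => diagonal M)

end ContactProduct

/-- `⌈x⌉_T`: the smallest multiple of `T > 0` greater than or equal to `x`. -/
def ceilMul (T x : ℝ) : ℝ := T * ⌈x / T⌉

/-! ### Prequantizations and their cyclic quotients -/

section Prequantization

/-- `α` and the action of `𝕋¹ = ℝ/2πℤ` (identified with the unit circle through `t ↦ e^{it}`) make
`M` a prequantization of `(W, σ)`: `π : M → W` is a smooth principal `𝕋¹`-bundle, `α` is a contact
form with `π^* σ = dα`, and the Reeb flow of `α` is the action of `𝕋¹`. (As a principal action is
free, the Reeb flow is then Zoll of minimal period `2π`.) -/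
structure IsPrequantization
    {E : Type*} [NormedAddCommGroup E] [NormedSpace ℝ E]
    {M : Type*} [TopologicalSpace M] [ChartedSpace E M] [MulAction Circle M]
    {F : Type*} [NormedAddCommGroup F] [NormedSpace ℝ F]
    {W : Type*} [TopologicalSpace W] [ChartedSpace F W]
    (α : DForm 𝓘(ℝ, E) M 1) (σ : DForm 𝓘(ℝ, F) W 2) (π : M → W) : Prop where
  contact : IsContactForm α
  symplectic : IsSymplecticForm σ
  smooth_proj : ContMDiff 𝓘(ℝ, E) 𝓘(ℝ, F) ∞ π
  smooth_action : ContMDiff ((𝓡 1).prod 𝓘(ℝ, E)) 𝓘(ℝ, E) ∞ (fun p : Circle × M => p.1 • p.2)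
  invariant : ∀ (z : Circle) (x : M), π (z • x) = π x
  locally_trivial : ∀ w : W, ∃ e : Bundle.Trivialization Circle π, w ∈ e.baseSet ∧
    ContMDiffOn 𝓘(ℝ, E) (𝓘(ℝ, F).prod (𝓡 1)) ∞ e e.source ∧
    ContMDiffOn (𝓘(ℝ, F).prod (𝓡 1)) 𝓘(ℝ, E) ∞ e.toOpenPartialHomeomorph.symm e.target ∧
    ∀ (z : Circle), ∀ x ∈ e.source, (e (z • x)).2 = z * (e x).2
  reeb : IsReebFlow α (fun t x => Circle.exp t • x)
  pull_eq : DForm.pull π σ = α.d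

/-- The subgroup `ℤ_k ⊂ 𝕋¹`, `[j] ↦ 2πj/k`. -/
def cyclicSubgroup (k : ℕ) : Subgroup Circle := Subgroup.zpowers (Circle.exp (2 * Real.pi / k))

instance (k : ℕ) [NeZero k] : Finite (cyclicSubgroup k) := by
  have hk : (k : ℝ) ≠ 0 := Nat.cast_ne_zero.2 (NeZero.ne k)
  have h : IsOfFinOrder (Circle.exp (2 * Real.pi / k)) := by
    refine isOfFinOrder_iff_pow_eq_one.2 ⟨k, Nat.pos_of_ne_zero (NeZero.ne k), ?_⟩
    have e : (k : ℝ) * (2 * Real.pi / k) = 2 * Real.pi := by field_simp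
    have : Circle.exp (2 * Real.pi / k) ^ k = Circle.exp ((k : ℝ) * (2 * Real.pi / k)) := by
      ext; simp [← Complex.exp_nat_mul]
    rw [this, e, Circle.exp_two_pi]
  exact h.finite_zpowers

/-- The quotient `M_k = M / ℤ_k`, with the quotient topology and (for a free continuous action on a
compact Hausdorff manifold) the quotient manifold structure provided by Mathlib. -/
abbrev CyclicQuotient (k : ℕ) (M : Type*) [MulAction Circle M] : Type _ :=
  MulAction.orbitRel.Quotient (cyclicSubgroup k) M

/-- The covering map `M → M_k`. -/
def cyclicProj (k : ℕ) (M : Type*) [MulAction Circle M] : M → CyclicQuotient k M :=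
  Quotient.mk _

variable {E : Type*} [NormedAddCommGroup E] [NormedSpace ℝ E] [FiniteDimensional ℝ E]
  {M : Type*} [TopologicalSpace M] [T2Space M] [CompactSpace M] [ChartedSpace E M]
  [MulAction Circle M] [ContinuousSMul Circle M] [IsCancelSMul Circle M]

open Classical in
/-- The form `α_k` on `M_k`: the unique 1-form whose pull-back to `M` is `α`. -/
def quotientForm (k : ℕ) [NeZero k] (α : DForm 𝓘(ℝ, E) M 1) :
    DForm 𝓘(ℝ, E) (CyclicQuotient k M) 1 :=
  if h : ∃ α' : DForm 𝓘(ℝ, E) (CyclicQuotient k M) 1, DForm.pull (cyclicProj k M) α' = α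
  then h.choose else fun _ => 0

/-- `ψ` is the lift of `φ`: they are represented by isotopies `(ψ_t)` of `M` and `(φ_t)` of `M_k`,
starting at the identity, such that each `ψ_t` lifts `φ_t`. -/
def IsLift {k : ℕ} [NeZero k] {α : DForm 𝓘(ℝ, E) M 1}
    (φ : UCont (quotientForm k α)) (ψ : UCont α) : Prop :=
  ∃ (f : ContactIsotopy (quotientForm k α)) (g : ContactIsotopy α),
    UCont.mk f = φ ∧ UCont.mk g = ψ ∧
    ∀ t ∈ Icc (0 : ℝ) 1, cyclicProj k M ∘ g.toFun t = f.toFun t ∘ cyclicProj k M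

end Prequantization

end ContactGeometry

end

/-!
Write `N` for the quotient `M / ℤ_k`, `P = N × N × ℝ` for its contact product with form `β`, and `Δ`
for the diagonal. The circle action is the Reeb flow of `α`, so it preserves `α`, and it descends to the
Reeb flow of the quotient form; on the quotient, the time-`2π/k` map is the identity. The quotient map
`M → N` is a finite covering and a local diffeomorphism (`IsPrequantization.isFormCovering`).

*Lifting.* Families of contactomorphisms over a convex set of parameters lift through the covering, and
so do compactly supported families of the contact product, through the covering `M × M × ℝ → P`. The
preimage of `Δ` is `{π(x₁) = π(x₂), θ = 0}`, in which the diagonal of `M × M × ℝ` is open and closed;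
hence a lift which starts at the diagonal and projects to a Legendrian isotopy of graphs or of `Δ` is an
isotopy of the corresponding sets upstairs (`IsFormCovering.image_diagonal_eq`). Speeds are unchanged.
So a positive contractible loop downstairs lifts to one upstairs (`IsFormCovering.stronglyOrderable`),
and every real number admissible in the infimum defining `C_+` of a class is admissible for its lift
(`IsFormCovering.cPlus_lift_le`). Unique lifting of homotopies gives
`IsFormCovering.existsUnique_lift`.

*Cutting off.* The graph of a contact isotopy of `N` is not compactly supported in `P`. Its contact
Hamiltonian does not depend on `θ`, and multiplying it by a cut-off function of `θ` gives a compactly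
supported contact isotopy with the same effect on `Δ` (`exists_cutoff`). This needs the flow of a
compactly supported vector field to be smooth in all variables (`contDiff_of_isGlobalFlow`,
`exists_smooth_flow`). The Reeb flow of `β` is cut off by an explicit formula (`levelFlow`).

*Finiteness.* The speed of a compactly supported isotopy is bounded. Undoing a contact isotopy
while moving fast enough along the Reeb flow is therefore a non-negative isotopy, so `C_+ < ∞`
(`exists_nonnegTo`). If Reeb translates by arbitrarily negative times were above a given class, going
from `Δ` to the graph, up to such a translate, and back along the Reeb flow would combine to a positive
contractible loop, so `C_+ > -∞` under strong orderability (`NonnegTo.bddBelow`).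

*Conjugation.* A contactomorphism `ψ` of `N` in a path from the identity lifts to `P` as
`W(x₁, x₂, θ) = (ψ(x₁), ψ(x₂), θ + g(x₂) - g(x₁))`, which preserves `Δ` and maps the graph of `φ` to the
graph of `ψ φ ψ⁻¹`. If `T` is a multiple of `2π/k`, the time-`T` Reeb translate of `Δ` is `Δ`; then
`W φ_β^{tT}(Δ)` and `φ_β^{tT}(Δ)` are homotopic with fixed end points, through the lifts of the path
from the identity to `ψ`. Hence `C_+(φ) ≤ T` implies `C_+(ψ φ ψ⁻¹) ≤ T` (`cPlus_conj_le`), and the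
converse by symmetry: the values rounded up to multiples of `2π/k` agree (`ceilMul_cPlus_conj`).

In the file, forms are handled through their pairings with velocities of curves, and the exterior
derivative through Cartan's formula on two-parameter surfaces (`deriv_ev_sub_deriv_ev`).
-/

open Set Function
open scoped Manifold ContDiff Topology

noncomputable section

namespace ContactGeometry

set_option linter.unusedSectionVars false

/-! ### Velocities, and pairings of forms with families of curves -/

section VelocityCalculus

variable {E : Type*} [NormedAddCommGroup E] [NormedSpace ℝ E]
  {H : Type*} [TopologicalSpace H] {I : ModelWithCorners ℝ E H}
  {M : Type*} [TopologicalSpace M] [ChartedSpace H M]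
  {E' : Type*} [NormedAddCommGroup E'] [NormedSpace ℝ E']
  {H' : Type*} [TopologicalSpace H'] {J : ModelWithCorners ℝ E' H'}
  {B : Type*} [TopologicalSpace B] [ChartedSpace H' B]

/-- A form at a point as an alternating map on the model space `E`, to which all tangent spaces are
definitionally equal; this avoids transports along equalities of base points. -/
def DForm.toModel {n : ℕ} (σ : DForm I M n) (x : M) : E [⋀^Fin n]→L[ℝ] ℝ := σ x

/-- The value `σ_x(u)` of a 1-form, with `u` taken in the model space. -/
def DForm.ev (σ : DForm I M 1) (x : M) (u : E) : ℝ := σ.toModel x ![u]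

/-- The value `σ_x(u, v)` of a 2-form, with `u`, `v` taken in the model space. -/
def DForm.ev₂ (σ : DForm I M 2) (x : M) (u v : E) : ℝ := σ.toModel x ![u, v]

variable (I J) in
/-- The differential `d_x f`, as a map between the model spaces. -/
def mdf (f : M → B) (x : M) : E →L[ℝ] E' := mfderiv I J f x

variable (I) in
/-- The velocity `ċ(t)` of a curve `c`, as an element of the model space. -/
def vel (c : ℝ → M) (t : ℝ) : E := mdf 𝓘(ℝ, ℝ) I c t 1

theorem vec_one (v : Fin 1 → E) : v = ![v 0] := funext fun i => by fin_cases i; rfl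

theorem DForm.ev_add (σ : DForm I M 1) (x : M) (u v : E) :
    σ.ev x (u + v) = σ.ev x u + σ.ev x v := by
  have := (σ.toModel x).map_update_add (![0]) 0 u v
  rw [vec_one (update _ _ _), vec_one (update _ _ u), vec_one (update _ _ v)] at this
  simpa [DForm.ev] using this

theorem DForm.ev_smul (σ : DForm I M 1) (x : M) (c : ℝ) (u : E) :
    σ.ev x (c • u) = c * σ.ev x u := by
  have := (σ.toModel x).map_update_smul (![0]) 0 c u
  rw [vec_one (update _ _ _), vec_one (update _ _ u)] at this
  simpa [DForm.ev] using this

theorem DForm.ev_zero (σ : DForm I M 1) (x : M) : σ.ev x 0 = 0 := by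
  simpa using σ.ev_smul x 0 0

theorem DForm.ev_neg (σ : DForm I M 1) (x : M) (u : E) : σ.ev x (-u) = -σ.ev x u := by
  simpa using σ.ev_smul x (-1) u

theorem DForm.ev_sub (σ : DForm I M 1) (x : M) (u v : E) :
    σ.ev x (u - v) = σ.ev x u - σ.ev x v := by
  rw [sub_eq_add_neg, σ.ev_add, σ.ev_neg, sub_eq_add_neg]

theorem vec_update_zero (u v w : E) : update ![u, v] 0 w = ![w, v] :=
  funext fun i => by fin_cases i <;> rfl

theorem DForm.ev₂_add_left (σ : DForm I M 2) (x : M) (u u' v : E) :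
    σ.ev₂ x (u + u') v = σ.ev₂ x u v + σ.ev₂ x u' v := by
  have := (σ.toModel x).map_update_add (![0, v]) 0 u u'
  rwa [vec_update_zero, vec_update_zero, vec_update_zero] at this

theorem DForm.ev₂_smul_left (σ : DForm I M 2) (x : M) (c : ℝ) (u v : E) :
    σ.ev₂ x (c • u) v = c * σ.ev₂ x u v := by
  have := (σ.toModel x).map_update_smul (![0, v]) 0 c u
  rwa [vec_update_zero, vec_update_zero] at this

theorem DForm.ev₂_swap (σ : DForm I M 2) (x : M) (u v : E) : σ.ev₂ x u v = -σ.ev₂ x v u := by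
  have := (σ.toModel x).toAlternatingMap.map_swap ![v, u] (i := 0) (j := 1) (by simp)
  have e : (![v, u] ∘ Equiv.swap 0 1 : Fin 2 → E) = ![u, v] :=
    funext fun i => by fin_cases i <;> simp
  rw [e] at this
  exact this

theorem DForm.ev₂_smul_right (σ : DForm I M 2) (x : M) (c : ℝ) (u v : E) :
    σ.ev₂ x u (c • v) = c * σ.ev₂ x u v := by
  rw [σ.ev₂_swap, σ.ev₂_smul_left, σ.ev₂_swap x v]; ring

theorem DForm.ev₂_zero_left (σ : DForm I M 2) (x : M) (v : E) : σ.ev₂ x 0 v = 0 := by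
  simpa using σ.ev₂_smul_left x 0 0 v

theorem DForm.ev₂_zero_right (σ : DForm I M 2) (x : M) (v : E) : σ.ev₂ x v 0 = 0 := by
  simpa using σ.ev₂_smul_right x 0 v 0

theorem DForm.ext_ev {σ τ : DForm I M 1} {x : M} (h : ∀ u, σ.ev x u = τ.ev x u) : σ x = τ x := by
  change σ.toModel x = τ.toModel x
  ext v
  rw [vec_one v]
  exact h (v 0)

theorem DForm.ev_pull {σ : DForm J B 1} {f : M → B} {x : M} {u : E} :
    (DForm.pull f σ : DForm I M 1).ev x u = σ.ev (f x) (mdf I J f x u) := by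
  change σ.toModel (f x) (mdf I J f x ∘ ![u]) = _
  rw [vec_one (mdf I J f x ∘ ![u])]
  rfl

theorem mdf_comp {E'' : Type*} [NormedAddCommGroup E''] [NormedSpace ℝ E'']
    {H'' : Type*} [TopologicalSpace H''] {J' : ModelWithCorners ℝ E'' H''}
    {B' : Type*} [TopologicalSpace B'] [ChartedSpace H'' B'] {f : M → B} {g : B → B'} {x : M}
    (hg : MDifferentiableAt J J' g (f x)) (hf : MDifferentiableAt I J f x) (u : E) :
    mdf I J' (fun y => g (f y)) x u = mdf J J' g (f x) (mdf I J f x u) :=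
  mfderiv_comp_apply x hg hf u

theorem mdf_id (x : M) (u : E) : mdf I I (fun y : M => y) x u = u :=
  congrArg (fun L : E →L[ℝ] E => L u) (mfderiv_id (I := I) (x := x))

theorem mdf_const (b : B) (x : M) : mdf I J (fun _ : M => b) x = 0 := mfderiv_const

theorem mdf_eq_fderiv {f : E → E'} {x : E} : mdf 𝓘(ℝ, E) 𝓘(ℝ, E') f x = fderiv ℝ f x :=
  mfderiv_eq_fderiv

theorem _root_.Filter.EventuallyEq.mdf_eq {f g : M → B} {x : M} (h : f =ᶠ[𝓝 x] g) :
    mdf I J f x = mdf I J g x := h.mfderiv_eq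

theorem vel_comp {f : M → B} {c : ℝ → M} {t : ℝ} (hf : MDifferentiableAt I J f (c t))
    (hc : MDifferentiableAt 𝓘(ℝ, ℝ) I c t) :
    vel J (fun s => f (c s)) t = mdf I J f (c t) (vel I c t) :=
  mdf_comp hf hc 1

theorem vel_eq_deriv {c : ℝ → E} {t : ℝ} : vel 𝓘(ℝ, E) c t = deriv c t := by
  rw [vel, mdf_eq_fderiv]
  exact fderiv_apply_one_eq_deriv

theorem _root_.Filter.EventuallyEq.vel_eq {c c' : ℝ → M} {t : ℝ} (h : c =ᶠ[𝓝 t] c') :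
    vel I c t = vel I c' t := by
  rw [vel, vel, h.mdf_eq]

theorem vel_comp_real {c : ℝ → M} {g : ℝ → ℝ} {t g' : ℝ}
    (hc : MDifferentiableAt 𝓘(ℝ, ℝ) I c (g t)) (hg : HasDerivAt g g' t) :
    vel I (fun s => c (g s)) t = g' • vel I c (g t) := by
  rw [vel_comp (I := 𝓘(ℝ, ℝ)) hc hg.differentiableAt.mdifferentiableAt, vel_eq_deriv, hg.deriv]
  have := (mdf 𝓘(ℝ, ℝ) I c (g t)).map_smul g' 1
  simpa [vel] using this

theorem vel_const (x : M) (t : ℝ) : vel I (fun _ => x) t = 0 := by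
  rw [vel, mdf_const]; rfl

theorem hasMFDerivAt_of_vel {c : ℝ → M} {t : ℝ} (hc : MDifferentiableAt 𝓘(ℝ, ℝ) I c t) {u : E}
    (hu : vel I c t = u) :
    HasMFDerivAt 𝓘(ℝ, ℝ) I c t ((1 : ℝ →L[ℝ] ℝ).smulRight u : ℝ →L[ℝ] E) := by
  have h := hc.hasMFDerivAt
  have e : mdf 𝓘(ℝ, ℝ) I c t = (1 : ℝ →L[ℝ] ℝ).smulRight u := by
    ext
    simpa [vel] using hu
  exact e ▸ h

theorem vel_of_hasMFDerivAt {c : ℝ → M} {t : ℝ} {L : ℝ →L[ℝ] E}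
    (h : HasMFDerivAt 𝓘(ℝ, ℝ) I c t L) : vel I c t = L 1 :=
  congrArg (fun L : ℝ →L[ℝ] E => L 1) h.mfderiv

/-- The differential of a map of two variables is the sum of the partial differentials. -/
theorem mdf_prod {E'' : Type*} [NormedAddCommGroup E''] [NormedSpace ℝ E'']
    {H'' : Type*} [TopologicalSpace H''] {J' : ModelWithCorners ℝ E'' H''}
    {B' : Type*} [TopologicalSpace B'] [ChartedSpace H'' B'] {f : B' → M → B} {p : B' × M}
    (hf : MDifferentiableAt (J'.prod I) J (uncurry f) p) (u : E'') (v : E) :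
    mdf (J'.prod I) J (uncurry f) p (u, v) =
      mdf J' J (fun s => f s p.2) p.1 u + mdf I J (f p.1) p.2 v :=
  mfderiv_prod_eq_add_apply (v := (u, v)) hf

theorem mdf_prodMk {E'' : Type*} [NormedAddCommGroup E''] [NormedSpace ℝ E'']
    {H'' : Type*} [TopologicalSpace H''] {J' : ModelWithCorners ℝ E'' H''}
    {B' : Type*} [TopologicalSpace B'] [ChartedSpace H'' B'] {f : M → B} {g : M → B'} {x : M}
    (hf : MDifferentiableAt I J f x) (hg : MDifferentiableAt I J' g x) (u : E) :
    mdf I (J.prod J') (fun x => (f x, g x)) x u = (mdf I J f x u, mdf I J' g x u) :=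
  congrArg (fun L : E →L[ℝ] E' × E'' => L u) (mfderiv_prodMk hf hg)

theorem vel_prodMk {c : ℝ → M} {c' : ℝ → B} {t : ℝ} (hc : MDifferentiableAt 𝓘(ℝ, ℝ) I c t)
    (hc' : MDifferentiableAt 𝓘(ℝ, ℝ) J c' t) :
    vel (I.prod J) (fun s => (c s, c' s)) t = (vel I c t, vel J c' t) :=
  mdf_prodMk hc hc' 1

/-- The velocity of `t ↦ f(t, c(t))` is the sum of the two partial velocities. -/
theorem vel_two {f : ℝ → M → B} {c : ℝ → M} {t : ℝ}
    (hf : MDifferentiableAt (𝓘(ℝ, ℝ).prod I) J (uncurry f) (t, c t))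
    (hc : MDifferentiableAt 𝓘(ℝ, ℝ) I c t) :
    vel J (fun s => f s (c s)) t =
      vel J (fun s => f s (c t)) t + mdf I J (f t) (c t) (vel I c t) := by
  have h1 := vel_comp (f := uncurry f) (c := fun s => (s, c s)) hf (mdifferentiableAt_id.prodMk hc)
  have h3 : vel (𝓘(ℝ, ℝ).prod I) (fun s => (s, c s)) t = (1, vel I c t) := by
    refine (vel_prodMk mdifferentiableAt_id hc).trans ?_
    rw [show (id : ℝ → ℝ) = fun y => y from rfl, vel, mdf_id]
  rw [h3, mdf_prod hf] at h1
  exact h1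

section Smooth

variable [IsManifold I ∞ M] [I.Boundaryless]

instance instIsManifoldOne : IsManifold I 1 M := IsManifold.of_le (n := ∞) (by simp)

theorem mfderiv_extChartAt_symm_apply {x₀ x : M} (hx : x ∈ (chartAt H x₀).source) (u : E) :
    mdf 𝓘(ℝ, E) I (extChartAt I x₀).symm (extChartAt I x₀ x)
      (mdf I 𝓘(ℝ, E) (extChartAt I x₀) x u) = u := by
  have hx' : x ∈ (extChartAt I x₀).source := by rwa [extChartAt_source]
  have hy := (extChartAt I x₀).map_source hx'
  have h := mfderivWithin_extChartAt_symm_comp_mfderiv_extChartAt (I := I) hy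
  rw [I.range_eq_univ, mfderivWithin_univ, (extChartAt I x₀).left_inv hx'] at h
  exact congrArg (fun L : E →L[ℝ] E => L u) h

theorem DForm.inChart_apply (σ : DForm I M 1) (x₀ : M) (y u : E) :
    σ.inChart x₀ y ![u] = σ.ev ((extChartAt I x₀).symm y)
      (mdf 𝓘(ℝ, E) I (extChartAt I x₀).symm y u) := by
  change σ.toModel _ (mdf 𝓘(ℝ, E) I (extChartAt I x₀).symm y ∘ ![u]) = _
  rw [vec_one (mdf _ _ _ _ ∘ ![u])]
  rfl

theorem DForm.ev_eq_inChart (σ : DForm I M 1) {x₀ x : M} (hx : x ∈ (chartAt H x₀).source) (u : E) :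
    σ.ev x u = σ.inChart x₀ (extChartAt I x₀ x)
      ![mdf I 𝓘(ℝ, E) (extChartAt I x₀) x u] := by
  rw [σ.inChart_apply, mfderiv_extChartAt_symm_apply hx,
    (extChartAt I x₀).left_inv (by rwa [extChartAt_source])]

theorem contDiffAt_of_isSmooth {σ : DForm I M 1} (hσ : σ.IsSmooth) {x₀ x : M}
    (hx : x ∈ (chartAt H x₀).source) : ContDiffAt ℝ ∞ (σ.inChart x₀) (extChartAt I x₀ x) :=
  (hσ x₀).contDiffAt ((isOpen_extChartAt_target x₀).mem_nhds
    ((extChartAt I x₀).map_source (by rwa [extChartAt_source])))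

/-- The derivative in `τ` at `τ = g(b)` of a smooth family of curves in a normed space depends
smoothly on the parameter `b`. -/
theorem contMDiffAt_deriv_param [IsManifold J ∞ B] {f : B → ℝ → E} {g : B → ℝ} {b₀ : B}
    (hf : ContMDiffAt (J.prod 𝓘(ℝ, ℝ)) 𝓘(ℝ, E) ∞ (uncurry f) (b₀, g b₀))
    (hg : ContMDiffAt J 𝓘(ℝ, ℝ) ∞ g b₀) :
    ContMDiffAt J 𝓘(ℝ, E) ∞ (fun b => deriv (f b) (g b)) b₀ := by
  have h := ContMDiffAt.mfderiv (m := ∞) f g hf hg (by simp)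
  have h' : ContMDiffAt J 𝓘(ℝ, ℝ →L[ℝ] E) ∞ (fun b => mdf 𝓘(ℝ, ℝ) 𝓘(ℝ, E) (f b) (g b)) b₀ := by
    refine h.congr_of_eventuallyEq (Filter.Eventually.of_forall fun b => ?_)
    exact (congrFun (inTangentCoordinates_model_space (I := 𝓘(ℝ, ℝ)) (I' := 𝓘(ℝ, E)) g
      (fun x => f x (g x)) (fun b => mdf 𝓘(ℝ, ℝ) 𝓘(ℝ, E) (f b) (g b)) b₀) b).symm
  have h2 := h'.clm_apply (contMDiffAt_const (c := (1 : ℝ)))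
  refine h2.congr_of_eventuallyEq (Filter.Eventually.of_forall fun b => ?_)
  exact vel_eq_deriv.symm

theorem contDiff_apply_singleton :
    ContDiff ℝ ∞ (fun p : (E [⋀^Fin 1]→L[ℝ] ℝ) × E => p.1 ![p.2]) := by
  have h : ContDiff ℝ ∞ (fun p : (E [⋀^Fin 1]→L[ℝ] ℝ) × E =>
      ((ContinuousAlternatingMap.ofSubsingletonLIE (𝕜 := ℝ) (E := E) (F := ℝ) (0 : Fin 1)).symm p.1)
        p.2) :=
    ContDiff.clm_apply
      ((ContinuousAlternatingMap.ofSubsingletonLIE (𝕜 := ℝ) (E := E) (F := ℝ)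
        (0 : Fin 1)).symm.contDiff.comp contDiff_fst) contDiff_snd
  convert h using 2 with p
  change _ = p.1 _
  congr 1
  funext i
  fin_cases i; rfl

/-- The pairing of a smooth 1-form with the velocities of a smooth family of curves is smooth. -/
theorem contMDiffAt_ev_vel [IsManifold J ∞ B] {σ : DForm I M 1} (hσ : σ.IsSmooth)
    {Γ : B → ℝ → M} {g : B → ℝ} {b₀ : B}
    (hΓ : ContMDiffAt (J.prod 𝓘(ℝ, ℝ)) I ∞ (uncurry Γ) (b₀, g b₀))
    (hg : ContMDiffAt J 𝓘(ℝ, ℝ) ∞ g b₀) :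
    ContMDiffAt J 𝓘(ℝ, ℝ) ∞ (fun b => σ.ev (Γ b (g b)) (vel I (Γ b) (g b))) b₀ := by
  set x₀ := Γ b₀ (g b₀) with hx₀
  have hmk : ContMDiffAt J (J.prod 𝓘(ℝ, ℝ)) ∞ (fun b => (b, g b)) b₀ := contMDiffAt_id.prodMk hg
  have hΓg : ContMDiffAt J I ∞ (fun b => Γ b (g b)) b₀ := hΓ.comp b₀ hmk
  have hφ : ContMDiffAt I 𝓘(ℝ, E) ∞ (extChartAt I x₀) (Γ b₀ (g b₀)) :=
    contMDiffAt_extChartAt' (mem_chart_source H _)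
  have h1 : ContMDiffAt (J.prod 𝓘(ℝ, ℝ)) 𝓘(ℝ, E) ∞
      (uncurry fun b τ => extChartAt I x₀ (Γ b τ)) (b₀, g b₀) :=
    ContMDiffAt.comp (b₀, g b₀) (g := extChartAt I x₀) (f := uncurry Γ) hφ hΓ
  have h2 := contMDiffAt_deriv_param h1 hg
  have h3 : ContMDiffAt J 𝓘(ℝ, E [⋀^Fin 1]→L[ℝ] ℝ) ∞
      (fun b => σ.inChart x₀ (extChartAt I x₀ (Γ b (g b)))) b₀ :=
    ContMDiffAt.comp b₀ (g := fun x => σ.inChart x₀ (extChartAt I x₀ x))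
      (f := fun b => Γ b (g b))
      (ContMDiffAt.comp _ (contDiffAt_of_isSmooth hσ (mem_chart_source H x₀)).contMDiffAt hφ) hΓg
  have h4 := contDiff_apply_singleton.contMDiff.contMDiffAt.comp b₀ (h3.prodMk_space h2)
  refine h4.congr_of_eventuallyEq ?_
  have hs : ∀ᶠ b in 𝓝 b₀, Γ b (g b) ∈ (chartAt H x₀).source :=
    hΓg.continuousAt.preimage_mem_nhds (chart_source_mem_nhds H x₀)
  have hsm : ∀ᶠ b in 𝓝 b₀, ContMDiffAt (J.prod 𝓘(ℝ, ℝ)) I 1 (uncurry Γ) (b, g b) :=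
    hmk.continuousAt.eventually
      ((contMDiffAt_iff_contMDiffAt_nhds (by simp)).1
        (hΓ.of_le (by simp : (1 : WithTop ℕ∞) ≤ ∞)))
  filter_upwards [hs, hsm] with b hb hb'
  have hd : MDifferentiableAt 𝓘(ℝ, ℝ) I (Γ b) (g b) :=
    (ContMDiffAt.comp (g b) (g := uncurry Γ) (f := fun τ => (b, τ)) hb'
      (contMDiffAt_const.prodMk contMDiffAt_id)).mdifferentiableAt (by simp)
  rw [σ.ev_eq_inChart hb]
  simp only [comp_apply]
  rw [← vel_comp (mdifferentiableAt_extChartAt hb) hd, vel_eq_deriv]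

theorem contMDiff_ev_vel [IsManifold J ∞ B] {σ : DForm I M 1} (hσ : σ.IsSmooth)
    {Γ : B → ℝ → M} {g : B → ℝ} (hΓ : ContMDiff (J.prod 𝓘(ℝ, ℝ)) I ∞ (uncurry Γ))
    (hg : ContMDiff J 𝓘(ℝ, ℝ) ∞ g) :
    ContMDiff J 𝓘(ℝ, ℝ) ∞ (fun b => σ.ev (Γ b (g b)) (vel I (Γ b) (g b))) :=
  fun b => contMDiffAt_ev_vel hσ (hΓ _) (hg b)

theorem contDiffAt_of_contMDiffAt_prod {f : ℝ × ℝ → E} {p : ℝ × ℝ} {n : WithTop ℕ∞}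
    (h : ContMDiffAt (𝓘(ℝ, ℝ).prod 𝓘(ℝ, ℝ)) 𝓘(ℝ, E) n f p) : ContDiffAt ℝ n f p := by
  rw [← modelWithCornersSelf_prod, chartedSpaceSelf_prod] at h
  exact h.contDiffAt

/-- Cartan's formula on a surface: for a smooth 1-form `σ` and a smooth map `z` of two real
variables, `∂ₜ (σ(∂ₛ z)) - ∂ₛ (σ(∂ₜ z)) = dσ(∂ₜ z, ∂ₛ z)`. -/
theorem deriv_ev_sub_deriv_ev {σ : DForm I M 1} (hσ : σ.IsSmooth) {z : ℝ → ℝ → M} {t₀ s₀ : ℝ}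
    (hz : ContMDiffAt (𝓘(ℝ, ℝ).prod 𝓘(ℝ, ℝ)) I ∞ (uncurry z) (t₀, s₀)) :
    deriv (fun t => σ.ev (z t s₀) (vel I (z t) s₀)) t₀ -
      deriv (fun s => σ.ev (z t₀ s) (vel I (fun t => z t s) t₀)) s₀ =
    σ.d.ev₂ (z t₀ s₀) (vel I (fun t => z t s₀) t₀) (vel I (z t₀) s₀) := by
  set x₀ := z t₀ s₀ with hx₀
  have hφ : ContMDiffAt I 𝓘(ℝ, E) ∞ (extChartAt I x₀) (uncurry z (t₀, s₀)) :=
    contMDiffAt_extChartAt' (mem_chart_source H _)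
  set Z : ℝ × ℝ → E := fun p => extChartAt I x₀ (uncurry z p) with hZ
  have hZs : ContDiffAt ℝ ∞ Z (t₀, s₀) :=
    contDiffAt_of_contMDiffAt_prod (ContMDiffAt.comp (t₀, s₀) hφ hz)
  set w := σ.inChart x₀ with hw
  have hws : ContDiffAt ℝ ∞ w (Z (t₀, s₀)) := contDiffAt_of_isSmooth hσ (mem_chart_source H _)
  set η : ℝ × ℝ → (ℝ × ℝ) [⋀^Fin 1]→L[ℝ] ℝ :=
    fun p => (w (Z p)).compContinuousLinearMap (fderiv ℝ Z p) with hη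
  -- on a neighbourhood of the base point, `η` computes the pairings of `σ` with the velocities
  have hnear : ∀ᶠ p in 𝓝 (t₀, s₀), uncurry z p ∈ (chartAt H x₀).source ∧
      ContMDiffAt (𝓘(ℝ, ℝ).prod 𝓘(ℝ, ℝ)) I 1 (uncurry z) p :=
    Filter.Eventually.and (hz.continuousAt.preimage_mem_nhds (chart_source_mem_nhds H x₀))
      ((contMDiffAt_iff_contMDiffAt_nhds (by simp)).1
        (hz.of_le (by simp : (1 : WithTop ℕ∞) ≤ ∞)))
  have hηev : ∀ p : ℝ × ℝ, ∀ e, η p ![e] = w (Z p) ![fderiv ℝ Z p e] := by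
    intro p e
    change w (Z p) (fderiv ℝ Z p ∘ ![e]) = _
    rw [vec_one (fderiv ℝ Z p ∘ ![e])]
    rfl
  have hkey : ∀ p : ℝ × ℝ, uncurry z p ∈ (chartAt H x₀).source →
      ContMDiffAt (𝓘(ℝ, ℝ).prod 𝓘(ℝ, ℝ)) I 1 (uncurry z) p →
      (mdf I 𝓘(ℝ, E) (extChartAt I x₀) (uncurry z p) (vel I (fun t => z t p.2) p.1) =
        fderiv ℝ Z p (1, 0)) ∧
      (mdf I 𝓘(ℝ, E) (extChartAt I x₀) (uncurry z p) (vel I (z p.1) p.2) =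
        fderiv ℝ Z p (0, 1)) := by
    intro p hp hps
    have hd1 : MDifferentiableAt 𝓘(ℝ, ℝ) I (fun t => z t p.2) p.1 :=
      (ContMDiffAt.comp p.1 (g := uncurry z) (f := fun t => (t, p.2)) hps
        (contMDiffAt_id.prodMk contMDiffAt_const)).mdifferentiableAt (by simp)
    have hd2 : MDifferentiableAt 𝓘(ℝ, ℝ) I (fun t => z p.1 t) p.2 :=
      (ContMDiffAt.comp p.2 (g := uncurry z) (f := fun t => (p.1, t)) hps
        (contMDiffAt_const.prodMk contMDiffAt_id)).mdifferentiableAt (by simp)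
    have hφ' := mdifferentiableAt_extChartAt (I := I) hp
    have hZd : DifferentiableAt ℝ Z p :=
      (contDiffAt_of_contMDiffAt_prod (ContMDiffAt.comp p
        (contMDiffAt_extChartAt' (n := 1) hp) hps)).differentiableAt (by simp)
    constructor
    · refine (vel_comp (f := extChartAt I x₀) (c := fun t => z t p.2) hφ' hd1).symm.trans ?_
      rw [vel_eq_deriv]
      have h1 : HasDerivAt (fun t : ℝ => (t, p.2)) ((1 : ℝ), (0 : ℝ)) p.1 :=
        (hasDerivAt_id _).prodMk (hasDerivAt_const _ _)
      exact (hZd.hasFDerivAt.comp_hasDerivAt p.1 (f := fun t : ℝ => (t, p.2)) h1).deriv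
    · refine (vel_comp (f := extChartAt I x₀) (c := fun t => z p.1 t) hφ' hd2).symm.trans ?_
      rw [vel_eq_deriv]
      have h1 : HasDerivAt (fun t : ℝ => (p.1, t)) ((0 : ℝ), (1 : ℝ)) p.2 :=
        (hasDerivAt_const _ _).prodMk (hasDerivAt_id _)
      exact (hZd.hasFDerivAt.comp_hasDerivAt p.2 (f := fun t : ℝ => (p.1, t)) h1).deriv
  have hZf : ContDiffAt ℝ ∞ (fderiv ℝ Z) (t₀, s₀) := hZs.fderiv_right (by simp)
  have hpair : ∀ e : ℝ × ℝ, DifferentiableAt ℝ (fun p => η p ![e]) (t₀, s₀) := by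
    intro e
    have h1 : ContDiffAt ℝ ∞ (fun p => w (Z p)) (t₀, s₀) := hws.comp (t₀, s₀) hZs
    have h2 : ContDiffAt ℝ ∞ (fun p => fderiv ℝ Z p e) (t₀, s₀) :=
      hZf.clm_apply contDiffAt_const
    have := contDiff_apply_singleton.contDiffAt.comp (t₀, s₀) (h1.prodMk h2)
    refine (this.differentiableAt (by simp)).congr_of_eventuallyEq
      (Filter.Eventually.of_forall fun p => hηev p e)
  have hηd : DifferentiableAt ℝ η (t₀, s₀) := by
    have h1 : DifferentiableAt ℝ (fun p => (ContinuousAlternatingMap.ofSubsingletonLIE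
        (𝕜 := ℝ) (E := ℝ × ℝ) (F := ℝ) (0 : Fin 1)).symm (η p)) (t₀, s₀) := by
      have h2 : ∀ p, (ContinuousAlternatingMap.ofSubsingletonLIE
          (𝕜 := ℝ) (E := ℝ × ℝ) (F := ℝ) (0 : Fin 1)).symm (η p) =
          ((ContinuousAlternatingMap.ofSubsingletonLIE
          (𝕜 := ℝ) (E := E) (F := ℝ) (0 : Fin 1)).symm (w (Z p))).comp (fderiv ℝ Z p) := by
        intro p
        ext <;> rfl
      simp_rw [h2]
      refine DifferentiableAt.clm_comp ?_ (hZf.differentiableAt (by simp))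
      exact (LinearIsometryEquiv.differentiable _).differentiableAt.comp _
        ((hws.comp (t₀, s₀) hZs).differentiableAt (by simp))
    have := (LinearIsometryEquiv.differentiable (ContinuousAlternatingMap.ofSubsingletonLIE
        (𝕜 := ℝ) (E := ℝ × ℝ) (F := ℝ) (0 : Fin 1))).differentiableAt.comp _ h1
    refine this.congr_of_eventuallyEq (Filter.Eventually.of_forall fun p => ?_)
    exact (LinearIsometryEquiv.apply_symm_apply _ _).symm
  have hpb : extDeriv η (t₀, s₀) =
      (extDeriv w (Z (t₀, s₀))).compContinuousLinearMap (fderiv ℝ Z (t₀, s₀)) :=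
    extDeriv_pullback (r := ∞) (hws.differentiableAt (by simp)) hZs
      (by rw [minSmoothness_of_isRCLikeNormedField]; exact WithTop.coe_le_coe.2 (le_top : (2 : ℕ∞) ≤ ⊤))
  have hA := extDeriv_apply hηd ![((1 : ℝ), (0 : ℝ)), ((0 : ℝ), (1 : ℝ))]
  have hR : σ.d.ev₂ (z t₀ s₀) (vel I (fun t => z t s₀) t₀) (vel I (z t₀) s₀) =
      extDeriv η (t₀, s₀) ![((1 : ℝ), (0 : ℝ)), ((0 : ℝ), (1 : ℝ))] := by
    obtain ⟨k1, k2⟩ := hkey (t₀, s₀) hnear.self_of_nhds.1 hnear.self_of_nhds.2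
    rw [hpb]
    change extDeriv w (Z (t₀, s₀)) (mdf I 𝓘(ℝ, E) (extChartAt I x₀) x₀ ∘ ![_, _]) =
      extDeriv w (Z (t₀, s₀)) (fderiv ℝ Z (t₀, s₀) ∘ ![_, _])
    congr 1
    funext i
    fin_cases i
    · exact k1
    · exact k2
  rw [hR, hA, Fin.sum_univ_two]
  have e0 : ((0 : Fin 2).removeNth ![((1 : ℝ), (0 : ℝ)), ((0 : ℝ), (1 : ℝ))] :
      Fin 1 → ℝ × ℝ) = ![(0, 1)] :=
    funext fun i => by fin_cases i; rfl
  have e1 : ((1 : Fin 2).removeNth ![((1 : ℝ), (0 : ℝ)), ((0 : ℝ), (1 : ℝ))] :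
      Fin 1 → ℝ × ℝ) = ![(1, 0)] :=
    funext fun i => by fin_cases i; rfl
  have d1 : deriv (fun t => σ.ev (z t s₀) (vel I (z t) s₀)) t₀ =
      fderiv ℝ (fun p => η p ![(0, 1)]) (t₀, s₀) (1, 0) := by
    have h1 : HasDerivAt (fun t : ℝ => (t, s₀)) ((1 : ℝ), (0 : ℝ)) t₀ :=
      (hasDerivAt_id _).prodMk (hasDerivAt_const _ _)
    rw [← ((hpair (0, 1)).hasFDerivAt.comp_hasDerivAt t₀ (f := fun t : ℝ => (t, s₀)) h1).deriv]
    refine Filter.EventuallyEq.deriv_eq ?_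
    filter_upwards [h1.continuousAt.eventually hnear] with t ht
    rw [comp_apply, hηev, ← (hkey (t, s₀) ht.1 ht.2).2]
    exact σ.ev_eq_inChart ht.1 _
  have d2 : deriv (fun s => σ.ev (z t₀ s) (vel I (fun t => z t s) t₀)) s₀ =
      fderiv ℝ (fun p => η p ![(1, 0)]) (t₀, s₀) (0, 1) := by
    have h1 : HasDerivAt (fun s : ℝ => (t₀, s)) ((0 : ℝ), (1 : ℝ)) s₀ :=
      (hasDerivAt_const _ _).prodMk (hasDerivAt_id _)
    rw [← ((hpair (1, 0)).hasFDerivAt.comp_hasDerivAt s₀ (f := fun s : ℝ => (t₀, s)) h1).deriv]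
    refine Filter.EventuallyEq.deriv_eq ?_
    filter_upwards [h1.continuousAt.eventually hnear] with t ht
    rw [comp_apply, hηev, ← (hkey (t₀, t) ht.1 ht.2).1]
    exact σ.ev_eq_inChart ht.1 _
  rw [d1, d2, e0, e1]
  simp [sub_eq_add_neg]

end Smooth

end VelocityCalculus

/-! ### Smoothness of flows in normed spaces -/

section FlowsInNormedSpaces

universe u

/-- Two-sided Grönwall inequality on `[-T, T]`. -/
theorem norm_le_gronwallBound_abs {E : Type*} [NormedAddCommGroup E] [NormedSpace ℝ E]
    {f f' : ℝ → E} {δ K ε T : ℝ}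
    (hf : ∀ t, |t| ≤ T → HasDerivAt f (f' t) t) (h0 : ‖f 0‖ ≤ δ)
    (hb : ∀ t, |t| ≤ T → ‖f' t‖ ≤ K * ‖f t‖ + ε) {t : ℝ} (ht : |t| ≤ T) :
    ‖f t‖ ≤ gronwallBound δ K ε |t| := by
  have habs : ∀ s ∈ Icc 0 |t|, |s| ≤ T := fun s hs => by
    rw [abs_of_nonneg hs.1]; exact hs.2.trans ht
  rcases le_total 0 t with h | h
  · have := norm_le_gronwallBound_of_norm_deriv_right_le (f := f) (f' := f') (a := 0) (b := |t|)
      (fun s hs => (hf s (habs s hs)).continuousAt.continuousWithinAt)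
      (fun s hs => (hf s (habs s ⟨hs.1, hs.2.le⟩)).hasDerivWithinAt) h0
      (fun s hs => hb s (habs s ⟨hs.1, hs.2.le⟩)) |t| ⟨abs_nonneg t, le_rfl⟩
    rw [sub_zero] at this
    rwa [abs_of_nonneg h] at this ⊢
  · have hd : ∀ s ∈ Icc 0 |t|, HasDerivAt (fun s => f (-s)) (-f' (-s)) s := fun s hs => by
      have := (hf (-s) (by rw [abs_neg]; exact habs s hs)).scomp s (hasDerivAt_neg s)
      exact this.congr_deriv (by simp)
    have := norm_le_gronwallBound_of_norm_deriv_right_le (f := fun s => f (-s))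
      (f' := fun s => -f' (-s)) (a := 0) (b := |t|) (δ := δ) (K := K) (ε := ε)
      (fun s hs => (hd s hs).continuousAt.continuousWithinAt)
      (fun s hs => (hd s ⟨hs.1, hs.2.le⟩).hasDerivWithinAt) (by simpa using h0)
      (fun s hs => by
        rw [norm_neg]
        exact hb (-s) (by rw [abs_neg]; exact habs s ⟨hs.1, hs.2.le⟩)) |t| ⟨abs_nonneg t, le_rfl⟩
    rw [sub_zero] at this
    rwa [abs_of_nonpos h, neg_neg, ← abs_of_nonpos h] at this

/-- `φ` is the global flow of the vector field `v` of a normed space. -/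
structure IsGlobalFlow {E : Type*} [NormedAddCommGroup E] [NormedSpace ℝ E] (v : E → E)
    (φ : ℝ → E → E) : Prop where
  map_zero : ∀ x, φ 0 x = x
  hasDerivAt : ∀ t x, HasDerivAt (fun s => φ s x) (v (φ t x)) t

variable {E : Type u} [NormedAddCommGroup E] [NormedSpace ℝ E]

/-- The solutions given by the Picard–Lindelöf theorem exist for a time which does not depend on the
initial point, since `v` is bounded and Lipschitz. -/
theorem exists_isGlobalFlow [CompleteSpace E] {v : E → E} (hv : ContDiff ℝ ∞ v)
    (hc : HasCompactSupport v) : ∃ φ, IsGlobalFlow v φ := by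
  obtain ⟨K, hK⟩ := ContDiff.lipschitzWith_of_hasCompactSupport hc hv (by simp)
  obtain ⟨L, hL⟩ := hc.exists_bound_of_continuous hv.continuous
  have hL0 : 0 ≤ L := (norm_nonneg _).trans (hL 0)
  have hloc : ∀ x : E, ∃ γ : ℝ → E, γ 0 = x ∧
      IsMIntegralCurveOn (I := 𝓘(ℝ, E)) γ (fun x => (v x : TangentSpace 𝓘(ℝ, E) x))
        (Ioo (-1) 1) := by
    intro x
    have hpl : IsPicardLindelof (fun _ => v) (tmin := -1) (tmax := 1) ⟨0, by simp⟩ x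
        L.toNNReal 0 L.toNNReal K :=
      ⟨fun _ _ => hK.lipschitzOnWith, fun _ _ => continuousOn_const,
        fun _ _ y _ => by rw [Real.coe_toNNReal _ hL0]; exact hL y, by simp⟩
    obtain ⟨γ, h0, hγ⟩ := hpl.exists_eq_forall_mem_Icc_hasDerivWithinAt₀
    refine ⟨γ, h0, fun t ht => ?_⟩
    have := (hγ t (Ioo_subset_Icc_self ht)).mono Ioo_subset_Icc_self
    exact this.hasFDerivWithinAt.hasMFDerivWithinAt
  have hv' : ContMDiff 𝓘(ℝ, E) 𝓘(ℝ, E).tangent 1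
      (fun x => (⟨x, v x⟩ : TangentBundle 𝓘(ℝ, E) E)) :=
    contMDiff_vectorSpace_iff_contDiff.2 (hv.of_le (by simp))
  choose φ h0 hφ using exists_isMIntegralCurve_of_isMIntegralCurveOn hv' one_pos hloc
  refine ⟨fun t x => φ x t, h0, fun t x => ?_⟩
  have h : HasFDerivAt (φ x) ((1 : ℝ →L[ℝ] ℝ).smulRight (v (φ x t))) t :=
    hasMFDerivAt_iff_hasFDerivAt.1 (hφ x t)
  exact h.hasDerivAt.congr_deriv (by simp)

namespace IsGlobalFlow

variable {v : E → E} {φ : ℝ → E → E}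

theorem dist_le (h : IsGlobalFlow v φ) {K : NNReal} (hK : LipschitzWith K v) (t : ℝ) (x y : E) :
    ‖φ t x - φ t y‖ ≤ ‖x - y‖ * Real.exp (K * |t|) := by
  have := norm_le_gronwallBound_abs (f := fun s => φ s x - φ s y)
    (f' := fun s => v (φ s x) - v (φ s y)) (δ := ‖x - y‖) (K := K) (ε := 0) (T := |t|)
    (fun s _ => (h.hasDerivAt s x).sub (h.hasDerivAt s y)) (by simp [h.map_zero])
    (fun s _ => by simpa using hK.norm_sub_le (φ s x) (φ s y)) (t := t) le_rfl
  rwa [gronwallBound_ε0] at this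

theorem norm_sub_le (h : IsGlobalFlow v φ) {L : ℝ} (hL : ∀ x, ‖v x‖ ≤ L) (s t : ℝ) (x : E) :
    ‖φ s x - φ t x‖ ≤ L * |s - t| := by
  have := Convex.norm_image_sub_le_of_norm_hasDerivWithin_le (f := fun s => φ s x) (s := univ)
    (f' := fun s => v (φ s x)) (C := L) (x := t) (y := s)
    (fun s _ => (h.hasDerivAt s x).hasDerivWithinAt) (fun s _ => hL _) convex_univ (mem_univ _)
    (mem_univ _)
  simpa using this

theorem continuous (h : IsGlobalFlow v φ) {K : NNReal} (hK : LipschitzWith K v) {L : ℝ}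
    (hL : ∀ x, ‖v x‖ ≤ L) : Continuous (uncurry φ) := by
  refine continuous_iff_continuousAt.2 fun ⟨t, x⟩ => ?_
  rw [ContinuousAt, tendsto_iff_norm_sub_tendsto_zero]
  have hb : ∀ p : ℝ × E, ‖uncurry φ p - uncurry φ (t, x)‖ ≤
      ‖p.2 - x‖ * Real.exp (K * |p.1|) + L * |p.1 - t| := fun p => by
    calc ‖uncurry φ p - uncurry φ (t, x)‖
        = ‖(φ p.1 p.2 - φ p.1 x) + (φ p.1 x - φ t x)‖ := by simp [uncurry]
      _ ≤ _ := (norm_add_le _ _).trans (add_le_add (h.dist_le hK _ _ _) (h.norm_sub_le hL _ _ _))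
  refine squeeze_zero (fun _ => norm_nonneg _) hb ?_
  have : Continuous fun p : ℝ × E => ‖p.2 - x‖ * Real.exp (K * |p.1|) + L * |p.1 - t| := by
    fun_prop
  simpa using this.tendsto (t, x)

/-- The linearization of the flow: if `A` solves the variational equation along the orbit of `x`,
then `A t` is the derivative of `φ_t` at `x`. -/
theorem hasFDerivAt_of_variational (h : IsGlobalFlow v φ) (hv : ContDiff ℝ ∞ v)
    {K K₂ : NNReal} (hK : LipschitzWith K v) (hK₂ : LipschitzWith K₂ (fderiv ℝ v))
    {T : ℝ} {x : E} {A : ℝ → E →L[ℝ] E} (hA0 : A 0 = ContinuousLinearMap.id ℝ E)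
    (hA : ∀ t, |t| ≤ T → HasDerivAt A ((fderiv ℝ v (φ t x)).comp (A t)) t) {t : ℝ}
    (ht : |t| ≤ T) : HasFDerivAt (φ t) (A t) x := by
  have hvd : ∀ y, HasFDerivAt v (fderiv ℝ v y) y := fun y =>
    (hv.differentiable (by simp) y).hasFDerivAt
  have hDv : ∀ y, ‖fderiv ℝ v y‖ ≤ K := fun y => norm_fderiv_le_of_lipschitz ℝ hK
  have htaylor : ∀ y z, ‖v z - v y - fderiv ℝ v y (z - y)‖ ≤ K₂ * ‖z - y‖ * ‖z - y‖ := by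
    intro y z
    refine Convex.norm_image_sub_le_of_norm_hasFDerivWithin_le' (s := segment ℝ y z)
      (f' := fderiv ℝ v) (fun w _ => (hvd w).hasFDerivWithinAt) (fun w hw => ?_)
      (convex_segment y z) (left_mem_segment ℝ y z) (right_mem_segment ℝ y z)
    refine (hK₂.norm_sub_le w y).trans ?_
    gcongr
    obtain ⟨a, b, ha, hb, hab, rfl⟩ := hw
    have : a • y + b • z - y = b • (z - y) := by
      rw [show a = 1 - b by linarith]; module
    rw [this, norm_smul, Real.norm_of_nonneg hb]
    exact mul_le_of_le_one_left (norm_nonneg _) (by linarith)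
  set e := Real.exp (K * T) with he
  have hT0 : 0 ≤ T := (abs_nonneg t).trans ht
  -- the remainder satisfies `‖r'‖ ≤ K ‖r‖ + O(‖y - x‖ ^ 2)`
  have hrem : ∀ y, ‖φ t y - φ t x - A t (y - x)‖ ≤
      (K₂ * e * e) * ‖y - x‖ ^ 2 * gronwallBound 0 K 1 |t| := by
    intro y
    have hgr := norm_le_gronwallBound_abs (f := fun s => φ s y - φ s x - A s (y - x))
      (f' := fun s => v (φ s y) - v (φ s x) - (fderiv ℝ v (φ s x)) (A s (y - x))) (δ := 0)
      (K := K) (ε := (K₂ * e * e) * ‖y - x‖ ^ 2) (T := T)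
      (fun s hs => by
        have h1 := (hA s hs).clm_apply (hasDerivAt_const s (y - x))
        exact (((h.hasDerivAt s y).sub (h.hasDerivAt s x)).sub h1).congr_deriv (by simp))
      (by simp [h.map_zero, hA0])
      (fun s hs => by
        have e1 : v (φ s y) - v (φ s x) - (fderiv ℝ v (φ s x)) (A s (y - x)) =
            (fderiv ℝ v (φ s x)) (φ s y - φ s x - A s (y - x)) +
            (v (φ s y) - v (φ s x) - fderiv ℝ v (φ s x) (φ s y - φ s x)) := by
          simp only [map_sub]; abel
        rw [e1]
        refine (norm_add_le _ _).trans (add_le_add ?_ ?_)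
        · exact (ContinuousLinearMap.le_opNorm _ _).trans
            (mul_le_mul_of_nonneg_right (hDv _) (norm_nonneg _))
        · refine (htaylor _ _).trans ?_
          have h2 : ‖φ s y - φ s x‖ ≤ ‖y - x‖ * e := (h.dist_le hK s y x).trans (by
            rw [he]; gcongr)
          calc (K₂ : ℝ) * ‖φ s y - φ s x‖ * ‖φ s y - φ s x‖
              ≤ K₂ * (‖y - x‖ * e) * (‖y - x‖ * e) := by gcongr
            _ = _ := by ring) ht
    refine hgr.trans (le_of_eq ?_)
    by_cases hK0 : (K : ℝ) = 0
    · rw [hK0, gronwallBound_K0]; simp [gronwallBound_K0]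
    · rw [gronwallBound_of_K_ne_0 hK0, gronwallBound_of_K_ne_0 hK0]; ring
  rw [hasFDerivAt_iff_isLittleO]
  refine Asymptotics.IsBigO.trans_isLittleO (g := fun y => ‖y - x‖ ^ 2) ?_ ?_
  · refine Asymptotics.IsBigO.of_bound ((K₂ * e * e) * gronwallBound 0 K 1 |t|)
      (Filter.Eventually.of_forall fun y => (hrem y).trans (le_of_eq ?_))
    rw [Real.norm_of_nonneg (by positivity)]; ring
  · have : (fun y => ‖y - x‖ ^ 2) =o[𝓝 x] fun y => ‖y - x‖ ^ 1 :=
      (Asymptotics.isLittleO_pow_pow (𝕜 := ℝ) one_lt_two).comp_tendsto (by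
        simpa using (continuous_id.sub continuous_const).norm.tendsto x (f := fun y => ‖y - x‖))
    simpa using this

end IsGlobalFlow

/-- The variational vector field `(y, A) ↦ (v(y), Dv(y) ∘ A)`, cut off by `χ` in the variable `A`. -/
def variationalField (v : E → E) (χ : (E →L[ℝ] E) → ℝ) (p : E × (E →L[ℝ] E)) :
    E × (E →L[ℝ] E) :=
  χ p.2 • (v p.1, (fderiv ℝ v p.1).comp p.2)

/-- Induction on the order of differentiability: the derivative of the flow in the space variable
solves the variational equation, hence is a component of the flow of a vector field of the same kind
on `E × (E →L[ℝ] E)`. -/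
theorem contDiff_of_isGlobalFlow_nat (n : ℕ) : ∀ {E : Type u} [NormedAddCommGroup E]
    [NormedSpace ℝ E] [FiniteDimensional ℝ E] {v : E → E} {φ : ℝ → E → E}, ContDiff ℝ ∞ v →
    HasCompactSupport v → IsGlobalFlow v φ → ContDiff ℝ n (uncurry φ) := by
  induction n with
  | zero =>
    intro E _ _ _ v φ hv hc h
    obtain ⟨K, hK⟩ := ContDiff.lipschitzWith_of_hasCompactSupport hc hv (by simp)
    obtain ⟨L, hL⟩ := hc.exists_bound_of_continuous hv.continuous
    exact contDiff_zero.2 (h.continuous hK hL)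
  | succ n ih =>
    intro E _ _ _ v φ hv hc h
    have : CompleteSpace E := FiniteDimensional.complete ℝ E
    obtain ⟨K, hK⟩ := ContDiff.lipschitzWith_of_hasCompactSupport hc hv (by simp)
    have hv' : ContDiff ℝ ∞ (fderiv ℝ v) := hv.fderiv_right (by simp)
    obtain ⟨K₂, hK₂⟩ := ContDiff.lipschitzWith_of_hasCompactSupport (hc.fderiv ℝ) hv' (by simp)
    obtain ⟨L, hL⟩ := hc.exists_bound_of_continuous hv.continuous
    refine contDiff_iff_contDiffAt.2 fun ⟨t₀, x₀⟩ => ?_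
    set T := |t₀| + 1 with hT
    have hR : 0 < Real.exp (K * T) := Real.exp_pos _
    let χ : ContDiffBump (0 : E →L[ℝ] E) := ⟨Real.exp (K * T), 2 * Real.exp (K * T), hR, by linarith⟩
    -- the variational field is linear in `A`, so it is cut off to be compactly supported
    set w := variationalField v χ with hw
    have hws : ContDiff ℝ ∞ w := by
      refine ContDiff.smul (χ.contDiff.comp contDiff_snd) ((hv.comp contDiff_fst).prodMk ?_)
      exact (hv'.comp contDiff_fst).clm_comp contDiff_snd
    have hwc : HasCompactSupport w := by
      refine HasCompactSupport.intro
        (hc.isCompact.prod (isCompact_closedBall (0 : E →L[ℝ] E) (2 * Real.exp (K * T)))) ?_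
      rintro ⟨y, A⟩ hyA
      by_cases hy : y ∈ tsupport v
      · have hA : A ∉ Metric.closedBall (0 : E →L[ℝ] E) (2 * Real.exp (K * T)) :=
          fun hA => hyA ⟨hy, hA⟩
        have : χ A = 0 := χ.zero_of_le_dist (by
          rw [Metric.mem_closedBall, not_le] at hA; exact hA.le)
        simp [hw, variationalField, this]
      · have h1 : v y = 0 := image_eq_zero_of_notMem_tsupport hy
        have h2 : fderiv ℝ v y = 0 := by
          have : y ∉ tsupport (fderiv ℝ v) := fun hh => hy (tsupport_fderiv_subset ℝ hh)
          exact image_eq_zero_of_notMem_tsupport this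
        simp [hw, variationalField, h1, h2]
    obtain ⟨Ψ, hΨ⟩ := exists_isGlobalFlow hws hwc
    have hΨs := ih hws hwc hΨ
    set A : ℝ → E → (E →L[ℝ] E) := fun t x => (Ψ t (x, ContinuousLinearMap.id ℝ E)).2 with hAdef
    set Y : ℝ → E → E := fun t x => (Ψ t (x, ContinuousLinearMap.id ℝ E)).1 with hYdef
    have hAd : ∀ t x, HasDerivAt (fun s => A s x)
        (χ (A t x) • (fderiv ℝ v (Y t x)).comp (A t x)) t := fun t x =>
      (hΨ.hasDerivAt t (x, _)).snd
    have hYd : ∀ t x, HasDerivAt (fun s => Y s x) (χ (A t x) • v (Y t x)) t := fun t x =>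
      (hΨ.hasDerivAt t (x, _)).fst
    have hA0 : ∀ x, A 0 x = ContinuousLinearMap.id ℝ E := fun x => by simp [hAdef, hΨ.map_zero]
    -- by Grönwall, the cut-off is not seen by the solution up to time `T`
    have hbound : ∀ t x, |t| ≤ T → ‖A t x‖ ≤ Real.exp (K * T) := by
      intro t x ht
      have := norm_le_gronwallBound_abs (f := fun s => A s x)
        (f' := fun s => χ (A s x) • (fderiv ℝ v (Y s x)).comp (A s x)) (δ := 1) (K := K) (ε := 0)
        (T := T) (fun s _ => hAd s x) (by
          simp only [hA0]; exact ContinuousLinearMap.norm_id_le)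
        (fun s _ => by
          rw [norm_smul, Real.norm_of_nonneg χ.nonneg, add_zero]
          refine (mul_le_of_le_one_left (norm_nonneg _) χ.le_one).trans ?_
          refine (ContinuousLinearMap.opNorm_comp_le _ _).trans ?_
          gcongr
          exact norm_fderiv_le_of_lipschitz ℝ hK) ht
      rw [gronwallBound_ε0, one_mul] at this
      exact this.trans (by gcongr)
    have hχ : ∀ t x, |t| ≤ T → χ (A t x) = 1 := fun t x ht =>
      χ.one_of_mem_closedBall (by
        rw [Metric.mem_closedBall, dist_zero_right]; exact hbound t x ht)
    have hTpos : 0 < T := by positivity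
    have hYφ : ∀ t x, |t| < T → Y t x = φ t x := by
      intro t x ht
      refine ODE_solution_unique_of_mem_Ioo (v := fun _ => v) (s := fun _ => univ) (K := K)
        (a := -T) (b := T) (t₀ := 0) (f := fun t => Y t x) (g := fun t => φ t x)
        (fun _ _ => hK.lipschitzOnWith) ⟨by linarith, hTpos⟩
        (fun s hs => ⟨?_, mem_univ _⟩) (fun s hs => ⟨h.hasDerivAt s x, mem_univ _⟩) ?_
        (abs_lt.1 ht)
      · have := hYd s x
        rwa [hχ s x (abs_lt.2 hs).le, one_smul] at this
      · simp [hYdef, hΨ.map_zero, h.map_zero]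
    have hfd : ∀ t x, |t| < T → HasFDerivAt (φ t) (A t x) x := by
      intro t x ht
      obtain ⟨T', h1, h2⟩ := exists_between ht
      refine h.hasFDerivAt_of_variational hv hK hK₂ (T := T') (A := fun t => A t x) (hA0 x)
        (fun s hs => ?_) h1.le
      have := hAd s x
      rwa [hχ s x (hs.trans h2.le), one_smul, hYφ s x (hs.trans_lt h2)] at this
    have hAs : ContDiff ℝ n (uncurry A) :=
      contDiff_snd.comp (hΨs.comp (contDiff_fst.prodMk (contDiff_snd.prodMk contDiff_const)))
    have hφs : ContDiff ℝ n (uncurry φ) := ih hv hc h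
    have hvφ : ContDiff ℝ n (fun p : ℝ × E => v (uncurry φ p)) :=
      (hv.of_le (by exact_mod_cast le_top)).comp hφs
    set f₁ : ℝ → E → (ℝ →L[ℝ] E) := fun t x =>
      (1 : ℝ →L[ℝ] ℝ).smulRight (v (φ t x)) with hf₁
    have hf₁s : ContDiff ℝ n (uncurry f₁) := by
      have : uncurry f₁ = fun p => ContinuousLinearMap.smulRightL ℝ ℝ E 1 (v (uncurry φ p)) := rfl
      rw [this]
      exact (ContinuousLinearMap.contDiff _).comp hvφ
    have hnhds : ∀ᶠ p : ℝ × E in 𝓝 (t₀, x₀), |p.1| < T :=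
      (continuous_fst.abs.tendsto (t₀, x₀)).eventually_lt_const (by simp [hT])
    rw [Nat.cast_succ, contDiffAt_succ_iff_hasFDerivAt]
    refine ⟨fun p => (f₁ p.1 p.2).coprod (A p.1 p.2), ⟨{p | |p.1| < T}, hnhds, ?_⟩, ?_⟩
    · intro p hp
      have hp' : ∀ᶠ q : ℝ × E in 𝓝 p, |q.1| < T :=
        (continuous_fst.abs.tendsto p).eventually_lt_const hp
      exact (hasStrictFDerivAt_uncurry_coprod (f := φ) (f₁ := f₁) (f₂ := A)
        (Filter.Eventually.of_forall fun q => (h.hasDerivAt q.1 q.2).hasFDerivAt)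
        (hp'.mono fun q hq => hfd q.1 q.2 hq) hf₁s.continuous.continuousAt
        hAs.continuous.continuousAt).hasFDerivAt
    · have e : (fun p : ℝ × E => (f₁ p.1 p.2).coprod (A p.1 p.2)) = fun p =>
          (uncurry f₁ p).comp (ContinuousLinearMap.fst ℝ ℝ E) +
          (uncurry A p).comp (ContinuousLinearMap.snd ℝ ℝ E) := by
        funext p; ext <;> simp [uncurry]
      rw [e]
      exact ((hf₁s.clm_comp contDiff_const).add (hAs.clm_comp contDiff_const)).contDiffAt

/-- The flow of a smooth compactly supported vector field of a finite-dimensional space is smooth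
in all variables. -/
theorem contDiff_of_isGlobalFlow [FiniteDimensional ℝ E] {v : E → E} {φ : ℝ → E → E}
    (hv : ContDiff ℝ ∞ v) (hc : HasCompactSupport v) (h : IsGlobalFlow v φ) :
    ContDiff ℝ ∞ (uncurry φ) :=
  contDiff_infty.2 fun n => contDiff_of_isGlobalFlow_nat n hv hc h

end FlowsInNormedSpaces

/-! ### Flows on manifolds -/

section FlowsOnManifolds

variable {E' : Type*} [NormedAddCommGroup E'] [NormedSpace ℝ E']
  {H' : Type*} [TopologicalSpace H'] {J : ModelWithCorners ℝ E' H'} [J.Boundaryless]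
  {B : Type*} [TopologicalSpace B] [ChartedSpace H' B] [IsManifold J ∞ B]

variable (J) in
/-- The vector field `b ↦ ∂_τ Γ(τ, b)|_{τ = 0}` tangent to a family of curves `τ ↦ Γ(τ, b)`. All the
vector fields to be integrated are given in this form. -/
def initialField (Γ : ℝ → B → B) (b : B) : E' := vel J (fun τ => Γ τ b) 0

variable {Γ : ℝ → B → B}

theorem contMDiff_initialField (hΓ : ContMDiff (𝓘(ℝ, ℝ).prod J) J ∞ (uncurry Γ))
    (h0 : ∀ b, Γ 0 b = b) :
    ContMDiff J J.tangent 1 (fun b => (⟨b, initialField (E' := E') J Γ b⟩ : TangentBundle J B)) := by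
  have s1 : ContMDiff J J.tangent 1 (fun b : B => (⟨b, 0⟩ : TangentBundle J B)) :=
    Bundle.contMDiff_zeroSection _ _
  have s2 : ContMDiff J 𝓘(ℝ, ℝ).tangent 1
      (fun _ : B => (⟨0, (1 : ℝ)⟩ : TangentBundle 𝓘(ℝ, ℝ) ℝ)) := contMDiff_const
  have s3 := (contMDiff_equivTangentBundleProd_symm (n := 1) (I := 𝓘(ℝ, ℝ)) (I' := J)
    (M := ℝ) (M' := B)).comp (s2.prodMk s1)
  have s4 : ContMDiff (𝓘(ℝ, ℝ).prod J).tangent J.tangent 1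
      (tangentMap (𝓘(ℝ, ℝ).prod J) J (uncurry Γ)) :=
    hΓ.contMDiff_tangentMap (m := 1) (WithTop.coe_le_coe.2 (le_top : (2 : ℕ∞) ≤ ⊤))
  refine (s4.comp s3).congr fun b => ?_
  refine Eq.trans ?_ (congrArg (tangentMap (𝓘(ℝ, ℝ).prod J) J (uncurry Γ))
    (show (⟨(0, b), ((1 : ℝ), (0 : E'))⟩ : TangentBundle (𝓘(ℝ, ℝ).prod J) (ℝ × B)) = _ from rfl))
  have e : mdf (𝓘(ℝ, ℝ).prod J) J (uncurry Γ) (0, b) ((1 : ℝ), (0 : E')) =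
      initialField J Γ b := by
    rw [mdf_prod (hΓ.mdifferentiableAt (by simp)), map_zero, add_zero]
    rfl
  have e2 : tangentMap (𝓘(ℝ, ℝ).prod J) J (uncurry Γ) ⟨(0, b), ((1 : ℝ), (0 : E'))⟩ =
      ⟨Γ 0 b, initialField (E' := E') J Γ b⟩ := congrArg (fun u : E' => (⟨Γ 0 b, u⟩ : TangentBundle J B)) e
  rw [e2, h0]

theorem isMIntegralCurveOn_initialField_iff {γ : ℝ → B} {s : Set ℝ} (hs : IsOpen s) :
    IsMIntegralCurveOn (I := J) γ (initialField J Γ) s ↔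
      ∀ t ∈ s, MDifferentiableAt 𝓘(ℝ, ℝ) J γ t ∧ vel J γ t = initialField J Γ (γ t) := by
  refine forall₂_congr fun t ht => ⟨fun h => ?_, fun h => ?_⟩
  · have h' := h.hasMFDerivAt (hs.mem_nhds ht)
    refine ⟨h'.mdifferentiableAt, (vel_of_hasMFDerivAt (L := (1 : ℝ →L[ℝ] ℝ).smulRight
      (initialField J Γ (γ t))) h').trans (by simp)⟩
  · exact (hasMFDerivAt_of_vel h.1 h.2).hasMFDerivWithinAt

/-- The flow exists and is smooth near each point: the vector field is cut off in a chart and the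
result on normed spaces applies. -/
theorem exists_local_flow [FiniteDimensional ℝ E']
    (hΓ : ContMDiff (𝓘(ℝ, ℝ).prod J) J ∞ (uncurry Γ)) (h0 : ∀ b, Γ 0 b = b) (b₀ : B) :
    ∃ U, IsOpen U ∧ b₀ ∈ U ∧ ∃ δ > 0, ∃ Φ : ℝ → B → B, (∀ b ∈ U, Φ 0 b = b) ∧
      ∀ t ∈ Ioo (-δ) δ, ∀ b ∈ U, ContMDiffAt (𝓘(ℝ, ℝ).prod J) J ∞ (uncurry Φ) (t, b) ∧
        vel J (fun s => Φ s b) t = initialField J Γ (Φ t b) := by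
  have : CompleteSpace E' := FiniteDimensional.complete ℝ E'
  set φ := extChartAt J b₀ with hφ
  have htn : φ.target ∈ 𝓝 (φ b₀) := extChartAt_target_mem_nhds b₀
  obtain ⟨R, hR, hRt⟩ := Metric.nhds_basis_closedBall.mem_iff.1 htn
  let χ : ContDiffBump (φ b₀) := ⟨R / 2, R, by linarith, by linarith⟩
  have hsymm : ∀ y ∈ φ.target, ContMDiffAt 𝓘(ℝ, E') J ∞ φ.symm y := fun y hy =>
    (contMDiffOn_extChartAt_symm b₀).contMDiffAt ((isOpen_extChartAt_target b₀).mem_nhds hy)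
  have hsrc : ∀ y ∈ φ.target, φ.symm y ∈ (chartAt H' b₀).source := fun y hy => by
    rw [← extChartAt_source J]; exact φ.map_target hy
  set v : E' → E' := fun y => χ y • deriv (fun τ => φ (Γ τ (φ.symm y))) 0 with hv
  have hvs : ContDiff ℝ ∞ v := by
    refine contDiff_iff_contDiffAt.2 fun y => ?_
    by_cases hy : y ∈ Metric.closedBall (φ b₀) R
    · have hyt := hRt hy
      refine χ.contDiffAt.smul ?_
      have h1 : ContMDiffAt (𝓘(ℝ, E').prod 𝓘(ℝ, ℝ)) J ∞
          (fun q : E' × ℝ => uncurry Γ (q.2, φ.symm q.1)) (y, 0) :=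
        hΓ.contMDiffAt.comp (y, (0 : ℝ)) (contMDiffAt_snd.prodMk
          (ContMDiffAt.comp (y, (0 : ℝ)) (g := φ.symm) (f := Prod.fst)
            (hsymm y hyt) contMDiffAt_fst))
      have h2 : ContMDiffAt (𝓘(ℝ, E').prod 𝓘(ℝ, ℝ)) 𝓘(ℝ, E') ∞
          (uncurry fun (y : E') (τ : ℝ) => φ (Γ τ (φ.symm y))) (y, (0 : ℝ)) := by
        refine ContMDiffAt.comp (y, (0 : ℝ)) (g := φ)
          (f := fun q : E' × ℝ => uncurry Γ (q.2, φ.symm q.1)) ?_ h1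
        refine contMDiffAt_extChartAt' ?_
        change Γ 0 (φ.symm y) ∈ _
        rw [h0]; exact hsrc y hyt
      exact (contMDiffAt_deriv_param (g := fun _ => 0) h2 contMDiffAt_const).contDiffAt
    · have : v =ᶠ[𝓝 y] fun _ => 0 := by
        filter_upwards [Metric.isClosed_closedBall.isOpen_compl.mem_nhds hy] with z hz
        rw [mem_compl_iff, Metric.mem_closedBall, not_le] at hz
        simp [hv, χ.zero_of_le_dist hz.le]
      exact contDiffAt_const.congr_of_eventuallyEq this
  have hvc : HasCompactSupport v := HasCompactSupport.intro
    (isCompact_closedBall (φ b₀) R) fun y hy => by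
      rw [Metric.mem_closedBall, not_le] at hy
      simp [hv, χ.zero_of_le_dist hy.le]
  obtain ⟨ψ, hψ⟩ := exists_isGlobalFlow hvs hvc
  have hψs := contDiff_of_isGlobalFlow hvs hvc hψ
  have hnb : ∀ᶠ p in 𝓝 ((0 : ℝ), φ b₀), uncurry ψ p ∈ Metric.ball (φ b₀) (R / 2) := by
    refine hψs.continuous.continuousAt.eventually (Metric.isOpen_ball.mem_nhds ?_)
    simp only [uncurry, hψ.map_zero]
    exact Metric.mem_ball_self (by linarith)
  rw [nhds_prod_eq] at hnb
  obtain ⟨p, hp, q, hq, hpq⟩ := Filter.eventually_prod_iff.1 hnb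
  obtain ⟨δ, hδ, hδp⟩ := Metric.eventually_nhds_iff_ball.1 hp
  have hqb : ∀ᶠ b in 𝓝 b₀, q (φ b) := (continuousAt_extChartAt b₀).eventually hq
  obtain ⟨V, hV, hVo, hbV⟩ := eventually_nhds_iff.1 hqb
  refine ⟨V ∩ (chartAt H' b₀).source, hVo.inter (chartAt H' b₀).open_source,
    ⟨hbV, mem_chart_source H' b₀⟩, δ, hδ, fun t b => φ.symm (ψ t (φ b)), ?_, ?_⟩
  · intro b hb
    change φ.symm (ψ 0 (φ b)) = b
    rw [hψ.map_zero, φ.left_inv (by rw [extChartAt_source]; exact hb.2)]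
  · intro t ht b hb
    have hball : ψ t (φ b) ∈ Metric.ball (φ b₀) (R / 2) :=
      hpq (hδp t (by rw [Real.ball_eq_Ioo]; simpa using ht)) (hV b hb.1)
    have htar : ψ t (φ b) ∈ φ.target := hRt (by
      rw [Metric.mem_closedBall]; exact (Metric.mem_ball.1 hball).le.trans (by linarith))
    constructor
    · have h1 : ContMDiffAt (𝓘(ℝ, ℝ).prod J) 𝓘(ℝ, E') ∞
          (fun q : ℝ × B => uncurry ψ (q.1, φ q.2)) (t, b) := by
        have h2 : ContMDiffAt (𝓘(ℝ, ℝ).prod J) 𝓘(ℝ, ℝ × E') ∞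
            (fun q : ℝ × B => (q.1, φ q.2)) (t, b) :=
          contMDiffAt_fst.prodMk_space (ContMDiffAt.comp (t, b) (g := φ) (f := Prod.snd)
            (contMDiffAt_extChartAt' hb.2) contMDiffAt_snd)
        exact hψs.contMDiff.contMDiffAt.comp (t, b) h2
      exact ContMDiffAt.comp (t, b) (g := φ.symm) (f := fun q : ℝ × B => uncurry ψ (q.1, φ q.2))
        (hsymm _ htar) h1
    · have hd := hψ.hasDerivAt t (φ b)
      have hmd : MDifferentiableAt 𝓘(ℝ, E') J φ.symm (ψ t (φ b)) :=
        (hsymm _ htar).mdifferentiableAt (by simp)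
      rw [vel_comp (f := φ.symm) (c := fun s => ψ s (φ b)) hmd
        hd.differentiableAt.mdifferentiableAt, vel_eq_deriv, hd.deriv]
      have hχ1 : χ (ψ t (φ b)) = 1 := χ.one_of_mem_closedBall (Metric.ball_subset_closedBall hball)
      rw [hv]
      simp only [hχ1, one_smul]
      set x := φ.symm (ψ t (φ b)) with hx
      have hxs : x ∈ (chartAt H' b₀).source := hsrc _ htar
      have e1 : deriv (fun τ => φ (Γ τ x)) 0 =
          mdf J 𝓘(ℝ, E') φ x (initialField J Γ x) := by
        rw [← vel_eq_deriv]
        have hg : MDifferentiableAt J 𝓘(ℝ, E') φ (Γ 0 x) := by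
          rw [h0]; exact mdifferentiableAt_extChartAt hxs
        have hc : MDifferentiableAt 𝓘(ℝ, ℝ) J (fun τ => Γ τ x) 0 :=
          (ContMDiffAt.comp (0 : ℝ) (g := uncurry Γ) (f := fun τ => (τ, x)) hΓ.contMDiffAt
            (contMDiffAt_id.prodMk contMDiffAt_const)).mdifferentiableAt (by simp)
        rw [vel_comp (f := φ) (c := fun τ => Γ τ x) hg hc, h0]
        rfl
      rw [e1]
      have := mfderiv_extChartAt_symm_apply (I := J) hxs (initialField J Γ x)
      rwa [← hφ, hx, φ.right_inv htar] at this

theorem integralCurve_unique [T2Space B] (hΓ : ContMDiff (𝓘(ℝ, ℝ).prod J) J ∞ (uncurry Γ))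
    (h0 : ∀ b, Γ 0 b = b) {γ γ' : ℝ → B}
    (hγ : ∀ t, MDifferentiableAt 𝓘(ℝ, ℝ) J γ t ∧ vel J γ t = initialField J Γ (γ t))
    (hγ' : ∀ t, MDifferentiableAt 𝓘(ℝ, ℝ) J γ' t ∧ vel J γ' t = initialField J Γ (γ' t))
    (h : γ 0 = γ' 0) : γ = γ' :=
  isMIntegralCurve_Ioo_eq_of_contMDiff_boundaryless (I := J) (contMDiff_initialField hΓ h0)
    (isMIntegralCurve_iff_isMIntegralCurveOn.2
      ((isMIntegralCurveOn_initialField_iff isOpen_univ).2 fun t _ => hγ t))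
    (isMIntegralCurve_iff_isMIntegralCurveOn.2
      ((isMIntegralCurveOn_initialField_iff isOpen_univ).2 fun t _ => hγ' t)) h

/-- A vector field whose integral curves exist for a uniform time outside a compact set has a
global flow, and this flow is smooth in all variables. -/
theorem exists_smooth_flow [FiniteDimensional ℝ E'] [T2Space B]
    (hΓ : ContMDiff (𝓘(ℝ, ℝ).prod J) J ∞ (uncurry Γ)) (h0 : ∀ b, Γ 0 b = b) {K : Set B}
    (hK : IsCompact K) {ε : ℝ} (hε : 0 < ε)
    (hout : ∀ b ∉ K, ∃ γ : ℝ → B, γ 0 = b ∧ ∀ t ∈ Ioo (-ε) ε,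
      MDifferentiableAt 𝓘(ℝ, ℝ) J γ t ∧ vel J γ t = initialField J Γ (γ t)) :
    ∃ Φ : ℝ → B → B, ContMDiff (𝓘(ℝ, ℝ).prod J) J ∞ (uncurry Φ) ∧ (∀ b, Φ 0 b = b) ∧
      (∀ t b, vel J (fun s => Φ s b) t = initialField J Γ (Φ t b)) ∧
      (∀ s t b, Φ (s + t) b = Φ s (Φ t b)) ∧ ∀ γ : ℝ → B, (∀ t,
        MDifferentiableAt 𝓘(ℝ, ℝ) J γ t ∧ vel J γ t = initialField J Γ (γ t)) →
        ∀ t, γ t = Φ t (γ 0) := by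
  have hv := contMDiff_initialField hΓ h0
  choose U hUo hbU δ hδ Ψ hΨ0 hΨ using exists_local_flow hΓ h0
  have hslice : ∀ b₀, ∀ t ∈ Ioo (-δ b₀) (δ b₀), ∀ b ∈ U b₀,
      MDifferentiableAt 𝓘(ℝ, ℝ) J (fun s => Ψ b₀ s b) t := fun b₀ t ht b hb =>
    (ContMDiffAt.comp t (g := uncurry (Ψ b₀)) (f := fun s => (s, b)) (hΨ b₀ t ht b hb).1
      (contMDiffAt_id.prodMk contMDiffAt_const)).mdifferentiableAt (by simp)
  have hcurve : ∀ b₀, ∀ b ∈ U b₀, IsMIntegralCurveOn (I := J) (fun s => Ψ b₀ s b)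
      (initialField J Γ) (Ioo (-δ b₀) (δ b₀)) := fun b₀ b hb =>
    (isMIntegralCurveOn_initialField_iff isOpen_Ioo).2 fun t ht =>
      ⟨hslice b₀ t ht b hb, (hΨ b₀ t ht b hb).2⟩
  obtain ⟨ε', hε', hunif⟩ : ∃ ε' > 0, ∀ b, ∃ γ : ℝ → B, γ 0 = b ∧
      IsMIntegralCurveOn (I := J) γ (initialField J Γ) (Ioo (-ε') ε') := by
    obtain ⟨s, -, hs⟩ := hK.elim_nhds_subcover U fun b _ => (hUo b).mem_nhds (hbU b)
    obtain ⟨ε', h1, h2, h3⟩ : ∃ ε' > 0, ε' ≤ ε ∧ ∀ b ∈ s, ε' ≤ δ b := by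
      induction s using Finset.cons_induction generalizing K with
      | empty => exact ⟨ε, hε, le_rfl, by simp⟩
      | cons a s ha ih =>
        have : ∃ ε' > 0, ε' ≤ ε ∧ ∀ b ∈ s, ε' ≤ δ b := by
          clear ih hs
          induction s using Finset.cons_induction with
          | empty => exact ⟨ε, hε, le_rfl, by simp⟩
          | cons c t hc ih =>
            obtain ⟨e, he, h1, h2⟩ := ih (by simp_all)
            exact ⟨min e (δ c), lt_min he (hδ c), (min_le_left _ _).trans h1, by
              intro b hb
              rcases Finset.mem_cons.1 hb with rfl | hb
              · exact min_le_right _ _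
              · exact (min_le_left _ _).trans (h2 b hb)⟩
        obtain ⟨e, he, h1, h2⟩ := this
        exact ⟨min e (δ a), lt_min he (hδ a), (min_le_left _ _).trans h1, by
          intro b hb
          rcases Finset.mem_cons.1 hb with rfl | hb
          · exact min_le_right _ _
          · exact (min_le_left _ _).trans (h2 b hb)⟩
    refine ⟨ε', h1, fun b => ?_⟩
    by_cases hb : b ∈ K
    · obtain ⟨c, hc, hbc⟩ := mem_iUnion₂.1 (hs hb)
      exact ⟨_, hΨ0 c b hbc, (hcurve c b hbc).mono
        (Ioo_subset_Ioo (neg_le_neg (h3 c hc)) (h3 c hc))⟩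
    · obtain ⟨γ, hγ0, hγ⟩ := hout b hb
      exact ⟨γ, hγ0, ((isMIntegralCurveOn_initialField_iff isOpen_Ioo).2 hγ).mono
        (Ioo_subset_Ioo (neg_le_neg h2) h2)⟩
  choose φ hφ0 hφ using exists_isMIntegralCurve_of_isMIntegralCurveOn hv hε' hunif
  have hφs : ∀ b t, MDifferentiableAt 𝓘(ℝ, ℝ) J (φ b) t ∧
      vel J (φ b) t = initialField J Γ (φ b t) := fun b t =>
    (isMIntegralCurveOn_initialField_iff isOpen_univ).1 ((hφ b).isMIntegralCurveOn univ) t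
      (mem_univ t)
  have hgroup : ∀ b s t, φ b (s + t) = φ (φ b t) s := fun b s t => by
    have h1 := (hφ b).comp_add t
    exact congrFun (isMIntegralCurve_Ioo_eq_of_contMDiff_boundaryless (t₀ := 0) hv h1
      (hφ (φ b t)) (by simp [hφ0])) s
  have hloc : ∀ b₀, ∀ b ∈ U b₀, EqOn (φ b) (fun s => Ψ b₀ s b) (Ioo (-δ b₀) (δ b₀)) :=
    fun b₀ b hb => isMIntegralCurveOn_Ioo_eqOn_of_contMDiff_boundaryless (t₀ := 0)
      ⟨by linarith [hδ b₀], hδ b₀⟩ hv ((hφ b).isMIntegralCurveOn _) (hcurve b₀ b hb)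
      (by rw [hφ0, hΨ0 b₀ b hb])
  set Φ : ℝ → B → B := fun t b => φ b t with hΦ
  have hsm : ∀ b₀, ∀ t ∈ Ioo (-δ b₀) (δ b₀), ∀ b ∈ U b₀,
      ContMDiffAt (𝓘(ℝ, ℝ).prod J) J ∞ (uncurry Φ) (t, b) := by
    intro b₀ t ht b hb
    refine (hΨ b₀ t ht b hb).1.congr_of_eventuallyEq ?_
    filter_upwards [prod_mem_nhds (isOpen_Ioo.mem_nhds ht) ((hUo b₀).mem_nhds hb)] with p hp
    exact hloc b₀ p.2 hp.2 hp.1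
  -- smoothness propagates along each orbit, by the group law
  have hstep : ∀ b c t s, φ b t ∈ U c → s - t ∈ Ioo (-δ c) (δ c) →
      ContMDiffAt (𝓘(ℝ, ℝ).prod J) J ∞ (uncurry Φ) (t, b) →
      ContMDiffAt (𝓘(ℝ, ℝ).prod J) J ∞ (uncurry Φ) (s, b) := by
    intro b c t s htc hst h
    have h1 : ContMDiffAt J J ∞ (Φ t) b :=
      ContMDiffAt.comp b (g := uncurry Φ) (f := fun b => (t, b)) h
        (contMDiffAt_const.prodMk contMDiffAt_id)
    have h2 : ContMDiffAt (𝓘(ℝ, ℝ).prod J) (𝓘(ℝ, ℝ).prod J) ∞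
        (fun p : ℝ × B => (p.1 - t, Φ t p.2)) (s, b) :=
      (contMDiffAt_fst.sub contMDiffAt_const).prodMk
        (ContMDiffAt.comp (s, b) (g := Φ t) (f := Prod.snd) h1 contMDiffAt_snd)
    refine (ContMDiffAt.comp (s, b) (g := uncurry Φ)
      (f := fun p : ℝ × B => (p.1 - t, Φ t p.2)) (hsm c _ hst _ htc) h2).congr_of_eventuallyEq
        (Filter.Eventually.of_forall fun p => ?_)
    change φ p.2 p.1 = φ (φ p.2 t) (p.1 - t)
    rw [← hgroup, sub_add_cancel]
  refine ⟨Φ, ?_, hφ0, fun t b => (hφs b t).2, fun s t b => hgroup b s t, fun γ hγ t =>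
    congrFun (integralCurve_unique hΓ h0 hγ (hφs (γ 0)) (hφ0 _).symm) t⟩
  rintro ⟨t, b⟩
  refine PreconnectedSpace.induction₂' (fun t s : ℝ =>
    ContMDiffAt (𝓘(ℝ, ℝ).prod J) J ∞ (uncurry Φ) (t, b) →
      ContMDiffAt (𝓘(ℝ, ℝ).prod J) J ∞ (uncurry Φ) (s, b)) (fun t => ?_)
    ⟨fun _ _ _ h1 h2 h => h2 (h1 h)⟩ 0 t
    (hsm b 0 ⟨by linarith [hδ b], hδ b⟩ b (hbU b))
  set c := φ b t with hc
  have h1 : ∀ᶠ s in 𝓝 t, φ b s ∈ U c :=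
    (hφs b t).1.continuousAt.eventually ((hUo c).mem_nhds (hbU c))
  have h2 : ∀ᶠ s in 𝓝 t, s ∈ Metric.ball t (δ c) := Metric.ball_mem_nhds t (hδ c)
  filter_upwards [h1, h2] with s hs1 hs2
  rw [Real.ball_eq_Ioo] at hs2
  exact ⟨hstep b c t s (hbU c) ⟨by linarith [hs2.1], by linarith [hs2.2]⟩,
    hstep b c s t hs1 ⟨by linarith [hs2.2], by linarith [hs2.1]⟩⟩

end FlowsOnManifolds

/-! ### Smooth surfaces in manifolds, and the form of the contact product -/

section ContactProductCalculus

theorem slice_left {E₁ H₁ M₁ E₂ H₂ M₂ E₃ H₃ M₃ : Type*} [NormedAddCommGroup E₁] [NormedSpace ℝ E₁]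
    [TopologicalSpace H₁] {I₁ : ModelWithCorners ℝ E₁ H₁} [TopologicalSpace M₁] [ChartedSpace H₁ M₁]
    [NormedAddCommGroup E₂] [NormedSpace ℝ E₂]
    [TopologicalSpace H₂] {I₂ : ModelWithCorners ℝ E₂ H₂} [TopologicalSpace M₂] [ChartedSpace H₂ M₂]
    [NormedAddCommGroup E₃] [NormedSpace ℝ E₃]
    [TopologicalSpace H₃] {I₃ : ModelWithCorners ℝ E₃ H₃} [TopologicalSpace M₃] [ChartedSpace H₃ M₃]
    {n : WithTop ℕ∞} {f : M₁ → M₂ → M₃} {a : M₁} {b : M₂}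
    (h : ContMDiffAt (I₁.prod I₂) I₃ n (uncurry f) (a, b)) :
    ContMDiffAt I₁ I₃ n (fun a => f a b) a :=
  ContMDiffAt.comp a (g := uncurry f) (f := fun a => (a, b)) h
    (contMDiffAt_id.prodMk contMDiffAt_const)

theorem slice_right {E₁ H₁ M₁ E₂ H₂ M₂ E₃ H₃ M₃ : Type*} [NormedAddCommGroup E₁] [NormedSpace ℝ E₁]
    [TopologicalSpace H₁] {I₁ : ModelWithCorners ℝ E₁ H₁} [TopologicalSpace M₁] [ChartedSpace H₁ M₁]
    [NormedAddCommGroup E₂] [NormedSpace ℝ E₂]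
    [TopologicalSpace H₂] {I₂ : ModelWithCorners ℝ E₂ H₂} [TopologicalSpace M₂] [ChartedSpace H₂ M₂]
    [NormedAddCommGroup E₃] [NormedSpace ℝ E₃]
    [TopologicalSpace H₃] {I₃ : ModelWithCorners ℝ E₃ H₃} [TopologicalSpace M₃] [ChartedSpace H₃ M₃]
    {n : WithTop ℕ∞} {f : M₁ → M₂ → M₃} {a : M₁} {b : M₂}
    (h : ContMDiffAt (I₁.prod I₂) I₃ n (uncurry f) (a, b)) :
    ContMDiffAt I₂ I₃ n (f a) b :=
  ContMDiffAt.comp b (g := uncurry f) (f := fun b => (a, b)) h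
    (contMDiffAt_const.prodMk contMDiffAt_id)

variable {E : Type*} [NormedAddCommGroup E] [NormedSpace ℝ E]
  {H : Type*} [TopologicalSpace H] {I : ModelWithCorners ℝ E H} [I.Boundaryless]
  {N : Type*} [TopologicalSpace N] [ChartedSpace H N] [IsManifold I ∞ N]

variable (I) in
/-- The model of the contact product `N × N × ℝ`. -/
abbrev cpModel : ModelWithCorners ℝ (E × E × ℝ) (ModelProd H (ModelProd H ℝ)) :=
  I.prod (I.prod 𝓘(ℝ, ℝ))

/-- Any two tangent vectors at a point are the partial velocities of a smooth surface. -/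
theorem exists_surface (x : N) (u v : E) : ∃ z : ℝ → ℝ → N,
    ContMDiffAt (𝓘(ℝ, ℝ).prod 𝓘(ℝ, ℝ)) I ∞ (uncurry z) (0, 0) ∧ z 0 0 = x ∧
      vel I (fun t => z t 0) 0 = u ∧ vel I (z 0) 0 = v := by
  set φ := extChartAt I x
  set u' : E := mdf I 𝓘(ℝ, E) φ x u
  set v' : E := mdf I 𝓘(ℝ, E) φ x v
  have h0 : φ x + (0 : ℝ) • u' + (0 : ℝ) • v' = φ x := by simp
  have hs : ContMDiffAt 𝓘(ℝ, E) I ∞ φ.symm (φ x) :=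
    (contMDiffOn_extChartAt_symm x).contMDiffAt (extChartAt_target_mem_nhds x)
  have hmd : MDifferentiableAt 𝓘(ℝ, E) I φ.symm (φ x) := hs.mdifferentiableAt (by simp)
  refine ⟨fun t s => φ.symm (φ x + t • u' + s • v'), ?_, ?_, ?_, ?_⟩
  · have h1 : ContMDiff (𝓘(ℝ, ℝ).prod 𝓘(ℝ, ℝ)) 𝓘(ℝ, E) ∞
        (fun p : ℝ × ℝ => φ x + p.1 • u' + p.2 • v') :=
      (contMDiff_const.add (contMDiff_fst.smul contMDiff_const)).add
        (contMDiff_snd.smul contMDiff_const)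
    exact ContMDiffAt.comp ((0 : ℝ), (0 : ℝ)) (g := φ.symm)
      (f := fun p : ℝ × ℝ => φ x + p.1 • u' + p.2 • v') (by rw [h0]; exact hs) h1.contMDiffAt
  · simp only [h0]; exact extChartAt_to_inv x
  · have hd : HasDerivAt (fun t : ℝ => φ x + t • u' + (0 : ℝ) • v') u' 0 := by
      simpa using ((hasDerivAt_id (0 : ℝ)).smul_const u').const_add (φ x)
    rw [vel_comp (f := φ.symm) (c := fun t : ℝ => φ x + t • u' + (0 : ℝ) • v')
      (by rw [h0]; exact hmd) hd.differentiableAt.mdifferentiableAt, vel_eq_deriv, hd.deriv, h0]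
    exact mfderiv_extChartAt_symm_apply (mem_chart_source H x) u
  · have hd : HasDerivAt (fun t : ℝ => φ x + (0 : ℝ) • u' + t • v') v' 0 := by
      simpa using ((hasDerivAt_id (0 : ℝ)).smul_const v').const_add (φ x)
    change vel I (fun t => φ.symm (φ x + (0 : ℝ) • u' + t • v')) 0 = v
    rw [vel_comp (f := φ.symm) (c := fun t : ℝ => φ x + (0 : ℝ) • u' + t • v')
      (by rw [h0]; exact hmd) hd.differentiableAt.mdifferentiableAt, vel_eq_deriv, hd.deriv, h0]
    exact mfderiv_extChartAt_symm_apply (mem_chart_source H x) v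

theorem exists_curve (x : N) (u : E) : ∃ c : ℝ → N, ContMDiffAt 𝓘(ℝ, ℝ) I ∞ c 0 ∧ c 0 = x ∧
    vel I c 0 = u := by
  obtain ⟨z, h, h0, -, h1⟩ := exists_surface (I := I) x 0 u
  exact ⟨z 0, slice_right h, h0, h1⟩

/-- A 1-form is smooth as soon as its pairings with the velocities of smooth families of curves are
smooth. -/
theorem DForm.isSmooth_of_ev_vel [FiniteDimensional ℝ E] {σ : DForm I N 1}
    (h : ∀ (Γ : E → ℝ → N) (y : E), ContMDiffAt (𝓘(ℝ, E).prod 𝓘(ℝ, ℝ)) I ∞ (uncurry Γ) (y, 0) →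
      ContMDiffAt 𝓘(ℝ, E) 𝓘(ℝ, ℝ) ∞ (fun y => σ.ev (Γ y 0) (vel I (Γ y) 0)) y) :
    σ.IsSmooth := by
  intro x₀
  set φ := extChartAt I x₀ with hφ
  have ht : IsOpen φ.target := isOpen_extChartAt_target x₀
  have hs : ∀ y ∈ φ.target, ContMDiffAt 𝓘(ℝ, E) I ∞ φ.symm y := fun y hy =>
    (contMDiffOn_extChartAt_symm x₀).contMDiffAt (ht.mem_nhds hy)
  have key : ∀ u : E, ContDiffOn ℝ ∞ (fun y => σ.inChart x₀ y ![u]) φ.target := by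
    intro u y hy
    have h1 : ContMDiff (𝓘(ℝ, E).prod 𝓘(ℝ, ℝ)) 𝓘(ℝ, E) ∞ (fun p : E × ℝ => p.1 + p.2 • u) :=
      contMDiff_fst.add (contMDiff_snd.smul contMDiff_const)
    have h2 := h (fun y τ => φ.symm (y + τ • u)) y
      (ContMDiffAt.comp (y, (0 : ℝ)) (g := φ.symm) (f := fun p : E × ℝ => p.1 + p.2 • u)
        (by simpa using hs y hy) h1.contMDiffAt)
    refine (h2.contDiffAt.congr_of_eventuallyEq ?_).contDiffWithinAt
    filter_upwards [ht.mem_nhds hy] with w hw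
    have hd : HasDerivAt (fun t : ℝ => w + t • u) u 0 := by
      simpa using ((hasDerivAt_id (0 : ℝ)).smul_const u).const_add w
    have e0 : w + (0 : ℝ) • u = w := by simp
    rw [vel_comp (f := φ.symm) (c := fun t : ℝ => w + t • u)
      (by rw [e0]; exact (hs w hw).mdifferentiableAt (by simp))
      hd.differentiableAt.mdifferentiableAt, vel_eq_deriv, hd.deriv, e0, σ.inChart_apply]
  set ℓ := (ContinuousAlternatingMap.ofSubsingletonLIE (𝕜 := ℝ) (E := E) (F := ℝ) (0 : Fin 1))
  have h3 : ContDiffOn ℝ ∞ (fun y => ℓ.symm (σ.inChart x₀ y)) φ.target := by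
    refine contDiffOn_clm_apply.2 fun u => (key u).congr fun y _ => ?_
    change σ.inChart x₀ y _ = _
    congr 1
    funext i; fin_cases i; rfl
  refine (ℓ.contDiff.comp_contDiffOn h3).congr fun y _ => ?_
  exact (LinearIsometryEquiv.apply_symm_apply _ _).symm

/-! ### The contact product -/

variable {α : DForm I N 1}

theorem vel_cp {c : ℝ → N × N × ℝ} {t : ℝ} (hc : MDifferentiableAt 𝓘(ℝ, ℝ) (cpModel I) c t) :
    vel (cpModel I) c t = (vel I (fun s => (c s).1) t, vel I (fun s => (c s).2.1) t,
      deriv (fun s => (c s).2.2) t) := by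
  have h1 : MDifferentiableAt 𝓘(ℝ, ℝ) I (fun s => (c s).1) t := hc.fst
  have h2 : MDifferentiableAt 𝓘(ℝ, ℝ) (I.prod 𝓘(ℝ, ℝ)) (fun s => (c s).2) t := hc.snd
  have h3 : MDifferentiableAt 𝓘(ℝ, ℝ) I (fun s => (c s).2.1) t := h2.fst
  have h4 : MDifferentiableAt 𝓘(ℝ, ℝ) 𝓘(ℝ, ℝ) (fun s => (c s).2.2) t := h2.snd
  rw [← vel_eq_deriv, ← vel_prodMk h3 h4, ← vel_prodMk h1 h2]

theorem productForm_ev (p : N × N × ℝ) (u : E × E × ℝ) :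
    (productForm α).ev p u = α.ev p.2.1 u.2.1 - Real.exp p.2.2 * α.ev p.1 u.1 := by
  have h1 : mdf (cpModel I) I (fun q : N × N × ℝ => q.1) p u = u.1 := by
    have := mfderiv_fst (I := I) (I' := I.prod 𝓘(ℝ, ℝ)) (x := p)
    exact congrArg (fun L : (E × E × ℝ) →L[ℝ] E => L u) this
  have h2 : mdf (cpModel I) I (fun q : N × N × ℝ => q.2.1) p u = u.2.1 := by
    rw [mdf_comp (I := cpModel I) (J := I.prod 𝓘(ℝ, ℝ)) (f := fun q : N × N × ℝ => q.2) (g := Prod.fst)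
      mdifferentiableAt_fst mdifferentiableAt_snd]
    have a1 := mfderiv_snd (I := I) (I' := I.prod 𝓘(ℝ, ℝ)) (x := p)
    have a2 := mfderiv_fst (I := I) (I' := 𝓘(ℝ, ℝ)) (x := p.2)
    have b1 : mdf (cpModel I) (I.prod 𝓘(ℝ, ℝ)) (fun q : N × N × ℝ => q.2) p u = u.2 :=
      congrArg (fun L : (E × E × ℝ) →L[ℝ] (E × ℝ) => L u) a1
    rw [b1]
    exact congrArg (fun L : (E × ℝ) →L[ℝ] E => L u.2) a2
  have e : (productForm α).ev p u =
      (DForm.pull (fun q : N × N × ℝ => q.2.1) α : DForm (cpModel I) _ 1).ev p u -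
      Real.exp p.2.2 * (DForm.pull (fun q : N × N × ℝ => q.1) α : DForm (cpModel I) _ 1).ev p u :=
    rfl
  rw [e, DForm.ev_pull, DForm.ev_pull, h1, h2]

theorem productForm_ev_vel {c : ℝ → N × N × ℝ} {t : ℝ}
    (hc : MDifferentiableAt 𝓘(ℝ, ℝ) (cpModel I) c t) :
    (productForm α).ev (c t) (vel (cpModel I) c t) =
      α.ev (c t).2.1 (vel I (fun s => (c s).2.1) t) -
        Real.exp (c t).2.2 * α.ev (c t).1 (vel I (fun s => (c s).1) t) := by
  rw [productForm_ev, vel_cp hc]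

theorem productForm_isSmooth [FiniteDimensional ℝ E] (hα : α.IsSmooth) :
    (productForm α).IsSmooth := by
  refine DForm.isSmooth_of_ev_vel fun Γ y hΓ => ?_
  have h1 : ContMDiffAt (𝓘(ℝ, E × E × ℝ).prod 𝓘(ℝ, ℝ)) I ∞ (uncurry fun y τ => (Γ y τ).1) (y, 0) :=
    contMDiffAt_fst.comp _ hΓ
  have h2 : ContMDiffAt (𝓘(ℝ, E × E × ℝ).prod 𝓘(ℝ, ℝ)) (I.prod 𝓘(ℝ, ℝ)) ∞
      (uncurry fun y τ => (Γ y τ).2) (y, 0) := contMDiffAt_snd.comp _ hΓ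
  have h3 : ContMDiffAt (𝓘(ℝ, E × E × ℝ).prod 𝓘(ℝ, ℝ)) I ∞ (uncurry fun y τ => (Γ y τ).2.1) (y, 0) :=
    contMDiffAt_fst.comp _ h2
  have h4 : ContMDiffAt (𝓘(ℝ, E × E × ℝ).prod 𝓘(ℝ, ℝ)) 𝓘(ℝ, ℝ) ∞
      (uncurry fun y τ => (Γ y τ).2.2) (y, 0) := contMDiffAt_snd.comp _ h2
  have h5 : ContMDiffAt 𝓘(ℝ, E × E × ℝ) 𝓘(ℝ, ℝ) ∞ (fun y => Real.exp (Γ y 0).2.2) y :=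
    Real.contDiff_exp.contDiffAt.contMDiffAt.comp y (slice_left h4)
  refine ((contMDiffAt_ev_vel hα (g := fun _ => 0) h3 contMDiffAt_const).sub
    (h5.mul (contMDiffAt_ev_vel hα (g := fun _ => 0) h1
      contMDiffAt_const))).congr_of_eventuallyEq ?_
  have hc : ContinuousAt (fun w : E × E × ℝ => (w, (0 : ℝ))) y :=
    (continuous_id.prodMk continuous_const).continuousAt
  filter_upwards [hc.eventually ((contMDiffAt_iff_contMDiffAt_nhds (by simp)).1
        (hΓ.of_le (by simp : (1 : WithTop ℕ∞) ≤ ∞)))] with w hw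
  exact productForm_ev_vel ((slice_right hw).mdifferentiableAt (by simp))

theorem productForm_d_ev₂ [FiniteDimensional ℝ E] (hα : α.IsSmooth) (p : N × N × ℝ)
    (u v : E × E × ℝ) :
    (productForm α).d.ev₂ p u v = α.d.ev₂ p.2.1 u.2.1 v.2.1 -
      Real.exp p.2.2 * α.d.ev₂ p.1 u.1 v.1 -
      Real.exp p.2.2 * (u.2.2 * α.ev p.1 v.1 - v.2.2 * α.ev p.1 u.1) := by
  obtain ⟨z, hz, rfl, rfl, rfl⟩ := exists_surface (I := cpModel I) p u v
  have h1 : ContMDiffAt (𝓘(ℝ, ℝ).prod 𝓘(ℝ, ℝ)) I ∞ (uncurry fun t s => (z t s).1) (0, 0) :=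
    contMDiffAt_fst.comp _ hz
  have h2 : ContMDiffAt (𝓘(ℝ, ℝ).prod 𝓘(ℝ, ℝ)) (I.prod 𝓘(ℝ, ℝ)) ∞
      (uncurry fun t s => (z t s).2) (0, 0) := contMDiffAt_snd.comp _ hz
  have h3 : ContMDiffAt (𝓘(ℝ, ℝ).prod 𝓘(ℝ, ℝ)) I ∞ (uncurry fun t s => (z t s).2.1) (0, 0) :=
    contMDiffAt_fst.comp _ h2
  have h4 : ContMDiffAt (𝓘(ℝ, ℝ).prod 𝓘(ℝ, ℝ)) 𝓘(ℝ, ℝ) ∞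
      (uncurry fun t s => (z t s).2.2) (0, 0) := contMDiffAt_snd.comp _ h2
  have hsw : ContMDiffAt (𝓘(ℝ, ℝ).prod 𝓘(ℝ, ℝ)) (𝓘(ℝ, ℝ).prod 𝓘(ℝ, ℝ)) ∞
      (fun q : ℝ × ℝ => (q.2, q.1)) (0, 0) := contMDiffAt_snd.prodMk contMDiffAt_fst
  have hnear := (contMDiffAt_iff_contMDiffAt_nhds (by simp)).1
    (hz.of_le (by simp : (1 : WithTop ℕ∞) ≤ ∞))
  -- derivatives of the pairings of `β` with the two partial velocities
  have hD : ∀ {f : ℝ → ℝ → N}, ContMDiffAt (𝓘(ℝ, ℝ).prod 𝓘(ℝ, ℝ)) I ∞ (uncurry f) (0, 0) →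
      DifferentiableAt ℝ (fun t => α.ev (f t 0) (vel I (f t) 0)) 0 := fun hf =>
    ((contMDiffAt_ev_vel hα (g := fun _ => 0) hf contMDiffAt_const).contDiffAt).differentiableAt
      (by simp)
  have hE : DifferentiableAt ℝ (fun t => (z t 0).2.2) 0 :=
    (slice_left h4).contDiffAt.differentiableAt (by simp)
  have hE' : DifferentiableAt ℝ (fun t => (z 0 t).2.2) 0 :=
    (slice_right h4).contDiffAt.differentiableAt (by simp)
  have d1 : deriv (fun t => (productForm α).ev (z t 0) (vel (cpModel I) (z t) 0)) 0 =
      deriv (fun t => α.ev (z t 0).2.1 (vel I (fun s => (z t s).2.1) 0)) 0 -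
      (Real.exp (z 0 0).2.2 * deriv (fun t => (z t 0).2.2) 0 *
        α.ev (z 0 0).1 (vel I (fun s => (z 0 s).1) 0) + Real.exp (z 0 0).2.2 *
        deriv (fun t => α.ev (z t 0).1 (vel I (fun s => (z t s).1) 0)) 0) := by
    have hc : ContinuousAt (fun w : ℝ => (w, (0 : ℝ))) 0 :=
      (continuous_id.prodMk continuous_const).continuousAt
    refine Eq.trans (Filter.EventuallyEq.deriv_eq ?_)
      ((hD h3).hasDerivAt.sub (hE.hasDerivAt.exp.mul (hD h1).hasDerivAt)).deriv
    filter_upwards [hc.eventually hnear] with w hw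
    exact productForm_ev_vel ((slice_right hw).mdifferentiableAt (by simp))
  have d2 : deriv (fun s => (productForm α).ev (z 0 s) (vel (cpModel I) (fun t => z t s) 0)) 0 =
      deriv (fun s => α.ev (z 0 s).2.1 (vel I (fun t => (z t s).2.1) 0)) 0 -
      (Real.exp (z 0 0).2.2 * deriv (fun s => (z 0 s).2.2) 0 *
        α.ev (z 0 0).1 (vel I (fun t => (z t 0).1) 0) + Real.exp (z 0 0).2.2 *
        deriv (fun s => α.ev (z 0 s).1 (vel I (fun t => (z t s).1) 0)) 0) := by
    have hc : ContinuousAt (fun w : ℝ => ((0 : ℝ), w)) 0 :=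
      (continuous_const.prodMk continuous_id).continuousAt
    refine Eq.trans (Filter.EventuallyEq.deriv_eq ?_)
      ((hD (f := fun s t => (z t s).2.1) (ContMDiffAt.comp ((0 : ℝ), (0 : ℝ))
          (g := uncurry fun t s => (z t s).2.1) (f := fun q : ℝ × ℝ => (q.2, q.1)) h3
          hsw)).hasDerivAt.sub
        (hE'.hasDerivAt.exp.mul (hD (f := fun s t => (z t s).1)
          (ContMDiffAt.comp ((0 : ℝ), (0 : ℝ)) (g := uncurry fun t s => (z t s).1)
          (f := fun q : ℝ × ℝ => (q.2, q.1)) h1 hsw)).hasDerivAt)).deriv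
    filter_upwards [hc.eventually hnear] with w hw
    exact productForm_ev_vel (c := fun t => z t w) ((slice_left hw).mdifferentiableAt (by simp))
  have k := deriv_ev_sub_deriv_ev (productForm_isSmooth hα) hz
  have k1 := deriv_ev_sub_deriv_ev hα h1
  have k2 := deriv_ev_sub_deriv_ev hα h3
  have v1 := vel_cp (I := I) ((slice_left hz).mdifferentiableAt (by simp))
  have v2 := vel_cp (I := I) ((slice_right hz).mdifferentiableAt (by simp))
  rw [← k, d1, d2, v1, v2]
  dsimp only
  rw [← k1, ← k2]
  ring

end ContactProductCalculus

/-! ### Contact families and Reeb flows -/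

section ContactFamilies

variable {E : Type*} [NormedAddCommGroup E] [NormedSpace ℝ E]
  {H : Type*} [TopologicalSpace H] {I : ModelWithCorners ℝ E H}
  {M : Type*} [TopologicalSpace M] [ChartedSpace H M]
  {A : Type*} [NormedAddCommGroup A] [NormedSpace ℝ A]
  {A' : Type*} [NormedAddCommGroup A'] [NormedSpace ℝ A'] {σ : DForm I M 1}

/-- `φ` preserves the cooriented kernel of `σ`: `φ^* σ` is a positive multiple of `σ` at each
point. -/
def IsConformal (σ : DForm I M 1) (φ : M → M) : Prop :=
  ∀ x, ∃ c > 0, ∀ u, σ.ev (φ x) (mdf I I φ x u) = c * σ.ev x u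

theorem IsConformal.comp {φ ψ : M → M} (hφ : IsConformal σ φ) (hψ : IsConformal σ ψ)
    (dφ : MDifferentiable I I φ) (dψ : MDifferentiable I I ψ) : IsConformal σ (φ ∘ ψ) := fun x => by
  obtain ⟨a, ha, h1⟩ := hφ (ψ x)
  obtain ⟨b, hb, h2⟩ := hψ x
  refine ⟨a * b, mul_pos ha hb, fun u => ?_⟩
  rw [show φ ∘ ψ = fun y => φ (ψ y) from rfl, mdf_comp (dφ _) (dψ _), h1, h2, mul_assoc]

theorem IsConformal.inv {φ ψ : M → M} (hφ : IsConformal σ φ) (h : RightInverse ψ φ)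
    (dφ : MDifferentiable I I φ) (dψ : MDifferentiable I I ψ) : IsConformal σ ψ := fun x => by
  obtain ⟨a, ha, h1⟩ := hφ (ψ x)
  refine ⟨a⁻¹, inv_pos.2 ha, fun u => ?_⟩
  have h2 := h1 (mdf I I ψ x u)
  rw [← mdf_comp (dφ _) (dψ _), h x] at h2
  have h3 : (fun y => φ (ψ y)) = fun y => y := funext h
  rw [h3, mdf_id] at h2
  rw [h2, inv_mul_cancel_left₀ ha.ne']

theorem contact_iff {φ : M → M} : (∀ (x : M) (v : Fin 1 → TangentSpace I x),
      (DForm.pull φ σ : DForm I M 1) x v = 0 ↔ σ x v = 0) ↔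
    ∀ x u, σ.ev (φ x) (mdf I I φ x u) = 0 ↔ σ.ev x u = 0 := by
  constructor
  · intro h x u
    rw [← DForm.ev_pull]
    exact h x ![u]
  · intro h x v
    have h1 : ∀ w : E, (DForm.pull φ σ : DForm I M 1).ev x w = 0 ↔ σ.ev x w = 0 := fun w => by
      rw [DForm.ev_pull]
      exact h x w
    have : v = ![v 0] := vec_one (E := E) v
    rw [this]
    exact h1 (v 0)

theorem IsConformal.contact {φ : M → M} (hφ : IsConformal σ φ) (x : M)
    (v : Fin 1 → TangentSpace I x) :
    (DForm.pull φ σ : DForm I M 1) x v = 0 ↔ σ x v = 0 := by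
  refine contact_iff.2 (fun x u => ?_) x v
  obtain ⟨c, hc, h⟩ := hφ x
  rw [h, mul_eq_zero, or_iff_right hc.ne']

theorem IsContactFamily.contMDiff {φ : A → M → M} (h : IsContactFamily σ univ φ) :
    ContMDiff (𝓘(ℝ, A).prod I) I ∞ (uncurry φ) := by
  have := h.smooth
  rwa [univ_prod_univ, contMDiffOn_univ] at this

theorem IsContactFamily.exists_inv_univ {φ : A → M → M} (h : IsContactFamily σ univ φ) :
    ∃ ψ : A → M → M, IsContactFamily σ univ ψ ∧
      ∀ a, LeftInverse (ψ a) (φ a) ∧ RightInverse (ψ a) (φ a) := by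
  obtain ⟨ψ, h1, h2⟩ := h.exists_inv
  exact ⟨ψ, h.inv h1 h2, fun a => h2 a (mem_univ a)⟩

theorem isContactFamily_univ_of {φ ψ : A → M → M}
    (hφ : ContMDiff (𝓘(ℝ, A).prod I) I ∞ (uncurry φ))
    (hψ : ContMDiff (𝓘(ℝ, A).prod I) I ∞ (uncurry ψ))
    (h : ∀ a, LeftInverse (ψ a) (φ a) ∧ RightInverse (ψ a) (φ a))
    (hc : ∀ a, IsConformal σ (φ a)) : IsContactFamily σ univ φ :=
  ⟨hφ.contMDiffOn, ⟨ψ, hψ.contMDiffOn, fun a _ => h a⟩, fun a _ => (hc a).contact⟩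

theorem IsContactFamily.mono {K K' : Set A} {φ : A → M → M} (h : IsContactFamily σ K φ)
    (hK : K' ⊆ K) : IsContactFamily σ K' φ := by
  obtain ⟨ψ, h1, h2⟩ := h.exists_inv
  exact ⟨h.smooth.mono (prod_mono hK subset_rfl), ⟨ψ, h1.mono (prod_mono hK subset_rfl),
    fun a ha => h2 a (hK ha)⟩, fun a ha => h.contact a (hK ha)⟩

theorem contMDiffOn_reparam {K : Set A} {K' : Set A'} {r : A' → A} {φ : A → M → M}
    (h : ContMDiffOn (𝓘(ℝ, A).prod I) I ∞ (uncurry φ) (K ×ˢ univ)) (hr : ContDiff ℝ ∞ r)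
    (hK : MapsTo r K' K) :
    ContMDiffOn (𝓘(ℝ, A').prod I) I ∞ (uncurry fun a => φ (r a)) (K' ×ˢ univ) := by
  have h1 : ContMDiff (𝓘(ℝ, A').prod I) (𝓘(ℝ, A).prod I) ∞ (fun q : A' × M => (r q.1, q.2)) :=
    (hr.contMDiff.comp contMDiff_fst).prodMk contMDiff_snd
  exact h.comp h1.contMDiffOn (fun q hq => ⟨hK hq.1, mem_univ _⟩)

theorem IsContactFamily.reparam {K : Set A} {φ : A → M → M} (h : IsContactFamily σ K φ)
    {K' : Set A'} {r : A' → A} (hr : ContDiff ℝ ∞ r) (hK : MapsTo r K' K) :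
    IsContactFamily σ K' (fun a => φ (r a)) := by
  obtain ⟨ψ, h1, h2⟩ := h.exists_inv
  exact ⟨contMDiffOn_reparam h.smooth hr hK, ⟨_, contMDiffOn_reparam h1 hr hK,
    fun a ha => h2 _ (hK ha)⟩, fun a ha => h.contact _ (hK ha)⟩

theorem isContactFamily_const {K : Set A'} {φ : A → M → M} {K' : Set A}
    (h : IsContactFamily σ K' φ) {a : A} (ha : a ∈ K') :
    IsContactFamily σ K fun _ : A' => φ a :=
  h.reparam contDiff_const fun _ _ => ha

theorem HasCompactSupp.reparam {K : Set A} {φ : A → M → M} (h : HasCompactSupp K φ)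
    {K' : Set A'} {r : A' → A} (hK : MapsTo r K' K) : HasCompactSupp K' (fun a => φ (r a)) := by
  obtain ⟨C, hC, h⟩ := h
  exact ⟨C, hC, fun a ha => h _ (hK ha)⟩

theorem HasCompactSupp.comp {K : Set A} {φ ψ : A → M → M} (hφ : HasCompactSupp K φ)
    (hψ : HasCompactSupp K ψ) : HasCompactSupp K (fun a => φ a ∘ ψ a) := by
  obtain ⟨C, hC, h⟩ := hφ
  obtain ⟨C', hC', h'⟩ := hψ
  refine ⟨C ∪ C', hC.union hC', fun a ha x hx => ?_⟩
  rw [mem_union, not_or] at hx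
  change φ a (ψ a x) = x
  rw [h' a ha x hx.2, h a ha x hx.1]

theorem HasCompactSupp.inv {K : Set A} {φ ψ : A → M → M} (hφ : HasCompactSupp K φ)
    (h : ∀ a ∈ K, LeftInverse (ψ a) (φ a)) : HasCompactSupp K ψ := by
  obtain ⟨C, hC, h'⟩ := hφ
  refine ⟨C, hC, fun a ha x hx => ?_⟩
  have := h a ha x
  rwa [h' a ha x hx] at this

/-- A conjugate of a compactly supported family, by a family which need not be compactly
supported. -/
theorem HasCompactSupp.conj {K : Set A} {φ ψ χ : A → M → M} (hφ : HasCompactSupp K φ)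
    (hK : IsCompact K) (h : ∀ a ∈ K, LeftInverse (ψ a) (χ a) ∧ RightInverse (ψ a) (χ a))
    (hχ : ContinuousOn (uncurry χ) (K ×ˢ univ)) :
    HasCompactSupp K (fun a => χ a ∘ φ a ∘ ψ a) := by
  obtain ⟨C, hC, h'⟩ := hφ
  refine ⟨uncurry χ '' (K ×ˢ C), (hK.prod hC).image_of_continuousOn
    (hχ.mono (prod_mono subset_rfl (subset_univ _))), fun a ha x hx => ?_⟩
  have : ψ a x ∉ C := fun hc => hx ⟨(a, ψ a x), ⟨ha, hc⟩, (h a ha).2 x⟩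
  simp only [comp_apply, h' a ha _ this]
  exact (h a ha).2 x

/-- `σ(d/dt φ_t(x))` for a family defined for all times. -/
def speed (σ : DForm I M 1) (φ : ℝ → M → M) (t : ℝ) (x : M) : ℝ :=
  σ.ev (φ t x) (vel I (fun s => φ s x) t)

theorem contactSpeed_eq_speed {φ : ℝ → M → M} {t : ℝ} {x : M} (ht : t ∈ Icc (0 : ℝ) 1)
    (h : MDifferentiableAt 𝓘(ℝ, ℝ) I (fun s => φ s x) t) :
    contactSpeed σ φ t x = speed σ φ t x := by
  have : UniqueMDiffWithinAt 𝓘(ℝ, ℝ) (Icc (0 : ℝ) 1) t :=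
    (uniqueDiffOn_Icc one_pos t ht).uniqueMDiffWithinAt
  rw [contactSpeed, mfderivWithin_eq_mfderiv this h]
  rfl

theorem speed_comp {φ ψ : ℝ → M → M} {t : ℝ} {x : M} {c : ℝ}
    (hφ : MDifferentiableAt (𝓘(ℝ, ℝ).prod I) I (uncurry φ) (t, ψ t x))
    (hψ : MDifferentiableAt 𝓘(ℝ, ℝ) I (fun s => ψ s x) t)
    (hc : ∀ u, σ.ev (φ t (ψ t x)) (mdf I I (φ t) (ψ t x) u) = c * σ.ev (ψ t x) u) :
    speed σ (fun t => φ t ∘ ψ t) t x = speed σ φ t (ψ t x) + c * speed σ ψ t x := by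
  have := vel_two (f := φ) (c := fun s => ψ s x) hφ hψ
  simp only [speed, comp_apply]
  rw [this, σ.ev_add, hc]

theorem speed_reparam {φ : ℝ → M → M} {r : ℝ → ℝ} {t r' : ℝ} {x : M}
    (hφ : MDifferentiableAt 𝓘(ℝ, ℝ) I (fun s => φ s x) (r t)) (hr : HasDerivAt r r' t) :
    speed σ (fun t => φ (r t)) t x = r' * speed σ φ (r t) x := by
  simp only [speed]
  rw [vel_comp_real (c := fun s => φ s x) hφ hr, σ.ev_smul]

theorem IsContactFamily.mdiff_curve {φ : ℝ → M → M} (h : IsContactFamily σ univ φ) (t : ℝ)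
    (x : M) : MDifferentiableAt 𝓘(ℝ, ℝ) I (fun s => φ s x) t :=
  (slice_left (h.contMDiff (t, x))).mdifferentiableAt (by simp)

theorem IsContactFamily.mdiff_uncurry {φ : A → M → M} (h : IsContactFamily σ univ φ) (p : A × M) :
    MDifferentiableAt (𝓘(ℝ, A).prod I) I (uncurry φ) p :=
  (h.contMDiff p).mdifferentiableAt (by simp)

theorem IsContactFamily.contMDiff_apply {φ : A → M → M} (h : IsContactFamily σ univ φ) (a : A) :
    ContMDiff I I ∞ (φ a) := contMDiff_slice h.smooth (mem_univ a)

theorem IsContactFamily.mdiff_apply {φ : A → M → M} (h : IsContactFamily σ univ φ) (a : A) :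
    MDifferentiable I I (φ a) := (h.contMDiff_apply a).mdifferentiable (by simp)

end ContactFamilies

section ReebFlows

variable {E : Type*} [NormedAddCommGroup E] [NormedSpace ℝ E]
  {H : Type*} [TopologicalSpace H] {I : ModelWithCorners ℝ E H} [I.Boundaryless]
  {N : Type*} [TopologicalSpace N] [ChartedSpace H N] [IsManifold I ∞ N] {α : DForm I N 1}

theorem vel_of_hasMFDerivAt_smulRight {c : ℝ → N} {t : ℝ} {R : E}
    (h : HasMFDerivAt 𝓘(ℝ, ℝ) I c t ((ContinuousLinearMap.id ℝ ℝ).smulRight R : ℝ →L[ℝ] E)) :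
    vel I c t = R := by
  rw [vel_of_hasMFDerivAt h]
  simp

/-- `F` is the Reeb flow of the contact form `α`, and it is smooth and satisfies the group law. (Both
properties follow from completeness; here they are evident, since the flow is a circle action.) -/
structure IsSmoothReebFlow (α : DForm I N 1) (F : ℝ → N → N) : Prop where
  contact : IsContactForm α
  smooth : ContMDiff (𝓘(ℝ, ℝ).prod I) I ∞ (uncurry F)
  isReeb : IsReebFlow α F
  add : ∀ s t x, F (s + t) x = F s (F t x)

namespace IsSmoothReebFlow

variable {F : ℝ → N → N} (hF : IsSmoothReebFlow α F)

include hF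

theorem mdiff_uncurry (p : ℝ × N) : MDifferentiableAt (𝓘(ℝ, ℝ).prod I) I (uncurry F) p :=
  (hF.smooth p).mdifferentiableAt (by simp)

theorem mdiff_curve (t : ℝ) (x : N) : MDifferentiableAt 𝓘(ℝ, ℝ) I (fun s => F s x) t :=
  (slice_left (hF.smooth (t, x))).mdifferentiableAt (by simp)

theorem contMDiff_apply (t : ℝ) : ContMDiff I I ∞ (F t) := fun x => slice_right (hF.smooth (t, x))

theorem mdiff (t : ℝ) : MDifferentiable I I (F t) := (hF.contMDiff_apply t).mdifferentiable (by simp)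

theorem map_zero (x : N) : F 0 x = x := hF.isReeb.1 x

theorem vel_eq (t : ℝ) (x : N) : vel I (fun s => F s x) t = initialField I F (F t x) := by
  have e : (fun s => F s x) = fun s => (fun r => F r (F t x)) (s - t) := by
    funext s
    change F s x = F (s - t) (F t x)
    rw [← hF.add, sub_add_cancel]
  rw [e, vel_comp_real (c := fun r => F r (F t x)) (hF.mdiff_curve _ _)
    (g := fun s => s - t) ((hasDerivAt_id t).sub_const t), one_smul, sub_self]
  rfl

theorem reeb_spec (x : N) : α.ev x (initialField I F x) = 1 ∧
    ∀ v, α.d.ev₂ x (initialField I F x) v = 0 := by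
  obtain ⟨R, ⟨h1, h2⟩, h3⟩ := hF.isReeb.2 x 0
  have h4 : initialField (E' := E) I F x = R := vel_of_hasMFDerivAt_smulRight (E := E) h3
  rw [← h4] at h1 h2
  have h1' : DForm.ev (E := E) α (F 0 x) (initialField I F x) = 1 := h1
  have h2' : ∀ v : E, α.d.ev₂ (F 0 x) (initialField I F x) v = 0 := h2
  rw [hF.map_zero] at h1' h2'
  exact ⟨h1', h2'⟩

theorem ev_reeb (x : N) : α.ev x (initialField I F x) = 1 := (hF.reeb_spec x).1

theorem d_reeb (x : N) (v : E) : α.d.ev₂ x (initialField I F x) v = 0 := (hF.reeb_spec x).2 v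

theorem d_reeb' (x : N) (v : E) : α.d.ev₂ x v (initialField I F x) = 0 := by
  rw [DForm.ev₂_swap, hF.d_reeb, neg_zero]

theorem eq_zero_of (x : N) {u : E} (h1 : α.ev x u = 0) (h2 : ∀ v, α.d.ev₂ x u v = 0) : u = 0 :=
  hF.contact.nondegenerate x u h1 fun v _ => h2 v

/-- Uniqueness of the Reeb vector. -/
theorem eq_reeb (x : N) {u : E} (h1 : α.ev x u = 1) (h2 : ∀ v, α.d.ev₂ x u v = 0) :
    u = initialField I F x := by
  refine sub_eq_zero.1 (hF.eq_zero_of x (by rw [α.ev_sub, h1, hF.ev_reeb, sub_self]) fun v => ?_)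
  rw [sub_eq_add_neg, DForm.ev₂_add_left, h2 v, ← neg_one_smul ℝ, DForm.ev₂_smul_left, hF.d_reeb]
  simp

/-- The Reeb flow preserves the contact form. -/
theorem ev_mdf (t : ℝ) (x : N) (u : E) : α.ev (F t x) (mdf I I (F t) x u) = α.ev x u := by
  obtain ⟨c, hc, rfl, rfl⟩ := exists_curve (I := I) x u
  have hz : ∀ t, ContMDiffAt (𝓘(ℝ, ℝ).prod 𝓘(ℝ, ℝ)) I ∞ (uncurry fun t s => F t (c s)) (t, 0) :=
    fun t => hF.smooth.contMDiffAt.comp (t, (0 : ℝ)) (contMDiffAt_fst.prodMk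
      (ContMDiffAt.comp (t, (0 : ℝ)) (g := c) (f := Prod.snd) hc contMDiffAt_snd))
  have hcd : MDifferentiableAt 𝓘(ℝ, ℝ) I c 0 := hc.mdifferentiableAt (by simp)
  have hv : ∀ t, vel I (fun s => F t (c s)) 0 = mdf I I (F t) (c 0) (vel I c 0) := fun t =>
    vel_comp (hF.mdiff t _) hcd
  have hd : ∀ t, DifferentiableAt ℝ (fun t => α.ev (F t (c 0)) (vel I (fun s => F t (c s)) 0)) t :=
    fun t => (contMDiffAt_ev_vel hF.contact.smooth (g := fun _ => 0) (hz t)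
      contMDiffAt_const).contDiffAt.differentiableAt (by simp)
  have h0 : ∀ t, deriv (fun t => α.ev (F t (c 0)) (vel I (fun s => F t (c s)) 0)) t = 0 := by
    intro t
    have := deriv_ev_sub_deriv_ev hF.contact.smooth (hz t)
    simp only [hF.vel_eq, hF.ev_reeb, hF.d_reeb, deriv_const, sub_zero] at this
    exact this
  have := is_const_of_deriv_eq_zero hd h0 t 0
  simp only [hv] at this
  rw [this, ← hv]
  simp only [hF.map_zero]

/-- The pairing of `α` with the velocity of `s ↦ F_{g(s)}(c(s))`. -/
theorem ev_vel_comp {g : ℝ → ℝ} {c : ℝ → N} {s g' : ℝ} (hg : HasDerivAt g g' s)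
    (hc : MDifferentiableAt 𝓘(ℝ, ℝ) I c s) :
    α.ev (F (g s) (c s)) (vel I (fun s => F (g s) (c s)) s) = g' + α.ev (c s) (vel I c s) := by
  have hm : MDifferentiableAt (𝓘(ℝ, ℝ).prod I) I (uncurry fun s x => F (g s) x) (s, c s) :=
    MDifferentiableAt.comp (s, c s) (g := uncurry F) (f := fun p : ℝ × N => (g p.1, p.2))
      (hF.mdiff_uncurry _) ((MDifferentiableAt.comp (s, c s) (g := g) (f := Prod.fst)
        hg.differentiableAt.mdifferentiableAt mdifferentiableAt_fst).prodMk mdifferentiableAt_snd)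
  rw [vel_two (f := fun s x => F (g s) x) hm hc, α.ev_add, hF.ev_mdf,
    vel_comp_real (c := fun r => F r (c s)) (hF.mdiff_curve _ _) hg, α.ev_smul, hF.vel_eq,
    hF.ev_reeb, mul_one]

/-- The Reeb vector field of `β = pr₂^* α - e^θ pr₁^* α` is `(0, R, 0)`. -/
theorem productForm_reeb_unique [FiniteDimensional ℝ E] (p : N × N × ℝ) {u : E × E × ℝ}
    (h1 : (productForm α).ev p u = 1) (h2 : ∀ v, (productForm α).d.ev₂ p u v = 0) :
    u = (0, initialField I F p.2.1, 0) := by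
  simp only [productForm_d_ev₂ hF.contact.smooth] at h2
  rw [productForm_ev] at h1
  have he := Real.exp_pos p.2.2
  have a1 : α.ev p.1 u.1 = 0 := by
    have := h2 (0, 0, 1)
    simpa [DForm.ev₂_zero_right, DForm.ev_zero, he.ne'] using this
  have a3 : u.2.2 = 0 := by
    have := h2 (initialField I F p.1, 0, 0)
    simpa [DForm.ev₂_zero_right, hF.d_reeb', hF.ev_reeb, he.ne'] using this
  have b1 : u.1 = 0 := by
    refine hF.eq_zero_of p.1 a1 fun v => ?_
    have := h2 (v, 0, 0)
    simpa [DForm.ev₂_zero_right, a3, he.ne'] using this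
  have b2 : u.2.1 = initialField I F p.2.1 := by
    refine hF.eq_reeb p.2.1 (by simpa [a1] using h1) fun v => ?_
    have := h2 (0, v, 0)
    simpa [DForm.ev₂_zero_right, DForm.ev_zero] using this
  rw [← b1, ← b2, ← a3]

theorem productForm_reeb_spec [FiniteDimensional ℝ E] (p : N × N × ℝ) :
    (productForm α).ev p (0, initialField I F p.2.1, 0) = 1 ∧
      ∀ v, (productForm α).d.ev₂ p (0, initialField I F p.2.1, 0) v = 0 := by
  refine ⟨by simp [productForm_ev, DForm.ev_zero, hF.ev_reeb], fun v => ?_⟩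
  simp [productForm_d_ev₂ hF.contact.smooth, DForm.ev₂_zero_left, DForm.ev_zero, hF.d_reeb]

theorem reebFlow_productForm [FiniteDimensional ℝ E] [T2Space N] (t : ℝ) (p : N × N × ℝ) :
    reebFlow (productForm α) t p = (p.1, F t p.2.1, p.2.2) := by
  set Γ : ℝ → N × N × ℝ → N × N × ℝ := fun t p => (p.1, F t p.2.1, p.2.2) with hΓ
  have hΓs : ContMDiff (𝓘(ℝ, ℝ).prod (cpModel I)) (cpModel I) ∞ (uncurry Γ) := by
    refine (contMDiff_fst.comp contMDiff_snd).prodMk (ContMDiff.prodMk ?_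
      (contMDiff_snd.comp (contMDiff_snd.comp contMDiff_snd)))
    exact hF.smooth.comp (contMDiff_fst.prodMk
      (contMDiff_fst.comp (contMDiff_snd.comp contMDiff_snd)))
  have hΓ0 : ∀ b, Γ 0 b = b := fun b => by simp [hΓ, hF.map_zero]
  have hmd : ∀ (t : ℝ) (p : N × N × ℝ), MDifferentiableAt 𝓘(ℝ, ℝ) (cpModel I) (fun s => Γ s p) t :=
    fun t p => (slice_left (hΓs (t, p))).mdifferentiableAt (by simp)
  have hvel : ∀ (t : ℝ) (p : N × N × ℝ),
      vel (cpModel I) (fun s => Γ s p) t = (0, initialField I F (Γ t p).2.1, 0) := fun t p => by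
    rw [vel_cp (hmd t p)]
    simp only [hΓ, vel_const, hF.vel_eq, deriv_const]
  have hinit : ∀ p, initialField (cpModel I) Γ p = (0, initialField I F p.2.1, 0) := fun p => by
    refine (hvel 0 p).trans ?_
    rw [hΓ0]
  have hR : IsReebFlow (productForm α) Γ := by
    refine ⟨hΓ0, fun p t => ⟨(0, initialField I F (Γ t p).2.1, 0),
      hF.productForm_reeb_spec (Γ t p), ?_⟩⟩
    exact hasMFDerivAt_of_vel (hmd t p) (hvel t p)
  have hex : ∃ G, IsReebFlow (productForm α) G := ⟨Γ, hR⟩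
  have hG : IsReebFlow (productForm α) hex.choose := hex.choose_spec
  rw [reebFlow, dif_pos hex]
  set G := hex.choose
  refine congrFun (integralCurve_unique hΓs hΓ0 (γ := fun s => G s p) (γ' := fun s => Γ s p)
    (fun t => ?_) (fun t => ⟨hmd t p, ?_⟩) ?_) t
  · obtain ⟨R, ⟨h1, h2⟩, h3⟩ := hG.2 p t
    refine ⟨h3.mdifferentiableAt, ?_⟩
    have h4 : vel (cpModel I) (fun s => G s p) t = R :=
      vel_of_hasMFDerivAt_smulRight (E := E × E × ℝ) h3
    rw [hinit, h4]
    exact hF.productForm_reeb_unique (G t p) h1 h2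
  · rw [hinit, hvel]
  · exact (hG.1 p).trans (hΓ0 p).symm

end IsSmoothReebFlow

end ReebFlows

/-! ### Cut-off Reeb flows of the contact product, conformal factors and graphs -/

section LevelFlow

/-- A cut-off function of the variable `θ`, equal to `1` on a neighbourhood of `[-|L|, |L|]` and
supported in `[-|L| - 2, |L| + 2]`. -/
def levelCutoff (L : ℝ) : ContDiffBump (0 : ℝ) :=
  ⟨|L| + 1, |L| + 2, by positivity, by linarith⟩

theorem contDiff_levelCutoff (L : ℝ) : ContDiff ℝ ∞ (levelCutoff L) := (levelCutoff L).contDiff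

theorem contDiff_deriv_levelCutoff (L : ℝ) : ContDiff ℝ ∞ (deriv (levelCutoff L)) :=
  (contDiff_infty_iff_deriv.1 (contDiff_levelCutoff L)).2

theorem hasDerivAt_levelCutoff (L x : ℝ) :
    HasDerivAt (levelCutoff L) (deriv (levelCutoff L) x) x :=
  ((contDiff_levelCutoff L).differentiable (by simp) x).hasDerivAt

theorem levelCutoff_of_le {L x : ℝ} (h : |x| ≤ |L|) :
    levelCutoff L x = 1 ∧ deriv (levelCutoff L) x = 0 := by
  have hx : x ∈ Metric.ball (0 : ℝ) (levelCutoff L).rIn := by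
    rw [Metric.mem_ball, dist_zero_right, Real.norm_eq_abs]
    change |x| < |L| + 1
    linarith
  have := (levelCutoff L).eventuallyEq_one_of_mem_ball hx
  exact ⟨this.self_of_nhds, by rw [this.deriv_eq]; exact deriv_const x 1⟩

theorem levelCutoff_of_lt {L x : ℝ} (h : |L| + 2 < |x|) :
    levelCutoff L x = 0 ∧ deriv (levelCutoff L) x = 0 := by
  have : levelCutoff L =ᶠ[𝓝 x] fun _ => 0 := by
    filter_upwards [continuous_abs.continuousAt.eventually_const_lt h] with y hy
    refine (levelCutoff L).zero_of_le_dist ?_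
    rw [dist_zero_right, Real.norm_eq_abs]
    exact hy.le
  exact ⟨this.self_of_nhds, by rw [this.deriv_eq]; exact deriv_const x 0⟩

variable {E : Type*} [NormedAddCommGroup E] [NormedSpace ℝ E]
  {H : Type*} [TopologicalSpace H] {I : ModelWithCorners ℝ E H} [I.Boundaryless]
  {N : Type*} [TopologicalSpace N] [ChartedSpace H N] [IsManifold I ∞ N] {α : DForm I N 1}

/-- The contact flow of the product generated by the compactly supported contact Hamiltonian
`ρ(θ)`, where `ρ` is a cut-off function equal to `1` on `[-|L|, |L|]`. It is explicit in terms of the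
Reeb flow, and it coincides with the Reeb flow of `β` where `|θ| ≤ |L|`. -/
def levelFlow (F : ℝ → N → N) (L t : ℝ) (p : N × N × ℝ) : N × N × ℝ :=
  (F (-(t * (Real.exp (-p.2.2) * deriv (levelCutoff L) p.2.2))) p.1,
    F (t * (levelCutoff L p.2.2 - deriv (levelCutoff L) p.2.2)) p.2.1, p.2.2)

namespace IsSmoothReebFlow

variable {F : ℝ → N → N} (hF : IsSmoothReebFlow α F)

include hF

theorem levelFlow_add (L s t : ℝ) (p : N × N × ℝ) :
    levelFlow F L (s + t) p = levelFlow F L s (levelFlow F L t p) := by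
  simp only [levelFlow, ← hF.add, add_mul, neg_add]

theorem levelFlow_zero (L : ℝ) : levelFlow F L 0 = id := by
  funext p
  simp [levelFlow, hF.map_zero]

theorem levelFlow_neg (L t : ℝ) : LeftInverse (levelFlow F L (-t)) (levelFlow F L t) ∧
    RightInverse (levelFlow F L (-t)) (levelFlow F L t) := by
  constructor <;> intro p
  · rw [← hF.levelFlow_add, neg_add_cancel, hF.levelFlow_zero]; rfl
  · rw [← hF.levelFlow_add, add_neg_cancel, hF.levelFlow_zero]; rfl

theorem levelFlow_of_le {L : ℝ} (t : ℝ) {p : N × N × ℝ} (h : |p.2.2| ≤ |L|) :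
    levelFlow F L t p = (p.1, F t p.2.1, p.2.2) := by
  simp [levelFlow, levelCutoff_of_le h, hF.map_zero]

theorem levelFlow_of_lt {L : ℝ} (t : ℝ) {p : N × N × ℝ} (h : |L| + 2 < |p.2.2|) :
    levelFlow F L t p = p := by
  simp [levelFlow, levelCutoff_of_lt h, hF.map_zero]

theorem contMDiff_levelFlow (L : ℝ) :
    ContMDiff (𝓘(ℝ, ℝ).prod (cpModel I)) (cpModel I) ∞ (uncurry (levelFlow F L)) := by
  have h1 : ContMDiff (𝓘(ℝ, ℝ).prod (cpModel I)) I ∞ (fun q : ℝ × N × N × ℝ => q.2.1) :=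
    contMDiff_fst.comp contMDiff_snd
  have h2 : ContMDiff (𝓘(ℝ, ℝ).prod (cpModel I)) I ∞ (fun q : ℝ × N × N × ℝ => q.2.2.1) :=
    contMDiff_fst.comp (contMDiff_snd.comp contMDiff_snd)
  have h3 : ContMDiff (𝓘(ℝ, ℝ).prod (cpModel I)) 𝓘(ℝ, ℝ) ∞ (fun q : ℝ × N × N × ℝ => q.2.2.2) :=
    contMDiff_snd.comp (contMDiff_snd.comp contMDiff_snd)
  have h0 : ContMDiff (𝓘(ℝ, ℝ).prod (cpModel I)) 𝓘(ℝ, ℝ) ∞ (fun q : ℝ × N × N × ℝ => q.1) :=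
    contMDiff_fst
  have d := (contDiff_deriv_levelCutoff L).contMDiff.comp h3
  have c := (contDiff_levelCutoff L).contMDiff.comp h3
  have e := (Real.contDiff_exp (n := ∞)).contMDiff.comp h3.neg
  refine (hF.smooth.comp ((h0.mul (e.mul d)).neg.prodMk h1)).prodMk
    ((hF.smooth.comp ((h0.mul (c.sub d)).prodMk h2)).prodMk h3)

theorem mdiff_levelFlow (L : ℝ) (t : ℝ) :
    MDifferentiable (cpModel I) (cpModel I) (levelFlow F L t) := fun p =>
  (slice_right (hF.contMDiff_levelFlow L (t, p))).mdifferentiableAt (by simp)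

/-- The form `β` itself is preserved, since the Reeb flow of `β` preserves the Hamiltonian `ρ(θ)`. -/
theorem levelFlow_ev_mdf (L t : ℝ) (p : N × N × ℝ) (u : E × E × ℝ) :
    (productForm α).ev (levelFlow F L t p) (mdf (cpModel I) (cpModel I) (levelFlow F L t) p u) =
      (productForm α).ev p u := by
  obtain ⟨c, hc, rfl, rfl⟩ := exists_curve (I := cpModel I) p u
  have hcd : MDifferentiableAt 𝓘(ℝ, ℝ) (cpModel I) c 0 := hc.mdifferentiableAt (by simp)
  have hm := hF.mdiff_levelFlow L t (c 0)
  have h1 : MDifferentiableAt 𝓘(ℝ, ℝ) I (fun s => (c s).1) 0 := hcd.fst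
  have h2 : MDifferentiableAt 𝓘(ℝ, ℝ) (I.prod 𝓘(ℝ, ℝ)) (fun s => (c s).2) 0 := hcd.snd
  have h3 : MDifferentiableAt 𝓘(ℝ, ℝ) I (fun s => (c s).2.1) 0 := h2.fst
  have h4 : MDifferentiableAt 𝓘(ℝ, ℝ) 𝓘(ℝ, ℝ) (fun s => (c s).2.2) 0 := h2.snd
  have hθ := h4.differentiableAt.hasDerivAt
  rw [← vel_comp hm hcd, productForm_ev_vel (c := fun s => levelFlow F L t (c s))
    (hm.comp (0 : ℝ) hcd), productForm_ev_vel hcd]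
  set θ := fun s => (c s).2.2
  have hρ := (hasDerivAt_levelCutoff L (θ 0)).comp (0 : ℝ) hθ
  have hρ' := (((contDiff_deriv_levelCutoff L).differentiable (by simp)
    (θ 0)).hasDerivAt).comp (0 : ℝ) hθ
  have k1 := hF.ev_vel_comp (((hθ.neg.exp.mul hρ').const_mul t).neg) h1
  have k2 := hF.ev_vel_comp ((hρ.sub hρ').const_mul t) h3
  simp only [levelFlow]
  refine Eq.trans (congrArg₂ (fun a b => a - Real.exp (θ 0) * b) k2 k1) ?_
  have e : Real.exp (θ 0) * Real.exp (-θ 0) = 1 := by rw [← Real.exp_add]; simp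
  simp only [comp_apply, Pi.neg_apply]
  change _ = α.ev (c 0).2.1 (vel I (fun s => (c s).2.1) 0) -
    Real.exp (θ 0) * α.ev (c 0).1 (vel I (fun s => (c s).1) 0)
  linear_combination (t * deriv (deriv (levelCutoff L)) (θ 0) * deriv θ 0
    - t * deriv (levelCutoff L) (θ 0) * deriv θ 0) * e

theorem isConformal_levelFlow (L t : ℝ) : IsConformal (productForm α) (levelFlow F L t) :=
  fun p => ⟨1, one_pos, fun u => by rw [hF.levelFlow_ev_mdf, one_mul]⟩

theorem isContactFamily_levelFlow (L : ℝ) :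
    IsContactFamily (productForm α) univ (levelFlow F L) := by
  refine isContactFamily_univ_of (hF.contMDiff_levelFlow L)
    (ψ := fun t => levelFlow F L (-t)) ?_ (fun t => hF.levelFlow_neg L t)
    (hF.isConformal_levelFlow L)
  have h0 : ContMDiff (𝓘(ℝ, ℝ).prod (cpModel I)) (𝓘(ℝ, ℝ).prod (cpModel I)) ∞
      (fun q : ℝ × N × N × ℝ => (-q.1, q.2)) := contMDiff_fst.neg.prodMk contMDiff_snd
  exact (hF.contMDiff_levelFlow L).comp h0

theorem hasCompactSupp_levelFlow [CompactSpace N] (L : ℝ) :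
    HasCompactSupp univ (levelFlow F L) := by
  refine ⟨univ ×ˢ univ ×ˢ Metric.closedBall 0 (|L| + 2),
    isCompact_univ.prod (isCompact_univ.prod (isCompact_closedBall 0 _)), fun t _ p hp => ?_⟩
  refine hF.levelFlow_of_lt t (not_le.1 fun h => hp ⟨mem_univ _, mem_univ _, ?_⟩)
  rwa [Metric.mem_closedBall, dist_zero_right, Real.norm_eq_abs]

theorem speed_levelFlow (L t : ℝ) (p : N × N × ℝ) :
    speed (productForm α) (levelFlow F L) t p = levelCutoff L p.2.2 := by
  rw [speed, productForm_ev_vel (c := fun s => levelFlow F L s p)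
    ((slice_left (hF.contMDiff_levelFlow L (t, p))).mdifferentiableAt (by simp))]
  have k1 := hF.ev_vel_comp (c := fun _ => p.1) (s := t) ((hasDerivAt_id t).mul_const
    (Real.exp (-p.2.2) * deriv (levelCutoff L) p.2.2)).neg mdifferentiableAt_const
  have k2 := hF.ev_vel_comp (c := fun _ => p.2.1) (s := t) ((hasDerivAt_id t).mul_const
    (levelCutoff L p.2.2 - deriv (levelCutoff L) p.2.2)) mdifferentiableAt_const
  simp only [levelFlow]
  refine Eq.trans (congrArg₂ (fun a b => a - Real.exp p.2.2 * b) k2 k1) ?_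
  have e : Real.exp p.2.2 * Real.exp (-p.2.2) = 1 := by rw [← Real.exp_add]; simp
  simp only [vel_const, α.ev_zero]
  linear_combination (deriv (levelCutoff L) p.2.2) * e

end IsSmoothReebFlow

end LevelFlow

section ConformalFactor

variable {E : Type*} [NormedAddCommGroup E] [NormedSpace ℝ E]
  {H : Type*} [TopologicalSpace H] {I : ModelWithCorners ℝ E H} [I.Boundaryless]
  {N : Type*} [TopologicalSpace N] [ChartedSpace H N] [IsManifold I ∞ N] {α : DForm I N 1}
  {A : Type*} [NormedAddCommGroup A] [NormedSpace ℝ A]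

/-- The coefficient `λ` in `φ^* α = λ α`, for a map `φ` preserving `ker α`; here `F` is the Reeb flow
of `α`. -/
def confCoeff (α : DForm I N 1) (F : ℝ → N → N) (φ : N → N) (x : N) : ℝ :=
  α.ev (φ x) (mdf I I φ x (initialField I F x))

/-- The graph `{(x, φ(x), log λ(x))}` of a contactomorphism `φ` with `φ^* α = λ α`, as a subset of the
contact product. -/
def graphSet (α : DForm I N 1) (F : ℝ → N → N) (φ : N → N) : Set (N × N × ℝ) :=
  range fun x => (x, φ x, Real.log (confCoeff α F φ x))

namespace IsSmoothReebFlow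

variable {F : ℝ → N → N} (hF : IsSmoothReebFlow α F)

include hF

theorem ev_mdf_eq_confCoeff {φ : N → N} (hφ : ∀ x u, α.ev (φ x) (mdf I I φ x u) = 0 ↔ α.ev x u = 0)
    (x : N) (u : E) : α.ev (φ x) (mdf I I φ x u) = confCoeff α F φ x * α.ev x u := by
  have h : α.ev x (u - α.ev x u • initialField I F x) = 0 := by
    rw [α.ev_sub, α.ev_smul, hF.ev_reeb]; ring
  have h2 := (hφ x _).2 h
  rw [map_sub, map_smul, α.ev_sub, α.ev_smul, sub_eq_zero] at h2
  rw [h2, confCoeff, mul_comm]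

theorem confCoeff_ne_zero {φ : N → N} (hφ : ∀ x u, α.ev (φ x) (mdf I I φ x u) = 0 ↔ α.ev x u = 0)
    (x : N) : confCoeff α F φ x ≠ 0 := fun h => by
  have := (hφ x _).1 h
  rw [hF.ev_reeb] at this
  exact one_ne_zero this

theorem confCoeff_eq_of {φ : N → N} {x : N} {c : ℝ}
    (h : ∀ u, α.ev (φ x) (mdf I I φ x u) = c * α.ev x u) : confCoeff α F φ x = c := by
  rw [confCoeff, h, hF.ev_reeb, mul_one]

theorem confCoeff_id (x : N) : confCoeff α F id x = 1 :=
  hF.confCoeff_eq_of fun u => by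
    rw [show (id : N → N) = fun y => y from rfl, mdf_id, one_mul]

theorem confCoeff_reeb (t : ℝ) (x : N) : confCoeff α F (F t) x = 1 :=
  hF.confCoeff_eq_of fun u => by rw [hF.ev_mdf, one_mul]

theorem contMDiff_confCoeff {G : A → N → N} (hG : ContMDiff (𝓘(ℝ, A).prod I) I ∞ (uncurry G)) :
    ContMDiff (𝓘(ℝ, A).prod I) 𝓘(ℝ, ℝ) ∞ (fun q : A × N => confCoeff α F (G q.1) q.2) := by
  have h1 : ContMDiff ((𝓘(ℝ, A).prod I).prod 𝓘(ℝ, ℝ)) I ∞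
      (uncurry fun (q : A × N) (τ : ℝ) => G q.1 (F τ q.2)) :=
    hG.comp ((contMDiff_fst.comp contMDiff_fst).prodMk
      (hF.smooth.comp (contMDiff_snd.prodMk (contMDiff_snd.comp contMDiff_fst))))
  refine (contMDiff_ev_vel hF.contact.smooth (g := fun _ => 0) h1 contMDiff_const).congr fun q => ?_
  have hm : MDifferentiableAt I I (G q.1) (F 0 q.2) :=
    (slice_right (hG (q.1, F 0 q.2))).mdifferentiableAt (by simp)
  rw [vel_comp (f := G q.1) (c := fun τ => F τ q.2) hm (hF.mdiff_curve 0 q.2), hF.map_zero]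
  rfl

theorem confCoeff_ne_zero_of_family {K : Set A} {G : A → N → N} (hG : IsContactFamily α K G) {a : A}
    (ha : a ∈ K) (x : N) : confCoeff α F (G a) x ≠ 0 :=
  hF.confCoeff_ne_zero (contact_iff.1 (hG.contact a ha)) x

/-- The members of a contact family through the identity preserve the coorientation. -/
theorem confCoeff_pos {G : A → N → N} (hG : IsContactFamily α univ G) {a₀ : A} (h0 : G a₀ = id)
    (a : A) (x : N) : 0 < confCoeff α F (G a) x := by
  have hc : Continuous fun a => confCoeff α F (G a) x :=
    (hF.contMDiff_confCoeff hG.contMDiff).continuous.comp (continuous_id.prodMk continuous_const)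
  by_contra h
  rw [not_lt] at h
  obtain ⟨b, hb⟩ := mem_range_of_exists_le_of_exists_ge hc ⟨a, h⟩
    ⟨a₀, by rw [h0, hF.confCoeff_id]; exact zero_le_one⟩
  exact hF.confCoeff_ne_zero_of_family hG (mem_univ b) x hb

theorem isConformal_of_family {G : A → N → N} (hG : IsContactFamily α univ G) {a₀ : A}
    (h0 : G a₀ = id) (a : A) : IsConformal α (G a) := fun x =>
  ⟨confCoeff α F (G a) x, hF.confCoeff_pos hG h0 a x,
    hF.ev_mdf_eq_confCoeff (contact_iff.1 (hG.contact a (mem_univ a))) x⟩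

end IsSmoothReebFlow

theorem exists_smoothTransition_eq {s : ℝ} (hs : s ∈ Icc (0 : ℝ) 1) :
    ∃ t ∈ Icc (0 : ℝ) 1, Real.smoothTransition t = s := by
  have := intermediate_value_Icc (f := Real.smoothTransition) zero_le_one
    Real.smoothTransition.continuous.continuousOn
  rw [Real.smoothTransition.zero_of_nonpos le_rfl, Real.smoothTransition.one_of_one_le le_rfl] at this
  exact this hs

theorem smoothTransition_mem (t : ℝ) : Real.smoothTransition t ∈ Icc (0 : ℝ) 1 :=
  ⟨Real.smoothTransition.nonneg t, Real.smoothTransition.le_one t⟩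

theorem contDiff_smoothTransition : ContDiff ℝ ∞ Real.smoothTransition :=
  Real.smoothTransition.contDiff

namespace ContactIsotopy

/-- The smooth step function maps `ℝ` to `[0,1]`, so that reparametrizing an isotopy by it gives a
family which is smooth in `t ∈ ℝ`. -/
theorem isContactFamily_smoothTransition (f : ContactIsotopy α) :
    IsContactFamily α univ fun t => f.toFun (Real.smoothTransition t) :=
  f.isContactFamily.reparam contDiff_smoothTransition fun t _ => smoothTransition_mem t

variable {F : ℝ → N → N}

theorem confCoeff_pos (hF : IsSmoothReebFlow α F) (f : ContactIsotopy α) {t : ℝ}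
    (ht : t ∈ Icc (0 : ℝ) 1) (x : N) : 0 < confCoeff α F (f.toFun t) x := by
  obtain ⟨s, -, rfl⟩ := exists_smoothTransition_eq ht
  refine hF.confCoeff_pos f.isContactFamily_smoothTransition (a₀ := 0) ?_ s x
  rw [Real.smoothTransition.zero_of_nonpos le_rfl, f.map_zero]

theorem conformalFactor_eq (hF : IsSmoothReebFlow α F) (f : ContactIsotopy α) {t : ℝ}
    (ht : t ∈ Icc (0 : ℝ) 1) (x : N) :
    conformalFactor f t x = Real.log (confCoeff α F (f.toFun t) x) := by
  have hp := f.confCoeff_pos hF ht x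
  have hex : ∃ g : ℝ, (DForm.pull (f.toFun t) α : DForm I N 1) x = Real.exp g • α x := by
    refine ⟨Real.log (confCoeff α F (f.toFun t) x),
      DForm.ext_ev (τ := fun x => Real.exp (Real.log (confCoeff α F (f.toFun t) x)) • α x)
        fun u => ?_⟩
    rw [DForm.ev_pull, hF.ev_mdf_eq_confCoeff (contact_iff.1 (f.isContactFamily.contact t ht))]
    change _ = Real.exp _ * α.ev x u
    rw [Real.exp_log hp]
  rw [conformalFactor, dif_pos hex]
  have hs := hex.choose_spec
  set g := hex.choose
  have : confCoeff α F (f.toFun t) x = Real.exp g := hF.confCoeff_eq_of fun u => by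
    rw [← DForm.ev_pull]
    exact congrArg (fun ω' : E [⋀^Fin 1]→L[ℝ] ℝ => ω' ![u]) hs
  rw [this, Real.log_exp]

theorem graphMap_image (hF : IsSmoothReebFlow α F) (f : ContactIsotopy α) {t : ℝ}
    (ht : t ∈ Icc (0 : ℝ) 1) : graphMap f t '' diagonal N = graphSet α F (f.toFun t) := by
  rw [diagonal, graphSet, ← range_comp]
  congr 1
  funext x
  simp [graphMap, f.conformalFactor_eq hF ht]

end ContactIsotopy

theorem IsSmoothReebFlow.graphSet_reeb {F : ℝ → N → N} (hF : IsSmoothReebFlow α F) (t : ℝ) :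
    graphSet α F (F t) = range fun x => (x, F t x, (0 : ℝ)) := by
  simp [graphSet, hF.confCoeff_reeb]

theorem IsSmoothReebFlow.reebFlow_image [FiniteDimensional ℝ E] [T2Space N] {F : ℝ → N → N}
    (hF : IsSmoothReebFlow α F) (t : ℝ) :
    reebFlow (productForm α) t '' diagonal N = graphSet α F (F t) := by
  rw [hF.graphSet_reeb, diagonal, ← range_comp]
  congr 1
  funext x
  simp [hF.reebFlow_productForm]

end ConformalFactor

/-! ### Contact Hamiltonians of families of contactomorphisms -/

section ContactHamiltonians

variable {E : Type*} [NormedAddCommGroup E] [NormedSpace ℝ E]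
  {H : Type*} [TopologicalSpace H] {I : ModelWithCorners ℝ E H} [I.Boundaryless]
  {N : Type*} [TopologicalSpace N] [ChartedSpace H N] [IsManifold I ∞ N] {α : DForm I N 1}

/-- The curve `τ ↦ G_{s,t+τ}(G_{s,t}⁻¹(x))` through `x`, for a family `G` with inverse `G'`. -/
def timeCurve (G G' : ℝ × ℝ → N → N) (a : ℝ × ℝ) (x : N) (τ : ℝ) : N :=
  G (a + τ • ((0 : ℝ), (1 : ℝ))) (G' a x)

/-- The contact Hamiltonian `α(∂ₜG ∘ G⁻¹)` of a family of contactomorphisms `G_{s,t}`. -/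
def timeHam (α : DForm I N 1) (G G' : ℝ × ℝ → N → N) (q : (ℝ × ℝ) × N) : ℝ :=
  α.ev q.2 (vel I (timeCurve G G' q.1 q.2) 0)

/-- The rate of change `(∂ₜ log λ) ∘ G⁻¹` of the conformal factor `λ` of a family `G_{s,t}`. -/
def timeConf (α : DForm I N 1) (F : ℝ → N → N) (G G' : ℝ × ℝ → N → N) (q : (ℝ × ℝ) × N) : ℝ :=
  deriv (fun τ : ℝ => Real.log (confCoeff α F (G (q.1 + τ • ((0 : ℝ), (1 : ℝ)))) (G' q.1 q.2))) 0

variable {F : ℝ → N → N} (hF : IsSmoothReebFlow α F) {G G' : ℝ × ℝ → N → N}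
  (hG : IsContactFamily α univ G) (hG' : IsContactFamily α univ G')
  (hGG' : ∀ a, LeftInverse (G' a) (G a) ∧ RightInverse (G' a) (G a))

theorem timeCurve_zero (hGG' : ∀ a, LeftInverse (G' a) (G a) ∧ RightInverse (G' a) (G a))
    (a : ℝ × ℝ) (x : N) : timeCurve G G' a x 0 = x := by
  simp only [timeCurve, zero_smul, add_zero]
  exact (hGG' a).2 x

theorem contMDiff_timeCurve (hG : IsContactFamily α univ G) (hG' : IsContactFamily α univ G') :
    ContMDiff ((𝓘(ℝ, ℝ × ℝ).prod I).prod 𝓘(ℝ, ℝ)) I ∞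
      (uncurry fun (q : (ℝ × ℝ) × N) τ => timeCurve G G' q.1 q.2 τ) := by
  have h1 : ContMDiff ((𝓘(ℝ, ℝ × ℝ).prod I).prod 𝓘(ℝ, ℝ)) 𝓘(ℝ, ℝ × ℝ) ∞
      (fun q : ((ℝ × ℝ) × N) × ℝ => q.1.1 + q.2 • ((0 : ℝ), (1 : ℝ))) :=
    (contMDiff_fst.comp contMDiff_fst).add (contMDiff_snd.smul contMDiff_const)
  exact hG.contMDiff.comp (h1.prodMk (hG'.contMDiff.comp contMDiff_fst))

theorem mdiff_timeCurve (hG : IsContactFamily α univ G) (hG' : IsContactFamily α univ G')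
    (a : ℝ × ℝ) (x : N) (τ : ℝ) : MDifferentiableAt 𝓘(ℝ, ℝ) I (timeCurve G G' a x) τ :=
  (slice_right (contMDiff_timeCurve hG hG' ((a, x), τ))).mdifferentiableAt (by simp)

/-- If `G` does not depend on the time near `a`, its contact Hamiltonian vanishes there. -/
theorem timeHam_eq_zero
    (hGG' : ∀ a, LeftInverse (G' a) (G a) ∧ RightInverse (G' a) (G a)) {a : ℝ × ℝ}
    (h : ∀ᶠ τ in 𝓝 (0 : ℝ), G (a + τ • ((0 : ℝ), (1 : ℝ))) = G a)
    (x : N) : vel I (timeCurve G G' a x) 0 = 0 ∧ timeHam α G G' (a, x) = 0 ∧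
      timeConf α F G G' (a, x) = 0 := by
  have h1 : timeCurve G G' a x =ᶠ[𝓝 0] fun _ => x := by
    filter_upwards [h] with τ hτ
    rw [timeCurve, hτ]
    exact (hGG' a).2 x
  have h2 : vel I (timeCurve G G' a x) 0 = 0 := by rw [h1.vel_eq, vel_const]
  refine ⟨h2, by rw [timeHam, h2, DForm.ev_zero], ?_⟩
  have h3 : (fun τ : ℝ => Real.log (confCoeff α F (G (a + τ • ((0 : ℝ), (1 : ℝ)))) (G' a x))) =ᶠ[𝓝 0]
      fun _ => Real.log (confCoeff α F (G a) (G' a x)) := by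
    filter_upwards [h] with τ hτ
    rw [hτ]
  rw [timeConf, h3.deriv_eq, deriv_const]

include hF hG hG' hGG'

theorem contMDiff_timeHam :
    ContMDiff (𝓘(ℝ, ℝ × ℝ).prod I) 𝓘(ℝ, ℝ) ∞ (timeHam α G G') := by
  refine (contMDiff_ev_vel hF.contact.smooth (g := fun _ => 0) (contMDiff_timeCurve hG hG')
    contMDiff_const).congr fun q => ?_
  rw [timeCurve_zero hGG']
  rfl

theorem contMDiff_timeConf {a₀ : ℝ × ℝ} (h0 : G a₀ = id) :
    ContMDiff (𝓘(ℝ, ℝ × ℝ).prod I) 𝓘(ℝ, ℝ) ∞ (timeConf α F G G') := by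
  have h1 : ContMDiff ((𝓘(ℝ, ℝ × ℝ).prod I).prod 𝓘(ℝ, ℝ)) 𝓘(ℝ, ℝ × ℝ) ∞
      (fun q : ((ℝ × ℝ) × N) × ℝ => q.1.1 + q.2 • ((0 : ℝ), (1 : ℝ))) :=
    (contMDiff_fst.comp contMDiff_fst).add (contMDiff_snd.smul contMDiff_const)
  have h2 := (hF.contMDiff_confCoeff hG.contMDiff).comp
    (h1.prodMk (hG'.contMDiff.comp contMDiff_fst))
  refine fun q => contMDiffAt_deriv_param
    (f := fun (q : (ℝ × ℝ) × N) (τ : ℝ) =>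
      Real.log (confCoeff α F (G (q.1 + τ • ((0 : ℝ), (1 : ℝ)))) (G' q.1 q.2)))
    (g := fun _ => 0) ?_ contMDiffAt_const
  exact ContMDiffAt.comp (q, (0 : ℝ)) (g := Real.log)
    (Real.contDiffAt_log.2 (hF.confCoeff_pos hG h0 _ _).ne').contMDiffAt (h2 _)

/-- The equation `dH + dα(Y, ·) = κ α` satisfied by a contact vector field `Y` with contact
Hamiltonian `H` and `L_Y α = κ α`, evaluated on the velocity of a curve. -/
theorem deriv_timeHam_add {a₀ : ℝ × ℝ} (h0 : G a₀ = id) (a : ℝ × ℝ) {c : ℝ → N}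
    (hc : ContMDiffAt 𝓘(ℝ, ℝ) I ∞ c 0) :
    deriv (fun σ => timeHam α G G' (a, c σ)) 0 +
        α.d.ev₂ (c 0) (vel I (timeCurve G G' a (c 0)) 0) (vel I c 0) =
      timeConf α F G G' (a, c 0) * α.ev (c 0) (vel I c 0) := by
  set z : ℝ → ℝ → N := fun τ σ => timeCurve G G' a (c σ) τ with hz
  have hzs : ContMDiffAt (𝓘(ℝ, ℝ).prod 𝓘(ℝ, ℝ)) I ∞ (uncurry z) (0, 0) := by
    refine (contMDiff_timeCurve hG hG').contMDiffAt.comp ((0 : ℝ), (0 : ℝ))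
      (f := fun p : ℝ × ℝ => ((a, c p.2), p.1)) ((contMDiffAt_const.prodMk
        (ContMDiffAt.comp ((0 : ℝ), (0 : ℝ)) (g := c) (f := Prod.snd) hc
          contMDiffAt_snd)).prodMk contMDiffAt_fst)
  have hz0 : z 0 = c := funext fun σ => timeCurve_zero hGG' a (c σ)
  have key := deriv_ev_sub_deriv_ev hF.contact.smooth hzs
  have hcd : MDifferentiableAt 𝓘(ℝ, ℝ) I c 0 := hc.mdifferentiableAt (by simp)
  set y := G' a (c 0) with hy
  set w : E := vel I (fun σ => G' a (c σ)) 0 with hw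
  have hG'c : MDifferentiableAt 𝓘(ℝ, ℝ) I (fun σ => G' a (c σ)) 0 :=
    (hG'.mdiff_apply a (c 0)).comp (0 : ℝ) hcd
  set l : ℝ → ℝ := fun τ => confCoeff α F (G (a + τ • ((0 : ℝ), (1 : ℝ)))) y with hl
  have e1 : ∀ τ, α.ev (z τ 0) (vel I (z τ) 0) = l τ * α.ev y w := fun τ => by
    have := vel_comp (f := G (a + τ • ((0 : ℝ), (1 : ℝ)))) (c := fun σ => G' a (c σ)) (t := 0)
      (hG.mdiff_apply _ _) hG'c
    change α.ev _ (vel I (fun σ => G (a + τ • ((0 : ℝ), (1 : ℝ))) (G' a (c σ))) 0) = _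
    rw [this]
    exact hF.ev_mdf_eq_confCoeff (contact_iff.1 (hG.contact _ (mem_univ _))) y w
  have hls : DifferentiableAt ℝ l 0 := by
    have h1 : ContMDiff 𝓘(ℝ, ℝ) (𝓘(ℝ, ℝ × ℝ).prod I) ∞
        (fun τ : ℝ => (a + τ • ((0 : ℝ), (1 : ℝ)), y)) :=
      (contMDiff_const.add (contMDiff_id.smul contMDiff_const)).prodMk contMDiff_const
    exact ((hF.contMDiff_confCoeff hG.contMDiff).comp h1).contDiff.differentiable (by simp) 0
  have hlpos : 0 < l 0 := hF.confCoeff_pos hG h0 _ _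
  have e2 : timeConf α F G G' (a, c 0) = deriv l 0 / l 0 :=
    (hls.hasDerivAt.log hlpos.ne').deriv
  have e3 : deriv (fun τ => α.ev (z τ 0) (vel I (z τ) 0)) 0 = deriv l 0 * α.ev y w := by
    simp only [e1]
    exact (hls.hasDerivAt.mul_const _).deriv
  have e4 : α.ev (c 0) (vel I c 0) = l 0 * α.ev y w := by
    rw [← e1 0, hz0]
  have e5 : (fun σ => α.ev (z 0 σ) (vel I (fun τ => z τ σ) 0)) =
      fun σ => timeHam α G G' (a, c σ) := by
    funext σ
    rw [hz0]
    rfl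
  rw [e3, e5, hz0] at key
  rw [e2, e4]
  have k2 : deriv (fun σ => timeHam α G G' (a, c σ)) 0 +
      α.d.ev₂ (c 0) (vel I (timeCurve G G' a (c 0)) 0) (vel I c 0) = deriv l 0 * α.ev y w := by
    rw [← key]; ring
  rw [k2]
  field_simp

end ContactHamiltonians

/-! ### The vector field cutting off graphs -/

section CutoffOfGraphs

variable {E : Type*} [NormedAddCommGroup E] [NormedSpace ℝ E]
  {H : Type*} [TopologicalSpace H] {I : ModelWithCorners ℝ E H} [I.Boundaryless]
  {N : Type*} [TopologicalSpace N] [ChartedSpace H N] [IsManifold I ∞ N] {α : DForm I N 1}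

/-- A cut-off function of the homotopy parameter `s`, equal to `1` on `[0,1]`. -/
def stripCutoff : ContDiffBump (1 / 2 : ℝ) := ⟨1, 2, one_pos, one_lt_two⟩

theorem stripCutoff_of_mem {s : ℝ} (hs : s ∈ Icc (0 : ℝ) 1) : stripCutoff s = 1 :=
  stripCutoff.one_of_mem_closedBall (by
    rw [Metric.mem_closedBall, Real.dist_eq, abs_le]
    change -1 ≤ _ ∧ _ ≤ (1 : ℝ)
    constructor <;> linarith [hs.1, hs.2])

theorem stripCutoff_of_notMem {s : ℝ} (hs : s ∉ Icc (-2 : ℝ) 3) : stripCutoff s = 0 :=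
  stripCutoff.zero_of_le_dist (by
    rw [Real.dist_eq]
    change (2 : ℝ) ≤ _
    by_contra! h
    rw [abs_lt] at h
    exact hs ⟨by linarith [h.1], by linarith [h.2]⟩)

/-- A family of curves in `ℝ² × (N × N × ℝ)` whose initial velocities are
`(∂ₜ, X)`, where `X` is the contact vector field with contact Hamiltonian `χ(s) ρ(θ) H_{s,t}(x₂)`,
a cut-off of the Hamiltonian generating the graphs of the `G_{s,t}`. -/
def cutoffCurve (α : DForm I N 1) (F : ℝ → N → N) (G G' : ℝ × ℝ → N → N) (L : ℝ) (τ : ℝ)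
    (q : (ℝ × ℝ) × (N × N × ℝ)) : (ℝ × ℝ) × (N × N × ℝ) :=
  (q.1 + τ • ((0 : ℝ), (1 : ℝ)),
    F (τ * -(stripCutoff q.1.1 * deriv (levelCutoff L) q.2.2.2 * timeHam α G G' (q.1, q.2.2.1) *
      Real.exp (-q.2.2.2))) q.2.1,
    F (τ * -(stripCutoff q.1.1 * deriv (levelCutoff L) q.2.2.2 * timeHam α G G' (q.1, q.2.2.1)))
      (timeCurve G G' q.1 q.2.2.1 (τ * (stripCutoff q.1.1 * levelCutoff L q.2.2.2))),
    q.2.2.2 + τ * (stripCutoff q.1.1 * levelCutoff L q.2.2.2 *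
      timeConf α F G G' (q.1, q.2.2.1)))

variable (I) in
/-- The model of the product of the parameter plane and the contact product. -/
abbrev planeModel : ModelWithCorners ℝ ((ℝ × ℝ) × (E × E × ℝ))
    (ModelProd (ℝ × ℝ) (ModelProd H (ModelProd H ℝ))) :=
  𝓘(ℝ, ℝ × ℝ).prod (cpModel I)

variable {F : ℝ → N → N} (hF : IsSmoothReebFlow α F) {G G' : ℝ × ℝ → N → N}
  (hG : IsContactFamily α univ G) (hG' : IsContactFamily α univ G')
  (hGG' : ∀ a, LeftInverse (G' a) (G a) ∧ RightInverse (G' a) (G a))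

include hF hG hG' hGG'

theorem cutoffCurve_zero (L : ℝ) (q : (ℝ × ℝ) × (N × N × ℝ)) :
    cutoffCurve α F G G' L 0 q = q := by
  simp [cutoffCurve, hF.map_zero, timeCurve_zero hGG']

theorem contMDiff_cutoffCurve {a₀ : ℝ × ℝ} (h0 : G a₀ = id) (L : ℝ) :
    ContMDiff (𝓘(ℝ, ℝ).prod (planeModel I)) (planeModel I) ∞
      (uncurry (cutoffCurve α F G G' L)) := by
  have hτ : ContMDiff (𝓘(ℝ, ℝ).prod (planeModel I)) 𝓘(ℝ, ℝ) ∞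
      (fun w : ℝ × (ℝ × ℝ) × (N × N × ℝ) => w.1) := contMDiff_fst
  have ha : ContMDiff (𝓘(ℝ, ℝ).prod (planeModel I)) 𝓘(ℝ, ℝ × ℝ) ∞
      (fun w : ℝ × (ℝ × ℝ) × (N × N × ℝ) => w.2.1) := contMDiff_fst.comp contMDiff_snd
  have hp : ContMDiff (𝓘(ℝ, ℝ).prod (planeModel I)) (cpModel I) ∞
      (fun w : ℝ × (ℝ × ℝ) × (N × N × ℝ) => w.2.2) := contMDiff_snd.comp contMDiff_snd
  have hs : ContMDiff (𝓘(ℝ, ℝ).prod (planeModel I)) 𝓘(ℝ, ℝ) ∞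
      (fun w : ℝ × (ℝ × ℝ) × (N × N × ℝ) => w.2.1.1) := (contDiff_fst (n := ∞)).contMDiff.comp ha
  have h1 : ContMDiff (𝓘(ℝ, ℝ).prod (planeModel I)) I ∞
      (fun w : ℝ × (ℝ × ℝ) × (N × N × ℝ) => w.2.2.1) := contMDiff_fst.comp hp
  have h2 : ContMDiff (𝓘(ℝ, ℝ).prod (planeModel I)) I ∞
      (fun w : ℝ × (ℝ × ℝ) × (N × N × ℝ) => w.2.2.2.1) :=
    contMDiff_fst.comp (contMDiff_snd.comp hp)
  have hθ : ContMDiff (𝓘(ℝ, ℝ).prod (planeModel I)) 𝓘(ℝ, ℝ) ∞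
      (fun w : ℝ × (ℝ × ℝ) × (N × N × ℝ) => w.2.2.2.2) :=
    contMDiff_snd.comp (contMDiff_snd.comp hp)
  have c1 := (stripCutoff.contDiff (n := ⊤)).contMDiff.comp hs
  have c2 := (contDiff_levelCutoff L).contMDiff.comp hθ
  have c3 := (contDiff_deriv_levelCutoff L).contMDiff.comp hθ
  have c4 := (contMDiff_timeHam hF hG hG' hGG').comp (ha.prodMk h2)
  have c5 := (contMDiff_timeConf hF hG hG' hGG' h0).comp (ha.prodMk h2)
  have c6 := (Real.contDiff_exp (n := ∞)).contMDiff.comp hθ.neg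
  refine (ha.add (hτ.smul contMDiff_const)).prodMk
    ((hF.smooth.comp ((hτ.mul (((c1.mul c3).mul c4).mul c6).neg).prodMk h1)).prodMk
    ((hF.smooth.comp ((hτ.mul ((c1.mul c3).mul c4).neg).prodMk
      ((contMDiff_timeCurve hG hG').comp ((ha.prodMk h2).prodMk (hτ.mul (c1.mul c2)))))).prodMk
    (hθ.add (hτ.mul ((c1.mul c2).mul c5)))))

theorem initialField_cutoffCurve {a₀ : ℝ × ℝ} (h0 : G a₀ = id) (L : ℝ) (a : ℝ × ℝ)
    (p : N × N × ℝ) :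
    initialField (planeModel I) (cutoffCurve α F G G' L) (a, p) =
      ((0, 1), -(stripCutoff a.1 * deriv (levelCutoff L) p.2.2 * timeHam α G G' (a, p.2.1) *
          Real.exp (-p.2.2)) • initialField I F p.1,
        -(stripCutoff a.1 * deriv (levelCutoff L) p.2.2 * timeHam α G G' (a, p.2.1)) •
            initialField I F p.2.1 +
          (stripCutoff a.1 * levelCutoff L p.2.2) • vel I (timeCurve G G' a p.2.1) 0,
        stripCutoff a.1 * levelCutoff L p.2.2 * timeConf α F G G' (a, p.2.1)) := by
  have hmd : MDifferentiableAt 𝓘(ℝ, ℝ) (planeModel I)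
      (fun τ => cutoffCurve α F G G' L τ (a, p)) 0 :=
    (slice_left (contMDiff_cutoffCurve hF hG hG' hGG' h0 L (0, (a, p)))).mdifferentiableAt (by simp)
  have h1 : MDifferentiableAt 𝓘(ℝ, ℝ) 𝓘(ℝ, ℝ × ℝ)
      (fun τ => (cutoffCurve α F G G' L τ (a, p)).1) 0 := hmd.fst
  have h2 : MDifferentiableAt 𝓘(ℝ, ℝ) (cpModel I)
      (fun τ => (cutoffCurve α F G G' L τ (a, p)).2) 0 := hmd.snd
  have hlin : ∀ m : ℝ, HasDerivAt (fun τ : ℝ => τ * m) m 0 := fun m => by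
    simpa using (hasDerivAt_id (0 : ℝ)).mul_const m
  refine (vel_prodMk h1 h2).trans (Prod.ext ?_ ?_)
  · change vel 𝓘(ℝ, ℝ × ℝ) (fun τ : ℝ => a + τ • ((0 : ℝ), (1 : ℝ))) 0 = (0, 1)
    rw [vel_eq_deriv]
    have := ((hasDerivAt_id (0 : ℝ)).smul_const ((0 : ℝ), (1 : ℝ))).const_add a
    simpa using this.deriv
  · change vel (cpModel I) (fun τ => (cutoffCurve α F G G' L τ (a, p)).2) 0 = _
    rw [vel_cp h2]
    refine Prod.ext ?_ (Prod.ext ?_ ?_)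
    · simp only [cutoffCurve]
      set m := -(stripCutoff a.1 * deriv (levelCutoff L) p.2.2 * timeHam α G G' (a, p.2.1) *
          Real.exp (-p.2.2))
      rw [vel_comp_real (c := fun r => F r p.1) (g := fun τ => τ * m) (hF.mdiff_curve _ _) (hlin m),
        hF.vel_eq, zero_mul, hF.map_zero]
    · simp only [cutoffCurve]
      set m := -(stripCutoff a.1 * deriv (levelCutoff L) p.2.2 * timeHam α G G' (a, p.2.1))
      set m' := stripCutoff a.1 * levelCutoff L p.2.2
      have e0 : timeCurve G G' a p.2.1 (0 * m') = p.2.1 := by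
        rw [zero_mul, timeCurve_zero hGG']
      have k1 : MDifferentiableAt (𝓘(ℝ, ℝ).prod I) I (uncurry fun s x => F (s * m) x)
          (0, timeCurve G G' a p.2.1 (0 * m')) :=
        MDifferentiableAt.comp _ (g := uncurry F) (f := fun w : ℝ × N => (w.1 * m, w.2))
          (hF.mdiff_uncurry _) ((MDifferentiableAt.comp _ (g := fun s : ℝ => s * m) (f := Prod.fst)
            (differentiableAt_id.mul_const m).mdifferentiableAt mdifferentiableAt_fst).prodMk
              mdifferentiableAt_snd)
      have k2 : MDifferentiableAt 𝓘(ℝ, ℝ) I (fun τ => timeCurve G G' a p.2.1 (τ * m')) 0 :=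
        MDifferentiableAt.comp (0 : ℝ) (g := timeCurve G G' a p.2.1) (f := fun τ => τ * m')
          (mdiff_timeCurve hG hG' _ _ _) (hlin m').differentiableAt.mdifferentiableAt
      rw [vel_two (f := fun s x => F (s * m) x) (c := fun τ => timeCurve G G' a p.2.1 (τ * m')) k1 k2,
        e0, vel_comp_real (c := fun r => F r p.2.1) (g := fun τ => τ * m) (hF.mdiff_curve _ _)
          (hlin m), hF.vel_eq, zero_mul, hF.map_zero,
        vel_comp_real (c := timeCurve G G' a p.2.1) (g := fun τ => τ * m')
          (mdiff_timeCurve hG hG' _ _ _) (hlin m'), zero_mul]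
      congr 1
      have : F 0 = fun x => x := funext hF.map_zero
      rw [this, mdf_id]
    · simp only [cutoffCurve]
      exact ((hlin _).const_add _).deriv

/-- Where the cut-off Hamiltonian vanishes, the field is `∂ₜ`. -/
theorem initialField_cutoffCurve_eq {a₀ : ℝ × ℝ} (h0 : G a₀ = id)
    (hneg : ∀ s t, t ≤ 0 → G (s, t) = id) (hone : ∀ s t, 1 ≤ t → G (s, t) = G (s, 1)) {L : ℝ}
    {a : ℝ × ℝ} {p : N × N × ℝ}
    (h : a.1 ∉ Icc (-2 : ℝ) 3 ∨ a.2 ∉ Icc (0 : ℝ) 1 ∨ |L| + 2 < |p.2.2|) :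
    initialField (planeModel I) (cutoffCurve α F G G' L) (a, p) = ((0, 1), 0, 0, 0) := by
  rw [initialField_cutoffCurve hF hG hG' hGG' h0]
  rcases h with h | h | h
  · simp [stripCutoff_of_notMem h]
  · have hc : ∀ᶠ τ in 𝓝 (0 : ℝ), G (a + τ • ((0 : ℝ), (1 : ℝ))) = G a := by
      obtain ⟨s, t⟩ := a
      rcases lt_or_ge t 0 with ht | ht
      · have : ∀ᶠ τ in 𝓝 (0 : ℝ), t + τ < 0 :=
          (continuous_const.add continuous_id).continuousAt.eventually_lt_const (by simpa using ht)
        filter_upwards [this] with τ hτ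
        simp only [Prod.smul_mk, smul_eq_mul, mul_zero, mul_one, Prod.mk_add_mk, add_zero]
        rw [hneg s _ hτ.le, hneg s t ht.le]
      · have ht1 : 1 < t := not_le.1 fun h1 => h ⟨ht, h1⟩
        have : ∀ᶠ τ in 𝓝 (0 : ℝ), 1 < t + τ :=
          (continuous_const.add continuous_id).continuousAt.eventually_const_lt (by simpa using ht1)
        filter_upwards [this] with τ hτ
        simp only [Prod.smul_mk, smul_eq_mul, mul_zero, mul_one, Prod.mk_add_mk, add_zero]
        rw [hone s _ hτ.le, hone s t ht1.le]
    obtain ⟨h1, h2, h3⟩ := timeHam_eq_zero (α := α) (F := F) hGG' hc p.2.1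
    simp [h1, h2, h3]
  · simp [levelCutoff_of_lt h]

end CutoffOfGraphs

/-! ### The cut-off flow preserves the contact structure -/

section CutoffFlow

variable {E : Type*} [NormedAddCommGroup E] [NormedSpace ℝ E]
  {H : Type*} [TopologicalSpace H] {I : ModelWithCorners ℝ E H} [I.Boundaryless]
  {N : Type*} [TopologicalSpace N] [ChartedSpace H N] [IsManifold I ∞ N] {α : DForm I N 1}

/-- Solution of a scalar linear differential equation. -/
theorem eq_exp_integral_mul {b k : ℝ → ℝ} (hk : Continuous k)
    (hb : ∀ t, HasDerivAt b (k t * b t) t) (t : ℝ) :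
    b t = Real.exp (∫ s in (0 : ℝ)..t, k s) * b 0 := by
  have hK : ∀ t, HasDerivAt (fun t => ∫ s in (0 : ℝ)..t, k s) (k t) t := fun t =>
    (hk.integral_hasStrictDerivAt 0 t).hasDerivAt
  have h1 : ∀ t, HasDerivAt (fun t => Real.exp (-∫ s in (0 : ℝ)..t, k s) * b t) 0 t := fun t =>
    ((hK t).neg.exp.mul (hb t)).congr_deriv (by ring)
  have h2 := is_const_of_deriv_eq_zero (fun t => (h1 t).differentiableAt)
    (fun t => (h1 t).deriv) t 0
  simp only [intervalIntegral.integral_same, neg_zero, Real.exp_zero, one_mul] at h2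
  rw [← h2, ← mul_assoc, ← Real.exp_add, add_neg_cancel, Real.exp_zero, one_mul]

variable {F : ℝ → N → N} (hF : IsSmoothReebFlow α F) {G G' : ℝ × ℝ → N → N}
  (hG : IsContactFamily α univ G) (hG' : IsContactFamily α univ G')
  (hGG' : ∀ a, LeftInverse (G' a) (G a) ∧ RightInverse (G' a) (G a))

include hF hG hG' hGG'

/-- The cut-off flow preserves the contact structure of the product: along an orbit, the pairings of
`β` with the linearized flow satisfy a linear differential equation. -/
theorem isConformal_cutoffFlow [FiniteDimensional ℝ E] {a₀ : ℝ × ℝ} (h0 : G a₀ = id) {L : ℝ}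
    {Φ : ℝ → (ℝ × ℝ) × (N × N × ℝ) → (ℝ × ℝ) × (N × N × ℝ)}
    (hΦ : ContMDiff (𝓘(ℝ, ℝ).prod (planeModel I)) (planeModel I) ∞ (uncurry Φ))
    (hΦ0 : ∀ q, Φ 0 q = q)
    (hΦv : ∀ t q, vel (planeModel I) (fun s => Φ s q) t =
      initialField (planeModel I) (cutoffCurve α F G G' L) (Φ t q))
    (hfst : ∀ t q, (Φ t q).1 = q.1 + t • ((0 : ℝ), (1 : ℝ))) (t : ℝ) (a : ℝ × ℝ) :
    IsConformal (productForm α) (fun p => (Φ t (a, p)).2) := by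
  intro p
  set κ : ℝ → ℝ := fun t => stripCutoff a.1 * levelCutoff L (Φ t (a, p)).2.2.2 *
    timeConf α F G G' ((Φ t (a, p)).1, (Φ t (a, p)).2.2.1) with hκ
  have hΦc : Continuous fun t => Φ t (a, p) :=
    hΦ.continuous.comp (continuous_id.prodMk continuous_const)
  have hκc : Continuous κ := by
    refine (continuous_const.mul ((levelCutoff L).continuous.comp
      (continuous_snd.comp (continuous_snd.comp (continuous_snd.comp hΦc))))).mul ?_
    exact (contMDiff_timeConf hF hG hG' hGG' h0).continuous.comp
      ((continuous_fst.comp hΦc).prodMk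
        (continuous_fst.comp (continuous_snd.comp (continuous_snd.comp hΦc))))
  refine ⟨Real.exp (∫ s in (0 : ℝ)..t, κ s), Real.exp_pos _, fun u => ?_⟩
  obtain ⟨c, hc, rfl, rfl⟩ := exists_curve (I := cpModel I) p u
  have hcd : MDifferentiableAt 𝓘(ℝ, ℝ) (cpModel I) c 0 := hc.mdifferentiableAt (by simp)
  -- `b t` is the pairing of `β` with the image of the initial vector under the linearized flow
  set z : ℝ → ℝ → N × N × ℝ := fun t σ => (Φ t (a, c σ)).2 with hz
  have hZs : ∀ t, ContMDiffAt (𝓘(ℝ, ℝ).prod 𝓘(ℝ, ℝ)) (planeModel I) ∞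
      (uncurry fun t σ => Φ t (a, c σ)) (t, 0) := fun t =>
    hΦ.contMDiffAt.comp (t, (0 : ℝ)) (contMDiffAt_fst.prodMk (contMDiffAt_const.prodMk
      (ContMDiffAt.comp (t, (0 : ℝ)) (g := c) (f := Prod.snd) hc contMDiffAt_snd)))
  have hzs : ∀ t, ContMDiffAt (𝓘(ℝ, ℝ).prod 𝓘(ℝ, ℝ)) (cpModel I) ∞ (uncurry z) (t, 0) := fun t =>
    contMDiffAt_snd.comp _ (hZs t)
  have hβ := productForm_isSmooth hF.contact.smooth
  set b : ℝ → ℝ := fun t => (productForm α).ev (z t 0) (vel (cpModel I) (z t) 0) with hb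
  have hbd : ∀ t, DifferentiableAt ℝ b t := fun t =>
    (contMDiffAt_ev_vel hβ (g := fun _ => 0) (hzs t) contMDiffAt_const).contDiffAt.differentiableAt
      (by simp)
  have hX : ∀ t σ, vel (cpModel I) (fun t => z t σ) t =
      (initialField (planeModel I) (cutoffCurve α F G G' L) (a + t • ((0 : ℝ), (1 : ℝ)), z t σ)).2 := by
    intro t σ
    have hmd : MDifferentiableAt 𝓘(ℝ, ℝ) (planeModel I) (fun s => Φ s (a, c σ)) t :=
      (slice_left (hΦ (t, (a, c σ)))).mdifferentiableAt (by simp)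
    have h1 : MDifferentiableAt 𝓘(ℝ, ℝ) 𝓘(ℝ, ℝ × ℝ) (fun s => (Φ s (a, c σ)).1) t := hmd.fst
    have h2 : MDifferentiableAt 𝓘(ℝ, ℝ) (cpModel I) (fun s => (Φ s (a, c σ)).2) t := hmd.snd
    have h3 := congrArg Prod.snd ((vel_prodMk h1 h2).symm.trans (hΦv t (a, c σ)))
    have h4 : Φ t (a, c σ) = (a + t • ((0 : ℝ), (1 : ℝ)), z t σ) := Prod.ext (hfst t (a, c σ)) rfl
    rw [h4] at h3
    exact h3
  have ha1 : ∀ t : ℝ, (a + t • ((0 : ℝ), (1 : ℝ))).1 = a.1 := fun t => by simp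
  -- the two-dimensional Cartan formula on the surface `z` gives the linear equation `b' = κ b`
  have hode : ∀ t, HasDerivAt b (κ t * b t) t := by
    intro t
    refine (hbd t).hasDerivAt.congr_deriv ?_
    have key := deriv_ev_sub_deriv_ev hβ (hzs t)
    set a' := a + t • ((0 : ℝ), (1 : ℝ)) with ha'
    have hX' : ∀ σ, (productForm α).ev (z t σ) (vel (cpModel I) (fun t => z t σ) t) =
        stripCutoff a.1 * levelCutoff L (z t σ).2.2 * timeHam α G G' (a', (z t σ).2.1) := by
      intro σ
      rw [hX, initialField_cutoffCurve hF hG hG' hGG' h0, productForm_ev]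
      simp only [α.ev_add, α.ev_smul, hF.ev_reeb, ha1]
      have e : Real.exp (z t σ).2.2 * Real.exp (-(z t σ).2.2) = 1 := by rw [← Real.exp_add]; simp
      change _ + _ * timeHam α G G' (a', (z t σ).2.1) - _ = _
      linear_combination (stripCutoff a.1 * deriv (levelCutoff L) (z t σ).2.2 *
        timeHam α G G' (a', (z t σ).2.1)) * e
    have hzt : ContMDiffAt 𝓘(ℝ, ℝ) (cpModel I) ∞ (z t) 0 := slice_right (hzs t)
    have hz2 : ContMDiffAt 𝓘(ℝ, ℝ) I ∞ (fun σ => (z t σ).2.1) 0 :=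
      contMDiffAt_fst.comp (0 : ℝ) (contMDiffAt_snd.comp (0 : ℝ) hzt)
    have hz3 : ContMDiffAt 𝓘(ℝ, ℝ) 𝓘(ℝ, ℝ) ∞ (fun σ => (z t σ).2.2) 0 :=
      contMDiffAt_snd.comp (0 : ℝ) (contMDiffAt_snd.comp (0 : ℝ) hzt)
    have hHd : DifferentiableAt ℝ (fun σ => timeHam α G G' (a', (z t σ).2.1)) 0 :=
      ((contMDiff_timeHam hF hG hG' hGG').contMDiffAt.comp (0 : ℝ)
        (contMDiffAt_const.prodMk hz2)).contDiffAt.differentiableAt (by simp)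
    have hθd := (hz3.contDiffAt.differentiableAt (by simp)).hasDerivAt
    have hρd := (hasDerivAt_levelCutoff L (z t 0).2.2).comp (0 : ℝ) hθd
    have d2 := ((hρd.const_mul (stripCutoff a.1)).mul hHd.hasDerivAt).deriv
    have hid := deriv_timeHam_add hF hG hG' hGG' h0 a' hz2
    have hκt : κ t = stripCutoff a.1 * levelCutoff L (z t 0).2.2 *
        timeConf α F G G' (a', (z t 0).2.1) := by
      simp only [hκ, hz, hfst, ha']
    have hbt : b t = α.ev (z t 0).2.1 (vel I (fun σ => (z t σ).2.1) 0) -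
        Real.exp (z t 0).2.2 * α.ev (z t 0).1 (vel I (fun σ => (z t σ).1) 0) :=
      productForm_ev_vel (hzt.mdifferentiableAt (by simp))
    simp only [hX'] at key
    rw [hX t 0, initialField_cutoffCurve hF hG hG' hGG' h0,
      productForm_d_ev₂ hF.contact.smooth, vel_cp (hzt.mdifferentiableAt (by simp))] at key
    simp only [DForm.ev₂_add_left, DForm.ev₂_smul_left, α.ev_smul, hF.ev_reeb, hF.d_reeb,
      ha1] at key
    have key2 : deriv b t - deriv (fun σ => stripCutoff a.1 * levelCutoff L (z t σ).2.2 *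
        timeHam α G G' (a', (z t σ).2.1)) 0 = _ := key
    have e : Real.exp (z t 0).2.2 * Real.exp (-(z t 0).2.2) = 1 := by rw [← Real.exp_add]; simp
    rw [hκt, hbt]
    have d3 : deriv (fun σ => stripCutoff a.1 * levelCutoff L (z t σ).2.2 *
        timeHam α G G' (a', (z t σ).2.1)) 0 = _ := d2
    rw [d3] at key2
    simp only [comp_apply] at key2
    linear_combination key2 + stripCutoff a.1 * levelCutoff L (z t 0).2.2 * hid -
      (stripCutoff a.1 * deriv (levelCutoff L) (z t 0).2.2 * timeHam α G G' (a', (z t 0).2.1) *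
        deriv (fun σ => (z t σ).2.2) 0) * e
  have hsol := eq_exp_integral_mul hκc hode t
  have hmd : MDifferentiableAt (cpModel I) (cpModel I) (fun p => (Φ t (a, p)).2) (c 0) := by
    have : ContMDiff (cpModel I) (planeModel I) ∞ (fun p => Φ t (a, p)) :=
      hΦ.comp (contMDiff_const.prodMk (contMDiff_const.prodMk contMDiff_id))
    exact ((contMDiff_snd.comp this).mdifferentiable (by simp)) (c 0)
  have hv := vel_comp (f := fun p => (Φ t (a, p)).2) (c := c) (t := 0) hmd hcd
  have hz0 : z 0 = c := funext fun σ => by simp only [hz, hΦ0]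
  rw [← hv]
  have hb0 : b 0 = (productForm α).ev (c 0) (vel (cpModel I) c 0) := by
    simp only [hb, hz0]
  rw [← hb0, ← hsol]

end CutoffFlow

/-! ### Cutting off the graphs of an isotopy -/

section CutoffTheorem

variable {E : Type*} [NormedAddCommGroup E] [NormedSpace ℝ E]
  {H : Type*} [TopologicalSpace H] {I : ModelWithCorners ℝ E H} [I.Boundaryless]
  {N : Type*} [TopologicalSpace N] [ChartedSpace H N] [IsManifold I ∞ N] {α : DForm I N 1}

/-- The contact isotopies `(x₁, x₂, θ) ↦ (x₁, G(x₂), θ + log λ(x₂))` of the product can be cut off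
to compactly supported ones without changing their values on the diagonal. -/
theorem exists_cutoff [FiniteDimensional ℝ E] [T2Space N] [CompactSpace N] {F : ℝ → N → N}
    (hF : IsSmoothReebFlow α F) {G : ℝ × ℝ → N → N} (hG : IsContactFamily α univ G)
    (hneg : ∀ s t, t ≤ 0 → G (s, t) = id) (hone : ∀ s t, 1 ≤ t → G (s, t) = G (s, 1)) :
    ∃ C : ℝ × ℝ → N × N × ℝ → N × N × ℝ, IsContactFamily (productForm α) univ C ∧
      (∀ a, IsConformal (productForm α) (C a)) ∧ (∀ s, C (s, 0) = id) ∧ HasCompactSupp univ C ∧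
      ∀ s ∈ Icc (0 : ℝ) 1, ∀ t x, C (s, t) (x, x, 0) =
        (x, G (s, t) x, Real.log (confCoeff α F (G (s, t)) x)) := by
  obtain ⟨G', hG', hGG'⟩ := hG.exists_inv_univ
  have h0 : G (0, 0) = id := hneg 0 0 le_rfl
  have hlogs : ContMDiff (𝓘(ℝ, ℝ × ℝ).prod I) 𝓘(ℝ, ℝ) ∞
      (fun q : (ℝ × ℝ) × N => Real.log (confCoeff α F (G q.1) q.2)) := fun q =>
    ContMDiffAt.comp q (g := Real.log)
      (Real.contDiffAt_log.2 (hF.confCoeff_pos hG h0 _ _).ne').contMDiffAt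
      (hF.contMDiff_confCoeff hG.contMDiff q)
  obtain ⟨L, hL⟩ : ∃ L : ℝ, ∀ s ∈ Icc (0 : ℝ) 1, ∀ t x,
      |Real.log (confCoeff α F (G (s, t)) x)| ≤ |L| := by
    obtain ⟨L, hL⟩ := (((isCompact_Icc (a := (0 : ℝ)) (b := 1)).prod
      (isCompact_Icc (a := (0 : ℝ)) (b := 1))).prod (isCompact_univ (X := N))).exists_bound_of_continuousOn
      hlogs.continuous.continuousOn
    refine ⟨L, fun s hs t x => ?_⟩
    rcases le_total t 0 with ht | ht
    · rw [hneg s t ht, hF.confCoeff_id]; simp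
    · rcases le_total t 1 with ht1 | ht1
      · exact (hL ((s, t), x) ⟨⟨hs, ht, ht1⟩, mem_univ x⟩).trans (le_abs_self L)
      · rw [hone s t ht1]
        exact (hL ((s, 1), x) ⟨⟨hs, by simp⟩, mem_univ x⟩).trans (le_abs_self L)
  -- the time is a coordinate of `ℝ² × (N × N × ℝ)`, on which the cut-off field is autonomous; it equals
  -- `∂ₜ` outside a compact set, hence has a global flow
  set e : ℝ × ℝ := (0, 1) with he
  have hΓ := contMDiff_cutoffCurve hF hG hG' hGG' h0 L
  have hΓ0 := cutoffCurve_zero hF hG hG' hGG' L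
  have hlin : ∀ (a : ℝ × ℝ) (t : ℝ), HasDerivAt (fun t : ℝ => a + t • e) e t := fun a t => by
    simpa using ((hasDerivAt_id t).smul_const e).const_add a
  have hstraight : ∀ (a : ℝ × ℝ) (p : N × N × ℝ) (t : ℝ),
      MDifferentiableAt 𝓘(ℝ, ℝ) (planeModel I) (fun t : ℝ => (a + t • e, p)) t ∧
      vel (planeModel I) (fun t : ℝ => (a + t • e, p)) t = ((0, 1), 0, 0, 0) := fun a p t => by
    have h1 := (hlin a t).differentiableAt.mdifferentiableAt
    refine ⟨h1.prodMk mdifferentiableAt_const, ?_⟩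
    refine (vel_prodMk (I := 𝓘(ℝ, ℝ × ℝ)) (J := cpModel I) (c := fun t : ℝ => a + t • e)
      (c' := fun _ => p) h1 mdifferentiableAt_const).trans ?_
    rw [vel_const, vel_eq_deriv, (hlin a t).deriv]
    rfl
  have hfst1 : ∀ (s t τ : ℝ), ((s, t) : ℝ × ℝ) + τ • e = (s, t + τ) := fun s t τ => by simp [he]
  obtain ⟨Φ, hΦ, hΦ0, hΦv, hΦadd, hΦu⟩ := exists_smooth_flow hΓ hΓ0
    (K := (Icc (-2 : ℝ) 3 ×ˢ Icc (-1 : ℝ) 2) ×ˢ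
      ((univ : Set N) ×ˢ (univ : Set N) ×ˢ Metric.closedBall (0 : ℝ) (|L| + 2)))
    ((isCompact_Icc.prod isCompact_Icc).prod (isCompact_univ.prod
      (isCompact_univ.prod (isCompact_closedBall 0 _)))) one_pos (by
      rintro ⟨⟨s, t⟩, p⟩ hb
      refine ⟨fun τ => ((s, t) + τ • e, p), by simp, fun τ hτ => ⟨(hstraight _ p τ).1, ?_⟩⟩
      rw [(hstraight _ p τ).2]
      refine (initialField_cutoffCurve_eq hF hG hG' hGG' h0 hneg hone ?_).symm
      rw [hfst1]
      by_contra! hcon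
      refine hb ⟨⟨hcon.1, ?_⟩, mem_univ _, mem_univ _, ?_⟩
      · constructor <;> linarith [hcon.2.1.1, hcon.2.1.2, hτ.1, hτ.2]
      · rw [Metric.mem_closedBall, dist_zero_right, Real.norm_eq_abs]
        exact hcon.2.2)
  have hΦmd : ∀ t q, MDifferentiableAt 𝓘(ℝ, ℝ) (planeModel I) (fun s => Φ s q) t := fun t q =>
    (slice_left (hΦ (t, q))).mdifferentiableAt (by simp)
  have hfst : ∀ t q, (Φ t q).1 = q.1 + t • e := by
    intro t q
    have hd : ∀ t, HasDerivAt (fun t => (Φ t q).1) e t := fun t => by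
      have h1 : MDifferentiableAt 𝓘(ℝ, ℝ) 𝓘(ℝ, ℝ × ℝ) (fun s => (Φ s q).1) t := (hΦmd t q).fst
      have h2 : MDifferentiableAt 𝓘(ℝ, ℝ) (cpModel I) (fun s => (Φ s q).2) t := (hΦmd t q).snd
      have h3 := congrArg Prod.fst ((vel_prodMk h1 h2).symm.trans (hΦv t q))
      rcases hq : Φ t q with ⟨a, p⟩
      rw [hq, initialField_cutoffCurve hF hG hG' hGG' h0, vel_eq_deriv] at h3
      exact h1.differentiableAt.hasDerivAt.congr_deriv h3
    have hd2 : ∀ t, HasDerivAt (fun t => (Φ t q).1 - (q.1 + t • e)) 0 t := fun t => by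
      exact ((hd t).sub (hlin q.1 t)).congr_deriv (sub_self e)
    have := is_const_of_deriv_eq_zero (fun t => (hd2 t).differentiableAt) (fun t => (hd2 t).deriv) t 0
    simp only [hΦ0, zero_smul, add_zero, sub_self] at this
    exact sub_eq_zero.1 this
  have hconf := isConformal_cutoffFlow hF hG hG' hGG' h0 hΦ hΦ0 hΦv hfst
  have hpair : ∀ s t p, Φ t ((s, 0), p) = ((s, t), (Φ t ((s, 0), p)).2) := fun s t p =>
    Prod.ext (by rw [hfst, hfst1, zero_add]) rfl
  have hpair' : ∀ s t p, Φ (-t) ((s, t), p) = ((s, 0), (Φ (-t) ((s, t), p)).2) := fun s t p =>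
    Prod.ext (by rw [hfst, hfst1, add_neg_cancel]) rfl
  have hsm : ContMDiff (𝓘(ℝ, ℝ × ℝ).prod (cpModel I)) (cpModel I) ∞
      (uncurry fun (a : ℝ × ℝ) p => (Φ a.2 ((a.1, 0), p)).2) := by
    have h1 : ContMDiff (𝓘(ℝ, ℝ × ℝ).prod (cpModel I)) 𝓘(ℝ, ℝ) ∞
        (fun w : (ℝ × ℝ) × (N × N × ℝ) => w.1.2) := (contDiff_snd (n := ∞)).contMDiff.comp contMDiff_fst
    have h2 : ContMDiff (𝓘(ℝ, ℝ × ℝ).prod (cpModel I)) 𝓘(ℝ, ℝ × ℝ) ∞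
        (fun w : (ℝ × ℝ) × (N × N × ℝ) => (w.1.1, (0 : ℝ))) :=
      (contDiff_fst.prodMk (contDiff_const (n := ∞))).contMDiff.comp contMDiff_fst
    exact contMDiff_snd.comp (hΦ.comp (h1.prodMk (h2.prodMk contMDiff_snd)))
  have hsm' : ContMDiff (𝓘(ℝ, ℝ × ℝ).prod (cpModel I)) (cpModel I) ∞
      (uncurry fun (a : ℝ × ℝ) p => (Φ (-a.2) (a, p)).2) := by
    have h1 : ContMDiff (𝓘(ℝ, ℝ × ℝ).prod (cpModel I)) 𝓘(ℝ, ℝ) ∞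
        (fun w : (ℝ × ℝ) × (N × N × ℝ) => -w.1.2) :=
      (contDiff_snd (n := ∞)).neg.contMDiff.comp contMDiff_fst
    exact contMDiff_snd.comp (hΦ.comp (h1.prodMk (contMDiff_fst.prodMk contMDiff_snd)))
  refine ⟨fun a p => (Φ a.2 ((a.1, 0), p)).2, isContactFamily_univ_of hsm hsm' ?_
    (fun a => hconf a.2 (a.1, 0)), fun a => hconf a.2 (a.1, 0), fun s => ?_, ?_, ?_⟩
  · rintro ⟨s, t⟩
    refine ⟨fun p => ?_, fun p => ?_⟩
    · change (Φ (-t) ((s, t), (Φ t ((s, 0), p)).2)).2 = p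
      rw [← hpair, ← hΦadd, neg_add_cancel, hΦ0]
    · change (Φ t ((s, 0), (Φ (-t) ((s, t), p)).2)).2 = p
      rw [← hpair', ← hΦadd, add_neg_cancel, hΦ0]
  · funext p
    change (Φ 0 ((s, 0), p)).2 = p
    rw [hΦ0]
  · refine ⟨univ ×ˢ univ ×ˢ Metric.closedBall 0 (|L| + 2),
      isCompact_univ.prod (isCompact_univ.prod (isCompact_closedBall 0 _)), fun a _ p hp => ?_⟩
    have hp' : |L| + 2 < |p.2.2| := not_le.1 fun h => hp ⟨mem_univ _, mem_univ _, by
      rwa [Metric.mem_closedBall, dist_zero_right, Real.norm_eq_abs]⟩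
    have := hΦu (fun t => ((a.1, 0) + t • e, p)) (fun t => ⟨(hstraight _ p t).1, by
      rw [(hstraight _ p t).2]
      exact (initialField_cutoffCurve_eq hF hG hG' hGG' h0 hneg hone
        (Or.inr (Or.inr hp'))).symm⟩) a.2
    simp only [zero_smul, add_zero] at this
    change (Φ a.2 ((a.1, 0), p)).2 = p
    rw [← this]
  · -- paths of points of the graphs are integral curves, as the cut-off functions equal `1` on them
    intro s hs t x
    have hGc : ∀ t, MDifferentiableAt 𝓘(ℝ, ℝ) I (fun t => G (s, t) x) t := fun t =>
      (slice_left (f := fun t x => G (s, t) x) (b := x) (hG.contMDiff.contMDiffAt.comp (t, x)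
        ((contDiff_const.prodMk (contDiff_id (n := ∞))).contMDiff.comp contMDiff_fst |>.prodMk
          contMDiff_snd).contMDiffAt)).mdifferentiableAt (by simp)
    have hlc : ∀ t, DifferentiableAt ℝ (fun t => Real.log (confCoeff α F (G (s, t)) x)) t :=
      fun t => (hlogs.contMDiffAt.comp t (f := fun t : ℝ => ((s, t), x))
        ((contDiff_const.prodMk (contDiff_id (n := ∞))).contMDiff.prodMk
          contMDiff_const).contMDiffAt).contDiffAt.differentiableAt (by simp)
    have hcurve : ∀ t, MDifferentiableAt 𝓘(ℝ, ℝ) (planeModel I)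
        (fun t => ((s, 0) + t • e, x, G (s, t) x, Real.log (confCoeff α F (G (s, t)) x))) t ∧
        vel (planeModel I) (fun t => ((s, 0) + t • e, x, G (s, t) x,
          Real.log (confCoeff α F (G (s, t)) x))) t =
        initialField (planeModel I) (cutoffCurve α F G G' L) ((s, 0) + t • e, x, G (s, t) x,
          Real.log (confCoeff α F (G (s, t)) x)) := by
      intro t
      have m1 := (hlin (s, 0) t).differentiableAt.mdifferentiableAt
      have m2 : MDifferentiableAt 𝓘(ℝ, ℝ) (cpModel I)
          (fun t => (x, G (s, t) x, Real.log (confCoeff α F (G (s, t)) x))) t :=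
        mdifferentiableAt_const.prodMk ((hGc t).prodMk (hlc t).mdifferentiableAt)
      refine ⟨m1.prodMk m2, ?_⟩
      refine (vel_prodMk m1 m2).trans ?_
      rw [vel_cp m2, vel_const, vel_eq_deriv, (hlin _ t).deriv, hfst1, zero_add,
        initialField_cutoffCurve hF hG hG' hGG' h0]
      obtain ⟨c1, c2⟩ := levelCutoff_of_le (hL s hs t x)
      have e1 : vel I (timeCurve G G' (s, t) (G (s, t) x)) 0 = vel I (fun t => G (s, t) x) t := by
        have : timeCurve G G' (s, t) (G (s, t) x) = fun τ => G (s, t + τ) x := by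
          funext τ
          rw [timeCurve, (hGG' (s, t)).1 x, ← he, hfst1]
        rw [this]
        have k := vel_comp_real (c := fun t => G (s, t) x) (g := fun τ => t + τ) (t := 0) (hGc _)
          ((hasDerivAt_id (0 : ℝ)).const_add t)
        rwa [one_smul, add_zero] at k
      have e2 : timeConf α F G G' ((s, t), G (s, t) x) =
          deriv (fun t => Real.log (confCoeff α F (G (s, t)) x)) t := by
        simp only [timeConf, (hGG' (s, t)).1 x, ← he, hfst1]
        exact (deriv_comp_const_add (f := fun t => Real.log (confCoeff α F (G (s, t)) x)) t 0).trans
          (by rw [add_zero])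
      simp only [c1, c2, stripCutoff_of_mem hs, e1, e2]
      simp [he]
    have := hΦu _ hcurve t
    simp only [zero_smul, add_zero] at this
    rw [hneg s 0 le_rfl, hF.confCoeff_id, Real.log_one] at this
    have h2 := congrArg Prod.snd this
    exact h2.symm

end CutoffTheorem

/-! ### Homotopies of Legendrian isotopies -/

section LegendrianHomotopies

variable {E : Type*} [NormedAddCommGroup E] [NormedSpace ℝ E]
  {H : Type*} [TopologicalSpace H] {I : ModelWithCorners ℝ E H}
  {M : Type*} [TopologicalSpace M] [ChartedSpace H M] {σ : DForm I M 1} {Λ : Set M}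
  {P P' Q Q' R : ℝ → Set M}

/-- The square `[0,1] × [0,1]` of homotopy parameters. -/
abbrev unitSquare : Set (ℝ × ℝ) := Icc (0 : ℝ) 1 ×ˢ Icc (0 : ℝ) 1

theorem isCompact_unitSquare : IsCompact unitSquare := isCompact_Icc.prod isCompact_Icc

theorem zero_mem_unit : (0 : ℝ) ∈ Icc (0 : ℝ) 1 := by simp

theorem one_mem_unit : (1 : ℝ) ∈ Icc (0 : ℝ) 1 := by simp

namespace LegHomotopic

theorem congr (h : LegHomotopic σ Λ P Q) (hP : ∀ t ∈ Icc (0 : ℝ) 1, P t = P' t)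
    (hQ : ∀ t ∈ Icc (0 : ℝ) 1, Q t = Q' t) : LegHomotopic σ Λ P' Q' := by
  obtain ⟨h, h1, h2, h3, h4⟩ := h
  exact ⟨h, h1, h2, fun s hs => ⟨(h3 s hs).1, (h3 s hs).2.trans (hP 1 one_mem_unit)⟩,
    fun t ht => ⟨(h4 t ht).1.trans (hP t ht), (h4 t ht).2.trans (hQ t ht)⟩⟩

theorem end_eq (h : LegHomotopic σ Λ P Q) : P 1 = Q 1 := by
  obtain ⟨h, h1, h2, h3, h4⟩ := h
  rw [← (h3 1 one_mem_unit).2, (h4 1 one_mem_unit).2]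

theorem symm (h : LegHomotopic σ Λ P Q) : LegHomotopic σ Λ Q P := by
  have he := h.end_eq
  obtain ⟨h, h1, h2, h3, h4⟩ := h
  have hr : ContDiff ℝ ∞ fun p : ℝ × ℝ => (1 - p.1, p.2) := by fun_prop
  have hm : MapsTo (fun p : ℝ × ℝ => (1 - p.1, p.2)) unitSquare unitSquare := fun p hp =>
    ⟨⟨by linarith [hp.1.2], by linarith [hp.1.1]⟩, hp.2⟩
  refine ⟨fun p => h (1 - p.1, p.2), h1.reparam hr hm, h2.reparam hm, fun s hs => ?_,
    fun t ht => ⟨?_, ?_⟩⟩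
  · have hs' : 1 - s ∈ Icc (0 : ℝ) 1 := ⟨by linarith [hs.2], by linarith [hs.1]⟩
    exact ⟨(h3 _ hs').1, (h3 _ hs').2.trans he⟩
  · simp only [sub_zero]; exact (h4 t ht).2
  · simp only [sub_self]; exact (h4 t ht).1

/-- With `h`, `k` the two homotopies, the composed one is `k_{s,t} k_{0,t}⁻¹ h_{s,t}`; this avoids
concatenations, which would not be smooth. -/
theorem trans (hPQ : LegHomotopic σ Λ P Q) (hQR : LegHomotopic σ Λ Q R) :
    LegHomotopic σ Λ P R := by
  have he := hPQ.end_eq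
  obtain ⟨h, h1, h2, h3, h4⟩ := hPQ
  obtain ⟨k, k1, k2, k3, k4⟩ := hQR
  obtain ⟨k', ks, ki⟩ := k1.exists_inv
  have hr : ContDiff ℝ ∞ fun p : ℝ × ℝ => ((0 : ℝ), p.2) := by fun_prop
  have hm : MapsTo (fun p : ℝ × ℝ => ((0 : ℝ), p.2)) unitSquare unitSquare := fun p hp =>
    ⟨zero_mem_unit, hp.2⟩
  have key : ∀ t ∈ Icc (0 : ℝ) 1, k' (0, t) '' Q t = Λ := fun t ht => by
    rw [← (k4 t ht).1]
    exact (ki (0, t) ⟨zero_mem_unit, ht⟩).1.image_image Λ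
  refine ⟨fun p => k p ∘ k' (0, p.2) ∘ h p, k1.comp (((k1.inv ks ki).reparam hr hm).comp h1),
    k2.comp (((k2.inv fun a ha => (ki a ha).1).reparam hm).comp h2), fun s hs => ⟨?_, ?_⟩,
    fun t ht => ⟨?_, ?_⟩⟩
  · have e : k' (0, 0) = id := by
      funext x
      have := (ki (0, 0) ⟨zero_mem_unit, zero_mem_unit⟩).1 x
      rwa [(k3 0 zero_mem_unit).1] at this
    simp only [(k3 s hs).1, (h3 s hs).1, e, id_comp]
  · rw [image_comp, image_comp, (h3 s hs).2, he, key 1 one_mem_unit, (k3 s hs).2]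
  · rw [image_comp, image_comp, (h4 t ht).1, ← image_comp]
    rw [(ki (0, t) ⟨zero_mem_unit, ht⟩).2.comp_eq_id, image_id]
  · rw [image_comp, image_comp, (h4 t ht).2, key t ht, (k4 t ht).2]

/-- Left multiplication by a compactly supported isotopy. -/
theorem mul_left (h : LegHomotopic σ Λ P Q) {φ : ℝ → M → M}
    (hφ : IsContactFamily σ (Icc (0 : ℝ) 1) φ) (hc : HasCompactSupp (Icc (0 : ℝ) 1) φ)
    (h0 : φ 0 = id) :
    LegHomotopic σ Λ (fun t => φ t '' P t) (fun t => φ t '' Q t) := by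
  obtain ⟨h, h1, h2, h3, h4⟩ := h
  have hr : ContDiff ℝ ∞ fun p : ℝ × ℝ => p.2 := contDiff_snd
  have hm : MapsTo (fun p : ℝ × ℝ => p.2) unitSquare (Icc (0 : ℝ) 1) := fun p hp => hp.2
  refine ⟨fun p => φ p.2 ∘ h p, (hφ.reparam hr hm).comp h1, (hc.reparam hm).comp h2,
    fun s hs => ⟨?_, ?_⟩, fun t ht => ⟨?_, ?_⟩⟩
  · simp only [(h3 s hs).1, h0, id_comp]
  · rw [image_comp, (h3 s hs).2]
  · rw [image_comp, (h4 t ht).1]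
  · rw [image_comp, (h4 t ht).2]

/-- Reparametrization of the time. -/
theorem comp_time (h : LegHomotopic σ Λ P Q) {r : ℝ → ℝ} (hr : ContDiff ℝ ∞ r)
    (hm : MapsTo r (Icc (0 : ℝ) 1) (Icc (0 : ℝ) 1)) (h0 : r 0 = 0) (h1 : r 1 = 1) :
    LegHomotopic σ Λ (fun t => P (r t)) (fun t => Q (r t)) := by
  obtain ⟨h, k1, k2, k3, k4⟩ := h
  have hr' : ContDiff ℝ ∞ fun p : ℝ × ℝ => (p.1, r p.2) :=
    contDiff_fst.prodMk (hr.comp contDiff_snd)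
  have hm' : MapsTo (fun p : ℝ × ℝ => (p.1, r p.2)) unitSquare unitSquare := fun p hp =>
    ⟨hp.1, hm hp.2⟩
  refine ⟨fun p => h (p.1, r p.2), k1.reparam hr' hm', k2.reparam hm', fun s hs => ?_,
    fun t ht => k4 _ (hm ht)⟩
  simp only [h0, h1]
  exact k3 s hs

/-- Conjugation by a contactomorphism, not necessarily compactly supported, which maps `Λ` to
itself. -/
theorem conj (h : LegHomotopic σ Λ P Q) {w w' : ℝ → M → M} (hw : IsContactFamily σ univ w)
    (hw' : IsContactFamily σ univ w')
    (hi : ∀ a, LeftInverse (w' a) (w a) ∧ RightInverse (w' a) (w a)) {u : ℝ}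
    (hΛ : w' u '' Λ = Λ) :
    LegHomotopic σ Λ (fun t => w u '' P t) (fun t => w u '' Q t) := by
  obtain ⟨h, h1, h2, h3, h4⟩ := h
  have hcw : IsContactFamily σ unitSquare fun _ : ℝ × ℝ => w u :=
    isContactFamily_const hw (mem_univ u)
  have key : ∀ p, w u ∘ h p ∘ w' u '' Λ = w u '' (h p '' Λ) := fun p => by
    rw [image_comp, image_comp, hΛ]
  refine ⟨fun p => w u ∘ h p ∘ w' u,
    hcw.comp (h1.comp (isContactFamily_const hw' (mem_univ u))),
    h2.conj isCompact_unitSquare (fun _ _ => hi u) hcw.smooth.continuousOn,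
    fun s hs => ⟨?_, ?_⟩, fun t ht => ⟨?_, ?_⟩⟩
  · simp only [(h3 s hs).1, id_comp]
    exact (hi u).2.comp_eq_id
  · rw [key, (h3 s hs).2]
  · rw [key, (h4 t ht).1]
  · rw [key, (h4 t ht).2]

/-- The homotopy of Legendrian isotopies defined by a two-parameter family. -/
theorem of_family {h : ℝ × ℝ → M → M} (h1 : IsContactFamily σ univ h) (h2 : HasCompactSupp univ h)
    (h3 : ∀ s, h (s, 0) = id)
    (h4 : ∀ s ∈ Icc (0 : ℝ) 1, h (s, 1) '' Λ = h (0, 1) '' Λ) :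
    LegHomotopic σ Λ (fun t => h (0, t) '' Λ) (fun t => h (1, t) '' Λ) :=
  ⟨h, h1.mono (subset_univ _), h2.imp fun _ hC => ⟨hC.1, fun a _ => hC.2 a (mem_univ a)⟩,
    fun s hs => ⟨h3 s, h4 s hs⟩, fun _ _ => ⟨rfl, rfl⟩⟩

end LegHomotopic

theorem HasCompactSupp.mono {A : Type*} [NormedAddCommGroup A] [NormedSpace ℝ A] {K K' : Set A}
    {φ : A → M → M} (h : HasCompactSupp K φ) (hK : K' ⊆ K) : HasCompactSupp K' φ :=
  h.imp fun _ hC => ⟨hC.1, fun a ha => hC.2 a (hK ha)⟩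

/-- A contact isotopy defined for all times. -/
def ContactIsotopy.ofFamily {φ : ℝ → M → M} (h : IsContactFamily σ univ φ) (h0 : φ 0 = id) :
    ContactIsotopy σ where
  toFun := φ
  isContactFamily := h.mono (subset_univ _)
  map_zero := h0

theorem continuous_speed [I.Boundaryless] [IsManifold I ∞ M] (hσ : σ.IsSmooth) {φ : ℝ → M → M}
    (h : IsContactFamily σ univ φ) : Continuous (uncurry (speed σ φ)) := by
  have h1 : ContMDiff ((𝓘(ℝ, ℝ).prod I).prod 𝓘(ℝ, ℝ)) I ∞
      (uncurry fun (b : ℝ × M) (τ : ℝ) => φ τ b.2) :=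
    h.contMDiff.comp (contMDiff_snd.prodMk (contMDiff_snd.comp contMDiff_fst))
  exact (contMDiff_ev_vel hσ (g := Prod.fst) h1 contMDiff_fst).continuous

theorem exists_speed_bound [I.Boundaryless] [IsManifold I ∞ M] (hσ : σ.IsSmooth) {φ : ℝ → M → M}
    (h : IsContactFamily σ univ φ) {C : Set M} (hC : IsCompact C) :
    ∃ S : ℝ, ∀ t ∈ Icc (0 : ℝ) 1, ∀ x ∈ C, |speed σ φ t x| ≤ S := by
  obtain ⟨S, hS⟩ := (isCompact_Icc.prod hC).exists_bound_of_continuousOn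
    (continuous_speed hσ h).continuousOn
  exact ⟨S, fun t ht x hx => hS (t, x) ⟨ht, hx⟩⟩

/-- The speeds of a compactly supported smooth isotopy are bounded. -/
theorem exists_speed_bound_of_hasCompactSupp [I.Boundaryless] [IsManifold I ∞ M] (hσ : σ.IsSmooth)
    {φ : ℝ → M → M} (h : IsContactFamily σ univ φ) (hc : HasCompactSupp univ φ) :
    ∃ S : ℝ, ∀ t ∈ Icc (0 : ℝ) 1, ∀ x, |speed σ φ t x| ≤ S := by
  obtain ⟨C, hC, hφ⟩ := hc
  obtain ⟨S, hS⟩ := exists_speed_bound hσ h hC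
  refine ⟨max S 0, fun t ht x => ?_⟩
  by_cases hx : x ∈ C
  · exact (hS t ht x hx).trans (le_max_left _ _)
  · have : (fun s => φ s x) = fun _ => x := funext fun s => hφ s (mem_univ s) x hx
    rw [speed, this, vel_const, DForm.ev_zero, abs_zero]
    exact le_max_right _ _

end LegendrianHomotopies

/-! ### The order, in terms of isotopies defined for all times -/

section OrderOnIsotopies

variable {E : Type*} [NormedAddCommGroup E] [NormedSpace ℝ E]
  {H : Type*} [TopologicalSpace H] {I : ModelWithCorners ℝ E H} [I.Boundaryless]
  {N : Type*} [TopologicalSpace N] [ChartedSpace H N] [IsManifold I ∞ N] {α : DForm I N 1}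

/-- A contact isotopy, reparametrized so as to be smooth in `t ∈ ℝ` and constant outside `[0,1]`. -/
def ContactIsotopy.ext (f : ContactIsotopy α) (t : ℝ) : N → N := f.toFun (Real.smoothTransition t)

theorem ContactIsotopy.isContactFamily_ext (f : ContactIsotopy α) :
    IsContactFamily α univ f.ext := f.isContactFamily_smoothTransition

theorem ContactIsotopy.ext_of_nonpos (f : ContactIsotopy α) {t : ℝ} (ht : t ≤ 0) : f.ext t = id := by
  rw [ContactIsotopy.ext, Real.smoothTransition.zero_of_nonpos ht, f.map_zero]

theorem ContactIsotopy.ext_of_one_le (f : ContactIsotopy α) {t : ℝ} (ht : 1 ≤ t) :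
    f.ext t = f.toFun 1 := by
  rw [ContactIsotopy.ext, Real.smoothTransition.one_of_one_le ht]

theorem ContactIsotopy.Homotopic.of_eqOn {f g : ContactIsotopy α}
    (h : ∀ t ∈ Icc (0 : ℝ) 1, f.toFun t = g.toFun t) : f.Homotopic g :=
  ⟨fun p => f.toFun p.2, f.isContactFamily_snd, fun _ _ => ⟨f.map_zero, rfl⟩,
    fun t ht => ⟨rfl, h t ht⟩⟩

/-- `f.ext` as a contact isotopy. -/
def ContactIsotopy.extIso (f : ContactIsotopy α) : ContactIsotopy α :=
  ContactIsotopy.ofFamily f.isContactFamily_ext (f.ext_of_nonpos le_rfl)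

theorem unit_convex {s a b : ℝ} (hs : s ∈ Icc (0 : ℝ) 1) (ha : a ∈ Icc (0 : ℝ) 1)
    (hb : b ∈ Icc (0 : ℝ) 1) : (1 - s) * a + s * b ∈ Icc (0 : ℝ) 1 :=
  convex_Icc (0 : ℝ) 1 ha hb (by linarith [hs.2]) hs.1 (by ring)

theorem ContactIsotopy.homotopic_extIso (f : ContactIsotopy α) : f.Homotopic f.extIso := by
  have hr : ContDiff ℝ ∞ fun p : ℝ × ℝ => (1 - p.1) * p.2 + p.1 * Real.smoothTransition p.2 := by
    have := contDiff_smoothTransition.comp (contDiff_snd (𝕜 := ℝ) (E := ℝ) (F := ℝ))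
    exact ((contDiff_const.sub contDiff_fst).mul contDiff_snd).add (contDiff_fst.mul this)
  refine ⟨fun p => f.toFun ((1 - p.1) * p.2 + p.1 * Real.smoothTransition p.2),
    f.isContactFamily.reparam hr fun p hp => unit_convex hp.1 hp.2 (smoothTransition_mem _),
    fun s _ => ⟨?_, ?_⟩, fun t _ => ⟨?_, ?_⟩⟩
  · simp [Real.smoothTransition.zero_of_nonpos le_rfl, f.map_zero]
  · simp [Real.smoothTransition.one_of_one_le le_rfl]
  · simp
  · simp [extIso, ContactIsotopy.ofFamily, ContactIsotopy.ext]

variable {F : ℝ → N → N}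

theorem IsSmoothReebFlow.graphSet_id (hF : IsSmoothReebFlow α F) :
    graphSet α F id = diagonal N := by
  simp [graphSet, hF.confCoeff_id, diagonal]

theorem IsSmoothReebFlow.levelFlow_diagonal (hF : IsSmoothReebFlow α F) (L t : ℝ) :
    levelFlow F L t '' diagonal N = graphSet α F (F t) := by
  rw [hF.graphSet_reeb, diagonal, ← range_comp]
  congr 1
  funext x
  exact hF.levelFlow_of_le t (by simp)

/-- The isotopy `ψ` exhibits the class of the graph of `f` as being at most the class of the Reeb
translate of the diagonal by `T`. As opposed to `LegLE`, the families are smooth in `t ∈ ℝ`. -/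
def NonnegTo (F : ℝ → N → N) (f : ContactIsotopy α) (T : ℝ) : Prop :=
  ∃ ψ : ℝ → N × N × ℝ → N × N × ℝ, IsContactFamily (productForm α) univ ψ ∧
    HasCompactSupp univ ψ ∧ ψ 0 = id ∧
    (∀ t ∈ Icc (0 : ℝ) 1, ∀ x ∈ graphSet α F (f.toFun 1), 0 ≤ speed (productForm α) ψ t x) ∧
    LegHomotopic (productForm α) (diagonal N) (fun t => ψ t '' graphSet α F (f.ext t))
      (fun t => graphSet α F (F (t * T)))

/-- The isotopies, given on `[0,1]`, are reparametrized by the smooth step function. -/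
theorem nonnegTo_of_legLE [FiniteDimensional ℝ E] [T2Space N] [CompactSpace N]
    (hF : IsSmoothReebFlow α F) {f : ContactIsotopy α} {T : ℝ}
    (h : LegLE (productForm α) (diagonal N) (fun t => graphMap f t '' diagonal N)
      (fun t => reebFlow (productForm α) (t * T) '' diagonal N)) : NonnegTo F f T := by
  obtain ⟨ψ, hc, hs, hh⟩ := h
  have hm : MapsTo Real.smoothTransition (univ : Set ℝ) (Icc (0 : ℝ) 1) := fun t _ =>
    smoothTransition_mem t
  have hr0 : Real.smoothTransition 0 = 0 := Real.smoothTransition.zero_of_nonpos le_rfl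
  have hr1 : Real.smoothTransition 1 = 1 := Real.smoothTransition.one_of_one_le le_rfl
  have hfam := ψ.isContactFamily_smoothTransition
  refine ⟨fun t => ψ.toFun (Real.smoothTransition t), hfam, hc.reparam hm, ?_, ?_, ?_⟩
  · change ψ.toFun (Real.smoothTransition 0) = id
    rw [hr0, ψ.map_zero]
  · intro t ht x hx
    have hx' : x ∈ graphMap f 1 '' diagonal N := by rwa [f.graphMap_image hF one_mem_unit]
    have h1 := hs _ (smoothTransition_mem t) x hx'
    have hmd : MDifferentiableWithinAt 𝓘(ℝ, ℝ) (cpModel I) (fun s => ψ.toFun s x) (Icc 0 1)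
        (Real.smoothTransition t) := by
      have h2 : ContMDiffOn 𝓘(ℝ, ℝ) (cpModel I) ∞ (fun s => ψ.toFun s x) (Icc 0 1) :=
        ψ.isContactFamily.smooth.comp (f := fun s : ℝ => (s, x))
          (contMDiff_id.prodMk contMDiff_const).contMDiffOn fun s hs => ⟨hs, mem_univ _⟩
      exact (h2 _ (smoothTransition_mem t)).mdifferentiableWithinAt (by simp)
    have hrd : HasDerivAt Real.smoothTransition (deriv Real.smoothTransition t) t :=
      (contDiff_smoothTransition.differentiable (by simp) t).hasDerivAt
    have hu : UniqueMDiffWithinAt 𝓘(ℝ, ℝ) (univ : Set ℝ) t := uniqueMDiffWithinAt_univ _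
    have hcomp := mfderivWithin_comp t (s := univ) (u := Icc (0 : ℝ) 1) hmd
      hrd.differentiableAt.mdifferentiableAt.mdifferentiableWithinAt (fun s _ => smoothTransition_mem s) hu
    rw [mfderivWithin_univ, mfderivWithin_univ] at hcomp
    obtain ⟨D, hD⟩ : ∃ D : ℝ →L[ℝ] E × E × ℝ, D = mfderivWithin 𝓘(ℝ, ℝ) (cpModel I)
        (fun s => ψ.toFun s x) (Icc (0 : ℝ) 1) (Real.smoothTransition t) := ⟨_, rfl⟩
    have e1 : vel (cpModel I) (fun s => ψ.toFun (Real.smoothTransition s) x) t =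
        D (deriv Real.smoothTransition t) := by
      rw [← vel_eq_deriv, hD]
      exact congrArg (fun A : ℝ →L[ℝ] E × E × ℝ => A 1) hcomp
    have hv : vel (cpModel I) (fun s => ψ.toFun (Real.smoothTransition s) x) t =
        deriv Real.smoothTransition t • D 1 := by
      rw [e1, ← D.map_smul, smul_eq_mul, mul_one]
    have h2 : 0 ≤ (productForm α).ev (ψ.toFun (Real.smoothTransition t) x) (D 1) := by
      rw [hD]
      exact h1
    have h3 : speed (productForm α) (fun t => ψ.toFun (Real.smoothTransition t)) t x =
        deriv Real.smoothTransition t * (productForm α).ev (ψ.toFun (Real.smoothTransition t) x)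
          (D 1) := by
      rw [speed, hv, DForm.ev_smul]
    rw [h3]
    refine mul_nonneg ?_ h2
    exact (Real.smoothTransition.monotone).deriv_nonneg
  · refine (hh.comp_time contDiff_smoothTransition (fun t _ => smoothTransition_mem t) hr0 hr1).congr
      (fun t _ => by beta_reduce; rw [f.graphMap_image hF (smoothTransition_mem t)]; rfl)
      (fun _ _ => rfl)
      |>.trans ?_
    -- the Reeb translates, reparametrized, are homotopic to the original ones
    have hr : ContDiff ℝ ∞ fun p : ℝ × ℝ =>
        ((1 - p.1) * Real.smoothTransition p.2 + p.1 * p.2) * T := by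
      have := contDiff_smoothTransition.comp (contDiff_snd (𝕜 := ℝ) (E := ℝ) (F := ℝ))
      exact (((contDiff_const.sub contDiff_fst).mul this).add
        (contDiff_fst.mul contDiff_snd)).mul contDiff_const
    refine (LegHomotopic.of_family ((hF.isContactFamily_levelFlow 0).reparam hr fun _ _ => mem_univ _)
      ((hF.hasCompactSupp_levelFlow 0).reparam fun _ _ => mem_univ _) (fun s => ?_)
      fun s _ => ?_).congr (fun t _ => ?_) fun t _ => ?_
    · simp only [hr0]
      rw [show ((1 - s) * 0 + s * 0) * T = 0 by ring, hF.levelFlow_zero]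
    · simp only [hr1]
      rw [show ((1 - s) * 1 + s * 1) * T = ((1 - 0) * 1 + 0 * 1) * T by ring]
    · simp only [hF.levelFlow_diagonal, hF.reebFlow_image]
      congr 2; ring
    · simp only [hF.levelFlow_diagonal]
      congr 2; ring

theorem contactSpeed_eq_speed_of_family {σ : DForm (cpModel I) (N × N × ℝ) 1}
    {ψ : ℝ → N × N × ℝ → N × N × ℝ} (h : IsContactFamily σ univ ψ) {t : ℝ}
    (ht : t ∈ Icc (0 : ℝ) 1) (x : N × N × ℝ) : contactSpeed σ ψ t x = speed σ ψ t x :=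
  contactSpeed_eq_speed ht (h.mdiff_curve t x)

theorem NonnegTo.legLE [FiniteDimensional ℝ E] [T2Space N]
    (hF : IsSmoothReebFlow α F) {f : ContactIsotopy α} {T : ℝ} (h : NonnegTo F f T) :
    LegLE (productForm α) (diagonal N) (fun t => graphMap f.extIso t '' diagonal N)
      (fun t => reebFlow (productForm α) (t * T) '' diagonal N) := by
  obtain ⟨ψ, h1, h2, h3, h4, h5⟩ := h
  refine ⟨ContactIsotopy.ofFamily h1 h3, h2.mono (subset_univ _), fun t ht x hx => ?_,
    h5.congr (fun t ht => ?_) fun t _ => ?_⟩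
  · change 0 ≤ contactSpeed _ ψ t x
    rw [contactSpeed_eq_speed_of_family h1 ht]
    refine h4 t ht x ?_
    beta_reduce at hx
    rw [f.extIso.graphMap_image hF one_mem_unit] at hx
    rwa [← f.ext_of_one_le le_rfl]
  · beta_reduce
    rw [f.extIso.graphMap_image hF ht]; rfl
  · rw [hF.reebFlow_image]

/-- A contact isotopy of `N` gives a compactly supported isotopy of the product, which moves the
diagonal through the graphs. -/
theorem exists_cutoff_isotopy_apply [FiniteDimensional ℝ E] [T2Space N] [CompactSpace N]
    (hF : IsSmoothReebFlow α F) (f : ContactIsotopy α) :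
    ∃ C C' : ℝ → N × N × ℝ → N × N × ℝ, IsContactFamily (productForm α) univ C ∧
      IsContactFamily (productForm α) univ C' ∧
      (∀ a, LeftInverse (C' a) (C a) ∧ RightInverse (C' a) (C a)) ∧
      (∀ a, IsConformal (productForm α) (C a)) ∧ C 0 = id ∧ HasCompactSupp univ C ∧
      ∀ t x, C t (x, x, 0) = (x, f.ext t x, Real.log (confCoeff α F (f.ext t) x)) := by
  obtain ⟨C, h1, h2, h3, h4, h5⟩ := exists_cutoff hF (G := fun p : ℝ × ℝ => f.ext p.2)
    (f.isContactFamily_ext.reparam contDiff_snd fun _ _ => mem_univ _)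
    (fun _ _ ht => f.ext_of_nonpos ht) (fun _ _ ht => by rw [f.ext_of_one_le ht, f.ext_of_one_le le_rfl])
  have h1' : IsContactFamily (productForm α) univ fun t : ℝ => C (0, t) :=
    h1.reparam (by fun_prop) fun _ _ => mem_univ _
  obtain ⟨C', k1, k2⟩ := h1'.exists_inv_univ
  exact ⟨_, C', h1', k1, k2, fun a => h2 _, h3 0, h4.reparam fun _ _ => mem_univ _,
    h5 0 zero_mem_unit⟩

theorem image_diagonal_eq_graphSet {C : N × N × ℝ → N × N × ℝ} {φ : N → N}
    (h : ∀ x, C (x, x, 0) = (x, φ x, Real.log (confCoeff α F φ x))) :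
    C '' diagonal N = graphSet α F φ := by
  rw [diagonal, graphSet, ← range_comp]
  exact congrArg range (funext h)

theorem exists_cutoff_isotopy [FiniteDimensional ℝ E] [T2Space N] [CompactSpace N]
    (hF : IsSmoothReebFlow α F) (f : ContactIsotopy α) :
    ∃ C C' : ℝ → N × N × ℝ → N × N × ℝ, IsContactFamily (productForm α) univ C ∧
      IsContactFamily (productForm α) univ C' ∧
      (∀ a, LeftInverse (C' a) (C a) ∧ RightInverse (C' a) (C a)) ∧
      (∀ a, IsConformal (productForm α) (C a)) ∧ C 0 = id ∧ HasCompactSupp univ C ∧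
      ∀ t, C t '' diagonal N = graphSet α F (f.ext t) := by
  obtain ⟨C, C', h1, h2, h3, h4, h5, h6, h7⟩ := exists_cutoff_isotopy_apply hF f
  exact ⟨C, C', h1, h2, h3, h4, h5, h6, fun t => image_diagonal_eq_graphSet (h7 t)⟩

/-- Homotopic contact isotopies have homotopic graphs. -/
theorem legHomotopic_of_homotopic [FiniteDimensional ℝ E] [T2Space N] [CompactSpace N]
    (hF : IsSmoothReebFlow α F) {f g : ContactIsotopy α} (h : f.Homotopic g) :
    LegHomotopic (productForm α) (diagonal N) (fun t => graphSet α F (f.ext t))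
      (fun t => graphSet α F (g.ext t)) := by
  obtain ⟨h, h1, h2, h3⟩ := h
  set r := Real.smoothTransition with hr
  have hr0 : ∀ t ≤ 0, r t = 0 := fun t ht => Real.smoothTransition.zero_of_nonpos ht
  have hr1 : ∀ t, 1 ≤ t → r t = 1 := fun t ht => Real.smoothTransition.one_of_one_le ht
  have hrr : ContDiff ℝ ∞ fun p : ℝ × ℝ => (r p.1, r p.2) :=
    (contDiff_smoothTransition.comp contDiff_fst).prodMk (contDiff_smoothTransition.comp contDiff_snd)
  obtain ⟨C, k1, -, k3, k4, k5⟩ := exists_cutoff hF (G := fun p : ℝ × ℝ => h (r p.1, r p.2))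
    (h1.reparam hrr fun p _ => ⟨smoothTransition_mem _, smoothTransition_mem _⟩)
    (fun s t ht => by
      simp only [hr0 t ht]
      exact (h2 _ (smoothTransition_mem s)).1)
    (fun s t ht => by simp only [hr1 t ht, hr1 1 le_rfl])
  have hC : ∀ s ∈ Icc (0 : ℝ) 1, ∀ t, C (s, t) '' diagonal N = graphSet α F (h (r s, r t)) := by
    intro s hs t
    rw [diagonal, graphSet, ← range_comp]
    congr 1
    funext x
    exact k5 s hs t x
  refine (LegHomotopic.of_family k1 k4 k3 fun s hs => ?_).congr (fun t _ => ?_) fun t _ => ?_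
  · rw [hC s hs, hC 0 zero_mem_unit, hr1 1 le_rfl, (h2 _ (smoothTransition_mem s)).2, hr0 0 le_rfl,
      (h2 _ zero_mem_unit).2]
  · rw [hC 0 zero_mem_unit, hr0 0 le_rfl, (h3 _ (smoothTransition_mem t)).1]; rfl
  · rw [hC 1 one_mem_unit, hr1 1 le_rfl, (h3 _ (smoothTransition_mem t)).2]; rfl

theorem NonnegTo.congr_homotopic [FiniteDimensional ℝ E] [T2Space N] [CompactSpace N]
    (hF : IsSmoothReebFlow α F) {f g : ContactIsotopy α} (h : f.Homotopic g) (T : ℝ) :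
    NonnegTo F f T ↔ NonnegTo F g T := by
  have hl := legHomotopic_of_homotopic hF h
  have he : f.toFun 1 = g.toFun 1 := by
    obtain ⟨h, -, h2, h3⟩ := h
    rw [← (h2 1 one_mem_unit).2, (h3 1 one_mem_unit).2]
  constructor
  · rintro ⟨ψ, h1, h2, h3, h4, h5⟩
    exact ⟨ψ, h1, h2, h3, he ▸ h4, ((hl.mul_left (h1.mono (subset_univ _))
      (h2.mono (subset_univ _)) h3).symm.trans h5)⟩
  · rintro ⟨ψ, h1, h2, h3, h4, h5⟩
    exact ⟨ψ, h1, h2, h3, he ▸ h4, ((hl.mul_left (h1.mono (subset_univ _))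
      (h2.mono (subset_univ _)) h3).trans h5)⟩

theorem NonnegTo.congr_mk [FiniteDimensional ℝ E] [T2Space N] [CompactSpace N]
    (hF : IsSmoothReebFlow α F) {f g : ContactIsotopy α} (h : UCont.mk f = UCont.mk g) (T : ℝ) :
    NonnegTo F f T ↔ NonnegTo F g T := by
  have := Quot.eqvGen_exact h
  induction this with
  | rel x y hxy => exact NonnegTo.congr_homotopic hF hxy T
  | refl x => exact Iff.rfl
  | symm x y hxy ih => exact (ih (Quot.eqvGen_sound hxy)).symm
  | trans x y z hxy hyz ih1 ih2 =>
    exact (ih1 (Quot.eqvGen_sound hxy)).trans (ih2 (Quot.eqvGen_sound hyz))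

/-- `C_+` in terms of a single representative of a class. -/
theorem cPlus_mk [FiniteDimensional ℝ E] [T2Space N] [CompactSpace N]
    (hF : IsSmoothReebFlow α F) (f : ContactIsotopy α) :
    CPlus (UCont.mk f) = sInf {c : EReal | ∃ T : ℝ, c = T ∧ NonnegTo F f T} := by
  apply le_antisymm
  · refine le_sInf ?_
    rintro _ ⟨T, rfl, hT⟩
    refine iInf₂_le_of_le f.extIso (Quot.sound f.homotopic_extIso).symm (sInf_le ⟨T, rfl, ?_⟩)
    refine hT.legLE hF |> fun h => ?_
    exact h
  · refine le_iInf₂ fun g hg => sInf_le_sInf ?_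
    rintro _ ⟨T, rfl, hT⟩
    exact ⟨T, rfl, (NonnegTo.congr_mk hF hg T).1 (nonnegTo_of_legLE hF hT)⟩

end OrderOnIsotopies

/-! ### Finiteness of the order spectral selector -/

section Finiteness

variable {E : Type*} [NormedAddCommGroup E] [NormedSpace ℝ E]
  {H : Type*} [TopologicalSpace H] {I : ModelWithCorners ℝ E H} [I.Boundaryless]
  {N : Type*} [TopologicalSpace N] [ChartedSpace H N] [IsManifold I ∞ N] {α : DForm I N 1}
  {F : ℝ → N → N}

theorem IsSmoothReebFlow.speed_levelFlow_comp (hF : IsSmoothReebFlow α F) (L T : ℝ)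
    {φ : ℝ → N × N × ℝ → N × N × ℝ} (hφ : IsContactFamily (productForm α) univ φ) (t : ℝ)
    (x : N × N × ℝ) :
    speed (productForm α) (fun t => levelFlow F L (t * T) ∘ φ t) t x =
      T * levelCutoff L (φ t x).2.2 + speed (productForm α) φ t x := by
  have hK : IsContactFamily (productForm α) univ fun t : ℝ => levelFlow F L (t * T) :=
    (hF.isContactFamily_levelFlow L).reparam (by fun_prop) fun _ _ => mem_univ _
  rw [speed_comp (c := 1) (hK.mdiff_uncurry _) (hφ.mdiff_curve t x)
    (fun u => by rw [hF.levelFlow_ev_mdf, one_mul]), one_mul,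
    speed_reparam (r := fun t => t * T) (r' := T)
      ((hF.isContactFamily_levelFlow L).mdiff_curve _ _) (by simpa using (hasDerivAt_id t).mul_const T),
    hF.speed_levelFlow]

/-- Over a compact set, the points moved by an isotopy stay in the region where a suitable cut-off
function is constant. -/
theorem exists_levelCutoff_eq_one {φ : ℝ → N × N × ℝ → N × N × ℝ}
    (hφ : IsContactFamily (productForm α) univ φ) {C : Set (N × N × ℝ)} (hC : IsCompact C) :
    ∃ L : ℝ, ∀ t ∈ Icc (0 : ℝ) 1, ∀ x ∈ C, levelCutoff L (φ t x).2.2 = 1 := by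
  obtain ⟨L, hL⟩ := (isCompact_Icc.prod hC).exists_bound_of_continuousOn
    (continuous_snd.comp (continuous_snd.comp hφ.contMDiff.continuous)).continuousOn
  refine ⟨L, fun t ht x hx => (levelCutoff_of_le ?_).1⟩
  exact (hL (t, x) ⟨ht, hx⟩).trans (le_abs_self L)

theorem isCompact_diagonal [CompactSpace N] : IsCompact (diagonal N) :=
  isCompact_range (by fun_prop)

theorem isContactFamily_levelFlow_mul (hF : IsSmoothReebFlow α F) (L : ℝ) {A : Type*}
    [NormedAddCommGroup A] [NormedSpace ℝ A] {r : A → ℝ} (hr : ContDiff ℝ ∞ r) {K : Set A} :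
    IsContactFamily (productForm α) K fun a => levelFlow F L (r a) :=
  (hF.isContactFamily_levelFlow L).reparam hr fun _ _ => mem_univ _

theorem HasCompactSupp.reparam_univ {A A' M : Type*} [NormedAddCommGroup A] [NormedSpace ℝ A]
    [NormedAddCommGroup A'] [NormedSpace ℝ A'] [TopologicalSpace M] {φ : A → M → M}
    (h : HasCompactSupp univ φ) (r : A' → A) {K : Set A'} : HasCompactSupp K fun a => φ (r a) :=
  h.imp fun _ hC => ⟨hC.1, fun a _ => hC.2 (r a) (mem_univ _)⟩

/-- Every class lies below some Reeb translate of the diagonal. -/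
theorem exists_nonnegTo [FiniteDimensional ℝ E] [T2Space N] [CompactSpace N]
    (hF : IsSmoothReebFlow α F) (f : ContactIsotopy α) : ∃ T, NonnegTo F f T := by
  obtain ⟨C, C', h1, h1', hi, hconf, h0, hs, hΔ⟩ := exists_cutoff_isotopy hF f
  have hs' : HasCompactSupp univ C' := hs.inv fun a _ => (hi a).1
  obtain ⟨S, hS⟩ := exists_speed_bound_of_hasCompactSupp (productForm_isSmooth hF.contact.smooth) h1 hs
  have hr : ContDiff ℝ ∞ fun t : ℝ => 1 - t := by fun_prop
  -- with `C_t` moving the diagonal through the graphs of `f`, the path `C_{1-t} C_1⁻¹` undoes `f`; its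
  -- speed is bounded, so composing with a fast Reeb flow makes it non-negative
  have hD : IsContactFamily (productForm α) univ fun t : ℝ => C (1 - t) ∘ C' 1 :=
    (h1.reparam hr fun _ _ => mem_univ _).comp (isContactFamily_const h1' (mem_univ _))
  have hg : graphSet α F (f.toFun 1) = C 1 '' diagonal N := by rw [hΔ, f.ext_of_one_le le_rfl]
  obtain ⟨L, hL⟩ := exists_levelCutoff_eq_one hD
    ((isCompact_diagonal (N := N)).image (h1.contMDiff_apply 1).continuous)
  have hconst : ∀ {r : ℝ → ℝ}, ContDiff ℝ ∞ r → IsContactFamily (productForm α) univ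
    fun t => levelFlow F L (r t) := fun h => isContactFamily_levelFlow_mul hF L h
  refine ⟨S, fun t => levelFlow F L (t * S) ∘ C (1 - t) ∘ C' 1,
    (hconst (by fun_prop)).comp hD, ?_, ?_, ?_, ?_⟩
  · exact ((hF.hasCompactSupp_levelFlow L).reparam_univ _).comp
      ((hs.reparam_univ _).comp (hs'.reparam_univ fun _ => 1))
  · simp only [zero_mul, hF.levelFlow_zero, sub_zero, id_comp]
    exact (hi 1).2.comp_eq_id
  · intro t ht x hx
    rw [hg] at hx
    have h2 := hF.speed_levelFlow_comp L S hD t x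
    refine le_of_le_of_eq ?_ h2.symm
    have h3 : speed (productForm α) (fun t : ℝ => C (1 - t) ∘ C' 1) t x =
        (-1) * speed (productForm α) C (1 - t) (C' 1 x) :=
      speed_reparam (φ := C) (r := fun t => 1 - t) (x := C' 1 x) (h1.mdiff_curve _ _)
        (by simpa using (hasDerivAt_id t).const_sub 1)
    have h4 := abs_le.1 (hS (1 - t) ⟨by linarith [ht.2], by linarith [ht.1]⟩ (C' 1 x))
    rw [h3, hL t ht x hx]
    linarith [h4.2]
  · -- the homotopy is `K_{tS} C_a C_{a+t}⁻¹ C_t`, with `a` going from `1 - t` to `0`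
    have ra : ContDiff ℝ ∞ fun p : ℝ × ℝ => (1 - p.1) * (1 - p.2) := by fun_prop
    have rb : ContDiff ℝ ∞ fun p : ℝ × ℝ => (1 - p.1) * (1 - p.2) + p.2 := by fun_prop
    refine (LegHomotopic.of_family (h := fun p : ℝ × ℝ => levelFlow F L (p.2 * S) ∘
      C ((1 - p.1) * (1 - p.2)) ∘ C' ((1 - p.1) * (1 - p.2) + p.2) ∘ C p.2) ?_ ?_ ?_ ?_).congr ?_ ?_
    · exact (isContactFamily_levelFlow_mul hF L (by fun_prop)).comp
        ((h1.reparam ra fun _ _ => mem_univ _).comp ((h1'.reparam rb fun _ _ => mem_univ _).comp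
          (h1.reparam contDiff_snd fun _ _ => mem_univ _)))
    · exact ((hF.hasCompactSupp_levelFlow L).reparam_univ _).comp ((hs.reparam_univ _).comp
        ((hs'.reparam_univ _).comp (hs.reparam_univ _)))
    · intro s
      simp only [zero_mul, hF.levelFlow_zero, h0, comp_id, id_comp, add_zero]
      exact (hi _).2.comp_eq_id
    · intro s _
      simp
    · intro t _
      simp only [sub_zero, one_mul, sub_add_cancel, image_comp, hΔ]
    · intro t _
      simp only [sub_self, zero_mul, zero_add, h0, (hi t).1.comp_eq_id, comp_id,
        hF.levelFlow_diagonal]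

/-- If no positive loop based at the diagonal is contractible, the Reeb translates of the diagonal
lying above a given class are bounded from below: otherwise, going from the diagonal to the graph,
then up to a very negative Reeb translate and back along the Reeb flow would be, after adding the
speeds, a positive contractible loop. -/
theorem NonnegTo.bddBelow [FiniteDimensional ℝ E] [T2Space N] [CompactSpace N]
    (hF : IsSmoothReebFlow α F) (hord : StronglyOrderable α) (f : ContactIsotopy α) :
    ∃ S : ℝ, ∀ T, NonnegTo F f T → S ≤ T := by
  obtain ⟨C, C', h1, h1', hi, hconf, h0, hs, hΔ⟩ := exists_cutoff_isotopy hF f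
  have hs' : HasCompactSupp univ C' := hs.inv fun a _ => (hi a).1
  obtain ⟨S, hS⟩ := exists_speed_bound_of_hasCompactSupp (productForm_isSmooth hF.contact.smooth) h1 hs
  refine ⟨-S, fun T hT => not_lt.1 fun hTS => hord ?_⟩
  -- the loop is `K_{-tT} C_t C_1⁻¹ ψ_t C_1`, where `K` is a cut-off of the Reeb flow of `β`
  obtain ⟨ψ, k1, k2, k3, k4, k5⟩ := hT
  have c1 : IsContactFamily (productForm α) univ fun _ : ℝ => C 1 :=
    isContactFamily_const h1 (mem_univ _)
  have hψC : IsContactFamily (productForm α) univ fun t : ℝ => ψ t ∘ C 1 := k1.comp c1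
  have hDψ : IsContactFamily (productForm α) univ fun t : ℝ => C' 1 ∘ ψ t ∘ C 1 :=
    (isContactFamily_const h1' (mem_univ _)).comp hψC
  have hD : IsContactFamily (productForm α) univ fun t : ℝ => C t ∘ C' 1 ∘ ψ t ∘ C 1 := h1.comp hDψ
  obtain ⟨L, hL⟩ := exists_levelCutoff_eq_one hD (isCompact_diagonal (N := N))
  have hχ : IsContactFamily (productForm α) univ
      fun t : ℝ => levelFlow F L (t * -T) ∘ C t ∘ C' 1 ∘ ψ t ∘ C 1 :=
    (isContactFamily_levelFlow_mul hF L (by fun_prop)).comp hD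
  have hχ0 : levelFlow F L (0 * -T) ∘ C 0 ∘ C' 1 ∘ ψ 0 ∘ C 1 = id := by
    rw [zero_mul, hF.levelFlow_zero, h0, k3, id_comp, id_comp, id_comp]
    exact (hi 1).1.comp_eq_id
  refine ⟨ContactIsotopy.ofFamily hχ hχ0, ?_, fun t ht x hx => ?_, ?_⟩
  · exact ((hF.hasCompactSupp_levelFlow L).reparam_univ _).comp ((hs.reparam_univ id).comp
      ((hs'.reparam_univ fun _ => 1).comp ((k2.reparam_univ id).comp (hs.reparam_univ fun _ => 1))))
  · have e1 := (contactSpeed_eq_speed_of_family hχ ht x).trans (hF.speed_levelFlow_comp L (-T) hD t x)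
    refine lt_of_lt_of_eq ?_ e1.symm
    rw [hL t ht x hx]
    obtain ⟨c, hc, hc'⟩ := hconf t (C' 1 (ψ t (C 1 x)))
    have e2 := speed_comp (σ := productForm α) (φ := C) (ψ := fun t => C' 1 ∘ ψ t ∘ C 1) (t := t)
      (x := x) (c := c) (h1.mdiff_uncurry _) (hDψ.mdiff_curve t x) hc'
    obtain ⟨d, hd, hd'⟩ := (hconf 1).inv (hi 1).2 (h1.mdiff_apply 1) (h1'.mdiff_apply 1) (ψ t (C 1 x))
    have e3 : speed (productForm α) (fun t => C' 1 ∘ ψ t ∘ C 1) t x =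
        d * speed (productForm α) ψ t (C 1 x) := by
      simp only [speed, comp_apply]
      rw [vel_comp (f := C' 1) (c := fun s => ψ s (C 1 x)) (h1'.mdiff_apply 1 _)
        (k1.mdiff_curve t _), hd']
    have e4 : 0 ≤ speed (productForm α) ψ t (C 1 x) := by
      refine k4 t ht _ ?_
      rw [← f.ext_of_one_le le_rfl, ← hΔ]
      exact mem_image_of_mem _ hx
    have e5 := abs_le.1 (hS t ht (C' 1 (ψ t (C 1 x))))
    have e6 : 0 ≤ c * (d * speed (productForm α) ψ t (C 1 x)) := by positivity
    have e7 : speed (productForm α) (fun t => C t ∘ C' 1 ∘ ψ t ∘ C 1) t x =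
        speed (productForm α) C t (C' 1 (ψ t (C 1 x))) + c * (d * speed (productForm α) ψ t (C 1 x)) := by
      rw [← e3]; exact e2
    rw [e7]
    linarith [e5.1]
  · -- replacing `C_1⁻¹ ψ_t C_1` by `C_u⁻¹ ψ_t C_u`, with `u` going from `1` to `t`, leads to
    -- `K_{-tT} ψ_t C_t`
    have ru : ContDiff ℝ ∞ fun p : ℝ × ℝ => (1 - p.1) + p.1 * p.2 := by fun_prop
    refine LegHomotopic.trans (Q := fun t => levelFlow F L (t * -T) '' (ψ t '' graphSet α F (f.ext t)))
      ((LegHomotopic.of_family (h := fun p : ℝ × ℝ => levelFlow F L (p.2 * -T) ∘ C p.2 ∘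
        C' ((1 - p.1) + p.1 * p.2) ∘ ψ p.2 ∘ C ((1 - p.1) + p.1 * p.2)) ?_ ?_ ?_ ?_).congr ?_ ?_)
      ((k5.mul_left (φ := fun t => levelFlow F L (t * -T))
        (isContactFamily_levelFlow_mul hF L (by fun_prop))
        ((hF.hasCompactSupp_levelFlow L).reparam_univ _)
        (by simp [hF.levelFlow_zero])).congr (fun _ _ => rfl) ?_)
    · exact (isContactFamily_levelFlow_mul hF L (by fun_prop)).comp
        ((h1.reparam contDiff_snd fun _ _ => mem_univ _).comp
          ((h1'.reparam ru fun _ _ => mem_univ _).comp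
            ((k1.reparam contDiff_snd fun _ _ => mem_univ _).comp
              (h1.reparam ru fun _ _ => mem_univ _))))
    · exact ((hF.hasCompactSupp_levelFlow L).reparam_univ _).comp ((hs.reparam_univ _).comp
        ((hs'.reparam_univ _).comp ((k2.reparam_univ _).comp (hs.reparam_univ _))))
    · intro s
      simp only [zero_mul, hF.levelFlow_zero, h0, k3, id_comp, mul_zero, add_zero]
      exact (hi _).1.comp_eq_id
    · intro s _
      simp
    · intro t _
      simp [ContactIsotopy.ofFamily]
    · intro t _
      simp only [sub_self, zero_add, one_mul, image_comp, hΔ]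
      rw [← hΔ, LeftInverse.image_image (hi t).2]
    · intro t _
      rw [← hF.levelFlow_diagonal L, mul_neg]
      exact (hF.levelFlow_neg L _).1.image_image _

/-- The infimum defining `C_+` is over a non-empty set. -/
theorem cPlus_ne_top [FiniteDimensional ℝ E] [T2Space N] [CompactSpace N]
    (hF : IsSmoothReebFlow α F) (φ : UCont α) : CPlus φ ≠ ⊤ := by
  obtain ⟨f, rfl⟩ := Quot.exists_rep φ
  obtain ⟨T, hT⟩ := exists_nonnegTo hF f
  change CPlus (UCont.mk f) ≠ ⊤
  rw [cPlus_mk hF]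
  exact ne_top_of_le_ne_top (EReal.coe_ne_top T) (sInf_le ⟨T, rfl, hT⟩)

/-- The infimum defining `C_+` is over a set bounded from below. -/
theorem cPlus_ne_bot [FiniteDimensional ℝ E] [T2Space N] [CompactSpace N]
    (hF : IsSmoothReebFlow α F) (hord : StronglyOrderable α) (φ : UCont α) : CPlus φ ≠ ⊥ := by
  obtain ⟨f, rfl⟩ := Quot.exists_rep φ
  obtain ⟨S, hS⟩ := NonnegTo.bddBelow hF hord f
  change CPlus (UCont.mk f) ≠ ⊥
  rw [cPlus_mk hF]
  refine ne_bot_of_le_ne_bot (EReal.coe_ne_bot S) (le_sInf ?_)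
  rintro _ ⟨T, rfl, hT⟩
  exact EReal.coe_le_coe_iff.2 (hS T hT)

end Finiteness

/-! ### Conjugation invariance -/

section Conjugation

variable {E : Type*} [NormedAddCommGroup E] [NormedSpace ℝ E]
  {H : Type*} [TopologicalSpace H] {I : ModelWithCorners ℝ E H} [I.Boundaryless]
  {N : Type*} [TopologicalSpace N] [ChartedSpace H N] [IsManifold I ∞ N] {α : DForm I N 1}
  {A : Type*} [NormedAddCommGroup A] [NormedSpace ℝ A] {F : ℝ → N → N}

/-- The lift `(x₁, x₂, θ) ↦ (φ(x₁), φ(x₂), θ + log λ(x₂) - log λ(x₁))` of a contactomorphism `φ`,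
`φ^* α = λ α`, to the contact product. -/
def productLift (α : DForm I N 1) (F : ℝ → N → N) (φ : N → N) (p : N × N × ℝ) : N × N × ℝ :=
  (φ p.1, φ p.2.1, p.2.2 + Real.log (confCoeff α F φ p.2.1) - Real.log (confCoeff α F φ p.1))

namespace IsSmoothReebFlow

variable (hF : IsSmoothReebFlow α F)

include hF

theorem confCoeff_comp {φ ψ : N → N} (hφ : IsConformal α φ) (dφ : MDifferentiable I I φ)
    (dψ : MDifferentiable I I ψ) (x : N) :
    confCoeff α F (φ ∘ ψ) x = confCoeff α F φ (ψ x) * confCoeff α F ψ x := by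
  obtain ⟨a, ha, h1⟩ := hφ (ψ x)
  rw [hF.confCoeff_eq_of h1, confCoeff, show φ ∘ ψ = fun y => φ (ψ y) from rfl,
    mdf_comp (dφ _) (dψ _), h1]
  rfl

theorem confCoeff_pos_of_isConformal {φ : N → N} (hφ : IsConformal α φ) (x : N) :
    0 < confCoeff α F φ x := by
  obtain ⟨a, ha, h1⟩ := hφ x
  rwa [hF.confCoeff_eq_of h1]

theorem log_confCoeff_comp {φ ψ : N → N} (hφ : IsConformal α φ) (hψ : IsConformal α ψ)
    (dφ : MDifferentiable I I φ) (dψ : MDifferentiable I I ψ) (x : N) :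
    Real.log (confCoeff α F (φ ∘ ψ) x) =
      Real.log (confCoeff α F φ (ψ x)) + Real.log (confCoeff α F ψ x) := by
  rw [hF.confCoeff_comp hφ dφ dψ, Real.log_mul (hF.confCoeff_pos_of_isConformal hφ _).ne'
    (hF.confCoeff_pos_of_isConformal hψ _).ne']

theorem log_confCoeff_inv {φ ψ : N → N} (hφ : IsConformal α φ) (hψ : IsConformal α ψ)
    (dφ : MDifferentiable I I φ) (dψ : MDifferentiable I I ψ) (h : LeftInverse ψ φ) (x : N) :
    Real.log (confCoeff α F ψ (φ x)) = -Real.log (confCoeff α F φ x) := by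
  have := hF.log_confCoeff_comp hψ hφ dψ dφ x
  rw [h.comp_eq_id, hF.confCoeff_id, Real.log_one] at this
  linarith

theorem productLift_id : productLift α F id = id := by
  funext p
  simp [productLift, hF.confCoeff_id]

theorem productLift_leftInverse {φ ψ : N → N} (hφ : IsConformal α φ) (hψ : IsConformal α ψ)
    (dφ : MDifferentiable I I φ) (dψ : MDifferentiable I I ψ) (h : LeftInverse ψ φ) :
    LeftInverse (productLift α F ψ) (productLift α F φ) := fun p => by
  simp only [productLift, h p.1, h p.2.1, hF.log_confCoeff_inv hφ hψ dφ dψ h]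
  ext <;> simp
  ring

theorem contMDiff_productLift {G : A → N → N} (hG : IsContactFamily α univ G)
    (hc : ∀ a, IsConformal α (G a)) :
    ContMDiff (𝓘(ℝ, A).prod (cpModel I)) (cpModel I) ∞ (uncurry fun a => productLift α F (G a)) := by
  have hlog : ContMDiff (𝓘(ℝ, A).prod I) 𝓘(ℝ, ℝ) ∞
      (fun q : A × N => Real.log (confCoeff α F (G q.1) q.2)) := fun q =>
    ContMDiffAt.comp q (g := Real.log)
      (Real.contDiffAt_log.2 (hF.confCoeff_pos_of_isConformal (hc _) _).ne').contMDiffAt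
      (hF.contMDiff_confCoeff hG.contMDiff q)
  have h1 : ContMDiff (𝓘(ℝ, A).prod (cpModel I)) (𝓘(ℝ, A).prod I) ∞
      (fun q : A × N × N × ℝ => (q.1, q.2.1)) :=
    contMDiff_fst.prodMk (contMDiff_fst.comp contMDiff_snd)
  have h2 : ContMDiff (𝓘(ℝ, A).prod (cpModel I)) (𝓘(ℝ, A).prod I) ∞
      (fun q : A × N × N × ℝ => (q.1, q.2.2.1)) :=
    contMDiff_fst.prodMk (contMDiff_fst.comp (contMDiff_snd.comp contMDiff_snd))
  have h3 : ContMDiff (𝓘(ℝ, A).prod (cpModel I)) 𝓘(ℝ, ℝ) ∞ (fun q : A × N × N × ℝ => q.2.2.2) :=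
    contMDiff_snd.comp (contMDiff_snd.comp contMDiff_snd)
  exact (hG.contMDiff.comp h1).prodMk ((hG.contMDiff.comp h2).prodMk
    ((h3.add (hlog.comp h2)).sub (hlog.comp h1)))

/-- The lift of `φ` pulls `β` back to `λ(x₂) β`. -/
theorem productLift_ev_mdf {G : A → N → N} (hG : IsContactFamily α univ G)
    (hc : ∀ a, IsConformal α (G a)) (a : A) (p : N × N × ℝ) (u : E × E × ℝ) :
    (productForm α).ev (productLift α F (G a) p)
      (mdf (cpModel I) (cpModel I) (productLift α F (G a)) p u) =
      confCoeff α F (G a) p.2.1 * (productForm α).ev p u := by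
  obtain ⟨c, hcs, rfl, rfl⟩ := exists_curve (I := cpModel I) p u
  have hcd : MDifferentiableAt 𝓘(ℝ, ℝ) (cpModel I) c 0 := hcs.mdifferentiableAt (by simp)
  have hm : MDifferentiableAt (cpModel I) (cpModel I) (productLift α F (G a)) (c 0) :=
    (slice_right (f := fun a => productLift α F (G a))
      (hF.contMDiff_productLift hG hc (a, c 0))).mdifferentiableAt (by simp)
  have h1 : MDifferentiableAt 𝓘(ℝ, ℝ) I (fun s => (c s).1) 0 := hcd.fst
  have h2 : MDifferentiableAt 𝓘(ℝ, ℝ) (I.prod 𝓘(ℝ, ℝ)) (fun s => (c s).2) 0 := hcd.snd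
  have h3 : MDifferentiableAt 𝓘(ℝ, ℝ) I (fun s => (c s).2.1) 0 := h2.fst
  have key : ∀ {e : ℝ → N}, MDifferentiableAt 𝓘(ℝ, ℝ) I e 0 →
      α.ev (G a (e 0)) (vel I (fun s => G a (e s)) 0) =
        confCoeff α F (G a) (e 0) * α.ev (e 0) (vel I e 0) := fun {e} he => by
    rw [vel_comp (hG.mdiff_apply a _) he,
      hF.ev_mdf_eq_confCoeff (contact_iff.1 (hc a).contact)]
  rw [← vel_comp hm hcd, productForm_ev_vel (c := fun s => productLift α F (G a) (c s))
    (hm.comp (0 : ℝ) hcd), productForm_ev_vel hcd]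
  simp only [productLift]
  rw [key h1, key h3, Real.exp_sub, Real.exp_add,
    Real.exp_log (hF.confCoeff_pos_of_isConformal (hc a) _),
    Real.exp_log (hF.confCoeff_pos_of_isConformal (hc a) _)]
  have := (hF.confCoeff_pos_of_isConformal (hc a) (c 0).1).ne'
  field_simp

theorem isContactFamily_productLift {G G' : A → N → N} (hG : IsContactFamily α univ G)
    (hG' : IsContactFamily α univ G')
    (hi : ∀ a, LeftInverse (G' a) (G a) ∧ RightInverse (G' a) (G a))
    (hc : ∀ a, IsConformal α (G a)) :
    IsContactFamily (productForm α) univ fun a => productLift α F (G a) := by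
  have hc' : ∀ a, IsConformal α (G' a) := fun a =>
    (hc a).inv (hi a).2 (hG.mdiff_apply a) (hG'.mdiff_apply a)
  refine isContactFamily_univ_of (hF.contMDiff_productLift hG hc)
    (hF.contMDiff_productLift hG' hc') (fun a => ⟨?_, ?_⟩) fun a p => ?_
  · exact hF.productLift_leftInverse (hc a) (hc' a) (hG.mdiff_apply a) (hG'.mdiff_apply a) (hi a).1
  · exact hF.productLift_leftInverse (hc' a) (hc a) (hG'.mdiff_apply a) (hG.mdiff_apply a) (hi a).2
  · exact ⟨_, hF.confCoeff_pos_of_isConformal (hc a) _, hF.productLift_ev_mdf hG hc a p⟩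

theorem productLift_diagonal {φ ψ : N → N} (h : RightInverse ψ φ) :
    productLift α F φ '' diagonal N = diagonal N := by
  rw [diagonal, ← range_comp]
  apply Subset.antisymm
  · rintro _ ⟨x, rfl⟩
    exact ⟨φ x, by simp [productLift]⟩
  · rintro _ ⟨x, rfl⟩
    exact ⟨ψ x, by simp [productLift, h x]⟩

/-- The lift of `φ` maps the graph of `f` to the graph of `φ f φ⁻¹`. -/
theorem productLift_graphSet {φ ψ f : N → N} (hφ : IsConformal α φ) (hψ : IsConformal α ψ)
    (hf : IsConformal α f) (dφ : MDifferentiable I I φ) (dψ : MDifferentiable I I ψ)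
    (df : MDifferentiable I I f) (hl : LeftInverse ψ φ) (hr : RightInverse ψ φ) :
    productLift α F φ '' graphSet α F f = graphSet α F (φ ∘ f ∘ ψ) := by
  have key : ∀ x, productLift α F φ (x, f x, Real.log (confCoeff α F f x)) =
      (φ x, (φ ∘ f ∘ ψ) (φ x), Real.log (confCoeff α F (φ ∘ f ∘ ψ) (φ x))) := fun x => by
    rw [hF.log_confCoeff_comp hφ (hf.comp hψ df dψ) dφ (df.comp dψ),
      hF.log_confCoeff_comp hf hψ df dψ, hF.log_confCoeff_inv hφ hψ dφ dψ hl]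
    simp only [productLift, comp_apply, hl x]
    ext <;> simp
    ring
  rw [graphSet, graphSet, ← range_comp]
  apply Subset.antisymm
  · rintro _ ⟨x, rfl⟩
    exact ⟨φ x, (key x).symm⟩
  · rintro _ ⟨x, rfl⟩
    refine ⟨ψ x, (key (ψ x)).trans ?_⟩
    rw [hr x]

end IsSmoothReebFlow

theorem HasCompactSupp.conj_const {M : Type*} [TopologicalSpace M] {K : Set A} {φ : A → M → M}
    (hφ : HasCompactSupp K φ) {w w' : M → M} (hw : Continuous w) (h : RightInverse w' w) :
    HasCompactSupp K fun a => w ∘ φ a ∘ w' := by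
  obtain ⟨C, hC, h'⟩ := hφ
  refine ⟨w '' C, hC.image hw, fun a ha x hx => ?_⟩
  have : w' x ∉ C := fun hc => hx ⟨w' x, hc, h x⟩
  simp only [comp_apply, h' a ha _ this]
  exact h x

/-- If the Reeb flow at time `T` is the identity, then conjugation changes the values of `T'` such that
a class lies below the Reeb translate of the diagonal by `T'` at most by a rescaling of `T' - T`. The
reason is that `w K_{tT} w⁻¹`, for `w` in a path from the identity to the lift of the conjugating
contactomorphism, maps the diagonal to itself at `t = 1`. -/
theorem NonnegTo.conj [FiniteDimensional ℝ E] [T2Space N] [CompactSpace N]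
    (hF : IsSmoothReebFlow α F) {f p q : ContactIsotopy α} {T ε δ : ℝ} (hT : F T = id)
    (hq : ∀ t, q.toFun t = p.toFun 1 ∘ f.toFun t ∘ p.inv.toFun 1)
    (hδ : ∀ x, ε * confCoeff α F (p.toFun 1) x ≤ δ) (h : NonnegTo F f (T + ε)) :
    NonnegTo F q (T + δ) := by
  obtain ⟨ψ, k1, k2, k3, k4, k5⟩ := h
  have hG := p.isContactFamily_ext
  obtain ⟨G', hG', hi⟩ := hG.exists_inv_univ
  have hc : ∀ a, IsConformal α (p.ext a) := hF.isConformal_of_family hG (p.ext_of_nonpos le_rfl)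
  have hc' : ∀ a, IsConformal α (G' a) := fun a =>
    (hc a).inv (hi a).2 (hG.mdiff_apply a) (hG'.mdiff_apply a)
  have hG1 : p.ext 1 = p.toFun 1 := p.ext_of_one_le le_rfl
  have hG1' : G' 1 = p.inv.toFun 1 := by
    funext x
    have := (hi 1).1 (p.inv.toFun 1 x)
    rwa [hG1, (p.inv_spec one_mem_unit).2 x] at this
  have hW : IsContactFamily (productForm α) univ fun u => productLift α F (p.ext u) :=
    hF.isContactFamily_productLift hG hG' hi hc
  have hW' : IsContactFamily (productForm α) univ fun u => productLift α F (G' u) :=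
    hF.isContactFamily_productLift hG' hG (fun a => ⟨(hi a).2, (hi a).1⟩) hc'
  have hWi : ∀ a, LeftInverse (productLift α F (G' a)) (productLift α F (p.ext a)) ∧
      RightInverse (productLift α F (G' a)) (productLift α F (p.ext a)) := fun a =>
    ⟨hF.productLift_leftInverse (hc a) (hc' a) (hG.mdiff_apply a) (hG'.mdiff_apply a) (hi a).1,
      hF.productLift_leftInverse (hc' a) (hc a) (hG'.mdiff_apply a) (hG.mdiff_apply a) (hi a).2⟩
  have hWΔ : ∀ a, productLift α F (p.ext a) '' diagonal N = diagonal N := fun a =>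
    hF.productLift_diagonal (hi a).2
  have hWΔ' : ∀ a, productLift α F (G' a) '' diagonal N = diagonal N := fun a =>
    hF.productLift_diagonal (hi a).1
  have hgraph : ∀ t, productLift α F (p.ext 1) '' graphSet α F (f.ext t) =
      graphSet α F (q.ext t) := fun t => by
    rw [hF.productLift_graphSet (hc 1) (hc' 1) (hF.isConformal_of_family f.isContactFamily_ext
      (f.ext_of_nonpos le_rfl) t) (hG.mdiff_apply 1) (hG'.mdiff_apply 1)
      (f.isContactFamily_ext.mdiff_apply t) (hi 1).1 (hi 1).2, hG1, hG1', ContactIsotopy.ext,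
      ContactIsotopy.ext, hq]
  have hgr1 : graphSet α F (q.toFun 1) =
      productLift α F (p.ext 1) '' graphSet α F (f.toFun 1) := by
    rw [← q.ext_of_one_le le_rfl, ← hgraph, f.ext_of_one_le le_rfl]
  have hfc : IsCompact (graphSet α F (f.toFun 1)) := by
    obtain ⟨C, -, h1, -, -, -, -, -, hΔ⟩ := exists_cutoff_isotopy hF f
    rw [← f.ext_of_one_le le_rfl, ← hΔ]
    exact isCompact_diagonal.image (h1.contMDiff_apply 1).continuous
  -- the non-negative isotopy is `K'_{tδ} W K_{-tε} ψ_t W⁻¹`, with cut-offs `K`, `K'` of the Reeb flow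
  set W := productLift α F (p.ext 1) with hWdef
  set W' := productLift α F (G' 1) with hWdef'
  have cW : IsContactFamily (productForm α) univ fun _ : ℝ => W :=
    isContactFamily_const hW (mem_univ (1 : ℝ))
  have cW' : IsContactFamily (productForm α) univ fun _ : ℝ => W' :=
    isContactFamily_const hW' (mem_univ (1 : ℝ))
  obtain ⟨L, hL⟩ := exists_levelCutoff_eq_one k1 hfc
  have hinner : IsContactFamily (productForm α) univ fun t => levelFlow F L (t * -ε) ∘ ψ t :=
    (isContactFamily_levelFlow_mul hF L (by fun_prop)).comp k1
  have hmid : IsContactFamily (productForm α) univ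
      fun t => W ∘ (levelFlow F L (t * -ε) ∘ ψ t) ∘ W' := cW.comp (hinner.comp cW')
  obtain ⟨L', hL'⟩ := exists_levelCutoff_eq_one hmid
    (hfc.image (hW.contMDiff_apply 1).continuous)
  have hcs : HasCompactSupp univ fun t => W ∘ (levelFlow F L (t * -ε) ∘ ψ t) ∘ W' :=
    HasCompactSupp.conj_const (((hF.hasCompactSupp_levelFlow L).reparam_univ _).comp k2)
      (hW.contMDiff_apply 1).continuous (hWi 1).2
  refine ⟨fun t => levelFlow F L' (t * δ) ∘ W ∘ (levelFlow F L (t * -ε) ∘ ψ t) ∘ W',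
    (isContactFamily_levelFlow_mul hF L' (by fun_prop)).comp hmid,
    ((hF.hasCompactSupp_levelFlow L').reparam_univ _).comp hcs, ?_, fun t ht x hx => ?_, ?_⟩
  · simp only [zero_mul, hF.levelFlow_zero, k3, id_comp]
    exact (hWi 1).2.comp_eq_id
  · rw [hgr1] at hx
    have e1 := hF.speed_levelFlow_comp L' δ hmid t x
    refine le_of_le_of_eq ?_ e1.symm
    rw [hL' t ht x hx]
    obtain ⟨z, hz, rfl⟩ := hx
    have hWz : W' (W z) = z := (hWi 1).1 z
    have e2 := hF.speed_levelFlow_comp L (-ε) k1 t z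
    rw [hL t ht z hz] at e2
    have e3 : speed (productForm α) (fun t => W ∘ (levelFlow F L (t * -ε) ∘ ψ t) ∘ W') t (W z) =
        confCoeff α F (p.ext 1) (levelFlow F L (t * -ε) (ψ t z)).2.1 *
          speed (productForm α) (fun t => levelFlow F L (t * -ε) ∘ ψ t) t z := by
      simp only [speed, comp_apply, hWz]
      rw [vel_comp (f := W) (c := fun s => levelFlow F L (s * -ε) (ψ s z)) (hW.mdiff_apply 1 _)
        (hinner.mdiff_curve t z), hF.productLift_ev_mdf hG hc]
    rw [e3, e2]
    have h4 := k4 t ht z hz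
    set c := confCoeff α F (p.ext 1) (levelFlow F L (t * -ε) (ψ t z)).2.1 with hcdef
    have hcpos : 0 < c := hF.confCoeff_pos_of_isConformal (hc 1) _
    have hcδ : ε * c ≤ δ := by
      rw [hcdef, hG1]
      exact hδ _
    nlinarith [mul_nonneg hcpos.le h4]
  · -- the path `W K_{tT}(Δ)` is deformed to `K_{tT}(Δ)` through `W_u K_{tT} W_u⁻¹(Δ)`, with `u` going
    -- from `1` to `0`; at `t = 1` these are all equal to `Δ`, because `F T = id`
    have s1 : LegHomotopic (productForm α) (diagonal N)
        (fun t => (levelFlow F L (t * -ε) ∘ ψ t) '' graphSet α F (f.ext t))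
        (fun t => graphSet α F (F (t * T))) := by
      refine (k5.mul_left (φ := fun t => levelFlow F L (t * -ε))
        (isContactFamily_levelFlow_mul hF L (by fun_prop))
        ((hF.hasCompactSupp_levelFlow L).reparam_univ _) (by simp [hF.levelFlow_zero])).congr
        (fun t _ => by rw [image_comp]) fun t _ => ?_
      rw [← hF.levelFlow_diagonal L, ← hF.levelFlow_diagonal L, ← image_comp]
      congr 1
      funext x
      rw [comp_apply, ← hF.levelFlow_add]
      congr 1; ring
    have s2 := s1.conj hW hW' hWi (u := 1) (hWΔ' 1)
    have s3 : LegHomotopic (productForm α) (diagonal N) (fun t => W '' graphSet α F (F (t * T)))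
        (fun t => graphSet α F (F (t * T))) := by
      have ru : ContDiff ℝ ∞ fun a : ℝ × ℝ => 1 - a.1 := by fun_prop
      have key : ∀ (a t : ℝ), productLift α F (p.ext a) ∘ levelFlow F 0 (t * T) ∘
          productLift α F (G' a) '' diagonal N =
          productLift α F (p.ext a) '' graphSet α F (F (t * T)) := fun a t => by
        rw [image_comp, image_comp, hWΔ', hF.levelFlow_diagonal]
      refine ⟨fun a => productLift α F (p.ext (1 - a.1)) ∘ levelFlow F 0 (a.2 * T) ∘
        productLift α F (G' (1 - a.1)), ?_, ?_, fun s hs => ⟨?_, ?_⟩, fun t ht => ⟨?_, ?_⟩⟩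
      · exact (hW.reparam ru fun _ _ => mem_univ _).comp
          ((isContactFamily_levelFlow_mul hF 0 (by fun_prop)).comp
            (hW'.reparam ru fun _ _ => mem_univ _))
      · exact ((hF.hasCompactSupp_levelFlow 0).reparam_univ fun a : ℝ × ℝ => a.2 * T).conj
          isCompact_unitSquare (fun a _ => hWi _)
          (hW.reparam ru fun _ _ => mem_univ _).contMDiff.continuous.continuousOn
      · simp only [zero_mul, hF.levelFlow_zero, id_comp]
        exact (hWi _).2.comp_eq_id
      · refine (key (1 - s) 1).trans ?_
        simp only [one_mul, hT, hF.graphSet_id, hWΔ]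
        exact (hWΔ 1).symm
      · refine (key (1 - 0) t).trans ?_
        rw [sub_zero]
      · refine (key (1 - 1) t).trans ?_
        rw [sub_self, p.ext_of_nonpos le_rfl, hF.productLift_id, image_id]
    refine ((s2.trans s3).mul_left (φ := fun t => levelFlow F L' (t * δ))
      (isContactFamily_levelFlow_mul hF L' (by fun_prop))
      ((hF.hasCompactSupp_levelFlow L').reparam_univ _) (by simp [hF.levelFlow_zero])).congr
      (fun t _ => ?_) fun t _ => ?_
    · beta_reduce
      simp only [← hgraph, image_comp]
      rw [LeftInverse.image_image (hWi 1).1]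
    · rw [← hF.levelFlow_diagonal L', ← hF.levelFlow_diagonal L', ← image_comp]
      congr 1
      funext x
      rw [comp_apply, ← hF.levelFlow_add]
      congr 1; ring

/-- Upper bounds for `C_+` by periods of the Reeb flow are invariant under conjugation. -/
theorem cPlus_conj_le [FiniteDimensional ℝ E] [T2Space N] [CompactSpace N]
    (hF : IsSmoothReebFlow α F) {T : ℝ} (hT : F T = id) {φ ψ : UCont α} (h : CPlus φ ≤ T) :
    CPlus (ψ * φ * ψ⁻¹) ≤ T := by
  obtain ⟨f, rfl⟩ := Quot.exists_rep φ
  obtain ⟨p, rfl⟩ := Quot.exists_rep ψ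
  change CPlus (UCont.mk f) ≤ T at h
  change CPlus (UCont.mk ((p.mul f).mul p.inv)) ≤ T
  have hfam : IsContactFamily α (Icc (0 : ℝ) 1) fun t => p.toFun 1 ∘ f.toFun t ∘ p.inv.toFun 1 :=
    (isContactFamily_const p.isContactFamily one_mem_unit).comp (f.isContactFamily.comp
      (isContactFamily_const p.inv.isContactFamily one_mem_unit))
  set q : ContactIsotopy α := ⟨fun t => p.toFun 1 ∘ f.toFun t ∘ p.inv.toFun 1, hfam, by
    rw [f.map_zero, id_comp]
    exact (p.inv_spec one_mem_unit).2.comp_eq_id⟩ with hq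
  -- conjugating with `p_u`, where `u` moves from `1` to `t`
  have hhom : q.Homotopic ((p.mul f).mul p.inv) := by
    have ru : ContDiff ℝ ∞ fun a : ℝ × ℝ => (1 - a.1) * 1 + a.1 * a.2 := by fun_prop
    have mu : MapsTo (fun a : ℝ × ℝ => (1 - a.1) * 1 + a.1 * a.2) unitSquare (Icc (0 : ℝ) 1) :=
      fun a ha => unit_convex ha.1 one_mem_unit ha.2
    refine ⟨fun a => p.toFun ((1 - a.1) * 1 + a.1 * a.2) ∘ f.toFun a.2 ∘
      p.inv.toFun ((1 - a.1) * 1 + a.1 * a.2), (p.isContactFamily.reparam ru mu).comp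
        (f.isContactFamily_snd.comp (p.inv.isContactFamily.reparam ru mu)),
      fun s hs => ⟨?_, ?_⟩, fun t ht => ⟨?_, ?_⟩⟩
    · simp only [f.map_zero, id_comp]
      exact (p.inv_spec (unit_convex hs one_mem_unit zero_mem_unit)).2.comp_eq_id
    · simp [hq]
    · simp [hq]
    · simp [ContactIsotopy.mul, comp_assoc]
  have hmk : UCont.mk ((p.mul f).mul p.inv) = UCont.mk q := (Quot.sound hhom).symm
  obtain ⟨B, hB0, hB⟩ : ∃ B : ℝ, 0 < B ∧ ∀ x, confCoeff α F (p.toFun 1) x ≤ B := by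
    have hc : Continuous fun x => confCoeff α F (p.ext 1) x :=
      (hF.contMDiff_confCoeff p.isContactFamily_ext.contMDiff).continuous.comp
        (continuous_const.prodMk continuous_id)
    rw [p.ext_of_one_le le_rfl] at hc
    obtain ⟨B, hB⟩ := isCompact_univ.exists_bound_of_continuousOn hc.continuousOn
    exact ⟨max B 1, by positivity, fun x =>
      (le_abs_self _).trans ((hB x (mem_univ x)).trans (le_max_left _ _))⟩
  rw [hmk]
  refine le_of_forall_gt fun c hc => ?_
  obtain ⟨c', hTc', hc'⟩ := EReal.lt_iff_exists_real_btwn.1 hc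
  have hη : 0 < c' - T := sub_pos.2 (EReal.coe_lt_coe_iff.1 hTc')
  have h1 : CPlus (UCont.mk f) < ((T + (c' - T) / B : ℝ) : EReal) := h.trans_lt
    (EReal.coe_lt_coe_iff.2 (lt_add_of_pos_right _ (div_pos hη hB0)))
  rw [cPlus_mk hF, sInf_lt_iff] at h1
  obtain ⟨_, ⟨T', rfl, hT'⟩, hlt⟩ := h1
  have hlt' : T' - T ≤ (c' - T) / B := by linarith [EReal.coe_lt_coe_iff.1 hlt]
  have h2 : NonnegTo F q (T + (c' - T)) := by
    refine NonnegTo.conj hF hT (p := p) (ε := T' - T) (fun t => rfl) (fun x => ?_)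
      (by rwa [add_sub_cancel])
    have hx := p.confCoeff_pos hF one_mem_unit x
    calc (T' - T) * confCoeff α F (p.toFun 1) x
        ≤ (c' - T) / B * confCoeff α F (p.toFun 1) x := by gcongr
      _ ≤ (c' - T) / B * B := by gcongr; exact hB x
      _ = c' - T := by field_simp
  rw [cPlus_mk hF]
  refine lt_of_le_of_lt (sInf_le ⟨_, rfl, h2⟩) ?_
  rwa [add_sub_cancel]

theorem UCont.inv_mul_conj (φ ψ : UCont α) : ψ⁻¹ * (ψ * φ * ψ⁻¹) * ψ⁻¹⁻¹ = φ := by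
  obtain ⟨f, rfl⟩ := Quot.exists_rep φ
  obtain ⟨p, rfl⟩ := Quot.exists_rep ψ
  refine Quot.sound (ContactIsotopy.Homotopic.of_eqOn (f := (p.inv.mul ((p.mul f).mul p.inv)).mul
    p.inv.inv) fun t ht => ?_)
  have h1 := p.inv_spec ht
  have h2 := p.inv.inv_spec ht
  funext x
  simp only [ContactIsotopy.mul, comp_apply]
  rw [h2.2, h1.1]

theorem ceilMul_le_of_le_ceilMul {T x y : ℝ} (hT : 0 < T) (h : x ≤ ceilMul T y) :
    ceilMul T x ≤ ceilMul T y := by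
  refine mul_le_mul_of_nonneg_left ?_ hT.le
  refine Int.cast_le.2 (Int.ceil_le.2 ?_)
  rw [div_le_iff₀ hT, mul_comm]
  exact h

theorem le_ceilMul {T x : ℝ} (hT : 0 < T) : x ≤ ceilMul T x := by
  rw [ceilMul, mul_comm, ← div_le_iff₀ hT]
  exact Int.le_ceil _

theorem IsSmoothReebFlow.ceilMul_eq_id (hF : IsSmoothReebFlow α F) {T : ℝ} (hT : F T = id) (x : ℝ) :
    F (ceilMul T x) = id := by
  have hn : ∀ n : ℕ, F (n * T) = id := fun n => by
    induction n with
    | zero => funext x; simp [hF.map_zero]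
    | succ n ih =>
      funext x
      rw [Nat.cast_succ, add_mul, one_mul, hF.add, hT, ih]; rfl
  rw [ceilMul, mul_comm]
  obtain ⟨n, hn' | hn'⟩ := Int.eq_nat_or_neg ⌈x / T⌉
  · rw [hn']; exact_mod_cast hn n
  · funext y
    have h := hF.add (-(n * T)) (n * T) y
    rw [neg_add_cancel, hF.map_zero, hn n] at h
    rw [hn']
    push_cast
    rw [neg_mul]
    exact h.symm

/-- If the Reeb flow is periodic of period `T`, then `C_+`, rounded up to a multiple of `T`, is
invariant under conjugation. -/
theorem ceilMul_cPlus_conj [FiniteDimensional ℝ E] [T2Space N] [CompactSpace N]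
    (hF : IsSmoothReebFlow α F) (hord : StronglyOrderable α) {T : ℝ} (hT : 0 < T) (hFT : F T = id)
    (φ ψ : UCont α) :
    ceilMul T (CPlus (ψ * φ * ψ⁻¹)).toReal = ceilMul T (CPlus φ).toReal := by
  have hle : ∀ φ ψ : UCont α,
      ceilMul T (CPlus (ψ * φ * ψ⁻¹)).toReal ≤ ceilMul T (CPlus φ).toReal := fun φ ψ => by
    refine ceilMul_le_of_le_ceilMul hT ?_
    have h1 : CPlus φ ≤ ((ceilMul T (CPlus φ).toReal : ℝ) : EReal) := by
      conv_lhs => rw [← EReal.coe_toReal (cPlus_ne_top hF φ) (cPlus_ne_bot hF hord φ)]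
      exact EReal.coe_le_coe_iff.2 (le_ceilMul hT)
    have h2 := cPlus_conj_le hF (hF.ceilMul_eq_id hFT _) (ψ := ψ) h1
    rw [← EReal.coe_toReal (cPlus_ne_top hF (ψ * φ * ψ⁻¹)) (cPlus_ne_bot hF hord _)] at h2
    exact EReal.coe_le_coe_iff.1 h2
  refine le_antisymm (hle φ ψ) ?_
  have := hle (ψ * φ * ψ⁻¹) ψ⁻¹
  rwa [UCont.inv_mul_conj] at this

end Conjugation

/-! ### Coverings compatible with contact forms -/

section Coverings

variable {E : Type*} [NormedAddCommGroup E] [NormedSpace ℝ E]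
  {H : Type*} [TopologicalSpace H] {I : ModelWithCorners ℝ E H}
  {M : Type*} [TopologicalSpace M] [ChartedSpace H M]
  {N : Type*} [TopologicalSpace N] [ChartedSpace H N]
  {E' : Type*} [NormedAddCommGroup E'] [NormedSpace ℝ E']
  {H' : Type*} [TopologicalSpace H'] {J : ModelWithCorners ℝ E' H'}
  {B : Type*} [TopologicalSpace B] [ChartedSpace H' B]
  {π : M → N} {α : DForm I M 1} {α' : DForm I N 1}

/-- `π` is a finite covering by a local diffeomorphism, and it pulls `α'` back to `α`. Finiteness is
encoded by properness, and local invertibility by smooth local sections through all points. -/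
structure IsFormCovering (π : M → N) (α : DForm I M 1) (α' : DForm I N 1) : Prop where
  isLocalHomeomorph : IsLocalHomeomorph π
  isProperMap : IsProperMap π
  surjective : Surjective π
  contMDiff : ContMDiff I I ∞ π
  exists_section : ∀ x, ∃ ℓ : N → M, ContMDiffAt I I ∞ ℓ (π x) ∧ ℓ (π x) = x ∧
    ∀ᶠ y in 𝓝 (π x), π (ℓ y) = y
  pull_eq : DForm.pull π α' = α

namespace IsFormCovering

variable (hπ : IsFormCovering π α α')

include hπ

theorem isCoveringMap [T2Space M] [T1Space N] : IsCoveringMap π := by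
  rw [isCoveringMap_iff_isCoveringMapOn_univ]
  refine hπ.isProperMap.isClosedMap.isCoveringMapOn_of_isLocalHomeomorphOn (fun y _ => ?_)
    (hπ.isLocalHomeomorph.isLocalHomeomorphOn.mono (subset_univ _))
  refine (hπ.isProperMap.isCompact_preimage isCompact_singleton).finite ?_
  refine (hπ.isLocalHomeomorph.isLocalHomeomorphOn.mono (subset_univ _)).isDiscrete_of_image ?_
  exact Set.Subsingleton.isDiscrete fun a ha b hb => by
    obtain ⟨_, h1, rfl⟩ := ha
    obtain ⟨_, h2, rfl⟩ := hb
    exact h1.trans h2.symm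

theorem mdiff : MDifferentiable I I π := hπ.contMDiff.mdifferentiable (by simp)

theorem section_eventually {x : M} {ℓ : N → M} (h1 : ContinuousAt ℓ (π x)) (h2 : ℓ (π x) = x)
    (h3 : ∀ᶠ y in 𝓝 (π x), π (ℓ y) = y) : ∀ᶠ z in 𝓝 x, ℓ (π z) = z := by
  obtain ⟨U, hU, hxU, hinj⟩ := hπ.isLocalHomeomorph.isLocallyInjective x
  have hc := hπ.contMDiff.continuous.continuousAt (x := x)
  have h4 : ∀ᶠ z in 𝓝 x, ℓ (π z) ∈ U := by
    have : Filter.Tendsto (fun z => ℓ (π z)) (𝓝 x) (𝓝 (ℓ (π x))) := h1.tendsto.comp hc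
    rw [h2] at this
    exact this (hU.mem_nhds hxU)
  filter_upwards [h4, hc.eventually h3, hU.mem_nhds hxU] with z hz h5 hzU
  exact hinj hz hzU h5

/-- A continuous lift of a smooth map is smooth. -/
theorem contMDiffOn_lift {s : Set B} {g : B → M} (hg : ContinuousOn g s)
    (h : ContMDiffOn J I ∞ (fun b => π (g b)) s) : ContMDiffOn J I ∞ g s := by
  intro b hb
  obtain ⟨ℓ, h1, h2, h3⟩ := hπ.exists_section (g b)
  have h4 := hπ.section_eventually h1.continuousAt h2 h3
  have h5 : ContMDiffWithinAt J I ∞ (fun b => ℓ (π (g b))) s b :=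
    ContMDiffAt.comp_contMDiffWithinAt b (g := ℓ) h1 (h b hb)
  refine h5.congr_of_eventuallyEq ?_ h2.symm
  filter_upwards [(hg b hb).eventually h4] with b' hb'
  exact hb'.symm

theorem ev_mdf (x : M) (u : E) : α'.ev (π x) (mdf I I π x u) = α.ev x u := by
  rw [← hπ.pull_eq, DForm.ev_pull]

theorem ev_vel {c : ℝ → M} {t : ℝ} (hc : MDifferentiableAt 𝓘(ℝ, ℝ) I c t) :
    α'.ev (π (c t)) (vel I (fun s => π (c s)) t) = α.ev (c t) (vel I c t) := by
  rw [vel_comp (hπ.mdiff _) hc, hπ.ev_mdf]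

theorem mdf_surjective (x : M) : Surjective (mdf I I π x) := by
  obtain ⟨ℓ, h1, h2, h3⟩ := hπ.exists_section x
  have h4 : (fun z => π (ℓ z)) =ᶠ[𝓝 (π x)] fun z => z := h3
  intro v
  refine ⟨mdf I I ℓ (π x) v, ?_⟩
  have h5 := mdf_comp (hπ.mdiff (ℓ (π x))) (h1.mdifferentiableAt (by simp)) v
  rw [h4.mdf_eq, mdf_id, h2] at h5
  exact h5.symm

section ContactForm

variable [I.Boundaryless] [IsManifold I ∞ M] [IsManifold I ∞ N]

theorem isSmooth [FiniteDimensional ℝ E] (hα : α.IsSmooth) : α'.IsSmooth := by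
  refine DForm.isSmooth_of_ev_vel fun Γ y hΓ => ?_
  obtain ⟨x, hx⟩ := hπ.surjective (Γ y 0)
  obtain ⟨ℓ, h1, h2, h3⟩ := hπ.exists_section x
  rw [hx] at h1 h3
  have h4 : ContMDiffAt (𝓘(ℝ, E).prod 𝓘(ℝ, ℝ)) I ∞ (uncurry fun y τ => ℓ (Γ y τ)) (y, 0) :=
    ContMDiffAt.comp (y, (0 : ℝ)) (g := ℓ) (f := uncurry Γ) h1 hΓ
  refine (contMDiffAt_ev_vel hα (g := fun _ => 0) h4 contMDiffAt_const).congr_of_eventuallyEq ?_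
  have h5 : ∀ᶠ p in 𝓝 ((y, 0) : E × ℝ), ContMDiffAt (𝓘(ℝ, E).prod 𝓘(ℝ, ℝ)) I 1
      (uncurry fun y τ => ℓ (Γ y τ)) p :=
    (contMDiffAt_iff_contMDiffAt_nhds (by simp)).1 (h4.of_le (m := 1) (by simp))
  have h6 : ∀ᶠ p in 𝓝 ((y, 0) : E × ℝ), π (ℓ (Γ p.1 p.2)) = Γ p.1 p.2 :=
    hΓ.continuousAt.eventually h3
  have hm : Filter.Tendsto (fun y : E => (y, (0 : ℝ))) (𝓝 y) (𝓝 (y, 0)) :=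
    (Continuous.prodMk_left (0 : ℝ)).tendsto y
  filter_upwards [hm.eventually h5, hm.eventually h6.eventually_nhds] with z h7 h8
  have h9 : MDifferentiableAt 𝓘(ℝ, ℝ) I (fun τ => ℓ (Γ z τ)) 0 :=
    (slice_right h7).mdifferentiableAt (by simp)
  have h10 : (fun τ => π (ℓ (Γ z τ))) =ᶠ[𝓝 0] Γ z :=
    ((Continuous.prodMk_right z).tendsto (0 : ℝ)).eventually h8
  have h11 : π (ℓ (Γ z 0)) = Γ z 0 := h10.self_of_nhds
  rw [← hπ.ev_vel h9, h10.vel_eq, h11]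

theorem d_ev₂ (hα : α.IsSmooth) (hα' : α'.IsSmooth) (x : M) (u v : E) :
    α'.d.ev₂ (π x) (mdf I I π x u) (mdf I I π x v) = α.d.ev₂ x u v := by
  obtain ⟨z, hz, h0, rfl, rfl⟩ := exists_surface (I := I) x u v
  subst h0
  have e1 := deriv_ev_sub_deriv_ev hα hz
  have hz' : ContMDiffAt (𝓘(ℝ, ℝ).prod 𝓘(ℝ, ℝ)) I ∞ (uncurry fun t s => π (z t s)) (0, 0) :=
    hπ.contMDiff.contMDiffAt.comp _ hz
  have e2 := deriv_ev_sub_deriv_ev hα' hz'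
  have h5 : ∀ᶠ p in 𝓝 ((0, 0) : ℝ × ℝ), ContMDiffAt (𝓘(ℝ, ℝ).prod 𝓘(ℝ, ℝ)) I 1 (uncurry z) p :=
    (contMDiffAt_iff_contMDiffAt_nhds (by simp)).1 (hz.of_le (m := 1) (by simp))
  have h6 : (fun t => α'.ev (π (z t 0)) (vel I (fun s => π (z t s)) 0)) =ᶠ[𝓝 0]
      fun t => α.ev (z t 0) (vel I (z t) 0) := by
    filter_upwards [((Continuous.prodMk_left (0 : ℝ)).tendsto 0).eventually h5] with t ht
    exact hπ.ev_vel ((slice_right ht).mdifferentiableAt (by simp))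
  have h7 : (fun s => α'.ev (π (z 0 s)) (vel I (fun t => π (z t s)) 0)) =ᶠ[𝓝 0]
      fun s => α.ev (z 0 s) (vel I (fun t => z t s) 0) := by
    filter_upwards [((Continuous.prodMk_right (0 : ℝ)).tendsto 0).eventually h5] with s hs
    exact hπ.ev_vel ((slice_left hs).mdifferentiableAt (by simp))
  rw [h6.deriv_eq, h7.deriv_eq, e1, vel_comp (hπ.mdiff _) ((slice_left hz).mdifferentiableAt (by simp)),
    vel_comp (hπ.mdiff _) ((slice_right hz).mdifferentiableAt (by simp))] at e2
  exact e2.symm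

theorem isContactForm [FiniteDimensional ℝ E] (hα : IsContactForm α) : IsContactForm α' := by
  have hs := hπ.isSmooth hα.smooth
  refine ⟨hs, fun y hy => ?_, fun y u hu hd => ?_⟩
  · obtain ⟨x, rfl⟩ := hπ.surjective y
    refine hα.ne_zero x ?_
    refine DForm.ext_ev (σ := α) (τ := fun _ => 0) fun u => ?_
    rw [← hπ.ev_mdf]
    exact congrArg (fun ω' : E [⋀^Fin 1]→L[ℝ] ℝ => ω' ![mdf I I π x u]) hy
  · obtain ⟨x, rfl⟩ := hπ.surjective y
    obtain ⟨w, rfl⟩ := hπ.mdf_surjective x u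
    have h1 : α.ev x w = 0 := (hπ.ev_mdf x w).symm.trans hu
    have h2 : w = 0 := hα.nondegenerate x w h1 fun v hv => by
      have h3 := hd (mdf I I π x v) ((hπ.ev_mdf x v).trans hv)
      exact (hπ.d_ev₂ hα.smooth hs x w v).symm.trans h3
    rw [h2, map_zero]
    rfl

theorem isSmoothReebFlow [FiniteDimensional ℝ E] {F : ℝ → M → M} (hF : IsSmoothReebFlow α F)
    {F' : ℝ → N → N} (h : ∀ t x, F' t (π x) = π (F t x)) : IsSmoothReebFlow α' F' := by
  have hc := hπ.isContactForm hF.contact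
  refine ⟨hc, ?_, ⟨fun y => ?_, fun y t => ?_⟩, fun s t y => ?_⟩
  · rintro ⟨t, y⟩
    obtain ⟨x, rfl⟩ := hπ.surjective y
    obtain ⟨ℓ, h1, h2, h3⟩ := hπ.exists_section x
    have h4 : ContMDiffAt (𝓘(ℝ, ℝ).prod I) I ∞ (fun p : ℝ × N => π (F p.1 (ℓ p.2))) (t, π x) :=
      hπ.contMDiff.contMDiffAt.comp _ (hF.smooth.contMDiffAt.comp (t, π x)
        (contMDiffAt_fst.prodMk (ContMDiffAt.comp (t, π x) (g := ℓ) (f := Prod.snd) h1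
          contMDiffAt_snd)))
    refine h4.congr_of_eventuallyEq ?_
    filter_upwards [(continuous_snd.tendsto (t, π x)).eventually h3] with p hp
    rw [← h, hp]; rfl
  · obtain ⟨x, rfl⟩ := hπ.surjective y
    rw [h, hF.map_zero]
  · obtain ⟨x, rfl⟩ := hπ.surjective y
    have e : (fun s => F' s (π x)) = fun s => π (F s x) := funext fun s => h s x
    refine ⟨(mdf I I π (F t x) (initialField I F (F t x)) : E), ?_, ?_⟩
    · have hR := hF.reeb_spec (F t x)
      have hR' : α'.ev (π (F t x)) (mdf I I π (F t x) (initialField I F (F t x))) = 1 ∧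
          ∀ v, α'.d.ev₂ (π (F t x)) (mdf I I π (F t x) (initialField I F (F t x))) v = 0 := by
        refine ⟨by rw [hπ.ev_mdf, hR.1], fun v => ?_⟩
        obtain ⟨w, rfl⟩ := hπ.mdf_surjective (F t x) v
        rw [hπ.d_ev₂ hF.contact.smooth hc.smooth, hR.2]
      rw [← h] at hR'
      exact hR'
    · rw [e]
      refine hasMFDerivAt_of_vel (c := fun s => π (F s x)) ?_ ?_
      · exact (hπ.mdiff _).comp t (hF.mdiff_curve t x)
      · rw [vel_comp (hπ.mdiff _) (hF.mdiff_curve t x), hF.vel_eq]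
  · obtain ⟨x, rfl⟩ := hπ.surjective y
    rw [h, h, h, hF.add]

end ContactForm

end IsFormCovering

/-- The covering of contact products induced by a covering. -/
def productCover (π : M → N) (p : M × M × ℝ) : N × N × ℝ := (π p.1, π p.2.1, p.2.2)

theorem IsFormCovering.product [I.Boundaryless] [IsManifold I ∞ M] [IsManifold I ∞ N]
    (hπ : IsFormCovering π α α') :
    IsFormCovering (I := cpModel I) (productCover π) (productForm α) (productForm α') where
  isLocalHomeomorph := by
    intro p
    obtain ⟨e, he, h⟩ := hπ.isLocalHomeomorph p.1
    obtain ⟨e', he', h'⟩ := hπ.isLocalHomeomorph p.2.1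
    refine ⟨e.prod (e'.prod (OpenPartialHomeomorph.refl ℝ)), ⟨he, he', trivial⟩, ?_⟩
    funext q
    exact Prod.ext (congrFun h q.1) (Prod.ext (congrFun h' q.2.1) rfl)
  isProperMap := hπ.isProperMap.prodMap (hπ.isProperMap.prodMap isProperMap_id)
  surjective := fun q => by
    obtain ⟨x, hx⟩ := hπ.surjective q.1
    obtain ⟨y, hy⟩ := hπ.surjective q.2.1
    exact ⟨(x, y, q.2.2), by rw [productCover, hx, hy]⟩
  contMDiff := (hπ.contMDiff.comp contMDiff_fst).prodMk
    ((hπ.contMDiff.comp (contMDiff_fst.comp contMDiff_snd)).prodMk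
      (contMDiff_snd.comp contMDiff_snd))
  exists_section := fun p => by
    obtain ⟨ℓ, h1, h2, h3⟩ := hπ.exists_section p.1
    obtain ⟨ℓ', h1', h2', h3'⟩ := hπ.exists_section p.2.1
    have k2 : ContMDiffAt (cpModel I) I ∞ (fun q : N × N × ℝ => q.2.1) (productCover π p) :=
      (contMDiff_fst.comp contMDiff_snd).contMDiffAt
    refine ⟨fun q => (ℓ q.1, ℓ' q.2.1, q.2.2), ?_, ?_, ?_⟩
    · exact (ContMDiffAt.comp (productCover π p) (g := ℓ) (f := Prod.fst) h1 contMDiffAt_fst).prodMk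
        ((ContMDiffAt.comp (productCover π p) (g := ℓ') h1' k2).prodMk
          (contMDiff_snd.comp contMDiff_snd).contMDiffAt)
    · simp only [productCover, h2, h2']
    · filter_upwards [(continuous_fst.tendsto (productCover π p)).eventually h3,
        (k2.continuousAt).eventually h3'] with q hq hq'
      simp only [productCover, hq, hq']
  pull_eq := by
    funext p
    refine DForm.ext_ev fun u => ?_
    have k : MDifferentiableAt (cpModel I) (cpModel I) (productCover π) p :=
      (((hπ.contMDiff.comp contMDiff_fst).prodMk
        ((hπ.contMDiff.comp (contMDiff_fst.comp contMDiff_snd)).prodMk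
          (contMDiff_snd.comp contMDiff_snd))) p).mdifferentiableAt (by simp)
    rw [DForm.ev_pull]
    obtain ⟨c, hc, rfl, rfl⟩ := exists_curve (I := cpModel I) p u
    have hcd : MDifferentiableAt 𝓘(ℝ, ℝ) (cpModel I) c 0 := hc.mdifferentiableAt (by simp)
    have h1 : MDifferentiableAt 𝓘(ℝ, ℝ) I (fun s => (c s).1) 0 := hcd.fst
    have h2 : MDifferentiableAt 𝓘(ℝ, ℝ) (I.prod 𝓘(ℝ, ℝ)) (fun s => (c s).2) 0 := hcd.snd
    have h3 : MDifferentiableAt 𝓘(ℝ, ℝ) I (fun s => (c s).2.1) 0 := h2.fst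
    rw [← vel_comp k hcd, productForm_ev_vel (c := fun s => productCover π (c s))
      (k.comp (0 : ℝ) hcd), productForm_ev_vel hcd, ← hπ.ev_vel h1, ← hπ.ev_vel h3]
    rfl

end Coverings

/-! ### Lifts of contact families -/

section Lifts

variable {E : Type*} [NormedAddCommGroup E] [NormedSpace ℝ E]
  {H : Type*} [TopologicalSpace H] {I : ModelWithCorners ℝ E H}
  {M : Type*} [TopologicalSpace M] [ChartedSpace H M] [T2Space M]
  {N : Type*} [TopologicalSpace N] [ChartedSpace H N] [T1Space N]
  {A : Type*} [NormedAddCommGroup A] [NormedSpace ℝ A]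
  {π : M → N} {σ : DForm I M 1} {σ' : DForm I N 1}

/-- `(Φ_a)` lifts the family `(φ_a)` along `π`, for `a ∈ K`. -/
def LiftsFamily (π : M → N) (K : Set A) (Φ : A → M → M) (φ : A → N → N) : Prop :=
  ∀ a ∈ K, ∀ x, π (Φ a x) = φ a (π x)

theorem LiftsFamily.comp {K : Set A} {Φ Ψ : A → M → M} {φ ψ : A → N → N}
    (h : LiftsFamily π K Φ φ) (h' : LiftsFamily π K Ψ ψ) :
    LiftsFamily π K (fun a => Φ a ∘ Ψ a) fun a => φ a ∘ ψ a := fun a ha x => by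
  simp only [comp_apply, h a ha, h' a ha]

theorem IsContactFamily.continuousOn_curve {K : Set A} {Φ : A → M → M}
    (h : IsContactFamily σ K Φ) (x : M) : ContinuousOn (fun a => Φ a x) K :=
  h.smooth.continuousOn.comp (f := fun a => (a, x)) (by fun_prop) fun _ ha => ⟨ha, mem_univ _⟩

namespace IsFormCovering

variable (hπ : IsFormCovering π σ σ')

include hπ

theorem eqOn_lift {K : Set A} (hK : IsPreconnected K) {a₀ : A} (ha₀ : a₀ ∈ K) {g g' : A → M}
    (hg : ContinuousOn g K) (hg' : ContinuousOn g' K) (h : ∀ a ∈ K, π (g a) = π (g' a))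
    (h0 : g a₀ = g' a₀) : ∀ a ∈ K, g a = g' a :=
  hπ.isCoveringMap.eqOn_of_comp_eqOn hK hg hg' h ha₀ h0

theorem lift_unique {K : Set A} (hK : IsPreconnected K) {a₀ : A} (ha₀ : a₀ ∈ K)
    {Φ Ψ : A → M → M} {φ : A → N → N} (hΦ : IsContactFamily σ K Φ) (hΨ : IsContactFamily σ K Ψ)
    (h1 : LiftsFamily π K Φ φ) (h2 : LiftsFamily π K Ψ φ) (h0 : Φ a₀ = Ψ a₀) :
    ∀ a ∈ K, Φ a = Ψ a := fun a ha => by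
  funext x
  exact hπ.eqOn_lift hK ha₀ (hΦ.continuousOn_curve x) (hΨ.continuousOn_curve x)
    (fun b hb => (h1 b hb x).trans (h2 b hb x).symm) (congrFun h0 x) a ha

/-- Lifting a continuous family of maps over a convex set of parameters, from the identity at `a₀`,
by lifting the homotopies defined by the segments from `a₀`. -/
theorem exists_continuous_lift {K : Set A} (hK : Convex ℝ K) {a₀ : A} (ha₀ : a₀ ∈ K)
    {φ : A → N → N} (hφ : ContinuousOn (uncurry φ) (K ×ˢ univ)) (h0 : φ a₀ = id) :
    ∃ Φ : A → M → M, ContinuousOn (uncurry Φ) (K ×ˢ univ) ∧ Φ a₀ = id ∧ LiftsFamily π K Φ φ := by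
  classical
  have hseg : ∀ z : unitInterval × K × M, a₀ + (z.1 : ℝ) • ((z.2.1 : A) - a₀) ∈ K := fun z =>
    hK.add_smul_sub_mem ha₀ z.2.1.2 z.1.2
  have hc : Continuous fun z : unitInterval × K × M =>
      φ (a₀ + (z.1 : ℝ) • ((z.2.1 : A) - a₀)) (π z.2.2) :=
    hφ.comp_continuous (f := fun z : unitInterval × K × M =>
      (a₀ + (z.1 : ℝ) • ((z.2.1 : A) - a₀), π z.2.2))
      (Continuous.prodMk (by fun_prop) (hπ.contMDiff.continuous.comp (by fun_prop)))
      fun z => ⟨hseg z, mem_univ _⟩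
  set Hm : C(unitInterval × K × M, N) := ⟨_, hc⟩ with hHm
  set f : C(K × M, M) := ⟨Prod.snd, continuous_snd⟩
  have H0 : ∀ a, Hm (0, a) = π (f a) := fun a => by
    change φ (a₀ + ((0 : unitInterval) : ℝ) • ((a.1 : A) - a₀)) (π a.2) = π a.2
    rw [show ((0 : unitInterval) : ℝ) = 0 from rfl, zero_smul, add_zero, h0]
    rfl
  set L := hπ.isCoveringMap.liftHomotopy Hm f H0
  have hL : ∀ z, π (L z) = Hm z := congrFun (hπ.isCoveringMap.liftHomotopy_lifts Hm f H0)
  have hL0 : ∀ a, L (0, a) = a.2 := hπ.isCoveringMap.liftHomotopy_zero Hm f H0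
  refine ⟨fun a x => if ha : a ∈ K then L (1, (⟨a, ha⟩, x)) else x, ?_, ?_, ?_⟩
  · rw [continuousOn_iff_continuous_domRestrict]
    have e : (K ×ˢ (univ : Set M)).domRestrict
        (uncurry fun (a : A) x => if ha : a ∈ K then L (1, (⟨a, ha⟩, x)) else x) =
        fun z => L (1, (⟨z.1.1, z.2.1⟩, z.1.2)) := by
      funext z
      exact dif_pos z.2.1
    rw [e]
    refine L.continuous.comp (continuous_const.prodMk (Continuous.prodMk ?_ ?_))
    · exact Continuous.subtype_mk (by fun_prop) _
    · fun_prop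
  · funext x
    refine (dif_pos ha₀).trans (Eq.trans (hπ.isCoveringMap.const_of_comp (g := fun τ => L (τ, (⟨a₀, ha₀⟩, x)))
      (L.continuous.comp (by fun_prop)) (fun τ τ' => ?_) 1 0) (hL0 _))
    rw [hL, hL]
    change φ (a₀ + (τ : ℝ) • (a₀ - a₀)) (π x) = φ (a₀ + (τ' : ℝ) • (a₀ - a₀)) (π x)
    simp
  · intro a ha x
    simp only [dif_pos ha]
    rw [hL]
    change φ (a₀ + ((1 : unitInterval) : ℝ) • (a - a₀)) (π x) = φ a (π x)
    simp

/-- A contact family over a convex set of parameters, with `φ_{a₀} = id`, has a lift. -/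
theorem exists_lift {K : Set A} (hK : Convex ℝ K) {a₀ : A} (ha₀ : a₀ ∈ K)
    {φ : A → N → N} (hφ : IsContactFamily σ' K φ) (h0 : φ a₀ = id) :
    ∃ Φ : A → M → M, IsContactFamily σ K Φ ∧ Φ a₀ = id ∧ LiftsFamily π K Φ φ := by
  obtain ⟨ψ, hψs, hψ⟩ := hφ.exists_inv
  have h0' : ψ a₀ = id := by
    funext y
    have := (hψ a₀ ha₀).1 y
    rwa [h0] at this
  obtain ⟨Φ, h1, h2, h3⟩ := hπ.exists_continuous_lift hK ha₀ hφ.smooth.continuousOn h0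
  obtain ⟨Ψ, k1, k2, k3⟩ := hπ.exists_continuous_lift hK ha₀ hψs.continuousOn h0'
  have smooth : ∀ {Φ : A → M → M} {φ : A → N → N}, ContinuousOn (uncurry Φ) (K ×ˢ univ) →
      LiftsFamily π K Φ φ → ContMDiffOn (𝓘(ℝ, A).prod I) I ∞ (uncurry φ) (K ×ˢ univ) →
      ContMDiffOn (𝓘(ℝ, A).prod I) I ∞ (uncurry Φ) (K ×ˢ univ) := fun {Φ φ} h h' h'' => by
    refine hπ.contMDiffOn_lift h ?_
    have hm : ContMDiff (𝓘(ℝ, A).prod I) (𝓘(ℝ, A).prod I) ∞ (fun q : A × M => (q.1, π q.2)) :=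
      contMDiff_fst.prodMk (hπ.contMDiff.comp contMDiff_snd)
    exact (h''.comp hm.contMDiffOn fun q hq => ⟨hq.1, mem_univ _⟩).congr fun q hq => h' q.1 hq.1 q.2
  have curve : ∀ {Φ Ψ : A → M → M}, ContinuousOn (uncurry Φ) (K ×ˢ univ) →
      ContinuousOn (uncurry Ψ) (K ×ˢ univ) → ∀ x, ContinuousOn (fun a => Φ a (Ψ a x)) K :=
    fun {Φ Ψ} h h' x => h.comp (f := fun a => (a, Ψ a x)) (continuousOn_id.prodMk
      (h'.comp (f := fun a => (a, x)) (by fun_prop) fun _ ha => ⟨ha, mem_univ _⟩))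
      fun _ ha => ⟨ha, mem_univ _⟩
  have sΦ := smooth h1 h3 hφ.smooth
  refine ⟨Φ, ⟨sΦ, ⟨Ψ, smooth k1 k3 hψs, fun a ha => ⟨fun x => ?_, fun x => ?_⟩⟩,
    fun a ha => contact_iff.2 fun x u => ?_⟩, h2, h3⟩
  · exact hπ.eqOn_lift hK.isPreconnected ha₀ (curve k1 h1 x) continuousOn_const
      (fun b hb => by rw [k3 b hb, h3 b hb, (hψ b hb).1]) (by rw [h2, k2]; rfl) a ha
  · exact hπ.eqOn_lift hK.isPreconnected ha₀ (curve h1 k1 x) continuousOn_const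
      (fun b hb => by rw [h3 b hb, k3 b hb, (hψ b hb).2]) (by rw [h2, k2]; rfl) a ha
  · have dΦ : MDifferentiableAt I I (Φ a) x := (contMDiff_slice sΦ ha x).mdifferentiableAt (by simp)
    have dφ : MDifferentiableAt I I (φ a) (π x) :=
      (contMDiff_slice hφ.smooth ha _).mdifferentiableAt (by simp)
    have e : (fun z => π (Φ a z)) = fun z => φ a (π z) := funext fun z => h3 a ha z
    rw [← hπ.ev_mdf, ← hπ.ev_mdf, ← mdf_comp (hπ.mdiff _) dΦ, h3 a ha, e,
      mdf_comp dφ (hπ.mdiff x)]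
    exact contact_iff.1 (hφ.contact a ha) (π x) _

theorem hasCompactSupp_lift {K : Set A} (hK : IsPreconnected K) {a₀ : A} (ha₀ : a₀ ∈ K)
    {φ : A → N → N} {Φ : A → M → M} (hΦ : IsContactFamily σ K Φ) (h0 : Φ a₀ = id)
    (h : LiftsFamily π K Φ φ) (hc : HasCompactSupp K φ) : HasCompactSupp K Φ := by
  obtain ⟨C, hC, hφ⟩ := hc
  refine ⟨π ⁻¹' C, hπ.isProperMap.isCompact_preimage hC, fun a ha x hx => ?_⟩
  exact hπ.eqOn_lift hK ha₀ (hΦ.continuousOn_curve x) continuousOn_const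
    (fun b hb => by rw [h b hb, hφ b hb _ hx]) (by rw [h0]; rfl) a ha

theorem contactSpeed_lift {φ : ContactIsotopy σ'} {Φ : ContactIsotopy σ}
    (h : LiftsFamily π (Icc (0 : ℝ) 1) Φ.toFun φ.toFun) {t : ℝ} (ht : t ∈ Icc (0 : ℝ) 1) (x : M) :
    contactSpeed σ Φ.toFun t x = contactSpeed σ' φ.toFun t (π x) := by
  have hmd : MDifferentiableWithinAt 𝓘(ℝ, ℝ) I (fun s => Φ.toFun s x) (Icc 0 1) t := by
    have h2 : ContMDiffOn 𝓘(ℝ, ℝ) I ∞ (fun s => Φ.toFun s x) (Icc 0 1) :=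
      Φ.isContactFamily.smooth.comp (f := fun s : ℝ => (s, x))
        (contMDiff_id.prodMk contMDiff_const).contMDiffOn fun s hs => ⟨hs, mem_univ _⟩
    exact (h2 t ht).mdifferentiableWithinAt (by simp)
  have hu : UniqueMDiffWithinAt 𝓘(ℝ, ℝ) (Icc (0 : ℝ) 1) t :=
    (uniqueDiffOn_Icc one_pos t ht).uniqueMDiffWithinAt
  have h3 := mfderiv_comp_mfderivWithin t (hπ.mdiff (Φ.toFun t x)) hmd hu
  have h4 : mfderivWithin 𝓘(ℝ, ℝ) I (fun s => φ.toFun s (π x)) (Icc (0 : ℝ) 1) t =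
      mfderivWithin 𝓘(ℝ, ℝ) I (π ∘ fun s => Φ.toFun s x) (Icc (0 : ℝ) 1) t :=
    mfderivWithin_congr (fun s hs => (h s hs x).symm) (h t ht x).symm
  obtain ⟨D, hD⟩ : ∃ D : ℝ →L[ℝ] E, D = mfderivWithin 𝓘(ℝ, ℝ) I
    (fun s => Φ.toFun s x) (Icc (0 : ℝ) 1) t := ⟨_, rfl⟩
  obtain ⟨D', hD'⟩ : ∃ D' : ℝ →L[ℝ] E, D' = mfderivWithin 𝓘(ℝ, ℝ) I
    (fun s => φ.toFun s (π x)) (Icc (0 : ℝ) 1) t := ⟨_, rfl⟩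
  have e1 : contactSpeed σ Φ.toFun t x = σ.ev (Φ.toFun t x) (D 1) := by rw [hD]; rfl
  have e2 : contactSpeed σ' φ.toFun t (π x) = σ'.ev (φ.toFun t (π x)) (D' 1) := by rw [hD']; rfl
  have e3 : D' 1 = mdf I I π (Φ.toFun t x) (D 1) := by
    rw [hD, hD', h4]
    exact congrArg (fun A : ℝ →L[ℝ] E => A 1) h3
  rw [e1, e2, e3, ← h t ht, hπ.ev_mdf]

theorem speed_lift {φ : ℝ → N → N} {Φ : ℝ → M → M} (hΦ : IsContactFamily σ univ Φ)
    (h : LiftsFamily π univ Φ φ) (t : ℝ) (x : M) : speed σ Φ t x = speed σ' φ t (π x) := by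
  have e : (fun s => φ s (π x)) = fun s => π (Φ s x) := funext fun s => (h s (mem_univ s) x).symm
  rw [speed, speed, e, ← h t (mem_univ t), hπ.ev_vel (hΦ.mdiff_curve t x)]

end IsFormCovering

end Lifts

/-! ### Lifts of Legendrian isotopies, and the order spectral selector -/

section LegendrianLifts

variable {E : Type*} [NormedAddCommGroup E] [NormedSpace ℝ E]
  {H : Type*} [TopologicalSpace H] {I : ModelWithCorners ℝ E H} [I.Boundaryless]
  {M : Type*} [TopologicalSpace M] [ChartedSpace H M] [T2Space M] [IsManifold I ∞ M]
  {N : Type*} [TopologicalSpace N] [ChartedSpace H N] [T2Space N] [IsManifold I ∞ N]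
  {A : Type*} [NormedAddCommGroup A] [NormedSpace ℝ A]
  {π : M → N} {α : DForm I M 1} {α' : DForm I N 1}

namespace IsFormCovering

variable (hπ : IsFormCovering π α α')

include hπ

/-- If the images of the diagonal of `N` under two families are nested, so are the images of the
diagonal of `M` under their lifts, as soon as they are so for one parameter: a path in the preimage
`{π(x₁) = π(x₂), θ = 0}` of the diagonal, starting in the diagonal, stays there. -/
theorem image_diagonal_subset {K : Set A} (hK : IsPreconnected K) {a₀ : A} (ha₀ : a₀ ∈ K)
    {φ ψ : A → N × N × ℝ → N × N × ℝ} {Φ Ψ : A → M × M × ℝ → M × M × ℝ}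
    (hψ : IsContactFamily (productForm α') K ψ) (hΦ : IsContactFamily (productForm α) K Φ)
    (hΨ : IsContactFamily (productForm α) K Ψ) (h1 : LiftsFamily (productCover π) K Φ φ)
    (h2 : LiftsFamily (productCover π) K Ψ ψ)
    (h0 : Φ a₀ '' diagonal M ⊆ Ψ a₀ '' diagonal M)
    (h : ∀ a ∈ K, φ a '' diagonal N ⊆ ψ a '' diagonal N) :
    ∀ a ∈ K, Φ a '' diagonal M ⊆ Ψ a '' diagonal M := by
  obtain ⟨Ψ', hs, hi⟩ := hΨ.exists_inv
  obtain ⟨ψ', -, hi'⟩ := hψ.exists_inv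
  have hΨ' := hΨ.inv hs hi
  rintro a ha _ ⟨_, ⟨x, rfl⟩, rfl⟩
  have hcont := (hΨ'.comp hΦ).continuousOn_curve (x, x, (0 : ℝ))
  have key : ∀ b ∈ K, π (Ψ' b (Φ b (x, x, 0))).1 = π (Ψ' b (Φ b (x, x, 0))).2.1 ∧
      (Ψ' b (Φ b (x, x, 0))).2.2 = 0 := fun b hb => by
    obtain ⟨_, ⟨y, rfl⟩, hy⟩ := h b hb (mem_image_of_mem _ ⟨π x, rfl⟩)
    have e1 : ψ b (productCover π (Ψ' b (Φ b (x, x, 0)))) = ψ b (y, y, 0) := by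
      rw [← h2 b hb, (hi b hb).2, h1 b hb]
      exact hy.symm
    have e2 := (hi' b hb).1.injective e1
    have e3 : π (Ψ' b (Φ b (x, x, 0))).1 = y := congrArg Prod.fst e2
    have e4 : π (Ψ' b (Φ b (x, x, 0))).2.1 = y := congrArg (fun p : N × N × ℝ => p.2.1) e2
    exact ⟨e3.trans e4.symm, congrArg (fun p : N × N × ℝ => p.2.2) e2⟩
  have hstart : (Ψ' a₀ (Φ a₀ (x, x, 0))).1 = (Ψ' a₀ (Φ a₀ (x, x, 0))).2.1 := by
    obtain ⟨_, ⟨y, rfl⟩, hy⟩ := h0 (mem_image_of_mem _ ⟨x, rfl⟩)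
    rw [← hy, (hi a₀ ha₀).1]
  have hall := hπ.eqOn_lift hK ha₀ (continuous_fst.comp_continuousOn hcont)
    ((continuous_fst.comp continuous_snd).comp_continuousOn hcont) (fun b hb => (key b hb).1)
    hstart a ha
  refine ⟨Ψ' a (Φ a (x, x, 0)), ⟨(Ψ' a (Φ a (x, x, 0))).1, ?_⟩, (hi a ha).2 _⟩
  exact Prod.ext rfl (Prod.ext hall (key a ha).2.symm)

theorem image_diagonal_eq {K : Set A} (hK : IsPreconnected K) {a₀ : A} (ha₀ : a₀ ∈ K)
    {φ ψ : A → N × N × ℝ → N × N × ℝ} {Φ Ψ : A → M × M × ℝ → M × M × ℝ}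
    (hφ : IsContactFamily (productForm α') K φ)
    (hψ : IsContactFamily (productForm α') K ψ) (hΦ : IsContactFamily (productForm α) K Φ)
    (hΨ : IsContactFamily (productForm α) K Ψ) (h1 : LiftsFamily (productCover π) K Φ φ)
    (h2 : LiftsFamily (productCover π) K Ψ ψ) (h0 : Φ a₀ = Ψ a₀)
    (h : ∀ a ∈ K, φ a '' diagonal N = ψ a '' diagonal N) {a : A} (ha : a ∈ K) :
    Φ a '' diagonal M = Ψ a '' diagonal M :=
  (hπ.image_diagonal_subset hK ha₀ hψ hΦ hΨ h1 h2 (by rw [h0]) (fun b hb => (h b hb).subset)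
    a ha).antisymm (hπ.image_diagonal_subset hK ha₀ hφ hΨ hΦ h2 h1 (by rw [h0])
      (fun b hb => (h b hb).symm.subset) a ha)

/-- Homotopies of Legendrian isotopies of the diagonal lift. -/
theorem legHomotopic_lift {φ ψ : ℝ → N × N × ℝ → N × N × ℝ} {Φ Ψ : ℝ → M × M × ℝ → M × M × ℝ}
    (hφ : IsContactFamily (productForm α') (Icc (0 : ℝ) 1) φ)
    (hψ : IsContactFamily (productForm α') (Icc (0 : ℝ) 1) ψ)
    (hΦ : IsContactFamily (productForm α) (Icc (0 : ℝ) 1) Φ)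
    (hΨ : IsContactFamily (productForm α) (Icc (0 : ℝ) 1) Ψ)
    (h1 : LiftsFamily (productCover π) (Icc (0 : ℝ) 1) Φ φ)
    (h2 : LiftsFamily (productCover π) (Icc (0 : ℝ) 1) Ψ ψ) (hΦ0 : Φ 0 = id) (hΨ0 : Ψ 0 = id)
    (h : LegHomotopic (productForm α') (diagonal N) (fun t => φ t '' diagonal N)
      (fun t => ψ t '' diagonal N)) :
    LegHomotopic (productForm α) (diagonal M) (fun t => Φ t '' diagonal M)
      (fun t => Ψ t '' diagonal M) := by
  -- the homotopy lifts as a family of maps; that the images of the diagonal are as required follows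
  -- from `image_diagonal_eq`, applied along segments of the square which start where it holds
  obtain ⟨h, k1, k2, k3, k4⟩ := h
  have hsq : Convex ℝ unitSquare := (convex_Icc (0 : ℝ) 1).prod (convex_Icc (0 : ℝ) 1)
  have hz : ((0 : ℝ), (0 : ℝ)) ∈ unitSquare := ⟨zero_mem_unit, zero_mem_unit⟩
  obtain ⟨G, g1, g2, g3⟩ := hπ.product.exists_lift hsq hz k1 (k3 0 zero_mem_unit).1
  have hI : IsPreconnected (Icc (0 : ℝ) 1) := isPreconnected_Icc
  -- restrictions of the homotopy to segments
  have ms : ∀ t ∈ Icc (0 : ℝ) 1, MapsTo (fun s : ℝ => (s, t)) (Icc (0 : ℝ) 1) unitSquare :=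
    fun t ht s hs => ⟨hs, ht⟩
  have mt : ∀ s ∈ Icc (0 : ℝ) 1, MapsTo (fun t : ℝ => (s, t)) (Icc (0 : ℝ) 1) unitSquare :=
    fun s hs t ht => ⟨hs, ht⟩
  have cs : ∀ t : ℝ, ContDiff ℝ ∞ fun s : ℝ => (s, t) := fun t => by fun_prop
  have ct : ∀ s : ℝ, ContDiff ℝ ∞ fun t : ℝ => (s, t) := fun s => by fun_prop
  have hs0 : ∀ s ∈ Icc (0 : ℝ) 1, G (s, 0) = id := fun s hs => by
    rw [← g2]
    refine hπ.product.lift_unique hI zero_mem_unit (g1.reparam (cs 0) (ms 0 zero_mem_unit))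
      (isContactFamily_const (K := Icc (0 : ℝ) 1) g1 hz) (φ := fun s => h (s, 0))
      (fun s hs => g3 _ ⟨hs, zero_mem_unit⟩) (fun s hs p => ?_) rfl s hs
    change productCover π (G (0, 0) p) = h (s, 0) (productCover π p)
    rw [g2, (k3 s hs).1]
    rfl
  have ht : ∀ s ∈ Icc (0 : ℝ) 1, ∀ {ψ : ℝ → N × N × ℝ → N × N × ℝ}
      {Ψ : ℝ → M × M × ℝ → M × M × ℝ}, IsContactFamily (productForm α') (Icc (0 : ℝ) 1) ψ →
      IsContactFamily (productForm α) (Icc (0 : ℝ) 1) Ψ →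
      LiftsFamily (productCover π) (Icc (0 : ℝ) 1) Ψ ψ → Ψ 0 = id →
      (∀ t ∈ Icc (0 : ℝ) 1, h (s, t) '' diagonal N = ψ t '' diagonal N) →
      ∀ t ∈ Icc (0 : ℝ) 1, G (s, t) '' diagonal M = Ψ t '' diagonal M :=
    fun s hs {ψ Ψ} hψ hΨ hl hΨ0 heq t ht =>
      hπ.image_diagonal_eq hI zero_mem_unit (φ := fun t => h (s, t)) (Φ := fun t => G (s, t))
        (k1.reparam (ct s) (mt s hs)) hψ
        (g1.reparam (ct s) (mt s hs)) hΨ (fun t ht => g3 _ ⟨hs, ht⟩) hl ((hs0 s hs).trans hΨ0.symm)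
        heq ht
  have h0t := ht 0 zero_mem_unit hφ hΦ h1 hΦ0 fun t ht => (k4 t ht).1
  refine ⟨G, g1, hπ.product.hasCompactSupp_lift hsq.isPreconnected hz g1 g2 g3 k2,
    fun s hs => ⟨hs0 s hs, ?_⟩, fun t ht' => ⟨h0t t ht', ?_⟩⟩
  · refine Eq.trans ?_ (h0t 1 one_mem_unit)
    exact hπ.image_diagonal_eq hI zero_mem_unit (φ := fun s => h (s, 1)) (Φ := fun s => G (s, 1))
      (ψ := fun _ => h (0, 1)) (Ψ := fun _ => G (0, 1))
      (k1.reparam (cs 1) (ms 1 one_mem_unit)) (isContactFamily_const k1 ⟨zero_mem_unit, one_mem_unit⟩)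
      (g1.reparam (cs 1) (ms 1 one_mem_unit)) (isContactFamily_const g1 ⟨zero_mem_unit, one_mem_unit⟩)
      (fun s hs => g3 _ ⟨hs, one_mem_unit⟩) (fun _ _ => g3 _ ⟨zero_mem_unit, one_mem_unit⟩) rfl
      (fun s hs => (k3 s hs).2.trans (k3 0 zero_mem_unit).2.symm) hs
  · exact ht 1 one_mem_unit hψ hΨ h2 hΨ0 (fun t ht => (k4 t ht).2) t ht'

/-- A positive contractible loop based at the diagonal of `N` lifts to one based at the diagonal of
`M`. -/
theorem stronglyOrderable (h : StronglyOrderable α) : StronglyOrderable α' := by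
  rintro ⟨φ, h1, h2, h3⟩
  obtain ⟨Φ, g1, g2, g3⟩ := hπ.product.exists_lift (convex_Icc (0 : ℝ) 1) zero_mem_unit
    φ.isContactFamily φ.map_zero
  refine h ⟨⟨Φ, g1, g2⟩, hπ.product.hasCompactSupp_lift isPreconnected_Icc zero_mem_unit g1 g2 g3 h1,
    fun t ht x hx => ?_, ?_⟩
  · obtain ⟨y, rfl⟩ := hx
    have e := hπ.product.contactSpeed_lift (φ := φ) (Φ := ⟨Φ, g1, g2⟩) g3 ht (y, y, 0)
    refine lt_of_lt_of_eq (h2 t ht _ ⟨π y, rfl⟩) e.symm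
  · have e := hπ.legHomotopic_lift (ψ := fun _ => id) (Ψ := fun _ => id) φ.isContactFamily
      (ContactIsotopy.one _).isContactFamily g1 (ContactIsotopy.one _).isContactFamily g3
      (fun _ _ _ => rfl) g2 rfl (h3.congr (fun _ _ => rfl) fun _ _ => (image_id _).symm)
    exact e.congr (fun _ _ => rfl) fun _ _ => image_id _

section Graphs

variable [FiniteDimensional ℝ E] [CompactSpace N] {F : ℝ → M → M} {F' : ℝ → N → N}
  {f : ContactIsotopy α'} {g : ContactIsotopy α}

theorem confCoeff_lift (hF : IsSmoothReebFlow α F) (hF' : IsSmoothReebFlow α' F') {φ : N → N}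
    {Φ : M → M} (hφ : IsConformal α' φ) (dφ : MDifferentiable I I φ) (dΦ : MDifferentiable I I Φ)
    (h : ∀ x, π (Φ x) = φ (π x)) (x : M) : confCoeff α F Φ x = confCoeff α' F' φ (π x) := by
  refine hF.confCoeff_eq_of fun u => ?_
  have e : (fun z => π (Φ z)) = fun z => φ (π z) := funext h
  rw [← hπ.ev_mdf, ← hπ.ev_mdf, ← mdf_comp (hπ.mdiff _) (dΦ x), h, e, mdf_comp (dφ _) (hπ.mdiff x),
    hF'.ev_mdf_eq_confCoeff (contact_iff.1 hφ.contact)]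

theorem liftsFamily_levelFlow (h : ∀ t x, F' t (π x) = π (F t x)) (L : ℝ) (r : ℝ → ℝ) {K : Set ℝ} :
    LiftsFamily (productCover π) K (fun t => levelFlow F L (r t)) fun t => levelFlow F' L (r t) :=
  fun t _ p => by simp only [productCover, levelFlow, h]

/-- A non-negative isotopy from the graph of `f` to a Reeb translate of the diagonal lifts. -/
theorem nonnegTo_lift [CompactSpace M] (hF : IsSmoothReebFlow α F) (hF' : IsSmoothReebFlow α' F')
    (h : ∀ t x, F' t (π x) = π (F t x))
    (hfg : LiftsFamily π (Icc (0 : ℝ) 1) g.toFun f.toFun) {T : ℝ} (hT : NonnegTo F' f T) :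
    NonnegTo F g T := by
  obtain ⟨ψ, h1, h2, h3, h4, h5⟩ := hT
  obtain ⟨C, -, c1, -, -, -, c2, c3, c4⟩ := exists_cutoff_isotopy_apply hF' f
  have hu : IsPreconnected (univ : Set ℝ) := isPreconnected_univ
  obtain ⟨Ψ, g1, g2, g3⟩ := hπ.product.exists_lift convex_univ (mem_univ (0 : ℝ)) h1 h3
  obtain ⟨D, d1, d2, d3⟩ := hπ.product.exists_lift convex_univ (mem_univ (0 : ℝ)) c1 c2
  have hext : ∀ t x, π (g.ext t x) = f.ext t (π x) := fun t x => hfg _ (smoothTransition_mem t) x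
  have hconf : ∀ t x, confCoeff α F (g.ext t) x = confCoeff α' F' (f.ext t) (π x) := fun t =>
    hπ.confCoeff_lift hF hF' (hF'.isConformal_of_family f.isContactFamily_ext
      (f.ext_of_nonpos le_rfl) t) (f.isContactFamily_ext.mdiff_apply t)
      (g.isContactFamily_ext.mdiff_apply t) (hext t)
  have hlog : ∀ x, Continuous fun t => Real.log (confCoeff α F (g.ext t) x) := fun x => by
    have hc : Continuous fun t => confCoeff α F (g.ext t) x :=
      (hF.contMDiff_confCoeff g.isContactFamily_ext.contMDiff).continuous.comp
        (continuous_id.prodMk continuous_const)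
    exact hc.log fun t => (hF.confCoeff_pos g.isContactFamily_ext (g.ext_of_nonpos le_rfl) t x).ne'
  have hD : ∀ t, D t '' diagonal M = graphSet α F (g.ext t) := fun t =>
    image_diagonal_eq_graphSet fun x => by
      refine hπ.product.eqOn_lift hu (mem_univ (0 : ℝ)) (d1.continuousOn_curve (x, x, 0))
        (g := fun t => D t (x, x, 0))
        (g' := fun t => (x, g.ext t x, Real.log (confCoeff α F (g.ext t) x))) ?_ ?_ ?_ t (mem_univ t)
      · exact (continuous_const.prodMk (Continuous.prodMk (g.isContactFamily_ext.contMDiff.continuous.comp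
          (continuous_id.prodMk continuous_const)) (hlog x))).continuousOn
      · intro s _
        rw [d3 s (mem_univ s)]
        refine (c4 s (π x)).trans ?_
        rw [productCover, hconf, hext]
      · rw [d2, g.ext_of_nonpos le_rfl, hF.confCoeff_id, Real.log_one]
        rfl
  have hC : ∀ t, C t '' diagonal N = graphSet α' F' (f.ext t) := fun t =>
    image_diagonal_eq_graphSet (c4 t)
  refine ⟨Ψ, g1, hπ.product.hasCompactSupp_lift hu (mem_univ (0 : ℝ)) g1 g2 g3 h2, g2,
    fun t ht x hx => ?_, ?_⟩
  · rw [hπ.product.speed_lift g1 g3]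
    refine h4 t ht _ ?_
    obtain ⟨y, rfl⟩ := hx
    have e : (productCover π (y, g.ext 1 y, Real.log (confCoeff α F (g.ext 1) y))) =
        (π y, f.ext 1 (π y), Real.log (confCoeff α' F' (f.ext 1) (π y))) := by
      rw [productCover, hconf, hext]
    rw [g.ext_of_one_le le_rfl, f.ext_of_one_le le_rfl] at e
    exact ⟨π y, e.symm⟩
  · have e := hπ.legHomotopic_lift (φ := fun t => ψ t ∘ C t) (Φ := fun t => Ψ t ∘ D t)
      (ψ := fun t => levelFlow F' 0 (t * T)) (Ψ := fun t => levelFlow F 0 (t * T))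
      ((h1.comp c1).mono (subset_univ _))
      (isContactFamily_levelFlow_mul hF' 0 (by fun_prop)) ((g1.comp d1).mono (subset_univ _))
      (isContactFamily_levelFlow_mul hF 0 (by fun_prop))
      (fun t _ => (g3.comp d3) t (mem_univ t)) (hπ.liftsFamily_levelFlow h 0 _)
      (by rw [g2, d2]; rfl) (by rw [zero_mul, hF.levelFlow_zero])
      (h5.congr (fun t _ => by rw [image_comp, hC]) fun t _ => by rw [hF'.levelFlow_diagonal])
    exact e.congr (fun t _ => by rw [image_comp, hD]) fun t _ => by rw [hF.levelFlow_diagonal]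

/-- Passing to a lift does not increase `C_+`. -/
theorem cPlus_lift_le [CompactSpace M] (hF : IsSmoothReebFlow α F) (hF' : IsSmoothReebFlow α' F')
    (h : ∀ t x, F' t (π x) = π (F t x))
    (hfg : LiftsFamily π (Icc (0 : ℝ) 1) g.toFun f.toFun) :
    CPlus (UCont.mk g) ≤ CPlus (UCont.mk f) := by
  rw [cPlus_mk hF, cPlus_mk hF']
  refine sInf_le_sInf ?_
  rintro _ ⟨T, rfl, hT⟩
  exact ⟨T, rfl, hπ.nonnegTo_lift hF hF' h hfg hT⟩

end Graphs

/-- Every class of contact isotopies has a unique lift. -/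
theorem existsUnique_lift (φ : UCont α') : ∃! ψ : UCont α, ∃ (f : ContactIsotopy α')
    (g : ContactIsotopy α), UCont.mk f = φ ∧ UCont.mk g = ψ ∧
      LiftsFamily π (Icc (0 : ℝ) 1) g.toFun f.toFun := by
  have hI : IsPreconnected (Icc (0 : ℝ) 1) := isPreconnected_Icc
  have hex : ∀ f : ContactIsotopy α', ∃ g : ContactIsotopy α,
      LiftsFamily π (Icc (0 : ℝ) 1) g.toFun f.toFun := fun f => by
    obtain ⟨Φ, g1, g2, g3⟩ := hπ.exists_lift (convex_Icc (0 : ℝ) 1) zero_mem_unit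
      f.isContactFamily f.map_zero
    exact ⟨⟨Φ, g1, g2⟩, g3⟩
  choose lift hlift using hex
  have huniq : ∀ {f : ContactIsotopy α'} {g g' : ContactIsotopy α},
      LiftsFamily π (Icc (0 : ℝ) 1) g.toFun f.toFun →
      LiftsFamily π (Icc (0 : ℝ) 1) g'.toFun f.toFun → ∀ t ∈ Icc (0 : ℝ) 1, g.toFun t = g'.toFun t :=
    fun {f g g'} h h' => hπ.lift_unique hI zero_mem_unit g.isContactFamily g'.isContactFamily h h'
      (g.map_zero.trans g'.map_zero.symm)
  have hhom : ∀ f f' : ContactIsotopy α', f.Homotopic f' →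
      UCont.mk (lift f) = UCont.mk (lift f') := fun f f' hff' => by
    obtain ⟨h, k1, k2, k3⟩ := hff'
    have hz : ((0 : ℝ), (0 : ℝ)) ∈ unitSquare := ⟨zero_mem_unit, zero_mem_unit⟩
    obtain ⟨G, g1, g2, g3⟩ := hπ.exists_lift ((convex_Icc (0 : ℝ) 1).prod (convex_Icc (0 : ℝ) 1)) hz
      k1 (k2 0 zero_mem_unit).1
    -- the lift of the homotopy is constant along the sides where the homotopy is
    have hconst : ∀ t ∈ Icc (0 : ℝ) 1, (∀ s ∈ Icc (0 : ℝ) 1, h (s, t) = h (0, t)) →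
        ∀ s ∈ Icc (0 : ℝ) 1, G (s, t) = G (0, t) := fun t ht hst s hs =>
      hπ.lift_unique hI zero_mem_unit (Φ := fun s => G (s, t)) (Ψ := fun _ => G (0, t))
        (φ := fun s => h (s, t)) (g1.reparam (by fun_prop) fun s hs => ⟨hs, ht⟩)
        (isContactFamily_const g1 ⟨zero_mem_unit, ht⟩) (fun s hs => g3 _ ⟨hs, ht⟩)
        (fun s hs x => (g3 _ ⟨zero_mem_unit, ht⟩ x).trans (congrFun (hst s hs) _).symm) rfl s hs
    have hside0 : ∀ s ∈ Icc (0 : ℝ) 1, G (s, 0) = id := fun s hs => by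
      rw [← g2]
      exact hconst 0 zero_mem_unit
        (fun s hs => (k2 s hs).1.trans (k2 0 zero_mem_unit).1.symm) s hs
    have hside : ∀ s ∈ Icc (0 : ℝ) 1, ∀ {f : ContactIsotopy α'},
        (∀ t ∈ Icc (0 : ℝ) 1, h (s, t) = f.toFun t) →
        ∀ t ∈ Icc (0 : ℝ) 1, G (s, t) = (lift f).toFun t := fun s hs f hf t ht =>
      hπ.lift_unique hI zero_mem_unit (Φ := fun t => G (s, t)) (φ := f.toFun)
        (g1.reparam (by fun_prop) fun t ht => ⟨hs, ht⟩)
        (lift f).isContactFamily (fun t ht x => (g3 _ ⟨hs, ht⟩ x).trans (congrFun (hf t ht) _)) (hlift f)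
        ((hside0 s hs).trans (lift f).map_zero.symm) t ht
    have h0 := hside 0 zero_mem_unit fun t ht => (k3 t ht).1
    refine Quot.sound ⟨G, g1, fun s hs => ⟨hside0 s hs, ?_⟩, fun t ht => ⟨h0 t ht,
      hside 1 one_mem_unit (fun t ht => (k3 t ht).2) t ht⟩⟩
    rw [hconst 1 one_mem_unit (fun s hs => (k2 s hs).2.trans (k2 0 zero_mem_unit).2.symm) s hs,
      h0 1 one_mem_unit]
  have key : ∀ {f : ContactIsotopy α'} {g : ContactIsotopy α},
      LiftsFamily π (Icc (0 : ℝ) 1) g.toFun f.toFun →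
      UCont.mk g = Quot.lift (fun f => UCont.mk (lift f)) hhom (UCont.mk f) := fun {f g} h =>
    Quot.sound (ContactIsotopy.Homotopic.of_eqOn (huniq h (hlift f)))
  obtain ⟨f, rfl⟩ := Quot.exists_rep φ
  refine ⟨UCont.mk (lift f), ⟨f, lift f, rfl, rfl, hlift f⟩, ?_⟩
  rintro _ ⟨f', g', h1, rfl, h3⟩
  rw [key h3, h1]

end IsFormCovering

end LegendrianLifts

/-! ### Smooth quotients by free actions, and cyclic quotients of prequantizations -/

section Quotients

variable {E : Type*} [NormedAddCommGroup E] [NormedSpace ℝ E]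
  {H : Type*} [TopologicalSpace H] {I : ModelWithCorners ℝ E H}
  {M : Type*} [TopologicalSpace M] [ChartedSpace H M] [IsManifold I ∞ M]
  {N : Type*} [TopologicalSpace N] [ChartedSpace H N]
  {G : Type*} [Group G] [MulAction G M]
  {π : M → N} {s : N → M}

/-- A local lift of the identity of the quotient is the action of a group element. -/
theorem _root_.IsQuotientCoveringMap.exists_eventuallyEq_smul (hq : IsQuotientCoveringMap π G)
    (hf : IsLocalHomeomorph π) {τ : M → M} {x : M} (hτ : ContinuousAt τ x)
    (h : ∀ᶠ y in 𝓝 x, π (τ y) = π y) : ∃ γ : G, τ =ᶠ[𝓝 x] fun y => γ • y := by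
  have := hq.toContinuousConstSMul
  obtain ⟨γ, hγ⟩ := hq.apply_eq_iff_mem_orbit.1 h.self_of_nhds
  simp only at hγ
  obtain ⟨U, hU, hxU, hinj⟩ := hf.isLocallyInjective x
  have h1 : Filter.Tendsto (fun y => γ⁻¹ • τ y) (𝓝 x) (𝓝 x) := by
    have h2 : Filter.Tendsto (fun y => γ⁻¹ • τ y) (𝓝 x) (𝓝 (γ⁻¹ • τ x)) :=
      Filter.Tendsto.const_smul hτ γ⁻¹
    rwa [← hγ, inv_smul_smul] at h2
  refine ⟨γ, ?_⟩
  filter_upwards [h1 (hU.mem_nhds hxU), hU.mem_nhds hxU, h] with y h2 h3 h4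
  rw [← inv_smul_eq_iff]
  exact hinj h2 h3 ((hq.map_smul _).trans h4)

/-- The charts of `N` are the charts of `M` composed with local inverses of `π`, one for each value
of the section `s`. -/
structure HasPushforwardCharts (hf : IsLocalHomeomorph π) (s : N → M) : Prop where
  rightInverse : RightInverse s π
  atlas_eq : atlas H N = {(hf.localInverseAt (s q)).trans (chartAt H (s q)) | q : N}
  chartAt_eq : ∀ q : N, chartAt H q = (hf.localInverseAt (s q)).trans (chartAt H (s q))

namespace HasPushforwardCharts

variable {hf : IsLocalHomeomorph π} (hc : HasPushforwardCharts (H := H) hf s)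
  (hq : IsQuotientCoveringMap π G) (hG : ∀ γ : G, ContMDiff I I ∞ fun x : M => γ • x)

include hq in
/-- The local lifts `ℓ ∘ π` of the identity, where `ℓ` is a local inverse of `π`, agree locally with
the action. -/
theorem exists_localInverseAt_comp (x : M) {y : M} (hy : π y ∈ (hf.localInverseAt x).source) :
    ∃ γ : G, (fun z => hf.localInverseAt x (π z)) =ᶠ[𝓝 y] fun z => γ • z := by
  have h1 : ContinuousAt (hf.localInverseAt x) (π y) := (hf.localInverseAt x).continuousAt hy
  refine hq.exists_eventuallyEq_smul hf (h1.comp hf.continuous.continuousAt) ?_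
  filter_upwards [hf.continuous.continuousAt ((hf.localInverseAt x).open_source.mem_nhds hy)]
    with z hz
  exact hf.apply_localInverseAt_of_mem hz

include hq hG in
theorem contMDiffAt_localInverseAt_comp (x : M) {y : M}
    (hy : π y ∈ (hf.localInverseAt x).source) :
    ContMDiffAt I I ∞ (fun z => hf.localInverseAt x (π z)) y := by
  obtain ⟨γ, hγ⟩ := exists_localInverseAt_comp hq x hy
  exact (hG γ).contMDiffAt.congr_of_eventuallyEq hγ

include hc hq hG

theorem isManifold : IsManifold I ∞ N := by
  refine isManifold_of_contDiffOn I ∞ N fun e e' he he' => ?_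
  rw [hc.atlas_eq] at he he'
  obtain ⟨q, rfl⟩ := he
  obtain ⟨q', rfl⟩ := he'
  -- a change of charts is the expression in charts of `M` of a local lift of the identity
  rw [← contMDiffOn_iff_contDiffOn]
  rintro y ⟨hy, hy2⟩
  simp only [mem_preimage, OpenPartialHomeomorph.trans_source,
    OpenPartialHomeomorph.trans_symm_eq_symm_trans_symm,
    OpenPartialHomeomorph.coe_trans, OpenPartialHomeomorph.symm_source, mem_inter_iff, comp_apply,
    IsLocalHomeomorph.localInverseAt_symm] at hy
  obtain ⟨⟨h1, -⟩, h3, h4⟩ := hy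
  have a1 : ContMDiffWithinAt 𝓘(ℝ, E) I ∞ (extChartAt I (s q)).symm (range I) y := by
    refine (contMDiffWithinAt_extChartAt_symm_range (s q) ?_)
    rw [extChartAt_target]
    exact ⟨h1, hy2⟩
  have a2 := contMDiffAt_localInverseAt_comp (I := I) hq hG (s q') h3
  have a3 : ContMDiffAt I 𝓘(ℝ, E) ∞ (extChartAt I (s q'))
      (hf.localInverseAt (s q') (π ((extChartAt I (s q)).symm y))) :=
    contMDiffAt_extChartAt' h4
  have a4 := ContMDiffAt.comp_contMDiffWithinAt y a3 (ContMDiffAt.comp_contMDiffWithinAt y a2 a1)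
  exact (a4.mono inter_subset_right).congr (fun _ _ => by simp) (by simp)

variable [IsManifold I ∞ N]

omit hq hG in
theorem extChartAt_apply (q r : N) :
    extChartAt I q r = extChartAt I (s q) (hf.localInverseAt (s q) r) := by
  simp only [extChartAt_coe, hc.chartAt_eq, OpenPartialHomeomorph.coe_trans, comp_apply]

omit hc hq hG in
theorem localInverseAt_section (hs : RightInverse s π) (q : N) :
    q ∈ (hf.localInverseAt (s q)).source ∧ hf.localInverseAt (s q) q = s q := by
  have h1 := hf.apply_self_mem_localInverseAt_source (x := s q)
  have h2 := hf.localInverseAt_apply_self (x := s q)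
  rw [hs q] at h1 h2
  exact ⟨h1, h2⟩

theorem contMDiffAt_localInverseAt (x : M) :
    ContMDiffAt I I ∞ (hf.localInverseAt x) (π x) := by
  obtain ⟨k1, k2⟩ := localInverseAt_section (hf := hf) hc.rightInverse (π x)
  have a1 : ContMDiffAt I I ∞ (hf.localInverseAt (s (π x))) (π x) := by
    have b1 : ContMDiffWithinAt 𝓘(ℝ, E) I ∞ (extChartAt I (s (π x))).symm (range I)
        (extChartAt I (π x) (π x)) := by
      rw [hc.extChartAt_apply, k2]
      exact contMDiffWithinAt_extChartAt_symm_range_self (s (π x))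
    have b2 := ContMDiffWithinAt.comp (s := univ) (π x) b1 (contMDiffAt_extChartAt (x := π x))
      (fun y _ => by simp)
    refine (contMDiffWithinAt_univ.1 b2).congr_of_eventuallyEq ?_
    have b3 : ∀ᶠ y in 𝓝 (π x), hf.localInverseAt (s (π x)) y ∈ (extChartAt I (s (π x))).source := by
      refine ((hf.localInverseAt (s (π x))).continuousAt k1).eventually ?_
      rw [k2]
      exact extChartAt_source_mem_nhds _
    filter_upwards [b3] with y hy
    rw [comp_apply, hc.extChartAt_apply, PartialEquiv.left_inv _ hy]
  have a2 : ContMDiffAt I I ∞ (fun z => hf.localInverseAt x (π z))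
      (hf.localInverseAt (s (π x)) (π x)) := by
    refine contMDiffAt_localInverseAt_comp hq hG x ?_
    rw [k2, hc.rightInverse]
    exact hf.apply_self_mem_localInverseAt_source
  refine (ContMDiffAt.comp (π x) a2 a1).congr_of_eventuallyEq ?_
  filter_upwards [(hf.localInverseAt (s (π x))).open_source.mem_nhds k1] with y hy
  rw [comp_apply, hf.apply_localInverseAt_of_mem hy]

theorem contMDiff_proj : ContMDiff I I ∞ π := by
  intro x
  obtain ⟨k1, k2⟩ := localInverseAt_section (hf := hf) hc.rightInverse (π x)
  have a1 := contMDiffAt_localInverseAt_comp (I := I) hq hG (s (π x)) k1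
  have a2 : ContMDiffAt I 𝓘(ℝ, E) ∞ (extChartAt I (s (π x)))
      (hf.localInverseAt (s (π x)) (π x)) := by
    rw [k2]
    exact contMDiffAt_extChartAt
  have a3 : ContMDiffWithinAt 𝓘(ℝ, E) I ∞ (extChartAt I (π x)).symm (range I)
      (extChartAt I (s (π x)) (hf.localInverseAt (s (π x)) (π x))) := by
    rw [← hc.extChartAt_apply]
    exact contMDiffWithinAt_extChartAt_symm_range_self (π x)
  have a4 := ContMDiffWithinAt.comp (s := univ) x a3 (ContMDiffAt.comp x a2 a1)
    (fun y _ => by simp)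
  refine (contMDiffWithinAt_univ.1 a4).congr_of_eventuallyEq ?_
  filter_upwards [hf.continuous.continuousAt (extChartAt_source_mem_nhds (I := I) (π x))] with y hy
  simp only [comp_apply]
  rw [← hc.extChartAt_apply, PartialEquiv.left_inv _ hy]

/-- An invariant form descends to the quotient. -/
theorem exists_pull_eq {α : DForm I M 1}
    (hα : ∀ (γ : G) (x : M) (u : E), α.ev (γ • x) (mdf I I (fun y => γ • y) x u) = α.ev x u) :
    ∃ α' : DForm I N 1, DForm.pull π α' = α := by
  refine ⟨fun q => DForm.pull (hf.localInverseAt (s q)) α q, funext fun x => DForm.ext_ev fun u => ?_⟩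
  obtain ⟨k1, k2⟩ := localInverseAt_section (hf := hf) hc.rightInverse (π x)
  have a1 := hc.contMDiffAt_localInverseAt hq hG (s (π x))
  rw [hc.rightInverse] at a1
  obtain ⟨γ, hγ⟩ := exists_localInverseAt_comp hq (s (π x)) k1
  have h1 := mdf_comp (a1.mdifferentiableAt (by simp))
    ((hc.contMDiff_proj hq hG).mdifferentiable (by simp) x) u
  rw [hγ.mdf_eq] at h1
  rw [DForm.ev_pull]
  change (DForm.pull (hf.localInverseAt (s (π x))) α).ev (π x) _ = _
  have h2 : hf.localInverseAt (s (π x)) (π x) = γ • x := hγ.self_of_nhds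
  rw [DForm.ev_pull, ← h1, h2, hα]

theorem isFormCovering [CompactSpace M] [T2Space N] {α : DForm I M 1} {α' : DForm I N 1}
    (h : DForm.pull π α' = α) : IsFormCovering π α α' where
  isLocalHomeomorph := hf
  isProperMap := hf.continuous.isProperMap
  surjective := hc.rightInverse.surjective
  contMDiff := hc.contMDiff_proj hq hG
  exists_section x := ⟨hf.localInverseAt x, hc.contMDiffAt_localInverseAt hq hG x,
    hf.localInverseAt_apply_self, by
      filter_upwards [(hf.localInverseAt x).open_source.mem_nhds
        hf.apply_self_mem_localInverseAt_source] with y hy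
      exact hf.apply_localInverseAt_of_mem hy⟩
  pull_eq := h

end HasPushforwardCharts

end Quotients

section CyclicQuotients

variable {E : Type*} [NormedAddCommGroup E] [NormedSpace ℝ E] [FiniteDimensional ℝ E]
  {M : Type*} [TopologicalSpace M] [T2Space M] [CompactSpace M] [ChartedSpace E M]
  [IsManifold 𝓘(ℝ, E) ∞ M] [MulAction Circle M] [ContinuousSMul Circle M] [IsCancelSMul Circle M]
  {F : Type*} [NormedAddCommGroup F] [NormedSpace ℝ F]
  {W : Type*} [TopologicalSpace W] [ChartedSpace F W]
  {α : DForm 𝓘(ℝ, E) M 1} {σ : DForm 𝓘(ℝ, F) W 2} {π : M → W}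

theorem isQuotientCoveringMap_cyclicProj (k : ℕ) [NeZero k] :
    IsQuotientCoveringMap (cyclicProj k M) (cyclicSubgroup k) :=
  isQuotientCoveringMap_quotientMk_of_properlyDiscontinuousSMul

/-- Mathlib's manifold structure on the quotient is of this form. -/
theorem exists_hasPushforwardCharts (k : ℕ) [NeZero k] :
    ∃ (hf : IsLocalHomeomorph (cyclicProj k M)) (s : CyclicQuotient k M → M),
      HasPushforwardCharts (H := E) hf s :=
  ⟨(isQuotientCoveringMap_cyclicProj k).isCoveringMap.isLocalHomeomorph, _,
    (Quotient.mk_surjective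
      (s := MulAction.orbitRel (cyclicSubgroup k) M)).hasRightInverse.choose_spec, rfl, fun _ => rfl⟩

namespace IsPrequantization

variable (h : IsPrequantization α σ π)

include h

/-- The circle action is the Reeb flow. -/
theorem isSmoothReebFlow : IsSmoothReebFlow α fun t x => Circle.exp t • x where
  contact := h.contact
  smooth := h.smooth_action.comp ((contMDiff_circleExp.comp contMDiff_fst).prodMk contMDiff_snd)
  isReeb := h.reeb
  add s t x := by rw [Circle.exp_add, mul_smul]

theorem contMDiff_smul (z : Circle) : ContMDiff 𝓘(ℝ, E) 𝓘(ℝ, E) ∞ fun x : M => z • x :=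
  h.smooth_action.comp (contMDiff_const.prodMk contMDiff_id)

theorem ev_mdf_smul (z : Circle) (x : M) (u : E) :
    α.ev (z • x) (mdf 𝓘(ℝ, E) 𝓘(ℝ, E) (fun y : M => z • y) x u) = α.ev x u := by
  obtain ⟨t, rfl⟩ := Circle.exp_surjective z
  exact h.isSmoothReebFlow.ev_mdf t x u

theorem isManifold_cyclicQuotient (k : ℕ) [NeZero k] :
    IsManifold 𝓘(ℝ, E) ∞ (CyclicQuotient k M) := by
  obtain ⟨hf, s, hc⟩ := exists_hasPushforwardCharts (E := E) (M := M) k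
  exact hc.isManifold (isQuotientCoveringMap_cyclicProj k) fun γ => h.contMDiff_smul γ

theorem isFormCovering (k : ℕ) [NeZero k] [IsManifold 𝓘(ℝ, E) ∞ (CyclicQuotient k M)] :
    IsFormCovering (cyclicProj k M) α (quotientForm k α) := by
  obtain ⟨hf, s, hc⟩ := exists_hasPushforwardCharts (E := E) (M := M) k
  have hG : ∀ γ : cyclicSubgroup k, ContMDiff 𝓘(ℝ, E) 𝓘(ℝ, E) ∞ fun x : M => γ • x :=
    fun γ => h.contMDiff_smul γ
  have h1 := hc.exists_pull_eq (isQuotientCoveringMap_cyclicProj k) hG (α := α)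
    fun γ => h.ev_mdf_smul γ
  refine hc.isFormCovering (isQuotientCoveringMap_cyclicProj k) hG ?_
  rw [quotientForm, dif_pos h1]
  exact h1.choose_spec

omit h in
/-- The circle acts on the quotient by the subgroup `ℤ_k`. -/
theorem exists_quotient_flow (k : ℕ) [NeZero k] :
    ∃ F : ℝ → CyclicQuotient k M → CyclicQuotient k M,
      (∀ t x, F t (cyclicProj k M x) = cyclicProj k M (Circle.exp t • x)) ∧
      F (2 * Real.pi / k) = id := by
  have hq := isQuotientCoveringMap_cyclicProj (M := M) k
  have key : ∀ (t : ℝ) (x y : M), cyclicProj k M x = cyclicProj k M y →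
      cyclicProj k M (Circle.exp t • x) = cyclicProj k M (Circle.exp t • y) := fun t x y hxy => by
    obtain ⟨γ, rfl⟩ := hq.apply_eq_iff_mem_orbit.1 hxy
    refine hq.apply_eq_iff_mem_orbit.2 ⟨γ, ?_⟩
    exact smul_comm (γ : Circle) (Circle.exp t) y
  refine ⟨fun t => Quotient.lift (fun x => cyclicProj k M (Circle.exp t • x))
    fun x y hxy => key t x y (Quotient.sound hxy), fun t x => rfl, funext fun q => ?_⟩
  obtain ⟨x, rfl⟩ := hq.surjective q
  exact hq.map_smul ⟨Circle.exp (2 * Real.pi / k), Subgroup.mem_zpowers _⟩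

end IsPrequantization

end CyclicQuotients

end ContactGeometry

end

theorem lemma8p5
    {E : Type*} [NormedAddCommGroup E] [NormedSpace ℝ E] [FiniteDimensional ℝ E]
    {M : Type*} [TopologicalSpace M] [T2Space M] [CompactSpace M]
    [ChartedSpace E M] [IsManifold 𝓘(ℝ, E) ∞ M]
    [MulAction Circle M] [ContinuousSMul Circle M] [IsCancelSMul Circle M]
    {F : Type*} [NormedAddCommGroup F] [NormedSpace ℝ F] [FiniteDimensional ℝ F]
    {W : Type*} [TopologicalSpace W] [T2Space W] [CompactSpace W]
    [ChartedSpace F W] [IsManifold 𝓘(ℝ, F) ∞ W]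
    (α : ContactGeometry.DForm 𝓘(ℝ, E) M 1) (σ : ContactGeometry.DForm 𝓘(ℝ, F) W 2) (π : M → W)
    (hpre : ContactGeometry.IsPrequantization α σ π)
    (hord : ContactGeometry.StronglyOrderable α)
    (k : ℕ) [NeZero k] :
    ContactGeometry.StronglyOrderable (ContactGeometry.quotientForm k α) ∧
    (∀ φ : ContactGeometry.UCont (ContactGeometry.quotientForm k α),
      ContactGeometry.CPlus φ ≠ ⊥ ∧ ContactGeometry.CPlus φ ≠ ⊤) ∧
    (∀ φ : ContactGeometry.UCont (ContactGeometry.quotientForm k α),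
      (∃! ψ : ContactGeometry.UCont α, ContactGeometry.IsLift φ ψ) ∧
      ∀ ψ : ContactGeometry.UCont α, ContactGeometry.IsLift φ ψ →
        ContactGeometry.CPlus φ ≥ ContactGeometry.CPlus ψ) ∧
    (∀ φ ψ : ContactGeometry.UCont (ContactGeometry.quotientForm k α),
      ContactGeometry.ceilMul (2 * Real.pi / k) (ContactGeometry.CPlus (ψ * φ * ψ⁻¹)).toReal =
        ContactGeometry.ceilMul (2 * Real.pi / k) (ContactGeometry.CPlus φ).toReal) := by
  have := hpre.isManifold_cyclicQuotient k
  have hcov := hpre.isFormCovering k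
  have hF := hpre.isSmoothReebFlow
  obtain ⟨F', h1, h2⟩ := ContactGeometry.IsPrequantization.exists_quotient_flow (M := M) k
  have hF' := hcov.isSmoothReebFlow hF h1
  have hord' := hcov.stronglyOrderable hord
  have hT : 0 < 2 * Real.pi / k := by
    have : (0 : ℝ) < k := Nat.cast_pos.2 (Nat.pos_of_ne_zero (NeZero.ne k))
    positivity
  -- `IsLift` compares compositions, `LiftsFamily` values
  have hlift : ∀ (φ : ContactGeometry.UCont (ContactGeometry.quotientForm k α))
      (ψ : ContactGeometry.UCont α), ContactGeometry.IsLift φ ψ ↔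
      ∃ (f : ContactGeometry.ContactIsotopy (ContactGeometry.quotientForm k α))
        (g : ContactGeometry.ContactIsotopy α), ContactGeometry.UCont.mk f = φ ∧
        ContactGeometry.UCont.mk g = ψ ∧ ContactGeometry.LiftsFamily
          (ContactGeometry.cyclicProj k M) (Set.Icc (0 : ℝ) 1) g.toFun f.toFun := fun φ ψ => by
    simp only [ContactGeometry.IsLift, ContactGeometry.LiftsFamily, funext_iff, Function.comp_apply]
  refine ⟨hord', fun φ => ⟨ContactGeometry.cPlus_ne_bot hF' hord' φ,
    ContactGeometry.cPlus_ne_top hF' φ⟩, fun φ => ⟨?_, fun ψ hψ => ?_⟩, fun φ ψ =>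
    ContactGeometry.ceilMul_cPlus_conj hF' hord' hT h2 φ ψ⟩
  · simpa only [hlift] using hcov.existsUnique_lift φ
  · obtain ⟨f, g, rfl, rfl, hfg⟩ := (hlift φ ψ).1 hψ
    exact hcov.cPlus_lift_le hF hF' h1 hfg
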